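/- **Setting.** Let $W(y|a)$ be a memoryless channel from an input alphabet $\mathcal A$ to an output alphabet $\mathcal B$: a jointly measurable transition density with respect to a $\sigma$-finite measure on $\mathcal B$, written $dy$ (Lebesgue or counting measure, for instance). Let $\pi:\mathbb R\to\mathcal A$ be measurable, $P_{\rm out}(y|x)=W(y|\pi(x))$, $\mathcal Dz$ the standard Gaussian measure, $A=\pi(Z)$ with $Z\sim\mathcal N(0,1)$, and $Y$ the output of $W$ for the input $A$. Assume that the integrals defining the entropies $H(Y)$ and $H(Y|A)$ converge absolutely and that $I(A;Y)>0$. Mutual information and capacity are in bits; the capacity over a set $\mathcal Q$ of admissible input laws (all laws, if there is no input constraint) is the supremum of the mutual information over the input laws in $\mathcal Q$. *Effective noise.* For $0<E\le1$ put $f(y|p,E)=\int P_{\rm out}(y|u)\,\mathcal N(u|p,E)\,du$, $\mathcal F(p|E)=\int f(y|p,E)\,(\partial_p\ln f(y|p,E))^2dy$, $J(E)=\mathbb E_{p\sim\mathcal N(0,1-E)}\mathcal F(p|E)$, and $J(0)=\lim_{E\downarrow0}J(E)\in[0,\infty]$. For a rate $R>0$, $\Sigma(E)^{-2}=J(E)/R$.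 *State evolution.* For an integer $B$, let ${\bf s}$ be uniform on the canonical basis of $\mathbb R^B$ (law $p_0$), ${\bf z}$ standard Gaussian in $\mathbb R^B$, $\theta({\bf x},{\bf s},{\bf z},\Sigma)=\exp\big(-\|{\bf x}-({\bf s}+{\bf z}\Sigma/\sqrt{\log_2B})\|^2\log_2 B/(2\Sigma^2)\big)$ (for $\Sigma=0$ or $\infty$: the limit of this expression), and $g({\bf s},{\bf z},\Sigma)=\int p_0(d{\bf x})\,\theta\,{\bf x}\big/\int p_0(d{\bf x})\,\theta$. Then $T_u(E)=\mathbb E\|g({\bf s},{\bf z},\Sigma(E))-{\bf s}\|^2$, $T_u^{(\infty)}(E)$ is the limit of the iterates of $T_u$ from $E$, the MSE floor is $E_0=T_u^{(\infty)}(0)$, and its basin is $\mathcal V_0=\{E\in[0,1]: T_u^{(\infty)}(E)=E_0\}$. *Potential.* With $\phi(y|z,E)=\int P_{\rm out}(y|x)\,\mathcal N(x|z\sqrt{1-E},E)\,dx$ let $$U_u(E)=-\frac{E}{2\ln(2)\,\Sigma(E)^2}-\frac1R\,\mathbb E_z\int\phi\log_2\phi\,dy,\qquad S_u(\Sigma)=\mathbb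 E_{{\bf s},{\bf z}}\log_B\int p_0(d{\bf x})\,\theta({\bf x},{\bf s},{\bf z},\Sigma),$$ where the first term of $U_u(0)$ is $0$, and $F_u(E)=U_u(E)-S_u(\Sigma(E))$, $\Delta F_u=\inf_{E\in[0,1]\setminus\mathcal V_0}(F_u(E)-F_u(E_0))$ with $\inf\emptyset=\infty$. The potential threshold is $R_{\rm pot}=\sup\{R>0:\ \Delta F_u>0\text{ at every rate in }(0,R]\}$. *Coupled ensemble.* The design functions $g_w$ vanish outside $[-1,1]$, and on $[-1,1]$ they are at least $g_0>0$ and $g_*$-Lipschitz, with $g_0,g_*$ independent of $w$. For $r,c\in\{1,\dots,\Gamma\}$ put $J_{r,c}=\gamma_r\Gamma g_w((r-c)/w)/(2w+1)$ with $\gamma_r$ such that $\sum_cJ_{r,c}=\Gamma$, and $\Sigma_c({\bf E})^{-2}=\sum_r\frac{J_{r,c}}{\Gamma\,\Sigma(E_r)^{2}}$. The coupled state evolution keeps $E_r=0$ for $r\le3w$ and for $r\ge\Gamma-3w+1$, and on the other rows it iterates ${\bf E}\mapsto\sum_c\frac{J_{r,c}}\Gamma\,\mathbb E\|g({\bf s},{\bf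 z},\Sigma_c({\bf E}))-{\bf s}\|^2$ from $E_r=1$. Let ${\bf E}^{(\infty)}$ be its limit and $$R_c=\liminf_{w\to\infty}\liminf_{\Gamma\to\infty}\sup\{R>0:\ \text{at every rate in }(0,R],\ E^{(\infty)}_r\le E_0\ \text{for all } r\}.$$ **Claim.** For $R>0$ let $\varphi_u(E)=U_u(E)-\max\big(0,1-\frac1{2\ln(2)\Sigma(E)^2}\big)$ on $[0,1]$. 1. For all $R>0$ and $E\in[0,1]$, $F_u(E)-\big(1+\frac{B}{2\ln B}\big)\to\varphi_u(E)$ as $B\to\infty$; that is, $F_u\to\varphi_u$ up to an additive constant which does not depend on $E$. 2. For all $R>0$, the only possible local minima of $\varphi_u$ on $[0,1]$ are at $E=0$ and $E=1$, and one of them is a global minimum. More precisely, $E=0$ is a local minimum iff $R<J(0)/(2\ln2)$, and $E=1$ is one iff $R>J(1)/(2\ln2)$. 3. For every $R>0$ with $R<J(0)/(2\ln2)$ the MSE floor vanishes: $\lim_{B\to\infty}E_0=0$. 4. For $R>0$, $\varphi_u(1)=\varphi_u(0)$ if and only if $R=I(A;Y)$. Moreover $\frac{J(1)}{2\ln2}<I(A;Y)<\frac{J(0)}{2\ln2}$,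 and $$I(A;Y)=-\int dy\,\mathcal Dz\,P_{\rm out}(y|z)\log_2\Big(\int\mathcal D\tilde z\,P_{\rm out}(y|\tilde z)\Big)+\int dy\,\mathcal Dz\,P_{\rm out}(y|z)\log_2P_{\rm out}(y|z),$$ which is also equal to the same expression with $W(y|a)$ in place of $P_{\rm out}(y|z)$ and the law of $A$ in place of $\mathcal Dz$. 5. Assume moreover that at small error the Fisher information $J$ satisfies one of the following: (a) $J(0)<\infty$ and, for every $\varepsilon>0$, $J(E_1)-J(E_2)\le\varepsilon\ln\frac{\ln(1/E_1)}{\ln(1/E_2)}$ for all sufficiently small $0<E_1\le E_2$ (for instance, $J$ is Lipschitz near $0$); or (b) $J(E)\ge c\ln(1/E)$ for some $c>0$ and all sufficiently small $E>0$. Then $$\lim_{B\to\infty}R_{\rm pot}=I(A;Y)\qquad\text{and}\qquad\lim_{B\to\infty}R_c=I(A;Y).$$ In particular both limits are the Shannon capacity $C$ of $W$ over $\mathcal Q$ whenever the law of $\pi(Z)$ is a capacity-achieving input law in $\mathcal Q$. -/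

import Mathlib

open MeasureTheory ProbabilityTheory Filter Topology Set
open scoped ENNReal NNReal

noncomputable section

namespace SparseSuperposition

/-- The standard Gaussian measure on the real line. -/
def stdGaussian : Measure ℝ := gaussianReal 0 1

/-! ### Memoryless channels, mutual information, capacity -/

/-- A memoryless channel with input alphabet `𝓐` and output alphabet `𝓑`, given by its transition
density `density a y = W(y | a)` with respect to a reference measure `ν` on `𝓑` (Lebesgue measure
for continuous outputs, counting measure for discrete ones). -/
structure MemorylessChannel (𝓐 𝓑 : Type*) [MeasurableSpace 𝓐] [MeasurableSpace 𝓑]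
    (ν : Measure 𝓑) where
  density : 𝓐 → 𝓑 → ℝ
  measurable_density : Measurable (Function.uncurry density)
  density_nonneg : ∀ a y, 0 ≤ density a y
  lintegral_density : ∀ a, ∫⁻ y, ENNReal.ofReal (density a y) ∂ν = 1

namespace MemorylessChannel

variable {𝓐 𝓑 : Type*} [MeasurableSpace 𝓐] [MeasurableSpace 𝓑] {ν : Measure 𝓑}

/-- The effective channel `P_out(y | x) = W(y | π(x))` obtained by putting the map `π` in front of
the channel `W`. -/
def withMap (W : MemorylessChannel 𝓐 𝓑 ν) (π : ℝ → 𝓐) (hπ : Measurable π) :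
    MemorylessChannel ℝ 𝓑 ν where
  density x y := W.density (π x) y
  measurable_density :=
    W.measurable_density.comp ((hπ.comp measurable_fst).prodMk measurable_snd)
  density_nonneg x y := W.density_nonneg (π x) y
  lintegral_density x := W.lintegral_density (π x)

/-- The output density `q(y) = ∫ W(y | a) P(da)` for the input law `P`. -/
def outDensity (W : MemorylessChannel 𝓐 𝓑 ν) (P : Measure 𝓐) (y : 𝓑) : ℝ :=
  ∫ a, W.density a y ∂P

/-- The joint law of input and output for the input law `P`. -/
def jointLaw (W : MemorylessChannel 𝓐 𝓑 ν) (P : Measure 𝓐) : Measure (𝓐 × 𝓑) :=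
  (P.prod ν).withDensity fun x => ENNReal.ofReal (W.density x.1 x.2)

/-- The mutual information `I(A; Y)` in bits, for `A` of law `P` and `Y` the output of the channel:
the relative entropy of the joint law with respect to the product of its marginals. -/
def mutualInfo (W : MemorylessChannel 𝓐 𝓑 ν) (P : Measure 𝓐) : ℝ≥0∞ :=
  InformationTheory.klDiv (W.jointLaw P) (P.prod ((W.jointLaw P).map Prod.snd)) /
    ENNReal.ofReal (Real.log 2)

/-- The Shannon capacity in bits per channel use, over the set `𝒬` of admissible input laws
(`Set.univ` when there is no input constraint). -/
def capacity (W : MemorylessChannel 𝓐 𝓑 ν) (𝒬 : Set (ProbabilityMeasure 𝓐)) : ℝ≥0∞ :=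
  ⨆ P ∈ 𝒬, W.mutualInfo (P : Measure 𝓐)

/-- The integrals defining the entropies `H(Y)` and `H(Y | A)` converge absolutely. -/
def FiniteEntropies (W : MemorylessChannel 𝓐 𝓑 ν) (P : Measure 𝓐) : Prop :=
  Integrable (fun y => W.outDensity P y * Real.logb 2 (W.outDensity P y)) ν ∧
    Integrable (fun x : 𝓐 × 𝓑 => W.density x.1 x.2 * Real.logb 2 (W.density x.1 x.2)) (P.prod ν)

/-- `- ∫ dy P(da) W(y|a) log₂ (∫ P(da') W(y|a')) + ∫ dy P(da) W(y|a) log₂ W(y|a)`. -/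
def infoIntegral (W : MemorylessChannel 𝓐 𝓑 ν) (P : Measure 𝓐) : ℝ :=
  -(∫ a, ∫ y, W.density a y * Real.logb 2 (∫ a', W.density a' y ∂P) ∂ν ∂P) +
    ∫ a, ∫ y, W.density a y * Real.logb 2 (W.density a y) ∂ν ∂P

end MemorylessChannel

/-! ### The section denoiser

The prior of a section is uniform on the `B` vectors of the canonical basis of `ℝ^B`. The effective
noise enters through `v = Σ⁻² ∈ [0, ∞]`. -/

/-- `θ(x, s, z, Σ) = exp (- ‖x - (s + z Σ / √(log₂ B))‖² / (2 Σ² / log₂ B))`, written as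
`exp (- ‖(x - s) √(log₂ B) / Σ - z‖² / 2)` with `v = Σ⁻²`. This also makes sense for `Σ = ∞`; for
`Σ = 0` it is replaced by its limit. -/
def theta (B : ℕ) (x s z : Fin B → ℝ) (v : ℝ≥0∞) : ℝ :=
  if v = ∞ then (if x = s then Real.exp (-(∑ k, z k ^ 2) / 2) else 0)
  else Real.exp (-(∑ k, ((x k - s k) * Real.sqrt (Real.logb 2 B * v.toReal) - z k) ^ 2) / 2)

/-- The `i`-th vector of the canonical basis: a section whose only non-zero component is `i`. -/
def sectionVec (B : ℕ) (i : Fin B) : Fin B → ℝ := Pi.single i 1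

/-- The partition function `∫ dx p₀(x) θ(x, s, z, Σ)`. -/
def partitionFn (B : ℕ) (s z : Fin B → ℝ) (v : ℝ≥0∞) : ℝ :=
  (∑ j, theta B (sectionVec B j) s z v) / B

/-- The denoiser `g_{in,i}(s, z, Σ)`. -/
def denoiser (B : ℕ) (s z : Fin B → ℝ) (v : ℝ≥0∞) (i : Fin B) : ℝ :=
  ((∑ j, theta B (sectionVec B j) s z v * sectionVec B j i) / B) / partitionFn B s z v

/-- The expectation over a section `s ∼ p₀` and a standard Gaussian vector `z` in `ℝ^B`. -/
def sectionExpect (B : ℕ) (h : (Fin B → ℝ) → (Fin B → ℝ) → ℝ) : ℝ :=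
  (∑ j, ∫ z, h (sectionVec B j) z ∂(Measure.pi fun _ : Fin B => stdGaussian)) / B

/-- The mean square error `𝔼 ∑ᵢ (g_{in,i}(s, z, Σ) - sᵢ)²` of the denoiser. -/
def sectionMSE (B : ℕ) (v : ℝ≥0∞) : ℝ :=
  sectionExpect B fun s z => ∑ i, (denoiser B s z v i - s i) ^ 2

/-- `S_u(Σ) = 𝔼 log_B ∫ dx p₀(x) θ(x, s, z, Σ)`. -/
def entropyTerm (B : ℕ) (v : ℝ≥0∞) : ℝ :=
  sectionExpect B fun s z => Real.logb B (partitionFn B s z v)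

namespace MemorylessChannel

variable {𝓑 : Type*} [MeasurableSpace 𝓑] {ν : Measure 𝓑}

/-! ### Effective noise

From here on the channel is an effective channel `P_out`, with real input. -/

/-- `f(y | p, E) = ∫ du P_out(y | u) 𝒩(u | p, E)`. -/
def smoothed (P : MemorylessChannel ℝ 𝓑 ν) (E p : ℝ) (y : 𝓑) : ℝ :=
  ∫ u, P.density u y ∂(gaussianReal p E.toNNReal)

/-- The Fisher information `ℱ(p | E) = ∫ dy f(y | p, E) (∂ₓ ln f(y | x, E))²` at `x = p`. -/
def fisherInfo (P : MemorylessChannel ℝ 𝓑 ν) (E p : ℝ) : ℝ≥0∞ :=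
  ∫⁻ y, ENNReal.ofReal
    (P.smoothed E p y * (deriv (fun x => Real.log (P.smoothed E x y)) p) ^ 2) ∂ν

/-- `J(E) = 𝔼_{p ∼ 𝒩(0, 1 - E)} ℱ(p | E)`. The formula is used for `0 < E ≤ 1`, where `f(y | ·, E)`
is smooth. At `E = 0` the value is the limit for `E ↓ 0`: it is `∞` for channels, such as
the binary symmetric channel preceded by the sign map, for which `P_out(y | ·)` jumps. -/
def avgFisher (P : MemorylessChannel ℝ 𝓑 ν) (E : ℝ) : ℝ≥0∞ :=
  if E = 0 then
    liminf (fun e : ℝ => ∫⁻ p, P.fisherInfo e p ∂(gaussianReal 0 (1 - e).toNNReal)) (𝓝[>] 0)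
  else ∫⁻ p, P.fisherInfo E p ∂(gaussianReal 0 (1 - E).toNNReal)

/-- The inverse effective noise variance `Σ(E)⁻² = J(E) / R`, in `[0, ∞]`. -/
def invNoise (P : MemorylessChannel ℝ 𝓑 ν) (R E : ℝ) : ℝ≥0∞ :=
  P.avgFisher E / ENNReal.ofReal R

/-! ### State evolution and potential of the underlying ensemble -/

/-- The state evolution operator `T_u`. -/
def seOp (P : MemorylessChannel ℝ 𝓑 ν) (B : ℕ) (R E : ℝ) : ℝ :=
  sectionMSE B (P.invNoise R E)

/-- `T_u^{(∞)}(E)`. -/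
def seLimit (P : MemorylessChannel ℝ 𝓑 ν) (B : ℕ) (R E : ℝ) : ℝ :=
  limUnder atTop fun t : ℕ => (P.seOp B R)^[t] E

/-- The MSE floor `E₀ = T_u^{(∞)}(0)`. -/
def mseFloor (P : MemorylessChannel ℝ 𝓑 ν) (B : ℕ) (R : ℝ) : ℝ :=
  P.seLimit B R 0

/-- The basin of attraction of the MSE floor. -/
def basin (P : MemorylessChannel ℝ 𝓑 ν) (B : ℕ) (R : ℝ) : Set ℝ :=
  {E | E ∈ Icc (0 : ℝ) 1 ∧ P.seLimit B R E = P.mseFloor B R}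

/-- `φ(y | z, E) = ∫ dx P_out(y | x) 𝒩(x | z √(1 - E), E)`. -/
def phi (P : MemorylessChannel ℝ 𝓑 ν) (E z : ℝ) (y : 𝓑) : ℝ :=
  ∫ x, P.density x y ∂(gaussianReal (z * Real.sqrt (1 - E)) E.toNNReal)

/-- `U_u(E) = - E / (2 ln 2 Σ(E)²) - (1 / R) 𝔼_z ∫ dy φ log₂ φ`. When `E = 0` and `Σ(0) = 0` the
first term is `0`. -/
def energyTerm (P : MemorylessChannel ℝ 𝓑 ν) (R E : ℝ) : ℝ :=
  -(E * (P.invNoise R E).toReal) / (2 * Real.log 2) -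
    (1 / R) * ∫ z, ∫ y, P.phi E z y * Real.logb 2 (P.phi E z y) ∂ν ∂stdGaussian

/-- The potential `F_u(E) = U_u(E) - S_u(Σ(E))`. -/
def potential (P : MemorylessChannel ℝ 𝓑 ν) (B : ℕ) (R E : ℝ) : ℝ :=
  P.energyTerm R E - entropyTerm B (P.invNoise R E)

/-- The free energy gap `ΔF_u`, the infimum of `F_u(E) - F_u(E₀)` over `E ∈ [0, 1]` outside of the
basin of the MSE floor; it is `∞` when there is no such `E`. -/
def freeEnergyGap (P : MemorylessChannel ℝ 𝓑 ν) (B : ℕ) (R : ℝ) : EReal :=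
  ⨅ E ∈ Icc (0 : ℝ) 1 \ P.basin B R,
    ((P.potential B R E - P.potential B R (P.mseFloor B R) : ℝ) : EReal)

/-- The potential threshold: the rate at which `ΔF_u` first fails to be positive. -/
def potThreshold (P : MemorylessChannel ℝ 𝓑 ν) (B : ℕ) : ℝ≥0∞ :=
  ⨆ R ∈ {R : ℝ | 0 < R ∧ ∀ R' ∈ Ioc 0 R, 0 < P.freeEnergyGap B R'}, ENNReal.ofReal R

/-- `1 / (2 ln 2 Σ(E)²)`, in `[0, ∞]`. -/
def relSnr (P : MemorylessChannel ℝ 𝓑 ν) (R E : ℝ) : ℝ≥0∞ :=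
  P.invNoise R E / ENNReal.ofReal (2 * Real.log 2)

/-- The large alphabet potential `φ_u(E) = U_u(E) - max (0, 1 - 1 / (2 ln 2 Σ(E)²))`. The subtraction
in `[0, ∞]` is truncated at `0`, so that `1 - x` there is the maximum of `0` and `1 - x`. -/
def largePotential (P : MemorylessChannel ℝ 𝓑 ν) (R E : ℝ) : ℝ :=
  P.energyTerm R E - (1 - P.relSnr R E).toReal

/-- Behaviour of the Fisher information `J` at small error: either `J(0) < ∞` and
`J(E₁) - J(E₂) ≤ ε ln (ln (1/E₁) / ln (1/E₂))` for small `E₁ ≤ E₂`, for any `ε > 0` (for a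
differentiable `J` this says that `E ln (1/E) J'(E) → 0`), or `J(E)` grows at least as fast as
a multiple of `ln (1/E)` for `E ↓ 0`. -/
def RegularFisher (P : MemorylessChannel ℝ 𝓑 ν) : Prop :=
  (P.avgFisher 0 < ∞ ∧ ∀ ε : ℝ, 0 < ε → ∃ η ∈ Ioo (0 : ℝ) 1, ∀ E₁ E₂ : ℝ,
      0 < E₁ → E₁ ≤ E₂ → E₂ ≤ η →
        (P.avgFisher E₁).toReal - (P.avgFisher E₂).toReal ≤
          ε * Real.log (Real.log (1 / E₁) / Real.log (1 / E₂))) ∨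
    ∃ c : ℝ, 0 < c ∧ ∃ η ∈ Ioo (0 : ℝ) 1, ∀ E ∈ Ioc 0 η,
      ENNReal.ofReal (c * Real.log (1 / E)) ≤ P.avgFisher E

end MemorylessChannel

/-! ### The spatially coupled ensemble

The block index `r ∈ {1, …, Γ}` is represented by `r - 1 : Fin Γ`. -/

/-- Design functions `g_w`: zero outside of `[-1, 1]`, at least `g₀ > 0` on `[-1, 1]`, and Lipschitz
there with a constant which does not depend on `w`. -/
def IsDesign (g : ℕ → ℝ → ℝ) : Prop :=
  ∃ g₀ : ℝ, 0 < g₀ ∧ ∃ gL : ℝ≥0, ∀ w,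
    (∀ x, 1 < |x| → g w x = 0) ∧ (∀ x, |x| ≤ 1 → g₀ ≤ g w x) ∧
      LipschitzOnWith gL (g w) (Icc (-1) 1)

/-- `g_w((r - c) / w) / (2 w + 1)`. -/
def rawCoupling (g : ℕ → ℝ → ℝ) (w Γ : ℕ) (r c : Fin Γ) : ℝ :=
  g w (((r : ℝ) - (c : ℝ)) / w) / (2 * w + 1)

/-- The block variances `J_{r,c} = γ_r Γ g_w((r - c) / w) / (2 w + 1)`, with `γ_r` chosen such that
`∑_c J_{r,c} / Γ = 1`. -/
def blockVariance (g : ℕ → ℝ → ℝ) (w Γ : ℕ) (r c : Fin Γ) : ℝ :=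
  (∑ c', rawCoupling g w Γ r c')⁻¹ * Γ * rawCoupling g w Γ r c

/-- The rows `{1, …, 3w} ∪ {Γ - 3w + 1, …, Γ}` on which the profile is pinned to `0`. -/
def IsPinned (w Γ : ℕ) (r : Fin Γ) : Prop :=
  (r : ℕ) + 1 ≤ 3 * w ∨ Γ + 1 ≤ (r : ℕ) + 1 + 3 * w

namespace MemorylessChannel

variable {𝓑 : Type*} [MeasurableSpace 𝓑] {ν : Measure 𝓑}

/-- The per-block inverse effective noise `Σ_c(E)⁻² = ∑_r J_{r,c} / (Γ Σ(E_r)²)`. -/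
def blockInvNoise (P : MemorylessChannel ℝ 𝓑 ν) (g : ℕ → ℝ → ℝ) (w Γ : ℕ) (R : ℝ)
    (E : Fin Γ → ℝ) (c : Fin Γ) : ℝ≥0∞ :=
  ∑ r, ENNReal.ofReal (blockVariance g w Γ r c / Γ) * P.invNoise R (E r)

open Classical in
/-- One step of the coupled state evolution: the operator `T_c` on the free rows, and the pinning
condition on the other ones. -/
def coupledStep (P : MemorylessChannel ℝ 𝓑 ν) (g : ℕ → ℝ → ℝ) (B w Γ : ℕ) (R : ℝ)
    (E : Fin Γ → ℝ) (r : Fin Γ) : ℝ :=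
  if IsPinned w Γ r then 0
  else ∑ c, blockVariance g w Γ r c / Γ * sectionMSE B (P.blockInvNoise g w Γ R E c)

open Classical in
/-- `T_c^{(∞)}(𝟏)`: the limit of the coupled state evolution started at `1` on the free rows. -/
def coupledLimit (P : MemorylessChannel ℝ 𝓑 ν) (g : ℕ → ℝ → ℝ) (B w Γ : ℕ) (R : ℝ) :
    Fin Γ → ℝ :=
  limUnder atTop fun t : ℕ =>
    (P.coupledStep g B w Γ R)^[t] (fun r => if IsPinned w Γ r then 0 else 1)

/-- The rate at which the limiting profile of the coupled state evolution first fails to be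
everywhere at most the MSE floor, for given `Γ` and `w`. -/
def coupledThresholdAt (P : MemorylessChannel ℝ 𝓑 ν) (g : ℕ → ℝ → ℝ) (B w Γ : ℕ) : ℝ≥0∞ :=
  ⨆ R ∈ {R : ℝ | 0 < R ∧ ∀ R' ∈ Ioc 0 R, ∀ r, P.coupledLimit g B w Γ R' r ≤ P.mseFloor B R'},
    ENNReal.ofReal R

/-- The threshold `R_c` of the coupled ensemble: first `Γ → ∞`, then `w → ∞`. -/
def coupledThreshold (P : MemorylessChannel ℝ 𝓑 ν) (g : ℕ → ℝ → ℝ) (B : ℕ) : ℝ≥0∞ :=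
  liminf (fun w : ℕ => liminf (fun Γ : ℕ => P.coupledThresholdAt g B w Γ) atTop) atTop

end MemorylessChannel

end SparseSuperposition

end

namespace SparseSuperposition

/-! ### Gaussian integrals on the line -/

/-! Everything reduces to one function of the noise level. Let `H(E)` be the output entropy in nats
when a part `1 - E` of the variance of the Gaussian input is known (`outEntropy`), `j = J/2`
(`halfFisher`) and `K = R ln 2`. Then `H(0) = H(Y|A)`, `H(1) = H(Y)`, and `H(1) - H(0)` is the
mutual information in nats. De Bruijn's identity along the Ornstein–Uhlenbeck semigroup says `H' =
j`, and the data processing inequality says that `j` is nonincreasing. Neither needs a derivative of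
`J`: both are used as `(E₂ - E₁) j(E₂) ≤ H(E₂) - H(E₁) ≤ (E₂ - E₁) j(E₁)` (`outEntropy_sub_bounds`).
If `j` took the same value twice, every likelihood would be an exponential after smoothing, hence
constant by normalization; so `I(A;Y) > 0` makes `j` strictly decreasing (`halfFisher_strictAnti`).

On the section side, all quantities are functions of the total relative weight `Q` of the wrong
positions: the error is `𝔼 Q/(1+Q)` (by the Nishimori identity) and the entropy is `𝔼 ln(1+Q)`. The
I-MMSE relation `hasDerivAt_logPart` makes the error a subgradient of the entropy in the inverse
noise. Put `x = 1/(2 ln 2 Σ²)`. For large `B` there is a sharp transition at `x = 1`: the normalized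
entropy tends to `max(0, 1 - x)`, and the error is at most a negative power of `B` when `x ≥ 1 + δ`.

Hence `K φ_u(E) = H(E) - E j(E) - max(0, K - j(E))`. Where `j ≥ K` this increases with `E`, and
where `j ≤ K` it decreases. As `j` is decreasing, only the endpoints can be local minima, and their
values agree exactly when `K = H(1) - H(0)`.

Potential threshold. The regularity assumption on `J` ensures that every `E` with `j(E) ≥ (1+δ)K`
flows to the MSE floor (`eventually_seLimit_eq_mseFloor`). At the other points the potential is at
least about `H(1) - (1+δ)K`, while at the floor it is at most about `H(0)`; so the gap is positive
below `I(A;Y)`. Above `I(A;Y)`, the point `E = 1` is outside the basin and has lower potential than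
the floor.

Coupled threshold. Below `I(A;Y)`, the profile is dominated by an almost stationary monotone front.
Summation by parts along it (`natPotential_front_le`) shows that the potential on its plateau cannot
be much larger than at `0`. So the plateau lies where `j ≥ (1+δ)K`, and the uncoupled evolution
carries it to the floor. Above `I(A;Y)`, a Bethe free energy which does not increase along a lower
bound of the evolution starts at no more than `Γ (H(1) - H(0))`, whereas a profile below the floor
would have energy close to `Γ K`. -/

instance : IsProbabilityMeasure stdGaussian := by unfold stdGaussian; infer_instance

lemma gaussianPDFReal_std (x : ℝ) :
    gaussianPDFReal 0 1 x = (Real.sqrt (2 * Real.pi))⁻¹ * Real.exp (-x ^ 2 / 2) := by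
  simp [gaussianPDFReal]

lemma hasDerivAt_gaussianPDFReal_std (x : ℝ) :
    HasDerivAt (gaussianPDFReal 0 1) (-x * gaussianPDFReal 0 1 x) x := by
  have h : gaussianPDFReal 0 1 =
      fun x => (Real.sqrt (2 * Real.pi))⁻¹ * Real.exp (-x ^ 2 / 2) := by
    ext x; exact gaussianPDFReal_std x
  rw [h]
  have h1 : HasDerivAt (fun x : ℝ => -x ^ 2 / 2) (-x) x := by
    have := ((hasDerivAt_pow 2 x).neg).div_const 2
    exact this.congr_deriv (by push_cast; ring)
  exact ((h1.exp).const_mul (Real.sqrt (2 * Real.pi))⁻¹).congr_deriv (by ring)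

lemma integral_stdGaussian (f : ℝ → ℝ) :
    ∫ x, f x ∂stdGaussian = ∫ x, f x * gaussianPDFReal 0 1 x := by
  rw [stdGaussian, integral_gaussianReal_eq_integral_smul one_ne_zero]
  simp [mul_comm]

lemma integrable_stdGaussian_iff (f : ℝ → ℝ) :
    Integrable f stdGaussian ↔ Integrable (fun x => f x * gaussianPDFReal 0 1 x) := by
  rw [stdGaussian, gaussianReal_of_var_ne_zero _ one_ne_zero,
    integrable_withDensity_iff_integrable_smul' (measurable_gaussianPDF 0 1)
      (by simp [gaussianPDF])]
  simp [toReal_gaussianPDF, mul_comm]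

/-- Gaussian integration by parts. -/
lemma integral_mul_self_stdGaussian {f f' : ℝ → ℝ} (hf : ∀ x, HasDerivAt f (f' x) x)
    (h1 : Integrable (fun x => x * f x) stdGaussian) (h2 : Integrable f' stdGaussian)
    (h3 : Integrable f stdGaussian) :
    ∫ x, x * f x ∂stdGaussian = ∫ x, f' x ∂stdGaussian := by
  rw [integral_stdGaussian, integral_stdGaussian]
  rw [integrable_stdGaussian_iff] at h1 h2 h3
  have := integral_mul_deriv_eq_deriv_mul_of_integrable (u := f) (u' := f')
    (v := gaussianPDFReal 0 1) (v' := fun x => -x * gaussianPDFReal 0 1 x)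
    (fun x _ => hf x) (fun x _ => hasDerivAt_gaussianPDFReal_std x)
    (h1.neg.congr (ae_of_all _ fun x => by simp; ring)) h2 h3
  have e : ∫ x, f x * (-x * gaussianPDFReal 0 1 x) = - ∫ x, x * f x * gaussianPDFReal 0 1 x := by
    rw [← integral_neg]; congr 1; ext x; ring
  rw [e] at this
  linarith

/-- The Cameron–Martin formula on the line. -/
lemma integral_add_stdGaussian (k : ℝ → ℝ) (a : ℝ) :
    ∫ x, k (x + a) ∂stdGaussian = ∫ x, k x * Real.exp (a * x - a ^ 2 / 2) ∂stdGaussian := by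
  rw [integral_stdGaussian, integral_stdGaussian,
    ← integral_add_right_eq_self (fun x => k x * Real.exp (a * x - a ^ 2 / 2) *
      gaussianPDFReal 0 1 x) a]
  congr 1; ext x
  rw [gaussianPDFReal_std, gaussianPDFReal_std]
  have : Real.exp (-x ^ 2 / 2) = Real.exp (a * (x + a) - a ^ 2 / 2) *
      Real.exp (-(x + a) ^ 2 / 2) := by
    rw [← Real.exp_add]; congr 1; ring
  rw [this]; ring

lemma integrable_exp_mul_stdGaussian (a : ℝ) :
    Integrable (fun x => Real.exp (a * x)) stdGaussian :=
  integrable_exp_mul_gaussianReal a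

lemma integral_exp_mul_stdGaussian (a : ℝ) :
    ∫ x, Real.exp (a * x) ∂stdGaussian = Real.exp (a ^ 2 / 2) := by
  have := congrFun (mgf_id_gaussianReal (μ := 0) (v := 1)) a
  simpa [mgf, stdGaussian] using this

lemma integrable_id_stdGaussian : Integrable (fun x : ℝ => x) stdGaussian :=
  (memLp_id_gaussianReal (μ := 0) (v := 1) 1).integrable (by simp)

lemma integrable_abs_stdGaussian : Integrable (fun x : ℝ => |x|) stdGaussian :=
  integrable_id_stdGaussian.abs

lemma integrable_sq_stdGaussian : Integrable (fun x : ℝ => x ^ 2) stdGaussian :=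
  (memLp_id_gaussianReal (μ := 0) (v := 1) 2).integrable_sq

lemma integral_id_stdGaussian : ∫ x, x ∂stdGaussian = 0 := integral_id_gaussianReal

lemma integral_sq_stdGaussian : ∫ x, x ^ 2 ∂stdGaussian = 1 := by
  have h := integral_mul_self_stdGaussian (f := fun x => x) (f' := fun _ => 1)
    (fun x => hasDerivAt_id x)
    (by simpa [pow_two] using integrable_sq_stdGaussian) (integrable_const 1)
    integrable_id_stdGaussian
  simpa [pow_two] using h

/-- The rotation invariance of a pair of independent standard Gaussian variables. -/
lemma map_rotation_stdGaussian {c s : ℝ} (hc0 : 0 ≤ c) (hs0 : 0 ≤ s) (h : c ^ 2 + s ^ 2 = 1) :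
    (stdGaussian.prod stdGaussian).map
      (fun x : ℝ × ℝ => (c * x.1 + s * x.2, -s * x.1 + c * x.2)) =
      stdGaussian.prod stdGaussian := by
  have hr := IsGaussian.map_rotation_eq_self (μ := gaussianReal 0 1)
    (by simp) (Real.arccos c)
  have hc : Real.cos (Real.arccos c) = c := Real.cos_arccos (by linarith) (by nlinarith)
  have hs : Real.sin (Real.arccos c) = s := by
    rw [Real.sin_arccos, show 1 - c ^ 2 = s ^ 2 by linarith, Real.sqrt_sq hs0]
  have e : (⇑(ContinuousLinearMap.rotation (E := ℝ) (Real.arccos c)) : ℝ × ℝ → ℝ × ℝ) =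
      (fun x : ℝ × ℝ => (c * x.1 + s * x.2, -s * x.1 + c * x.2)) := by
    ext x <;> simp [ContinuousLinearMap.rotation_apply, hc, hs]
  rw [e] at hr
  exact hr

lemma measurePreserving_rotation {c s : ℝ} (hc0 : 0 ≤ c) (hs0 : 0 ≤ s) (h : c ^ 2 + s ^ 2 = 1) :
    MeasurePreserving (fun x : ℝ × ℝ => (c * x.1 + s * x.2, -s * x.1 + c * x.2))
      (stdGaussian.prod stdGaussian) (stdGaussian.prod stdGaussian) :=
  ⟨by fun_prop, map_rotation_stdGaussian hc0 hs0 h⟩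

lemma measurePreserving_linComb {c s : ℝ} (hc0 : 0 ≤ c) (hs0 : 0 ≤ s) (h : c ^ 2 + s ^ 2 = 1) :
    MeasurePreserving (fun x : ℝ × ℝ => c * x.1 + s * x.2)
      (stdGaussian.prod stdGaussian) stdGaussian :=
  measurePreserving_fst.comp (measurePreserving_rotation hc0 hs0 h)

/-- Both `Real.sqrt` and `Real.toNNReal` send negative numbers to `0`, so no sign condition on `E`
is needed. -/
lemma gaussianReal_eq_map (p E : ℝ) :
    gaussianReal p E.toNNReal = stdGaussian.map (fun n => p + Real.sqrt E * n) := by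
  have h1 : stdGaussian.map (fun n => Real.sqrt E * n) = gaussianReal 0 E.toNNReal := by
    rw [stdGaussian, gaussianReal_map_const_mul]
    congr 1
    · simp
    · ext
      rcases le_total 0 E with hE | hE
      · simp [Real.sq_sqrt hE, hE]
      · simp [Real.sqrt_eq_zero_of_nonpos hE, Real.toNNReal_of_nonpos hE]
  have h2 := gaussianReal_map_const_add (μ := 0) (v := E.toNNReal) p
  rw [← h1, Measure.map_map (by fun_prop) (by fun_prop)] at h2
  simp only [zero_add] at h2
  rw [← h2]
  rfl

end SparseSuperposition

namespace SparseSuperposition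

/-! ### Gaussian vectors -/

/-- The law of a standard Gaussian vector. -/
noncomputable def gaussVec (B : ℕ) : Measure (Fin B → ℝ) := Measure.pi fun _ => stdGaussian

instance (B : ℕ) : IsProbabilityMeasure (gaussVec B) := by unfold gaussVec; infer_instance

/-- Resampling one coordinate independently does not change the law. This reduces integration by
parts and Cameron–Martin shifts in `ℝ^B` to their versions on the line. -/
lemma measurePreserving_update (B : ℕ) (i : Fin B) :
    MeasurePreserving (fun p : ℝ × (Fin B → ℝ) => Function.update p.2 i p.1)
      (stdGaussian.prod (gaussVec B)) (gaussVec B) := by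
  have hm : Measurable (fun p : ℝ × (Fin B → ℝ) => Function.update p.2 i p.1) := by
    refine measurable_pi_iff.2 fun k => ?_
    by_cases h : k = i
    · subst h; simpa using measurable_fst
    · simp only [Function.update_of_ne h]; fun_prop
  refine ⟨hm, ?_⟩
  symm
  refine Measure.pi_eq fun s hs => ?_
  rw [Measure.map_apply hm (MeasurableSet.univ_pi hs)]
  have : (fun p : ℝ × (Fin B → ℝ) => Function.update p.2 i p.1) ⁻¹' (univ.pi s) =
      s i ×ˢ univ.pi (Function.update s i univ) := by
    ext ⟨x, z⟩
    simp only [mem_preimage, mem_univ_pi, mem_prod]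
    constructor
    · intro h
      refine ⟨by simpa using h i, fun k => ?_⟩
      by_cases hk : k = i
      · subst hk; simp
      · simpa [hk] using h k
    · rintro ⟨h1, h2⟩ k
      by_cases hk : k = i
      · subst hk; simpa using h1
      · simpa [hk] using h2 k
  rw [this, Measure.prod_prod, gaussVec, Measure.pi_pi,
    ← Finset.mul_prod_erase Finset.univ (fun k => stdGaussian (s k)) (Finset.mem_univ i),
    ← Finset.mul_prod_erase Finset.univ (fun k => stdGaussian (Function.update s i univ k))
      (Finset.mem_univ i)]
  simp only [Function.update_self, measure_univ, one_mul]
  congr 1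
  refine Finset.prod_congr rfl fun k hk => ?_
  simp [Finset.ne_of_mem_erase hk]

lemma integral_gaussVec_update {B : ℕ} (i : Fin B) {f : (Fin B → ℝ) → ℝ}
    (hf : Integrable f (gaussVec B)) :
    ∫ z, f z ∂gaussVec B = ∫ z, ∫ x, f (Function.update z i x) ∂stdGaussian ∂gaussVec B := by
  have hp := measurePreserving_update B i
  have hi : Integrable (fun p : ℝ × (Fin B → ℝ) => f (Function.update p.2 i p.1))
      (stdGaussian.prod (gaussVec B)) := hp.integrable_comp_of_integrable hf
  rw [← integral_prod_symm _ hi]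
  conv_lhs => rw [← hp.map_eq]
  rw [integral_map hp.aemeasurable (by rw [hp.map_eq]; exact hf.1)]

lemma measurePreserving_vec_linComb (B : ℕ) {c s : ℝ} (hc0 : 0 ≤ c) (hs0 : 0 ≤ s)
    (h : c ^ 2 + s ^ 2 = 1) :
    MeasurePreserving (fun x : (Fin B → ℝ) × (Fin B → ℝ) => fun k => c * x.1 k + s * x.2 k)
      ((gaussVec B).prod (gaussVec B)) (gaussVec B) := by
  have h1 := (measurePreserving_arrowProdEquivProdArrow ℝ ℝ (Fin B)
    (fun _ => stdGaussian) (fun _ => stdGaussian)).symm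
  have h2 : MeasurePreserving (fun (x : Fin B → ℝ × ℝ) k => c * (x k).1 + s * (x k).2)
      (Measure.pi fun _ : Fin B => stdGaussian.prod stdGaussian)
      (Measure.pi fun _ : Fin B => stdGaussian) :=
    measurePreserving_pi _ _ fun _ => measurePreserving_linComb hc0 hs0 h
  exact h2.comp h1

lemma integrable_exp_sum_gaussVec {B : ℕ} (c : Fin B → ℝ) :
    Integrable (fun z => Real.exp (∑ k, c k * z k)) (gaussVec B) := by
  simp_rw [Real.exp_sum]
  exact Integrable.fintype_prod fun k => integrable_exp_mul_stdGaussian (c k)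

lemma integral_exp_sum_gaussVec {B : ℕ} (c : Fin B → ℝ) :
    ∫ z, Real.exp (∑ k, c k * z k) ∂gaussVec B = Real.exp (∑ k, c k ^ 2 / 2) := by
  simp_rw [Real.exp_sum, gaussVec]
  rw [integral_fintype_prod_eq_prod (f := fun k x => Real.exp (c k * x))]
  simp_rw [integral_exp_mul_stdGaussian]

lemma sum_two_coord {B : ℕ} (i j : Fin B) (a b : ℝ) (z : Fin B → ℝ) :
    ∑ k, (Pi.single j a + Pi.single i b : Fin B → ℝ) k * z k = a * z j + b * z i := by
  simp [add_mul, Finset.sum_add_distrib, Pi.single_apply]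

lemma sum_two_coord_sq {B : ℕ} {i j : Fin B} (hij : j ≠ i) (a b : ℝ) :
    ∑ k, (Pi.single j a + Pi.single i b : Fin B → ℝ) k ^ 2 / 2 = a ^ 2 / 2 + b ^ 2 / 2 := by
  have : ∀ k, (Pi.single j a + Pi.single i b : Fin B → ℝ) k ^ 2 / 2 =
      (if k = j then a ^ 2 / 2 else 0) + (if k = i then b ^ 2 / 2 else 0) := by
    intro k
    by_cases h1 : k = j
    · subst h1; simp [hij]
    · by_cases h2 : k = i
      · subst h2; simp [h1]
      · simp [h1, h2]
  simp_rw [this]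
  simp [Finset.sum_add_distrib]

lemma integrable_exp_two {B : ℕ} (i j : Fin B) (a b : ℝ) :
    Integrable (fun z => Real.exp (a * z j + b * z i)) (gaussVec B) := by
  have h := integrable_exp_sum_gaussVec (Pi.single j a + Pi.single i b : Fin B → ℝ)
  simp_rw [sum_two_coord i j] at h
  exact h

lemma integral_exp_two {B : ℕ} {i j : Fin B} (hij : j ≠ i) (a b : ℝ) :
    ∫ z, Real.exp (a * z j + b * z i) ∂gaussVec B = Real.exp (a ^ 2 / 2 + b ^ 2 / 2) := by
  have h := integral_exp_sum_gaussVec (Pi.single j a + Pi.single i b : Fin B → ℝ)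
  simp_rw [sum_two_coord i j] at h
  rw [h, sum_two_coord_sq hij]

lemma measurePreserving_eval_gaussVec {B : ℕ} (i : Fin B) :
    MeasurePreserving (fun z : Fin B → ℝ => z i) (gaussVec B) stdGaussian :=
  measurePreserving_eval _ i

lemma integrable_coord {B : ℕ} (i : Fin B) {f : ℝ → ℝ} (hf : Integrable f stdGaussian) :
    Integrable (fun z => f (z i)) (gaussVec B) :=
  (measurePreserving_eval_gaussVec i).integrable_comp_of_integrable hf

lemma integral_coord {B : ℕ} (i : Fin B) {f : ℝ → ℝ} (hf : Integrable f stdGaussian) :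
    ∫ z, f (z i) ∂gaussVec B = ∫ x, f x ∂stdGaussian := by
  have hp := measurePreserving_eval_gaussVec i
  conv_rhs => rw [← hp.map_eq]
  rw [integral_map hp.aemeasurable]
  rw [hp.map_eq]; exact hf.1

lemma integral_exp_coord {B : ℕ} (i : Fin B) (a : ℝ) :
    ∫ z, Real.exp (a * z i) ∂gaussVec B = Real.exp (a ^ 2 / 2) := by
  rw [integral_coord i (integrable_exp_mul_stdGaussian a), integral_exp_mul_stdGaussian]

/-- The Cameron–Martin formula for a shift of one coordinate. -/
lemma integral_add_single_gaussVec {B : ℕ} (i : Fin B) (a C : ℝ) {k : (Fin B → ℝ) → ℝ}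
    (hk : Measurable k) (hC : ∀ z, |k z| ≤ C) :
    ∫ z, k (z + Pi.single i a) ∂gaussVec B =
      ∫ z, k z * Real.exp (a * z i - a ^ 2 / 2) ∂gaussVec B := by
  have hm : Measurable fun z : Fin B → ℝ => k (z + Pi.single i a) := by fun_prop
  rw [integral_gaussVec_update i (Integrable.of_bound hm.aestronglyMeasurable C
    (ae_of_all _ fun z => hC _)), integral_gaussVec_update i (f := fun z => k z * _)]
  · congr 1; ext z
    have h1 : ∀ x, Function.update z i x + Pi.single i a = Function.update z i (x + a) := by
      intro x; ext l
      by_cases hl : l = i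
      · subst hl; simp
      · simp [hl]
    simp_rw [h1]
    rw [integral_add_stdGaussian (fun x => k (Function.update z i x)) a]
    simp
  · refine Integrable.bdd_mul (c := C) ?_ hk.aestronglyMeasurable (ae_of_all _ hC)
    have := (integrable_coord i (integrable_exp_mul_stdGaussian a)).mul_const
      (Real.exp (-(a ^ 2 / 2)))
    refine this.congr (ae_of_all _ fun z => ?_)
    simp only [← Real.exp_add, sub_eq_add_neg]

/-- Gaussian integration by parts in one coordinate. -/
lemma integral_coord_mul_gaussVec {B : ℕ} (i : Fin B) (C : ℝ) {f f' : (Fin B → ℝ) → ℝ}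
    (hf : Measurable f) (hf' : Measurable f') (hC : ∀ z, |f z| ≤ C) (hC' : ∀ z, |f' z| ≤ C)
    (hd : ∀ z x, HasDerivAt (fun x => f (Function.update z i x)) (f' (Function.update z i x)) x) :
    ∫ z, z i * f z ∂gaussVec B = ∫ z, f' z ∂gaussVec B := by
  have hu : ∀ z : Fin B → ℝ, Measurable fun x : ℝ => Function.update z i x :=
    fun z => measurable_update z
  have hcoord : Integrable (fun z : Fin B → ℝ => z i) (gaussVec B) :=
    integrable_coord i integrable_id_stdGaussian
  rw [integral_gaussVec_update i (hcoord.mul_bdd (c := C) hf.aestronglyMeasurable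
    (ae_of_all _ hC)), integral_gaussVec_update i (Integrable.of_bound hf'.aestronglyMeasurable C
    (ae_of_all _ hC'))]
  · congr 1; ext z
    simp only [Function.update_self]
    refine integral_mul_self_stdGaussian (hd z) ?_ ?_ ?_
    · exact integrable_id_stdGaussian.mul_bdd (c := C)
        (hf.comp (hu z)).aestronglyMeasurable (ae_of_all _ fun x => hC _)
    · exact Integrable.of_bound (hf'.comp (hu z)).aestronglyMeasurable C
        (ae_of_all _ fun x => hC' _)
    · exact Integrable.of_bound (hf.comp (hu z)).aestronglyMeasurable C
        (ae_of_all _ fun x => hC _)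

end SparseSuperposition

namespace SparseSuperposition

/-! ### The section denoiser as a softmax -/

/-- The Gibbs weights `exp (a y_k) / ∑ exp (a y_l)`. -/
noncomputable def gibbs {B : ℕ} (a : ℝ) (y : Fin B → ℝ) (k : Fin B) : ℝ :=
  Real.exp (a * y k) / ∑ l, Real.exp (a * y l)

/-- The relative weight `∑_{j ≠ i} exp (-a² + a (z_j - z_i))` of the wrong positions. -/
noncomputable def crossSum {B : ℕ} (a : ℝ) (i : Fin B) (z : Fin B → ℝ) : ℝ :=
  ∑ j ∈ Finset.univ.erase i, Real.exp (-a ^ 2 + a * (z j - z i))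

lemma sum_exp_pos {B : ℕ} (i : Fin B) (a : ℝ) (y : Fin B → ℝ) : 0 < ∑ l, Real.exp (a * y l) :=
  Finset.sum_pos (fun _ _ => Real.exp_pos _) ⟨i, Finset.mem_univ i⟩

lemma gibbs_nonneg {B : ℕ} (a : ℝ) (y : Fin B → ℝ) (k : Fin B) : 0 ≤ gibbs a y k := by
  unfold gibbs; positivity

lemma sum_gibbs {B : ℕ} (i : Fin B) (a : ℝ) (y : Fin B → ℝ) : ∑ k, gibbs a y k = 1 := by
  simp_rw [gibbs, ← Finset.sum_div]
  exact div_self (sum_exp_pos i a y).ne'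

lemma gibbs_le_one {B : ℕ} (a : ℝ) (y : Fin B → ℝ) (k : Fin B) : gibbs a y k ≤ 1 := by
  rw [← sum_gibbs k a y]
  exact Finset.single_le_sum (fun l _ => gibbs_nonneg a y l) (Finset.mem_univ k)

lemma measurable_gibbs {B : ℕ} (a : ℝ) (k : Fin B) :
    Measurable fun y : Fin B → ℝ => gibbs a y k := by
  unfold gibbs; fun_prop

lemma crossSum_nonneg {B : ℕ} (a : ℝ) (i : Fin B) (z : Fin B → ℝ) : 0 ≤ crossSum a i z :=
  Finset.sum_nonneg fun _ _ => (Real.exp_pos _).le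

lemma measurable_crossSum {B : ℕ} (a : ℝ) (i : Fin B) :
    Measurable fun z : Fin B → ℝ => crossSum a i z := by
  unfold crossSum; fun_prop

/-- With `i` the true position, the observation is `z + a e_i`. Dividing the partition sum by the
weight of `i` leaves `1 + Q`, where `Q = crossSum`. -/
lemma sum_exp_shift {B : ℕ} (a : ℝ) (i : Fin B) (z : Fin B → ℝ) :
    ∑ l, Real.exp (a * (z + Pi.single i a : Fin B → ℝ) l) =
      Real.exp (a ^ 2 + a * z i) * (1 + crossSum a i z) := by
  rw [← Finset.add_sum_erase _ _ (Finset.mem_univ i), mul_add, mul_one, crossSum, Finset.mul_sum]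
  congr 1
  · simp; ring
  · refine Finset.sum_congr rfl fun j hj => ?_
    rw [← Real.exp_add]
    simp [Finset.ne_of_mem_erase hj]; ring

lemma one_sub_gibbs_shift {B : ℕ} (a : ℝ) (i : Fin B) (z : Fin B → ℝ) :
    1 - gibbs a (z + Pi.single i a) i = crossSum a i z / (1 + crossSum a i z) := by
  have h := crossSum_nonneg a i z
  rw [gibbs, sum_exp_shift]
  have : a * (z + Pi.single i a : Fin B → ℝ) i = a ^ 2 + a * z i := by simp; ring
  rw [this, div_mul_cancel_left₀ (Real.exp_pos _).ne']
  field_simp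
  ring

/-- Expand the square: all sections have the same norm, so only the scalar product with the
observation depends on `j`. The first factor cancels in the denoiser. -/
lemma theta_eq {B : ℕ} {v : ℝ≥0∞} (hv : v ≠ ∞) {a : ℝ}
    (ha : a = Real.sqrt (Real.logb 2 B * v.toReal)) (i j : Fin B) (z : Fin B → ℝ) :
    theta B (sectionVec B j) (sectionVec B i) z v =
      Real.exp (-(∑ k, z k ^ 2) / 2 - a ^ 2 - a * z i) *
        Real.exp (a * (z + Pi.single i a : Fin B → ℝ) j) := by
  rw [theta, if_neg hv, ← ha, ← Real.exp_add]
  congr 1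
  have : ∀ k, ((sectionVec B j k - sectionVec B i k) * a - z k) ^ 2 = z k ^ 2 +
      (if k = j then a ^ 2 * (1 - 2 * (Pi.single i 1 : Fin B → ℝ) j) - 2 * a * z j else 0) +
      (if k = i then a ^ 2 + 2 * a * z i else 0) := by
    intro k
    by_cases h1 : k = j
    · subst h1
      by_cases h2 : k = i
      · subst h2; simp [sectionVec]; ring
      · simp [sectionVec, h2]; ring
    · by_cases h2 : k = i
      · subst h2; simp [sectionVec, h1]; ring
      · simp [sectionVec, h1, h2]
  simp_rw [this, Finset.sum_add_distrib]
  by_cases h2 : j = i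
  · subst h2; simp; ring
  · simp [h2]; ring

lemma denoiser_eq {B : ℕ} {v : ℝ≥0∞} (hv : v ≠ ∞) {a : ℝ}
    (ha : a = Real.sqrt (Real.logb 2 B * v.toReal)) (i k : Fin B) (z : Fin B → ℝ) :
    denoiser B (sectionVec B i) z v k = gibbs a (z + Pi.single i a) k := by
  have hB : (B : ℝ) ≠ 0 := by have := i.pos; positivity
  have h : ∑ j, theta B (sectionVec B j) (sectionVec B i) z v * sectionVec B j k =
      theta B (sectionVec B k) (sectionVec B i) z v := by
    rw [Finset.sum_eq_single k]
    · simp [sectionVec]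
    · intro b _ hb; simp [sectionVec, hb.symm]
    · simp
  rw [denoiser, h, partitionFn, div_div_div_cancel_right₀ hB]
  simp_rw [theta_eq hv ha]
  rw [← Finset.mul_sum, gibbs, mul_div_mul_left _ _ (Real.exp_pos _).ne']

lemma partitionFn_eq {B : ℕ} {v : ℝ≥0∞} (hv : v ≠ ∞) {a : ℝ}
    (ha : a = Real.sqrt (Real.logb 2 B * v.toReal)) (i : Fin B) (z : Fin B → ℝ) :
    partitionFn B (sectionVec B i) z v =
      Real.exp (-(∑ k, z k ^ 2) / 2) * (1 + crossSum a i z) / B := by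
  rw [partitionFn]
  simp_rw [theta_eq hv ha]
  rw [← Finset.mul_sum, sum_exp_shift, ← mul_assoc, ← Real.exp_add]
  congr 3
  ring_nf

/-- The error `𝔼 Q / (1 + Q)` of the denoiser, as a function of `a = √(log₂ B) / Σ`. -/
noncomputable def errProb (B : ℕ) (a : ℝ) : ℝ :=
  (∑ i : Fin B, ∫ z, crossSum a i z / (1 + crossSum a i z) ∂gaussVec B) / B

/-- `𝔼 ln (1 + Q)`, as a function of `a = √(log₂ B) / Σ`. -/
noncomputable def logPart (B : ℕ) (a : ℝ) : ℝ :=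
  (∑ i : Fin B, ∫ z, Real.log (1 + crossSum a i z) ∂gaussVec B) / B

lemma integrable_gibbs_mul {B : ℕ} (a : ℝ) (k : Fin B) {f : (Fin B → ℝ) → ℝ}
    (hf : Integrable f (gaussVec B)) : Integrable (fun z => gibbs a z k * f z) (gaussVec B) :=
  hf.bdd_mul (c := 1) (measurable_gibbs a k).aestronglyMeasurable
    (ae_of_all _ fun z => by
      rw [Real.norm_of_nonneg (gibbs_nonneg _ _ _)]; exact gibbs_le_one _ _ _)

lemma integrable_exp_coord_sub {B : ℕ} (a : ℝ) (i : Fin B) :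
    Integrable (fun z : Fin B → ℝ => Real.exp (a * z i - a ^ 2 / 2)) (gaussVec B) := by
  simp_rw [Real.exp_sub]
  exact (integrable_coord i (integrable_exp_mul_stdGaussian a)).div_const _

/-- The Nishimori identity: two independent samples of the posterior and the truth with one sample
have the same overlap. -/
lemma nishimori (B : ℕ) (a : ℝ) :
    ∑ i : Fin B, ∫ z, ∑ k, gibbs a (z + Pi.single i a) k ^ 2 ∂gaussVec B =
      ∑ i : Fin B, ∫ z, gibbs a (z + Pi.single i a) i ∂gaussVec B := by
  have hsq : ∀ (y : Fin B → ℝ) , |∑ k, gibbs a y k ^ 2| ≤ B := by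
    intro y
    rw [abs_of_nonneg (Finset.sum_nonneg fun _ _ => sq_nonneg _)]
    calc ∑ k, gibbs a y k ^ 2 ≤ ∑ _k : Fin B, (1 : ℝ) :=
          Finset.sum_le_sum fun k _ => pow_le_one₀ (gibbs_nonneg _ _ _) (gibbs_le_one _ _ _)
      _ = B := by simp
  have hmeas : Measurable fun y : Fin B → ℝ => ∑ k, gibbs a y k ^ 2 :=
    Finset.measurable_sum _ fun k _ => (measurable_gibbs a k).pow_const 2
  have h1 : ∀ i : Fin B, ∫ z, ∑ k, gibbs a (z + Pi.single i a) k ^ 2 ∂gaussVec B =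
      ∫ z, (∑ k, gibbs a z k ^ 2) * Real.exp (a * z i - a ^ 2 / 2) ∂gaussVec B :=
    fun i => integral_add_single_gaussVec i a B hmeas hsq
  have h2 : ∀ i : Fin B, ∫ z, gibbs a (z + Pi.single i a) i ∂gaussVec B =
      ∫ z, gibbs a z i * Real.exp (a * z i - a ^ 2 / 2) ∂gaussVec B :=
    fun i => integral_add_single_gaussVec i a 1 (measurable_gibbs a i) fun z => by
      rw [abs_of_nonneg (gibbs_nonneg _ _ _)]; exact gibbs_le_one _ _ _
  simp_rw [h1, h2]
  rw [← integral_finsetSum, ← integral_finsetSum]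
  · congr 1; ext z
    -- The Cameron–Martin weights `w_i = exp (a z_i - a²/2)` sum to the Gibbs denominator times `exp
    -- (-a²/2)`. Hence `g_k² ∑_i w_i = g_k w_k` pointwise.
    rw [← Finset.mul_sum, Finset.sum_mul]
    refine Finset.sum_congr rfl fun k _ => ?_
    simp_rw [Real.exp_sub, ← Finset.sum_div]
    have := (sum_exp_pos k a z).ne'
    rw [gibbs]
    field_simp
  · exact fun i _ => integrable_gibbs_mul a i (integrable_exp_coord_sub a i)
  · intro i _
    exact (integrable_exp_coord_sub a i).bdd_mul (c := B) hmeas.aestronglyMeasurable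
      (ae_of_all _ hsq)

lemma integrable_gibbs_shift {B : ℕ} (a : ℝ) (i k : Fin B) :
    Integrable (fun z => gibbs a (z + Pi.single i a) k) (gaussVec B) :=
  Integrable.of_bound ((measurable_gibbs a k).comp (by fun_prop)).aestronglyMeasurable 1
    (ae_of_all _ fun z => by
      rw [Real.norm_of_nonneg (gibbs_nonneg _ _ _)]; exact gibbs_le_one _ _ _)

lemma integrable_gibbs_shift_sq {B : ℕ} (a : ℝ) (i k : Fin B) :
    Integrable (fun z => gibbs a (z + Pi.single i a) k ^ 2) (gaussVec B) :=
  Integrable.of_bound (((measurable_gibbs a k).comp (by fun_prop)).pow_const 2).aestronglyMeasurable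
    1 (ae_of_all _ fun z => by
      rw [Real.norm_of_nonneg (sq_nonneg _)]
      exact pow_le_one₀ (gibbs_nonneg _ _ _) (gibbs_le_one _ _ _))

/-- The mean square error of the Gibbs weights. -/
noncomputable def gibbsMSE (B : ℕ) (a : ℝ) : ℝ :=
  (∑ i : Fin B, ∫ z, ∑ k, (gibbs a (z + Pi.single i a) k - sectionVec B i k) ^ 2 ∂gaussVec B) / B

lemma sum_sq_gibbs_sub {B : ℕ} (a : ℝ) (i : Fin B) (y : Fin B → ℝ) :
    ∑ k, (gibbs a y k - sectionVec B i k) ^ 2 = ∑ k, gibbs a y k ^ 2 - 2 * gibbs a y i + 1 := by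
  have : ∀ k, (gibbs a y k - sectionVec B i k) ^ 2 =
      gibbs a y k ^ 2 + (if k = i then 1 - 2 * gibbs a y i else 0) := by
    intro k
    by_cases h : k = i
    · subst h; simp [sectionVec]; ring
    · simp [sectionVec, h]
  simp_rw [this, Finset.sum_add_distrib]
  simp; ring

lemma integral_sum_sq_gibbs_sub {B : ℕ} (a : ℝ) (i : Fin B) :
    ∫ z, ∑ k, (gibbs a (z + Pi.single i a) k - sectionVec B i k) ^ 2 ∂gaussVec B =
      ∫ z, ∑ k, gibbs a (z + Pi.single i a) k ^ 2 ∂gaussVec B -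
        2 * ∫ z, gibbs a (z + Pi.single i a) i ∂gaussVec B + 1 := by
  simp_rw [sum_sq_gibbs_sub]
  have h1 : Integrable (fun z => ∑ k, gibbs a (z + Pi.single i a) k ^ 2) (gaussVec B) :=
    integrable_finsetSum _ fun k _ => integrable_gibbs_shift_sq a i k
  have h2 := (integrable_gibbs_shift a i i).const_mul 2
  have h3 := integral_add (h1.sub h2) (integrable_const (1 : ℝ))
  simp only [Pi.sub_apply] at h3
  rw [h3, integral_sub h1 h2, integral_const_mul]
  simp

/-- The squared error is `∑ g_k² - 2 g_i + 1`. By the Nishimori identity its mean is that of `1 -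
g_i = Q / (1 + Q)`. -/
lemma gibbsMSE_eq_errProb (B : ℕ) (a : ℝ) : gibbsMSE B a = errProb B a := by
  rw [gibbsMSE, errProb]
  congr 1
  simp_rw [integral_sum_sq_gibbs_sub, ← one_sub_gibbs_shift]
  have : ∀ i : Fin B, ∫ z, (1 - gibbs a (z + Pi.single i a) i) ∂gaussVec B =
      1 - ∫ z, gibbs a (z + Pi.single i a) i ∂gaussVec B := by
    intro i
    rw [integral_sub (integrable_const _) (integrable_gibbs_shift a i i)]
    simp
  simp_rw [this, Finset.sum_add_distrib, Finset.sum_sub_distrib, ← Finset.mul_sum]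
  rw [nishimori]
  ring

lemma sectionMSE_eq {B : ℕ} {v : ℝ≥0∞} (hv : v ≠ ∞) :
    sectionMSE B v = errProb B (Real.sqrt (Real.logb 2 B * v.toReal)) := by
  rw [← gibbsMSE_eq_errProb, sectionMSE, sectionExpect, gibbsMSE]
  simp_rw [denoiser_eq hv rfl]
  rfl

lemma integrable_exp_crossTerm {B : ℕ} (a : ℝ) (i j : Fin B) :
    Integrable (fun z => Real.exp (-a ^ 2 + a * (z j - z i))) (gaussVec B) := by
  have := (integrable_exp_two i j a (-a)).const_mul (Real.exp (-a ^ 2))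
  refine this.congr (ae_of_all _ fun z => ?_)
  simp only [← Real.exp_add]
  congr 1; ring

lemma integrable_crossSum {B : ℕ} (a : ℝ) (i : Fin B) :
    Integrable (fun z => crossSum a i z) (gaussVec B) :=
  integrable_finsetSum _ fun j _ => integrable_exp_crossTerm a i j

lemma integrable_log_one_add_crossSum {B : ℕ} (a : ℝ) (i : Fin B) :
    Integrable (fun z => Real.log (1 + crossSum a i z)) (gaussVec B) := by
  refine (integrable_crossSum a i).mono
    ((measurable_crossSum a i).const_add 1).log.aestronglyMeasurable (ae_of_all _ fun z => ?_)
  have h := crossSum_nonneg a i z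
  rw [Real.norm_of_nonneg (Real.log_nonneg (by linarith)), Real.norm_of_nonneg h]
  linarith [Real.log_le_sub_one_of_pos (show 0 < 1 + crossSum a i z by linarith)]

lemma integrable_sum_sq {B : ℕ} :
    Integrable (fun z : Fin B → ℝ => ∑ k, z k ^ 2) (gaussVec B) :=
  integrable_finsetSum _ fun k _ => integrable_coord k integrable_sq_stdGaussian

lemma integral_sum_sq {B : ℕ} : ∫ z : Fin B → ℝ, ∑ k, z k ^ 2 ∂gaussVec B = B := by
  rw [integral_finsetSum _ fun k _ => integrable_coord k integrable_sq_stdGaussian]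
  simp_rw [integral_coord _ integrable_sq_stdGaussian, integral_sq_stdGaussian]
  simp

/-- The two constants come from the factor `1/B` of the prior and from `𝔼 ‖z‖² = B`. -/
lemma entropyTerm_eq {B : ℕ} (hB : 2 ≤ B) {v : ℝ≥0∞} (hv : v ≠ ∞) :
    entropyTerm B v + (1 + (B : ℝ) / (2 * Real.log B)) =
      logPart B (Real.sqrt (Real.logb 2 B * v.toReal)) / Real.log B := by
  set a := Real.sqrt (Real.logb 2 B * v.toReal) with ha
  have hB0 : (0 : ℝ) < B := by positivity
  have hlog : 0 < Real.log B := Real.log_pos (by exact_mod_cast hB)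
  have h1 : ∀ i : Fin B, ∫ z, Real.logb B (partitionFn B (sectionVec B i) z v) ∂gaussVec B =
      (∫ z, Real.log (1 + crossSum a i z) ∂gaussVec B) / Real.log B - B / (2 * Real.log B) - 1 := by
    intro i
    have : ∀ z, Real.logb B (partitionFn B (sectionVec B i) z v) =
        Real.log (1 + crossSum a i z) / Real.log B - (∑ k, z k ^ 2) / (2 * Real.log B) - 1 := by
      intro z
      have hq := crossSum_nonneg a i z
      rw [partitionFn_eq hv ha, Real.logb, Real.log_div (by positivity) hB0.ne',
        Real.log_mul (Real.exp_pos _).ne' (by positivity), Real.log_exp]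
      field_simp
      ring
    simp_rw [this]
    rw [integral_sub _ (integrable_const _), integral_sub, integral_div, integral_div,
      integral_sum_sq]
    · simp
    · exact (integrable_log_one_add_crossSum a i).div_const _
    · exact integrable_sum_sq.div_const _
    · exact ((integrable_log_one_add_crossSum a i).div_const _).sub (integrable_sum_sq.div_const _)
  rw [entropyTerm, sectionExpect, logPart]
  change (∑ j, ∫ z, Real.logb B (partitionFn B (sectionVec B j) z v) ∂gaussVec B) / B + _ = _
  simp_rw [h1, Finset.sum_sub_distrib, ← Finset.sum_div]
  simp
  field_simp
  ring

lemma theta_top {B : ℕ} (i j : Fin B) (z : Fin B → ℝ) :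
    theta B (sectionVec B j) (sectionVec B i) z ∞ =
      if j = i then Real.exp (-(∑ k, z k ^ 2) / 2) else 0 := by
  have : sectionVec B j = sectionVec B i ↔ j = i := by
    refine ⟨fun h => ?_, fun h => by rw [h]⟩
    have := congrFun h j
    by_contra hne
    simp [sectionVec, hne] at this
  simp [theta, this]

lemma sectionMSE_top (B : ℕ) : sectionMSE B ∞ = 0 := by
  rw [sectionMSE, sectionExpect]
  have : ∀ (i : Fin B) (z : Fin B → ℝ),
      ∑ k, (denoiser B (sectionVec B i) z ∞ k - sectionVec B i k) ^ 2 = 0 := by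
    intro i z
    refine Finset.sum_eq_zero fun k _ => ?_
    have hB : (B : ℝ) ≠ 0 := by have := i.pos; positivity
    simp only [denoiser, partitionFn, theta_top]
    simp [div_div_div_cancel_right₀ hB]
  simp [this]

lemma entropyTerm_top {B : ℕ} (hB : 2 ≤ B) :
    entropyTerm B ∞ + (1 + (B : ℝ) / (2 * Real.log B)) = 0 := by
  have hB0 : (0 : ℝ) < B := by positivity
  have hlog : 0 < Real.log B := Real.log_pos (by exact_mod_cast hB)
  have h1 : ∀ i : Fin B, ∫ z, Real.logb B (partitionFn B (sectionVec B i) z ∞) ∂gaussVec B =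
      - B / (2 * Real.log B) - 1 := by
    intro i
    have : ∀ z, Real.logb B (partitionFn B (sectionVec B i) z ∞) =
        -(∑ k, z k ^ 2) / (2 * Real.log B) - 1 := by
      intro z
      simp only [partitionFn, theta_top]
      simp only [Finset.sum_ite_eq', Finset.mem_univ, if_true]
      rw [Real.logb, Real.log_div (by positivity) hB0.ne', Real.log_exp]
      field_simp
    simp_rw [this]
    have h3 := integral_sub (μ := gaussVec B) ((integrable_sum_sq (B := B)).neg.div_const
      (2 * Real.log B)) (integrable_const (1 : ℝ))
    simp only [Pi.neg_apply] at h3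
    rw [h3, integral_div, integral_neg, integral_sum_sq]
    simp
  rw [entropyTerm, sectionExpect]
  change (∑ j, ∫ z, Real.logb B (partitionFn B (sectionVec B j) z ∞) ∂gaussVec B) / B + _ = _
  simp_rw [h1]
  simp
  field_simp
  ring

end SparseSuperposition

namespace SparseSuperposition

/-! ### Monotonicity and bounds for the error of the denoiser -/

lemma integrable_affine {α : Type*} [MeasurableSpace α] {μ : Measure α} [IsProbabilityMeasure μ]
    {f : α → ℝ} (hf : Integrable f μ) (A c x₀ : ℝ) :
    Integrable (fun x => A + c * (f x - x₀)) μ :=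
  (integrable_const A).add ((hf.sub (integrable_const x₀)).const_mul c)

lemma integral_affine {α : Type*} [MeasurableSpace α] {μ : Measure α} [IsProbabilityMeasure μ]
    {f : α → ℝ} (hf : Integrable f μ) (A c x₀ : ℝ) :
    ∫ x, (A + c * (f x - x₀)) ∂μ = A + c * (∫ x, f x ∂μ - x₀) := by
  have h : Integrable (fun x => f x - x₀) μ := hf.sub (integrable_const x₀)
  rw [integral_add (integrable_const A) (h.const_mul c), integral_const_mul,
    integral_sub hf (integrable_const x₀)]
  simp

lemma integral_exp_crossTerm {B : ℕ} {i j : Fin B} (hij : j ≠ i) (a b : ℝ) :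
    ∫ z, Real.exp (b + a * (z j - z i)) ∂gaussVec B = Real.exp (b + a ^ 2) := by
  have h := integral_exp_two hij a (-a)
  have e : ∀ z : Fin B → ℝ, Real.exp (b + a * (z j - z i)) =
      Real.exp b * Real.exp (a * z j + -a * z i) := by
    intro z; rw [← Real.exp_add]; congr 1; ring
  simp_rw [e]
  rw [integral_const_mul, h, ← Real.exp_add]
  congr 1; ring

lemma integrable_exp_crossTerm' {B : ℕ} (a b : ℝ) (i j : Fin B) :
    Integrable (fun z => Real.exp (b + a * (z j - z i))) (gaussVec B) := by
  have := (integrable_exp_two i j a (-a)).const_mul (Real.exp b)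
  refine this.congr (ae_of_all _ fun z => ?_)
  simp only [← Real.exp_add]
  congr 1; ring

/-- An observation with parameter `a₂` amounts to two independent ones with parameters `a` and `b`,
`a₂² = a² + b²`. Each relative weight is then the product of the relative weights in the two
observations. -/
lemma crossSum_linComb {B : ℕ} {a b a₂ c s : ℝ} (hc : a₂ * c = a) (hs : a₂ * s = b)
    (h : a₂ ^ 2 = a ^ 2 + b ^ 2) (i : Fin B) (z z' : Fin B → ℝ) :
    crossSum a₂ i (fun k => c * z k + s * z' k) = ∑ j ∈ Finset.univ.erase i,
      Real.exp (-a ^ 2 + a * (z j - z i)) * Real.exp (-b ^ 2 + b * (z' j - z' i)) := by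
  refine Finset.sum_congr rfl fun j _ => ?_
  rw [← Real.exp_add, h, ← hc, ← hs]
  congr 1; ring

lemma bounded_div_one_add {q : ℝ} (hq : 0 ≤ q) : ‖q / (1 + q)‖ ≤ 1 := by
  rw [Real.norm_of_nonneg (by positivity), div_le_one (by positivity)]
  linarith

lemma integrable_err {B : ℕ} (a : ℝ) (i : Fin B) :
    Integrable (fun z => crossSum a i z / (1 + crossSum a i z)) (gaussVec B) :=
  Integrable.of_bound ((measurable_crossSum a i).div
    ((measurable_crossSum a i).const_add 1)).aestronglyMeasurable 1
    (ae_of_all _ fun z => bounded_div_one_add (crossSum_nonneg a i z))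

lemma integral_err_linComb {B : ℕ} {a b a₂ : ℝ} (ha : 0 ≤ a) (hb : 0 ≤ b) (ha₂ : 0 < a₂)
    (h : a₂ ^ 2 = a ^ 2 + b ^ 2) (i : Fin B) :
    ∃ f : (Fin B → ℝ) → (Fin B → ℝ) → ℝ,
      (∀ z z', f z z' = ∑ j ∈ Finset.univ.erase i,
        Real.exp (-a ^ 2 + a * (z j - z i)) * Real.exp (-b ^ 2 + b * (z' j - z' i))) ∧
      Integrable (fun z => ∫ z', f z z' / (1 + f z z') ∂gaussVec B) (gaussVec B) ∧
      (∀ z, Integrable (fun z' => f z z' / (1 + f z z')) (gaussVec B)) ∧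
      ∫ z, crossSum a₂ i z / (1 + crossSum a₂ i z) ∂gaussVec B =
        ∫ z, ∫ z', f z z' / (1 + f z z') ∂gaussVec B ∂gaussVec B := by
  have hp := measurePreserving_vec_linComb B (c := a / a₂) (s := b / a₂) (by positivity)
    (by positivity) (by field_simp; linarith)
  refine ⟨fun z z' => crossSum a₂ i (fun k => a / a₂ * z k + b / a₂ * z' k), fun z z' => ?_,
    ?_, fun z => ?_, ?_⟩
  · exact crossSum_linComb (by field_simp) (by field_simp) h i z z'
  · exact (hp.integrable_comp_of_integrable (integrable_err a₂ i)).integral_prod_left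
  · refine Integrable.of_bound (Measurable.aestronglyMeasurable ?_) 1
      (ae_of_all _ fun z' => bounded_div_one_add (crossSum_nonneg _ _ _))
    have : Measurable fun z' : Fin B → ℝ =>
        crossSum a₂ i (fun k => a / a₂ * z k + b / a₂ * z' k) :=
      (measurable_crossSum a₂ i).comp (by fun_prop)
    exact this.div (this.const_add 1)
  · conv_lhs => rw [← hp.map_eq]
    rw [integral_map hp.aemeasurable (by rw [hp.map_eq]; exact (integrable_err a₂ i).1)]
    exact integral_prod _ (hp.integrable_comp_of_integrable (integrable_err a₂ i))

/-- A further observation cannot increase the error: given the first one, the new factors have mean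
`1`, so that the total weight has conditional mean `q`. Conclude by Jensen for the concave function
`x / (1 + x)`, applied through its tangent at `q`. -/
lemma errProb_le_errProb_of_sq_add {B : ℕ} {a b a₂ : ℝ} (ha : 0 ≤ a) (hb : 0 ≤ b) (ha₂ : 0 < a₂)
    (h : a₂ ^ 2 = a ^ 2 + b ^ 2) : errProb B a₂ ≤ errProb B a := by
  refine div_le_div_of_nonneg_right (Finset.sum_le_sum fun i _ => ?_) (Nat.cast_nonneg B)
  obtain ⟨f, hf, hint, hint', heq⟩ := integral_err_linComb ha hb ha₂ h i
  rw [heq]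
  refine integral_mono hint (integrable_err a i) fun z => ?_
  have hq := crossSum_nonneg a i z
  set q := crossSum a i z with hqdef
  have hfi : Integrable (fun z' => f z z') (gaussVec B) := by
    simp_rw [hf]
    exact integrable_finsetSum _ fun j _ => (integrable_exp_crossTerm b i j).const_mul _
  have hfint : ∫ z', f z z' ∂gaussVec B = q := by
    simp_rw [hf]
    rw [integral_finsetSum _ fun j _ => (integrable_exp_crossTerm b i j).const_mul _]
    refine Finset.sum_congr rfl fun j hj => ?_
    rw [integral_const_mul, integral_exp_crossTerm (Finset.ne_of_mem_erase hj)]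
    simp
  have hf0 : ∀ z', 0 ≤ f z z' := fun z' => by
    rw [hf]; exact Finset.sum_nonneg fun _ _ => by positivity
  calc ∫ z', f z z' / (1 + f z z') ∂gaussVec B
      ≤ ∫ z', (q / (1 + q) + 1 / (1 + q) ^ 2 * (f z z' - q)) ∂gaussVec B := by
        refine integral_mono (hint' z) (integrable_affine hfi _ _ _) fun z' => ?_
        have h0 := hf0 z'
        have key : q / (1 + q) + 1 / (1 + q) ^ 2 * (f z z' - q) - f z z' / (1 + f z z') =
            (f z z' - q) ^ 2 / ((1 + q) ^ 2 * (1 + f z z')) := by field_simp; ring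
        have : 0 ≤ (f z z' - q) ^ 2 / ((1 + q) ^ 2 * (1 + f z z')) := by positivity
        show f z z' / (1 + f z z') ≤ q / (1 + q) + 1 / (1 + q) ^ 2 * (f z z' - q)
        linarith
    _ = q / (1 + q) := by
        rw [integral_affine hfi, hfint]
        simp

/-- Cauchy–Schwarz bounds the total weight `f` from below by `1 / Y`, where `Y` collects the inverse
factors and has mean `exp (2 b²) / q`. Then `f / (1 + f) ≥ 1 / (1 + Y)`, and Jensen for the convex
function `1 / (1 + y)` gives at least `q / (q + exp (2 b²)) ≥ exp (-2 b²) q / (1 + q)`. -/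
lemma exp_mul_errProb_le_of_sq_add {B : ℕ} {a b a₂ : ℝ} (ha : 0 ≤ a) (hb : 0 ≤ b) (ha₂ : 0 < a₂)
    (h : a₂ ^ 2 = a ^ 2 + b ^ 2) : Real.exp (-2 * b ^ 2) * errProb B a ≤ errProb B a₂ := by
  rw [errProb, errProb, ← mul_div_assoc, Finset.mul_sum]
  refine div_le_div_of_nonneg_right (Finset.sum_le_sum fun i _ => ?_) (Nat.cast_nonneg B)
  obtain ⟨f, hf, hint, hint', heq⟩ := integral_err_linComb ha hb ha₂ h i
  rw [heq, ← integral_const_mul]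
  refine integral_mono ((integrable_err a i).const_mul _) hint fun z => ?_
  have hq := crossSum_nonneg a i z
  have hf0 : ∀ z', 0 ≤ f z z' := fun z' => by
    rw [hf]; exact Finset.sum_nonneg fun _ _ => by positivity
  rcases hq.eq_or_lt with h0 | hq0
  · simp only [← h0, zero_div, mul_zero]
    exact integral_nonneg fun z' => div_nonneg (hf0 z') (by linarith [hf0 z'])
  set q := crossSum a i z with hqdef
  set x₀ := Real.exp (2 * b ^ 2) / q with hx₀
  have hx₀pos : 0 < x₀ := by positivity
  set Y : (Fin B → ℝ) → ℝ := fun z' => (∑ j ∈ Finset.univ.erase i,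
    Real.exp (-a ^ 2 + a * (z j - z i)) * Real.exp (b ^ 2 + -b * (z' j - z' i))) / q ^ 2 with hY
  have hYi : Integrable Y (gaussVec B) :=
    (integrable_finsetSum _ fun j _ =>
      (integrable_exp_crossTerm' (-b) (b ^ 2) i j).const_mul _).div_const _
  have hYint : ∫ z', Y z' ∂gaussVec B = x₀ := by
    rw [hY, integral_div, integral_finsetSum _ fun j _ =>
      (integrable_exp_crossTerm' (-b) (b ^ 2) i j).const_mul _]
    have : ∀ j ∈ Finset.univ.erase i, ∫ z', Real.exp (-a ^ 2 + a * (z j - z i)) *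
        Real.exp (b ^ 2 + -b * (z' j - z' i)) ∂gaussVec B =
        Real.exp (-a ^ 2 + a * (z j - z i)) * Real.exp (2 * b ^ 2) := by
      intro j hj
      rw [integral_const_mul, integral_exp_crossTerm (Finset.ne_of_mem_erase hj)]
      congr 2; ring
    rw [Finset.sum_congr rfl this, ← Finset.sum_mul]
    change q * _ / q ^ 2 = _
    rw [hx₀]; field_simp
  have hY0 : ∀ z', 0 ≤ Y z' := fun z' => by
    rw [hY]; positivity
  calc Real.exp (-2 * b ^ 2) * (q / (1 + q)) ≤ 1 / (1 + x₀) := by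
        have h1 : 1 ≤ Real.exp (2 * b ^ 2) := Real.one_le_exp (by positivity)
        have h2 : Real.exp (-2 * b ^ 2) = (Real.exp (2 * b ^ 2))⁻¹ := by
          rw [← Real.exp_neg]; congr 1; ring
        rw [h2, hx₀, inv_mul_eq_div, div_div, div_le_div_iff₀ (by positivity) (by positivity)]
        rw [mul_add, mul_div_cancel₀ _ hq0.ne']
        nlinarith
    _ = ∫ z', (1 / (1 + x₀) + -(1 / (1 + x₀) ^ 2) * (Y z' - x₀)) ∂gaussVec B := by
        rw [integral_affine hYi, hYint]
        simp
    _ ≤ ∫ z', f z z' / (1 + f z z') ∂gaussVec B := by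
        refine integral_mono (integrable_affine hYi _ _ _) (hint' z) fun z' => ?_
        have hc : q ^ 2 ≤ f z z' * (q ^ 2 * Y z') := by
          have : q ^ 2 * Y z' = ∑ j ∈ Finset.univ.erase i, Real.exp (-a ^ 2 + a * (z j - z i)) *
              Real.exp (b ^ 2 + -b * (z' j - z' i)) := by
            rw [hY]; field_simp
          rw [this, hf, hqdef, crossSum]
          refine Finset.sum_sq_le_sum_mul_sum_of_sq_le_mul _ (fun j _ => by positivity)
            (fun j _ => by positivity) (fun j _ => le_of_eq ?_)
          rw [← Real.exp_add, ← Real.exp_add, ← Real.exp_add, ← Real.exp_nat_mul]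
          congr 1; push_cast; ring
        have hc1 : 1 ≤ f z z' * Y z' := by
          have : q ^ 2 * 1 ≤ q ^ 2 * (f z z' * Y z') := by linarith
          exact le_of_mul_le_mul_left this (by positivity)
        have hYz := hY0 z'
        have hfz := hf0 z'
        have h1 : 1 / (1 + Y z') ≤ f z z' / (1 + f z z') := by
          rw [div_le_div_iff₀ (by positivity) (by positivity)]; linarith
        have key : 1 / (1 + Y z') - (1 / (1 + x₀) + -(1 / (1 + x₀) ^ 2) * (Y z' - x₀)) =
            (Y z' - x₀) ^ 2 / ((1 + x₀) ^ 2 * (1 + Y z')) := by field_simp; ring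
        have : 0 ≤ (Y z' - x₀) ^ 2 / ((1 + x₀) ^ 2 * (1 + Y z')) := by positivity
        show 1 / (1 + x₀) + -(1 / (1 + x₀) ^ 2) * (Y z' - x₀) ≤ f z z' / (1 + f z z')
        linarith

lemma errProb_antitone {B : ℕ} {a a₂ : ℝ} (ha : 0 ≤ a) (h : a ≤ a₂) :
    errProb B a₂ ≤ errProb B a := by
  rcases h.eq_or_lt with rfl | h'
  · exact le_rfl
  · refine errProb_le_errProb_of_sq_add ha (Real.sqrt_nonneg (a₂ ^ 2 - a ^ 2)) (by linarith) ?_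
    rw [Real.sq_sqrt (by nlinarith)]; ring

lemma exp_mul_errProb_le {B : ℕ} {a a₂ : ℝ} (ha : 0 ≤ a) (h : a ≤ a₂) :
    Real.exp (-2 * (a₂ ^ 2 - a ^ 2)) * errProb B a ≤ errProb B a₂ := by
  rcases h.eq_or_lt with rfl | h'
  · simp
  · have h0 : 0 ≤ a₂ ^ 2 - a ^ 2 := by nlinarith
    have := exp_mul_errProb_le_of_sq_add (B := B) ha (Real.sqrt_nonneg (a₂ ^ 2 - a ^ 2))
      (show 0 < a₂ by linarith) (by rw [Real.sq_sqrt h0]; ring)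
    rwa [Real.sq_sqrt h0] at this

lemma errProb_nonneg (B : ℕ) (a : ℝ) : 0 ≤ errProb B a := by
  refine div_nonneg (Finset.sum_nonneg fun i _ => integral_nonneg fun z => ?_) (Nat.cast_nonneg B)
  have := crossSum_nonneg a i z
  exact div_nonneg this (by linarith)

lemma crossSum_zero {B : ℕ} (i : Fin B) (z : Fin B → ℝ) : 1 + crossSum 0 i z = B := by
  have := i.pos
  simp [crossSum, Finset.card_erase_of_mem]
  rw [Nat.cast_sub (by omega)]; simp

lemma errProb_zero {B : ℕ} (hB : 1 ≤ B) : errProb B 0 = 1 - 1 / B := by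
  have h1 : ∀ (i : Fin B) (z : Fin B → ℝ),
      crossSum 0 i z / (1 + crossSum 0 i z) = 1 - 1 / B := by
    intro i z
    have h := crossSum_zero i z
    have hB0 : (B : ℝ) ≠ 0 := by positivity
    rw [h, eq_sub_of_add_eq' h]
    field_simp
  rw [errProb]
  simp_rw [h1]
  have hB0 : (B : ℝ) ≠ 0 := by positivity
  simp
  field_simp

lemma errProb_le_one (B : ℕ) {a : ℝ} (ha : 0 ≤ a) : errProb B a ≤ 1 := by
  rcases Nat.eq_zero_or_pos B with rfl | hB
  · simp [errProb]
  · calc errProb B a ≤ errProb B 0 := errProb_antitone le_rfl ha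
      _ ≤ 1 := by rw [errProb_zero hB]; simp

lemma errProb_pos {B : ℕ} (hB : 2 ≤ B) {a : ℝ} (ha : 0 ≤ a) : 0 < errProb B a := by
  refine lt_of_lt_of_le ?_ (exp_mul_errProb_le (B := B) le_rfl ha)
  rw [errProb_zero (by omega)]
  have : (2 : ℝ) ≤ B := by exact_mod_cast hB
  have : (1 : ℝ) / B < 1 := by rw [div_lt_one (by linarith)]; linarith
  have : (0 : ℝ) < 1 - 1 / B := by linarith
  positivity

lemma div_one_add_le_rpow {q θ : ℝ} (hq : 0 ≤ q) (h0 : 0 ≤ θ) (h1 : θ ≤ 1) :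
    q / (1 + q) ≤ q ^ θ := by
  rcases hq.eq_or_lt with rfl | hq0
  · simpa using Real.rpow_nonneg le_rfl θ
  rcases le_total q 1 with h | h
  · calc q / (1 + q) ≤ q / 1 := by gcongr; linarith
      _ = q ^ (1 : ℝ) := by simp
      _ ≤ q ^ θ := Real.rpow_le_rpow_of_exponent_ge hq0 h h1
  · calc q / (1 + q) ≤ 1 := by rw [div_le_one (by positivity)]; linarith
      _ ≤ q ^ θ := Real.one_le_rpow h h0

/-- The total weight of the wrong positions, without the noise of the right one. -/
noncomputable def wrongSum {B : ℕ} (a : ℝ) (i : Fin B) (z : Fin B → ℝ) : ℝ :=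
  ∑ j ∈ Finset.univ.erase i, Real.exp (-a ^ 2 + a * z j)

lemma crossSum_eq_wrongSum_mul {B : ℕ} (a : ℝ) (i : Fin B) (z : Fin B → ℝ) :
    crossSum a i z = wrongSum a i z * Real.exp (-a * z i) := by
  rw [crossSum, wrongSum, Finset.sum_mul]
  refine Finset.sum_congr rfl fun j _ => ?_
  rw [← Real.exp_add]; congr 1; ring

lemma wrongSum_mul_exp {B : ℕ} (a b : ℝ) (i : Fin B) (z : Fin B → ℝ) :
    wrongSum a i z * Real.exp (b * z i) =
      ∑ j ∈ Finset.univ.erase i, Real.exp (-a ^ 2) * Real.exp (a * z j + b * z i) := by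
  rw [wrongSum, Finset.sum_mul]
  refine Finset.sum_congr rfl fun j _ => ?_
  rw [← Real.exp_add, ← Real.exp_add]; congr 1; ring

lemma integrable_wrongSum_mul_exp {B : ℕ} (a b : ℝ) (i : Fin B) :
    Integrable (fun z => wrongSum a i z * Real.exp (b * z i)) (gaussVec B) := by
  simp_rw [wrongSum_mul_exp]
  exact integrable_finsetSum _ fun j _ => (integrable_exp_two i j a b).const_mul _

lemma integral_wrongSum_mul_exp_le {B : ℕ} (a b : ℝ) (i : Fin B) :
    ∫ z, wrongSum a i z * Real.exp (b * z i) ∂gaussVec B ≤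
      B * Real.exp (-a ^ 2 / 2) * Real.exp (b ^ 2 / 2) := by
  simp_rw [wrongSum_mul_exp]
  rw [integral_finsetSum _ fun j _ => (integrable_exp_two i j a b).const_mul _]
  calc _ = ∑ j ∈ Finset.univ.erase i, Real.exp (-a ^ 2 / 2) * Real.exp (b ^ 2 / 2) := by
        refine Finset.sum_congr rfl fun j hj => ?_
        rw [integral_const_mul, integral_exp_two (Finset.ne_of_mem_erase hj), ← Real.exp_add,
          ← Real.exp_add]
        congr 1; ring
    _ ≤ ∑ _j : Fin B, Real.exp (-a ^ 2 / 2) * Real.exp (b ^ 2 / 2) :=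
        Finset.sum_le_sum_of_subset_of_nonneg (Finset.erase_subset _ _)
          fun _ _ _ => by positivity
    _ = _ := by simp; ring

lemma wrongSum_nonneg {B : ℕ} (a : ℝ) (i : Fin B) (z : Fin B → ℝ) : 0 ≤ wrongSum a i z :=
  Finset.sum_nonneg fun _ _ => (Real.exp_pos _).le

/-- This is Gallager's trick: bound `Q / (1 + Q)` by `Q ^ θ`, then use concavity of the power for
the sum over the wrong positions only, whose mean is at most `m = B exp (-a²/2)`. The noise of the
right position keeps its exact moment `exp (θ² a²/2)`. Concavity enters as the weighted inequality
of arithmetic and geometric means. -/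
lemma errProb_le_exp {B : ℕ} (hB : 1 ≤ B) {a θ : ℝ} (h0 : 0 ≤ θ) (h1 : θ ≤ 1) :
    errProb B a ≤ Real.exp (θ * Real.log B - θ * (1 - θ) * a ^ 2 / 2) := by
  have hB0 : (0 : ℝ) < B := by positivity
  rw [errProb, div_le_iff₀ hB0]
  have main : ∀ i : Fin B, ∫ z, crossSum a i z / (1 + crossSum a i z) ∂gaussVec B ≤
      Real.exp (θ * Real.log B - θ * (1 - θ) * a ^ 2 / 2) := by
    intro i
    set m := B * Real.exp (-a ^ 2 / 2) with hm
    have hm0 : 0 < m := by positivity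
    have hi1 := integrable_wrongSum_mul_exp a (-θ * a) i
    have hi2 : Integrable (fun z : Fin B → ℝ => Real.exp ((-θ * a) * z i)) (gaussVec B) :=
      integrable_coord i (integrable_exp_mul_stdGaussian _)
    calc ∫ z, crossSum a i z / (1 + crossSum a i z) ∂gaussVec B
        ≤ ∫ z, m ^ θ * (θ / m * (wrongSum a i z * Real.exp ((-θ * a) * z i)) +
            (1 - θ) * Real.exp ((-θ * a) * z i)) ∂gaussVec B := by
          refine integral_mono (integrable_err a i)
            (((hi1.const_mul _).add (hi2.const_mul _)).const_mul _) fun z => ?_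
          have hw := wrongSum_nonneg a i z
          refine (div_one_add_le_rpow (crossSum_nonneg a i z) h0 h1).trans ?_
          have e1 : crossSum a i z = m * (wrongSum a i z / m) * Real.exp (-a * z i) := by
            rw [crossSum_eq_wrongSum_mul]; field_simp
          have e2 : (Real.exp (-a * z i)) ^ θ = Real.exp ((-θ * a) * z i) := by
            rw [← Real.exp_mul]; congr 1; ring
          rw [e1, Real.mul_rpow (by positivity) (by positivity),
            Real.mul_rpow hm0.le (by positivity), e2]
          have e3 : (wrongSum a i z / m) ^ θ ≤ θ * (wrongSum a i z / m) + (1 - θ) := by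
            have := Real.geom_mean_le_arith_mean2_weighted h0 (sub_nonneg.2 h1)
              (show 0 ≤ wrongSum a i z / m by positivity) zero_le_one (by ring)
            simpa using this
          calc m ^ θ * (wrongSum a i z / m) ^ θ * Real.exp ((-θ * a) * z i)
              ≤ m ^ θ * (θ * (wrongSum a i z / m) + (1 - θ)) * Real.exp ((-θ * a) * z i) := by
                gcongr
            _ = _ := by ring
      _ = m ^ θ * (θ / m * ∫ z, wrongSum a i z * Real.exp ((-θ * a) * z i) ∂gaussVec B +
            (1 - θ) * Real.exp ((-θ * a) ^ 2 / 2)) := by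
          rw [integral_const_mul, integral_add (hi1.const_mul _) (hi2.const_mul _),
            integral_const_mul, integral_const_mul, integral_exp_coord]
      _ ≤ m ^ θ * (θ / m * (m * Real.exp ((-θ * a) ^ 2 / 2)) +
            (1 - θ) * Real.exp ((-θ * a) ^ 2 / 2)) := by
          gcongr
          exact integral_wrongSum_mul_exp_le a (-θ * a) i
      _ = m ^ θ * Real.exp ((-θ * a) ^ 2 / 2) := by field_simp; ring
      _ = _ := by
          rw [Real.rpow_def_of_pos hm0, hm, Real.log_mul hB0.ne' (Real.exp_pos _).ne',
            Real.log_exp, ← Real.exp_add]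
          congr 1; ring
  calc _ ≤ ∑ _i : Fin B, Real.exp (θ * Real.log B - θ * (1 - θ) * a ^ 2 / 2) :=
        Finset.sum_le_sum fun i _ => main i
    _ = _ := by simp; ring

/-! ### The entropy of the section posterior -/

lemma logPart_nonneg (B : ℕ) (a : ℝ) : 0 ≤ logPart B a := by
  refine div_nonneg (Finset.sum_nonneg fun i _ => integral_nonneg fun z => ?_) (Nat.cast_nonneg B)
  have := crossSum_nonneg a i z
  exact Real.log_nonneg (by linarith)

lemma logPart_zero {B : ℕ} (hB : 1 ≤ B) : logPart B 0 = Real.log B := by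
  have hB0 : (B : ℝ) ≠ 0 := by positivity
  rw [logPart]
  simp_rw [crossSum_zero]
  simp
  field_simp

/-- With `S = wrongSum` and `m = B exp (-a²/2)`, one has `1 + Q ≤ (1 + S/m) (1 + m exp (-a z_i))`.
The logarithm of the first factor has mean at most `1`. That of the second is at most `ln 2 + max 0
(ln m) + a |z_i|`. -/
lemma logPart_le {B : ℕ} (hB : 1 ≤ B) {a : ℝ} (ha : 0 ≤ a) :
    logPart B a ≤ 1 + Real.log 2 + max 0 (Real.log B - a ^ 2 / 2) +
      a * ∫ x, |x| ∂stdGaussian := by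
  have hB0 : (0 : ℝ) < B := by positivity
  rw [logPart, div_le_iff₀ hB0]
  have main : ∀ i : Fin B, ∫ z, Real.log (1 + crossSum a i z) ∂gaussVec B ≤
      1 + Real.log 2 + max 0 (Real.log B - a ^ 2 / 2) + a * ∫ x, |x| ∂stdGaussian := by
    intro i
    set m := B * Real.exp (-a ^ 2 / 2) with hm
    have hm0 : 0 < m := by positivity
    have hlm : Real.log m = Real.log B - a ^ 2 / 2 := by
      rw [hm, Real.log_mul hB0.ne' (Real.exp_pos _).ne', Real.log_exp]; ring
    have hi1 : Integrable (wrongSum a i) (gaussVec B) := by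
      simpa using integrable_wrongSum_mul_exp a 0 i
    have hi1' : ∫ z, wrongSum a i z ∂gaussVec B ≤ m := by
      simpa using integral_wrongSum_mul_exp_le a 0 i
    have hi2 : Integrable (fun z : Fin B → ℝ => |z i|) (gaussVec B) :=
      integrable_coord i integrable_abs_stdGaussian
    set c := Real.log 2 + max 0 (Real.log m) with hc
    have hi3 : Integrable (fun z : Fin B → ℝ => a * |z i| + c) (gaussVec B) :=
      (hi2.const_mul a).add (integrable_const c)
    calc ∫ z, Real.log (1 + crossSum a i z) ∂gaussVec B
        ≤ ∫ z, (wrongSum a i z / m + (a * |z i| + c)) ∂gaussVec B := by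
          refine integral_mono (integrable_log_one_add_crossSum a i)
            ((hi1.div_const m).add hi3) fun z => ?_
          have hw := wrongSum_nonneg a i z
          have hw' : 0 ≤ wrongSum a i z / m := by positivity
          have e1 : crossSum a i z = (wrongSum a i z / m) * (m * Real.exp (-a * z i)) := by
            rw [crossSum_eq_wrongSum_mul]; field_simp
          have hpos : 0 < m * Real.exp (-a * z i) := by positivity
          have h1 : 1 + crossSum a i z ≤
              (1 + wrongSum a i z / m) * (1 + m * Real.exp (-a * z i)) := by
            rw [e1]; nlinarith
          have h2 : Real.log (1 + m * Real.exp (-a * z i)) ≤ a * |z i| + c := by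
            have h3 : 1 + m * Real.exp (-a * z i) ≤ 2 * Real.exp (a * |z i| + max 0 (Real.log m)) := by
              have h4 : (1 : ℝ) ≤ Real.exp (a * |z i| + max 0 (Real.log m)) :=
                Real.one_le_exp (by positivity)
              have h5 : m * Real.exp (-a * z i) ≤ Real.exp (a * |z i| + max 0 (Real.log m)) := by
                rw [Real.exp_add, mul_comm]
                have : Real.exp (Real.log m) = m := Real.exp_log hm0
                rw [← this]
                have h6 : -a * z i ≤ a * |z i| := by
                  have := neg_abs_le (z i)
                  nlinarith
                have h7 : Real.log m ≤ max 0 (Real.log m) := le_max_right _ _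
                simp only [Real.log_exp]
                gcongr
              linarith
            calc _ ≤ Real.log (2 * Real.exp (a * |z i| + max 0 (Real.log m))) :=
                  Real.log_le_log (by positivity) h3
              _ = a * |z i| + c := by
                  rw [Real.log_mul (by norm_num) (Real.exp_pos _).ne', Real.log_exp, hc]; ring
          calc Real.log (1 + crossSum a i z)
              ≤ Real.log ((1 + wrongSum a i z / m) * (1 + m * Real.exp (-a * z i))) :=
                Real.log_le_log (by linarith [crossSum_nonneg a i z]) h1
            _ = Real.log (1 + wrongSum a i z / m) + Real.log (1 + m * Real.exp (-a * z i)) :=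
                Real.log_mul (by positivity) (by positivity)
            _ ≤ wrongSum a i z / m + (a * |z i| + c) := by
                refine add_le_add ?_ h2
                linarith [Real.log_le_sub_one_of_pos (show 0 < 1 + wrongSum a i z / m by positivity)]
      _ = (∫ z, wrongSum a i z ∂gaussVec B) / m + (a * ∫ x, |x| ∂stdGaussian + c) := by
          rw [integral_add (hi1.div_const m) hi3, integral_div,
            integral_add (hi2.const_mul a) (integrable_const c), integral_const_mul,
            integral_coord i integrable_abs_stdGaussian]
          simp
      _ ≤ 1 + (a * ∫ x, |x| ∂stdGaussian + c) := by
          gcongr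
          rwa [div_le_one hm0]
      _ = _ := by rw [hc, hlm]; ring
  calc _ ≤ ∑ _i : Fin B, (1 + Real.log 2 + max 0 (Real.log B - a ^ 2 / 2) +
        a * ∫ x, |x| ∂stdGaussian) := Finset.sum_le_sum fun i _ => main i
    _ = _ := by simp; ring

end SparseSuperposition

/-! ### The I-MMSE relation for a section -/

namespace SparseSuperposition

lemma gibbs_shift_eq {B : ℕ} (a : ℝ) (i k : Fin B) (z : Fin B → ℝ) :
    a * (z + Pi.single i a : Fin B → ℝ) k = a * z k + a ^ 2 * sectionVec B i k := by
  by_cases h : k = i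
  · subst h; simp [sectionVec]; ring
  · simp [sectionVec, h]

lemma sectionVec_nonneg {B : ℕ} (i k : Fin B) : 0 ≤ sectionVec B i k := by
  by_cases h : k = i
  · subst h; simp [sectionVec]
  · simp [sectionVec, h]

lemma sectionVec_le_one {B : ℕ} (i k : Fin B) : sectionVec B i k ≤ 1 := by
  by_cases h : k = i
  · subst h; simp [sectionVec]
  · simp [sectionVec, h]

lemma hasDerivAt_log_sum_exp {B : ℕ} (i : Fin B) (a : ℝ) (z : Fin B → ℝ) :
    HasDerivAt (fun a : ℝ => Real.log (∑ k, Real.exp (a * z k + a ^ 2 * sectionVec B i k)))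
      (∑ k, gibbs a (z + Pi.single i a) k * (z k + 2 * a * sectionVec B i k)) a := by
  have h1 : ∀ k : Fin B, HasDerivAt (fun a : ℝ => a * z k + a ^ 2 * sectionVec B i k)
      (z k + 2 * a * sectionVec B i k) a := by
    intro k
    have := ((hasDerivAt_id a).mul_const (z k)).add
      ((hasDerivAt_pow 2 a).mul_const (sectionVec B i k))
    exact this.congr_deriv (by simp)
  have h2 := HasDerivAt.fun_sum (u := Finset.univ) fun k _ => (h1 k).exp
  have hpos : 0 < ∑ k, Real.exp (a * z k + a ^ 2 * sectionVec B i k) :=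
    Finset.sum_pos (fun _ _ => Real.exp_pos _) ⟨i, Finset.mem_univ i⟩
  refine (h2.log hpos.ne').congr_deriv ?_
  rw [Finset.sum_div]
  refine Finset.sum_congr rfl fun k _ => ?_
  simp_rw [gibbs, gibbs_shift_eq]
  ring

lemma hasDerivAt_gibbs_update {B : ℕ} (a : ℝ) (i k : Fin B) (z : Fin B → ℝ) (x : ℝ) :
    HasDerivAt (fun x => gibbs a (Function.update z k x + Pi.single i a) k)
      (a * (gibbs a (Function.update z k x + Pi.single i a) k -
        gibbs a (Function.update z k x + Pi.single i a) k ^ 2)) x := by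
  set c : ℝ := a ^ 2 * sectionVec B i k with hc
  set d : ℝ := ∑ l ∈ Finset.univ.erase k, Real.exp (a * z l + a ^ 2 * sectionVec B i l) with hd
  have hd0 : 0 ≤ d := Finset.sum_nonneg fun _ _ => (Real.exp_pos _).le
  have e : ∀ x, gibbs a (Function.update z k x + Pi.single i a) k =
      Real.exp (a * x + c) / (Real.exp (a * x + c) + d) := by
    intro x
    rw [gibbs, ← Finset.add_sum_erase _ _ (Finset.mem_univ k)]
    simp_rw [gibbs_shift_eq, Function.update_self]
    congr 2
    refine Finset.sum_congr rfl fun l hl => ?_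
    rw [Function.update_of_ne (Finset.ne_of_mem_erase hl)]
  simp_rw [e]
  have h1 : HasDerivAt (fun x : ℝ => Real.exp (a * x + c)) (Real.exp (a * x + c) * a) x := by
    have := (((hasDerivAt_id x).const_mul a).add_const c).exp
    simpa using this
  have hpos : 0 < Real.exp (a * x + c) + d := by positivity
  refine (h1.div (h1.add_const d) hpos.ne').congr_deriv ?_
  field_simp

/-- Gaussian integration by parts, as `∂_k g_k = a (g_k - g_k²)`. -/
lemma integral_coord_mul_gibbs {B : ℕ} (a : ℝ) (i k : Fin B) :
    ∫ z, z k * gibbs a (z + Pi.single i a) k ∂gaussVec B =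
      a * (∫ z, gibbs a (z + Pi.single i a) k ∂gaussVec B -
        ∫ z, gibbs a (z + Pi.single i a) k ^ 2 ∂gaussVec B) := by
  have hm : Measurable fun z : Fin B → ℝ => gibbs a (z + Pi.single i a) k :=
    (measurable_gibbs a k).comp (by fun_prop)
  have hb : ∀ y : Fin B → ℝ, |gibbs a y k| ≤ max 1 |a| := fun y => by
    rw [abs_of_nonneg (gibbs_nonneg _ _ _)]
    exact (gibbs_le_one _ _ _).trans (le_max_left _ _)
  have hb' : ∀ y : Fin B → ℝ, |a * (gibbs a y k - gibbs a y k ^ 2)| ≤ max 1 |a| := fun y => by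
    have h0 := gibbs_nonneg a y k
    have h1 := gibbs_le_one a y k
    rw [abs_mul, abs_of_nonneg (by nlinarith : 0 ≤ gibbs a y k - gibbs a y k ^ 2)]
    exact (mul_le_of_le_one_right (abs_nonneg a) (by nlinarith)).trans (le_max_right _ _)
  have hm' : Measurable fun z : Fin B → ℝ =>
      a * (gibbs a (z + Pi.single i a) k - gibbs a (z + Pi.single i a) k ^ 2) :=
    (hm.sub (hm.pow_const 2)).const_mul a
  rw [integral_coord_mul_gaussVec k (max 1 |a|) hm hm'
    (fun z => hb _) (fun z => hb' _) (fun z x => hasDerivAt_gibbs_update a i k z x),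
    integral_const_mul, integral_sub (integrable_gibbs_shift a i k)
      (integrable_gibbs_shift_sq a i k)]

lemma log_sum_exp_eq {B : ℕ} (a : ℝ) (i : Fin B) (z : Fin B → ℝ) :
    Real.log (∑ k, Real.exp (a * z k + a ^ 2 * sectionVec B i k)) =
      a ^ 2 + a * z i + Real.log (1 + crossSum a i z) := by
  have h := crossSum_nonneg a i z
  simp_rw [← gibbs_shift_eq]
  rw [sum_exp_shift, Real.log_mul (Real.exp_pos _).ne' (by positivity), Real.log_exp]

lemma integrable_log_sum_exp {B : ℕ} (a : ℝ) (i : Fin B) :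
    Integrable (fun z => Real.log (∑ k, Real.exp (a * z k + a ^ 2 * sectionVec B i k)))
      (gaussVec B) := by
  simp_rw [log_sum_exp_eq]
  exact ((integrable_const _).add ((integrable_coord i integrable_id_stdGaussian).const_mul a)).add
    (integrable_log_one_add_crossSum a i)

lemma integral_log_sum_exp {B : ℕ} (a : ℝ) (i : Fin B) :
    ∫ z, Real.log (∑ k, Real.exp (a * z k + a ^ 2 * sectionVec B i k)) ∂gaussVec B =
      a ^ 2 + ∫ z, Real.log (1 + crossSum a i z) ∂gaussVec B := by
  simp_rw [log_sum_exp_eq]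
  have h1 : Integrable (fun z : Fin B → ℝ => a * z i) (gaussVec B) :=
    (integrable_coord i integrable_id_stdGaussian).const_mul a
  have h2 : Integrable (fun z : Fin B → ℝ => a ^ 2 + a * z i) (gaussVec B) :=
    (integrable_const _).add h1
  rw [integral_add h2 (integrable_log_one_add_crossSum a i), integral_add (integrable_const _) h1,
    integral_const_mul, integral_coord i integrable_id_stdGaussian, integral_id_stdGaussian]
  simp

lemma hasDerivAt_integral_log_sum_exp {B : ℕ} (a : ℝ) (i : Fin B) :
    HasDerivAt (fun a : ℝ =>
      ∫ z, Real.log (∑ k, Real.exp (a * z k + a ^ 2 * sectionVec B i k)) ∂gaussVec B)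
      (∫ z, ∑ k, gibbs a (z + Pi.single i a) k * (z k + 2 * a * sectionVec B i k) ∂gaussVec B)
      a := by
  have hz : Integrable (fun z : Fin B → ℝ => ∑ k, (|z k| + 2 * (|a| + 1))) (gaussVec B) :=
    integrable_finsetSum _ fun k _ =>
      (integrable_coord k integrable_abs_stdGaussian).add (integrable_const _)
  have hm : AEStronglyMeasurable
      (fun z => ∑ k, gibbs a (z + Pi.single i a) k * (z k + 2 * a * sectionVec B i k))
      (gaussVec B) := by
    refine (Finset.measurable_sum _ fun k _ => ?_).aestronglyMeasurable
    have hm : Measurable fun z : Fin B → ℝ => gibbs a (z + Pi.single i a) k :=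
      (measurable_gibbs a k).comp (by fun_prop)
    exact hm.mul (by fun_prop)
  have hbd : ∀ z : Fin B → ℝ, ∀ a' ∈ Metric.ball a 1,
      ‖∑ k, gibbs a' (z + Pi.single i a') k * (z k + 2 * a' * sectionVec B i k)‖ ≤
        ∑ k, (|z k| + 2 * (|a| + 1)) := by
    intro z a' ha'
    refine (norm_sum_le _ _).trans (Finset.sum_le_sum fun k _ => ?_)
    rw [norm_mul, Real.norm_of_nonneg (gibbs_nonneg _ _ _)]
    refine (mul_le_of_le_one_left (norm_nonneg _) (gibbs_le_one _ _ _)).trans ?_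
    rw [Metric.mem_ball, Real.dist_eq] at ha'
    have h1 : |a'| ≤ |a| + 1 := by
      have := abs_sub_abs_le_abs_sub a' a
      linarith
    have h2 := sectionVec_le_one i k
    have h3 := sectionVec_nonneg i k
    have h4 := abs_nonneg a'
    have h5 : |2 * a' * sectionVec B i k| = 2 * |a'| * sectionVec B i k := by
      rw [abs_mul, abs_mul, abs_of_nonneg h3]; simp
    have h6 : |z k + 2 * a' * sectionVec B i k| ≤ |z k| + |2 * a' * sectionVec B i k| :=
      abs_add_le _ _
    have h7 : |a'| * sectionVec B i k ≤ |a'| := mul_le_of_le_one_right h4 h2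
    rw [Real.norm_eq_abs]
    linarith
  have hdiff : ∀ z : Fin B → ℝ, ∀ a' ∈ Metric.ball a 1, HasDerivAt (fun a : ℝ =>
      Real.log (∑ k, Real.exp (a * z k + a ^ 2 * sectionVec B i k)))
      (∑ k, gibbs a' (z + Pi.single i a') k * (z k + 2 * a' * sectionVec B i k)) a' :=
    fun z a' _ => hasDerivAt_log_sum_exp i a' z
  generalize hF' : (fun (a : ℝ) (z : Fin B → ℝ) =>
    ∑ k, gibbs a (z + Pi.single i a) k * (z k + 2 * a * sectionVec B i k)) = F' at *
  have e : ∀ a z, ∑ k, gibbs a (z + Pi.single i a) k * (z k + 2 * a * sectionVec B i k) =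
    F' a z := fun a z => by rw [← hF']
  simp_rw [e] at hm hbd hdiff ⊢
  exact (hasDerivAt_integral_of_dominated_loc_of_deriv_le (μ := gaussVec B)
    (F := fun a z => Real.log (∑ k, Real.exp (a * z k + a ^ 2 * sectionVec B i k)))
    (F' := F')
    (bound := fun z => ∑ k, (|z k| + 2 * (|a| + 1))) (Metric.ball_mem_nhds a one_pos)
    (Eventually.of_forall fun a' => (integrable_log_sum_exp a' i).1) (integrable_log_sum_exp a i)
    hm (ae_of_all _ hbd) hz (ae_of_all _ hdiff)).2

/-- In expectation `ln (1 + Q)` is the logarithm of the partition sum minus `a²`. Its derivative is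
`𝔼 ∑ g_k (z_k + 2 a s_k) - 2 a`, and integration by parts turns this into `-a 𝔼 (∑ g_k² - 2 g_i +
1)`. -/
lemma hasDerivAt_logPart (B : ℕ) (a : ℝ) :
    HasDerivAt (logPart B) (-a * errProb B a) a := by
  have h1 : ∀ i : Fin B, HasDerivAt (fun a => ∫ z, Real.log (1 + crossSum a i z) ∂gaussVec B)
      (-a * ∫ z, ∑ k, (gibbs a (z + Pi.single i a) k - sectionVec B i k) ^ 2 ∂gaussVec B) a := by
    intro i
    have e : (fun a => ∫ z, Real.log (1 + crossSum a i z) ∂gaussVec B) = fun a =>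
        ∫ z, Real.log (∑ k, Real.exp (a * z k + a ^ 2 * sectionVec B i k)) ∂gaussVec B - a ^ 2 := by
      ext a; rw [integral_log_sum_exp]; ring
    rw [e]
    refine ((hasDerivAt_integral_log_sum_exp a i).sub (hasDerivAt_pow 2 a)).congr_deriv ?_
    have hi1 : ∀ k : Fin B, Integrable (fun z => z k * gibbs a (z + Pi.single i a) k)
        (gaussVec B) := fun k =>
      (integrable_coord k integrable_id_stdGaussian).mul_bdd (c := 1)
        (integrable_gibbs_shift a i k).1 (ae_of_all _ fun z => by
          rw [Real.norm_of_nonneg (gibbs_nonneg _ _ _)]; exact gibbs_le_one _ _ _)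
    have hi2 : ∀ k : Fin B, Integrable (fun z => 2 * a * sectionVec B i k *
        gibbs a (z + Pi.single i a) k) (gaussVec B) := fun k =>
      (integrable_gibbs_shift a i k).const_mul _
    have hi3 : ∀ k : Fin B, Integrable (fun z => z k * gibbs a (z + Pi.single i a) k +
        2 * a * sectionVec B i k * gibbs a (z + Pi.single i a) k) (gaussVec B) := fun k =>
      (hi1 k).add (hi2 k)
    have e2 : ∀ (k : Fin B) (z : Fin B → ℝ),
        gibbs a (z + Pi.single i a) k * (z k + 2 * a * sectionVec B i k) =
        z k * gibbs a (z + Pi.single i a) k +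
          2 * a * sectionVec B i k * gibbs a (z + Pi.single i a) k := fun k z => by ring
    simp_rw [e2]
    rw [integral_finsetSum _ fun k _ => hi3 k]
    have e3 : ∀ k : Fin B, ∫ z, (z k * gibbs a (z + Pi.single i a) k +
          2 * a * sectionVec B i k * gibbs a (z + Pi.single i a) k) ∂gaussVec B =
        a * ∫ z, gibbs a (z + Pi.single i a) k ∂gaussVec B -
        a * ∫ z, gibbs a (z + Pi.single i a) k ^ 2 ∂gaussVec B +
        (if k = i then 2 * a * ∫ z, gibbs a (z + Pi.single i a) i ∂gaussVec B else 0) := by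
      intro k
      rw [integral_add (hi1 k) (hi2 k), integral_coord_mul_gibbs, integral_const_mul]
      by_cases h : k = i
      · subst h; simp [sectionVec]; ring
      · simp [sectionVec, h]; ring
    simp_rw [e3, Finset.sum_add_distrib, Finset.sum_sub_distrib, ← Finset.mul_sum]
    rw [← integral_finsetSum _ fun k _ => integrable_gibbs_shift a i k,
      ← integral_finsetSum _ fun k _ => integrable_gibbs_shift_sq a i k,
      integral_sum_sq_gibbs_sub]
    simp_rw [sum_gibbs i]
    simp
    ring
  have h2 := (HasDerivAt.fun_sum (u := Finset.univ) fun i _ => h1 i).div_const (B : ℝ)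
  refine h2.congr_deriv ?_
  rw [← gibbsMSE_eq_errProb, gibbsMSE, ← Finset.mul_sum]
  ring

/-- The error is (up to a factor) a subgradient of the entropy, as functions of `a²`. -/
lemma logPart_sub_ge (B : ℕ) {a a' : ℝ} (ha : 0 ≤ a) (ha' : 0 ≤ a') :
    -(errProb B a / 2) * (a' ^ 2 - a ^ 2) ≤ logPart B a' - logPart B a := by
  -- The derivative of `f` at `x` is `x (errProb B a - errProb B x)`. Since the error decreases, `f`
  -- has its minimum over `[0, ∞)` at `a`, which is the claim.
  set f : ℝ → ℝ := fun x => logPart B x + errProb B a / 2 * x ^ 2 with hf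
  have hd : ∀ x, HasDerivAt f (x * (errProb B a - errProb B x)) x := fun x =>
    ((hasDerivAt_logPart B x).add ((hasDerivAt_pow 2 x).const_mul (errProb B a / 2))).congr_deriv
      (by simp; ring)
  have hc : Continuous f := continuous_iff_continuousAt.2 fun x => (hd x).continuousAt
  have hmin : f a ≤ f a' := by
    rcases le_total a a' with h | h
    · have : MonotoneOn f (Icc a a') := by
        refine monotoneOn_of_deriv_nonneg (convex_Icc a a') hc.continuousOn
          (fun x _ => (hd x).differentiableAt.differentiableWithinAt) fun x hx => ?_
        rw [interior_Icc] at hx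
        rw [(hd x).deriv]
        have := errProb_antitone (B := B) ha hx.1.le
        exact mul_nonneg (by linarith [hx.1]) (by linarith)
      exact this ⟨le_rfl, h⟩ ⟨h, le_rfl⟩ h
    · have : AntitoneOn f (Icc a' a) := by
        refine antitoneOn_of_deriv_nonpos (convex_Icc a' a) hc.continuousOn
          (fun x _ => (hd x).differentiableAt.differentiableWithinAt) fun x hx => ?_
        rw [interior_Icc] at hx
        rw [(hd x).deriv]
        have := errProb_antitone (B := B) (ha'.trans hx.1.le) hx.2.le
        exact mul_nonpos_of_nonneg_of_nonpos (by linarith [hx.1]) (by linarith)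
      exact this ⟨le_rfl, h⟩ ⟨h, le_rfl⟩ h
  simp only [hf] at hmin
  linarith

/-! ### Error and entropy as functions of the inverse noise -/

/-- The entropy `S_u` up to the constant `- (1 + B / (2 ln B))`. -/
noncomputable def redEntropy (B : ℕ) (v : ℝ≥0∞) : ℝ :=
  entropyTerm B v + (1 + (B : ℝ) / (2 * Real.log B))

lemma redEntropy_top {B : ℕ} (hB : 2 ≤ B) : redEntropy B ∞ = 0 := entropyTerm_top hB

lemma log_cast_pos {B : ℕ} (hB : 2 ≤ B) : 0 < Real.log B := Real.log_pos (by exact_mod_cast hB)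

lemma logb_cast_pos {B : ℕ} (hB : 2 ≤ B) : 0 < Real.logb 2 B :=
  Real.logb_pos (by norm_num) (by exact_mod_cast hB)

/-- The parameter `a = √(v log₂ B)`. -/
noncomputable def snrParam (B : ℕ) (v : ℝ≥0∞) : ℝ := Real.sqrt (Real.logb 2 B * v.toReal)

lemma snrParam_nonneg (B : ℕ) (v : ℝ≥0∞) : 0 ≤ snrParam B v := Real.sqrt_nonneg _

/-- In other words `a²/2 = x ln B` with `x = v / (2 ln 2)`. Comparing `a²/2` with `ln B`, as the
bounds above do, is comparing `x` with its critical value `1`. -/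
lemma snrParam_sq {B : ℕ} (hB : 2 ≤ B) (v : ℝ≥0∞) :
    snrParam B v ^ 2 = Real.log B * v.toReal / Real.log 2 := by
  rw [snrParam, Real.sq_sqrt (mul_nonneg (logb_cast_pos hB).le ENNReal.toReal_nonneg), Real.logb]
  ring

lemma snrParam_mono {B : ℕ} (hB : 2 ≤ B) {v w : ℝ≥0∞} (hw : w ≠ ∞) (h : v ≤ w) :
    snrParam B v ≤ snrParam B w :=
  Real.sqrt_le_sqrt (mul_le_mul_of_nonneg_left (ENNReal.toReal_mono hw h) (logb_cast_pos hB).le)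

lemma sectionMSE_nonneg (B : ℕ) (v : ℝ≥0∞) : 0 ≤ sectionMSE B v := by
  by_cases h : v = ∞
  · rw [h, sectionMSE_top]
  · rw [sectionMSE_eq h]; exact errProb_nonneg _ _

lemma sectionMSE_le_one (B : ℕ) (v : ℝ≥0∞) : sectionMSE B v ≤ 1 := by
  by_cases h : v = ∞
  · rw [h, sectionMSE_top]; exact zero_le_one
  · rw [sectionMSE_eq h]; exact errProb_le_one _ (Real.sqrt_nonneg _)

lemma sectionMSE_antitone {B : ℕ} (hB : 2 ≤ B) : Antitone (sectionMSE B) := by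
  intro v w h
  by_cases hw : w = ∞
  · rw [hw, sectionMSE_top]; exact sectionMSE_nonneg _ _
  · rw [sectionMSE_eq hw, sectionMSE_eq (ne_top_of_le_ne_top hw h)]
    exact errProb_antitone (Real.sqrt_nonneg _) (snrParam_mono hB hw h)

lemma sectionMSE_pos {B : ℕ} (hB : 2 ≤ B) {v : ℝ≥0∞} (hv : v ≠ ∞) : 0 < sectionMSE B v := by
  rw [sectionMSE_eq hv]; exact errProb_pos hB (Real.sqrt_nonneg _)

/-- The logarithm of the error is Lipschitz in the inverse noise, with constant of order `ln B`.
This is what makes the state evolution contract on a doubly logarithmic scale. -/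
lemma exp_mul_sectionMSE_le {B : ℕ} (hB : 2 ≤ B) {v w : ℝ≥0∞} (hw : w ≠ ∞) (h : v ≤ w) :
    Real.exp (-2 * (Real.log B / Real.log 2 * (w.toReal - v.toReal))) * sectionMSE B v ≤
      sectionMSE B w := by
  rw [sectionMSE_eq hw, sectionMSE_eq (ne_top_of_le_ne_top hw h)]
  have := exp_mul_errProb_le (B := B) (snrParam_nonneg B v) (snrParam_mono hB hw h)
  rw [snrParam_sq hB, snrParam_sq hB, snrParam, snrParam] at this
  convert this using 3
  ring

lemma sectionMSE_le_exp {B : ℕ} (hB : 2 ≤ B) {v : ℝ≥0∞} (hv : v ≠ ∞) {θ : ℝ} (h0 : 0 ≤ θ)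
    (h1 : θ ≤ 1) : sectionMSE B v ≤
      Real.exp (Real.log B * (θ - θ * (1 - θ) * (v.toReal / (2 * Real.log 2)))) := by
  rw [sectionMSE_eq hv]
  refine (errProb_le_exp (by omega) h0 h1).trans (le_of_eq ?_)
  have := snrParam_sq hB v
  rw [snrParam] at this
  rw [this]
  congr 1; ring

/-- The error is `ln 2 / 2` times a subgradient of the reduced entropy. -/
lemma redEntropy_sub_ge {B : ℕ} (hB : 2 ≤ B) {v w : ℝ≥0∞} (hv : v ≠ ∞) (hw : w ≠ ∞) :
    -(sectionMSE B v / (2 * Real.log 2)) * (w.toReal - v.toReal) ≤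
      redEntropy B w - redEntropy B v := by
  have hl := log_cast_pos hB
  rw [redEntropy, redEntropy, entropyTerm_eq hB hv, entropyTerm_eq hB hw, ← sub_div,
    sectionMSE_eq hv, le_div_iff₀ hl]
  refine le_trans (le_of_eq ?_) (logPart_sub_ge B (snrParam_nonneg B v) (snrParam_nonneg B w))
  have h1 := snrParam_sq hB v
  have h2 := snrParam_sq hB w
  rw [snrParam] at h1 h2
  rw [h1, h2]
  field_simp

lemma redEntropy_nonneg {B : ℕ} (hB : 2 ≤ B) (v : ℝ≥0∞) : 0 ≤ redEntropy B v := by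
  by_cases h : v = ∞
  · rw [h, redEntropy_top hB]
  · rw [redEntropy, entropyTerm_eq hB h]
    exact div_nonneg (logPart_nonneg _ _) (log_cast_pos hB).le

lemma redEntropy_zero {B : ℕ} (hB : 2 ≤ B) : redEntropy B 0 = 1 := by
  rw [redEntropy, entropyTerm_eq hB ENNReal.zero_ne_top]
  simp [logPart_zero (show 1 ≤ B by omega), (log_cast_pos hB).ne']

/-- The subgradient inequality at `v = 0`, where the reduced entropy is `1` and the error at most
`1`. -/
lemma redEntropy_ge {B : ℕ} (hB : 2 ≤ B) {v : ℝ≥0∞} (hv : v ≠ ∞) :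
    1 - v.toReal / (2 * Real.log 2) ≤ redEntropy B v := by
  have h := redEntropy_sub_ge hB ENNReal.zero_ne_top hv
  rw [redEntropy_zero hB] at h
  have h2 : 0 < Real.log 2 := Real.log_pos (by norm_num)
  have h3 : sectionMSE B 0 / (2 * Real.log 2) * v.toReal ≤ 1 / (2 * Real.log 2) * v.toReal := by
    gcongr
    exact sectionMSE_le_one B 0
  simp only [ENNReal.toReal_zero, sub_zero] at h
  have : 1 / (2 * Real.log 2) * v.toReal = v.toReal / (2 * Real.log 2) := by ring
  linarith

lemma redEntropy_le {B : ℕ} (hB : 2 ≤ B) {v : ℝ≥0∞} (hv : v ≠ ∞) :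
    redEntropy B v ≤ max 0 (1 - v.toReal / (2 * Real.log 2)) +
      ((1 + Real.log 2) / Real.log B +
        Real.sqrt (v.toReal / Real.log 2) * (∫ x, |x| ∂stdGaussian) / Real.sqrt (Real.log B)) := by
  have hl := log_cast_pos hB
  have h2 : 0 < Real.log 2 := Real.log_pos (by norm_num)
  rw [redEntropy, entropyTerm_eq hB hv, div_le_iff₀ hl]
  refine (logPart_le (by omega) (snrParam_nonneg B v)).trans (le_of_eq ?_)
  have e1 : max 0 (Real.log B - snrParam B v ^ 2 / 2) =
      max 0 (1 - v.toReal / (2 * Real.log 2)) * Real.log B := by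
    rw [snrParam_sq hB, max_mul_of_nonneg _ _ hl.le]
    congr 1
    · simp
    · field_simp
  have e2 : snrParam B v = Real.sqrt (v.toReal / Real.log 2) * Real.sqrt (Real.log B) := by
    rw [← Real.sqrt_mul (by positivity), snrParam, Real.logb]
    congr 1; field_simp
  have e3 : Real.log B = Real.sqrt (Real.log B) * Real.sqrt (Real.log B) :=
    (Real.mul_self_sqrt hl.le).symm
  have hs : Real.sqrt (Real.log B) ≠ 0 := (Real.sqrt_pos.2 hl).ne'
  rw [e1, e2, add_mul, add_mul, div_mul_cancel₀ _ hl.ne']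
  have e4 : Real.sqrt (v.toReal / Real.log 2) * (∫ x, |x| ∂stdGaussian) /
      Real.sqrt (Real.log B) * Real.log B =
      Real.sqrt (v.toReal / Real.log 2) * Real.sqrt (Real.log B) * ∫ x, |x| ∂stdGaussian := by
    nth_rewrite 2 [e3]
    field_simp
  rw [e4]; ring

end SparseSuperposition

namespace SparseSuperposition

/-! ### The Ornstein–Uhlenbeck semigroup on smooth functions -/

/-- The Mehler formula. -/
noncomputable def mehler (G : ℝ → ℝ) (τ z : ℝ) : ℝ :=
  ∫ n, G (τ * z + Real.sqrt (1 - τ ^ 2) * n) ∂stdGaussian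

/-- `x ln x`. -/
noncomputable def xlogx (x : ℝ) : ℝ := x * Real.log x

lemma continuous_xlogx : Continuous xlogx := Real.continuous_mul_log

lemma integrable_comp_of_bounded {f : ℝ → ℝ} (hf : Measurable f) {C : ℝ} (hC : ∀ x, |f x| ≤ C)
    {k : ℝ → ℝ} (hk : Measurable k) : Integrable (fun x => f (k x)) stdGaussian :=
  Integrable.of_bound (hf.comp hk).aestronglyMeasurable C (ae_of_all _ fun _ => hC _)

lemma abs_integral_le_of_bounded {f : ℝ → ℝ} {C : ℝ} (hC : ∀ x, |f x| ≤ C) :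
    |∫ x, f x ∂stdGaussian| ≤ C := by
  have := norm_integral_le_of_norm_le_const (μ := stdGaussian) (f := f) (ae_of_all _ hC)
  simpa using this

lemma abs_mehler_le {f : ℝ → ℝ} {C : ℝ} (hC : ∀ x, |f x| ≤ C) (τ z : ℝ) : |mehler f τ z| ≤ C :=
  abs_integral_le_of_bounded fun _ => hC _

lemma le_integral_of_le {f : ℝ → ℝ} {ε : ℝ} (hf : Integrable f stdGaussian) (h : ∀ x, ε ≤ f x) :
    ε ≤ ∫ x, f x ∂stdGaussian := by
  have := integral_mono (integrable_const ε) hf h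
  simpa using this

lemma measurable_mehler {f : ℝ → ℝ} (hf : Measurable f) (τ : ℝ) : Measurable (mehler f τ) := by
  have : Measurable fun p : ℝ × ℝ => f (τ * p.1 + Real.sqrt (1 - τ ^ 2) * p.2) :=
    hf.comp (by fun_prop)
  exact this.stronglyMeasurable.integral_prod_right.measurable

section Smooth

variable {G G' G'' : ℝ → ℝ} {C : ℝ}

lemma hasDerivAt_mehler (hG : ∀ x, HasDerivAt G (G' x) x) (hmG' : Measurable G')
    (hCG : ∀ x, |G x| ≤ C) (hC : ∀ x, |G' x| ≤ C) (τ z : ℝ) :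
    HasDerivAt (mehler G τ) (τ * mehler G' τ z) z := by
  have hmG : Measurable G :=
    (continuous_iff_continuousAt.2 fun x => (hG x).continuousAt).measurable
  have h := (hasDerivAt_integral_of_dominated_loc_of_deriv_le (μ := stdGaussian)
    (F := fun z n => G (τ * z + Real.sqrt (1 - τ ^ 2) * n))
    (F' := fun z n => G' (τ * z + Real.sqrt (1 - τ ^ 2) * n) * τ)
    (bound := fun _ => C * |τ|) (x₀ := z) (s := univ) univ_mem
    (Eventually.of_forall fun z' => (integrable_comp_of_bounded hmG hCG (by fun_prop)).1)
    (integrable_comp_of_bounded hmG hCG (by fun_prop))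
    ((integrable_comp_of_bounded hmG' hC (by fun_prop)).mul_const τ).1
    (ae_of_all _ fun n z' _ => by
      rw [norm_mul, Real.norm_eq_abs, Real.norm_eq_abs]
      exact mul_le_mul_of_nonneg_right (hC _) (abs_nonneg _))
    (integrable_const _)
    (ae_of_all _ fun n z' _ => by
      have h1 : HasDerivAt (fun z => τ * z + Real.sqrt (1 - τ ^ 2) * n) τ z' := by
        simpa using ((hasDerivAt_id z').const_mul τ).add_const (Real.sqrt (1 - τ ^ 2) * n)
      exact (hG _).comp z' h1)).2
  refine h.congr_deriv ?_
  rw [integral_mul_const, mehler, mul_comm]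

lemma integral_mul_mehler_aux (hG' : ∀ x, HasDerivAt G' (G'' x) x) (hmG'' : Measurable G'')
    (hC' : ∀ x, |G' x| ≤ C) (hC'' : ∀ x, |G'' x| ≤ C) (c σ : ℝ) :
    ∫ n, n * G' (c + σ * n) ∂stdGaussian = σ * ∫ n, G'' (c + σ * n) ∂stdGaussian := by
  have hmG' : Measurable G' :=
    (continuous_iff_continuousAt.2 fun x => (hG' x).continuousAt).measurable
  rw [← integral_const_mul]
  refine integral_mul_self_stdGaussian (fun x => ?_) ?_ ?_ ?_
  · have h1 : HasDerivAt (fun n => c + σ * n) σ x := by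
      simpa using ((hasDerivAt_id x).const_mul σ).const_add c
    exact ((hG' _).comp x h1).congr_deriv (mul_comm _ _)
  · exact integrable_id_stdGaussian.mul_bdd (c := C)
      (integrable_comp_of_bounded hmG' hC' (by fun_prop)).1 (ae_of_all _ fun x => hC' _)
  · exact (integrable_comp_of_bounded hmG'' hC'' (by fun_prop)).const_mul σ
  · exact integrable_comp_of_bounded hmG' hC' (by fun_prop)

lemma hasDerivAt_sqrt_one_sub_sq {τ : ℝ} (h0 : 0 ≤ τ) (h1 : τ < 1) :
    HasDerivAt (fun τ : ℝ => Real.sqrt (1 - τ ^ 2)) (-τ / Real.sqrt (1 - τ ^ 2)) τ := by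
  have hp : 0 < 1 - τ ^ 2 := by nlinarith
  have h := ((hasDerivAt_pow 2 τ).const_sub 1).sqrt hp.ne'
  refine h.congr_deriv ?_
  have := (Real.sqrt_pos.2 hp).ne'
  field_simp
  simp

/-- The chain rule produces a term with `n / √(1 - τ²)`. Integration by parts in `n` gives back a
factor `√(1 - τ²)` and removes the singularity. -/
lemma hasDerivAt_mehler_time (hG : ∀ x, HasDerivAt G (G' x) x)
    (hG' : ∀ x, HasDerivAt G' (G'' x) x) (hmG'' : Measurable G'')
    (hCG : ∀ x, |G x| ≤ C) (hC' : ∀ x, |G' x| ≤ C) (hC'' : ∀ x, |G'' x| ≤ C)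
    {τ : ℝ} (h0 : 0 < τ) (h1 : τ < 1) (z : ℝ) :
    HasDerivAt (fun τ => mehler G τ z) (z * mehler G' τ z - τ * mehler G'' τ z) τ := by
  have hmG : Measurable G :=
    (continuous_iff_continuousAt.2 fun x => (hG x).continuousAt).measurable
  have hmG' : Measurable G' :=
    (continuous_iff_continuousAt.2 fun x => (hG' x).continuousAt).measurable
  -- On `(0, b)` the square root stays away from `0`, which gives an integrable bound for the
  -- derivative.
  set b := (1 + τ) / 2 with hb
  have hb1 : b < 1 := by linarith
  have hbp : 0 < 1 - b ^ 2 := by nlinarith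
  have hC0 : 0 ≤ C := (abs_nonneg _).trans (hCG 0)
  have h := (hasDerivAt_integral_of_dominated_loc_of_deriv_le (μ := stdGaussian)
    (F := fun τ n => G (τ * z + Real.sqrt (1 - τ ^ 2) * n))
    (F' := fun τ n => G' (τ * z + Real.sqrt (1 - τ ^ 2) * n) *
      (z + -τ / Real.sqrt (1 - τ ^ 2) * n))
    (bound := fun n => C * (|z| + 1 / Real.sqrt (1 - b ^ 2) * |n|)) (x₀ := τ) (s := Ioo 0 b)
    (Ioo_mem_nhds h0 (by linarith))
    (Eventually.of_forall fun τ' => (integrable_comp_of_bounded hmG hCG (by fun_prop)).1)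
    (integrable_comp_of_bounded hmG hCG (by fun_prop))
    (((integrable_comp_of_bounded hmG' hC' (by fun_prop)).1).mul
      (by fun_prop : Measurable fun n : ℝ =>
        z + -τ / Real.sqrt (1 - τ ^ 2) * n).aestronglyMeasurable)
    (ae_of_all _ fun n τ' hτ' => by
      rw [norm_mul, Real.norm_eq_abs, Real.norm_eq_abs]
      have hs : Real.sqrt (1 - b ^ 2) ≤ Real.sqrt (1 - τ' ^ 2) :=
        Real.sqrt_le_sqrt (by nlinarith [hτ'.1, hτ'.2])
      have hsb : 0 < Real.sqrt (1 - b ^ 2) := Real.sqrt_pos.2 hbp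
      refine mul_le_mul (hC' _) ((abs_add_le _ _).trans (add_le_add le_rfl ?_)) (abs_nonneg _) hC0
      rw [abs_mul, abs_div, abs_neg, abs_of_pos hτ'.1, abs_of_nonneg (Real.sqrt_nonneg _)]
      refine mul_le_mul_of_nonneg_right ?_ (abs_nonneg _)
      exact div_le_div₀ zero_le_one (by linarith [hτ'.2]) hsb hs)
    (((integrable_const _).add (integrable_abs_stdGaussian.const_mul _)).const_mul _)
    (ae_of_all _ fun n τ' hτ' => by
      have h2 : HasDerivAt (fun τ => τ * z + Real.sqrt (1 - τ ^ 2) * n)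
          (z + -τ' / Real.sqrt (1 - τ' ^ 2) * n) τ' := by
        have := ((hasDerivAt_id τ').mul_const z).add
          ((hasDerivAt_sqrt_one_sub_sq hτ'.1.le (by linarith [hτ'.2])).mul_const n)
        exact this.congr_deriv (by simp)
      exact (hG _).comp τ' h2)).2
  refine h.congr_deriv ?_
  have hi1 : Integrable (fun n => G' (τ * z + Real.sqrt (1 - τ ^ 2) * n)) stdGaussian :=
    integrable_comp_of_bounded hmG' hC' (by fun_prop)
  have hi2 : Integrable (fun n => n * G' (τ * z + Real.sqrt (1 - τ ^ 2) * n)) stdGaussian :=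
    integrable_id_stdGaussian.mul_bdd (c := C) hi1.1 (ae_of_all _ fun x => hC' _)
  have e : ∀ n, G' (τ * z + Real.sqrt (1 - τ ^ 2) * n) * (z + -τ / Real.sqrt (1 - τ ^ 2) * n) =
      z * G' (τ * z + Real.sqrt (1 - τ ^ 2) * n) +
        -τ / Real.sqrt (1 - τ ^ 2) * (n * G' (τ * z + Real.sqrt (1 - τ ^ 2) * n)) := by
    intro n; ring
  simp_rw [e]
  rw [integral_add (hi1.const_mul _) (hi2.const_mul _), integral_const_mul, integral_const_mul,
    integral_mul_mehler_aux hG' hmG'' hC' hC'', mehler, mehler]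
  have : Real.sqrt (1 - τ ^ 2) ≠ 0 := (Real.sqrt_pos.2 (by nlinarith)).ne'
  field_simp
  ring

/-- The derivative of the entropy along the Ornstein–Uhlenbeck semigroup (de Bruijn's identity). -/
lemma hasDerivAt_entropy_mehler (hG : ∀ x, HasDerivAt G (G' x) x)
    (hG' : ∀ x, HasDerivAt G' (G'' x) x) (hmG'' : Measurable G'')
    (hCG : ∀ x, |G x| ≤ C) (hC' : ∀ x, |G' x| ≤ C) (hC'' : ∀ x, |G'' x| ≤ C)
    {ε : ℝ} (hε : 0 < ε) (hεG : ∀ x, ε ≤ G x) {τ : ℝ} (h0 : 0 < τ) (h1 : τ < 1) :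
    HasDerivAt (fun τ => ∫ z, xlogx (mehler G τ z) ∂stdGaussian)
      (τ * ∫ z, mehler G' τ z ^ 2 / mehler G τ z ∂stdGaussian) τ := by
  have hmG : Measurable G :=
    (continuous_iff_continuousAt.2 fun x => (hG x).continuousAt).measurable
  have hmG' : Measurable G' :=
    (continuous_iff_continuousAt.2 fun x => (hG' x).continuousAt).measurable
  have hC0 : 0 ≤ C := (abs_nonneg _).trans (hCG 0)
  have hU : ∀ τ z, ε ≤ mehler G τ z := fun τ z =>
    le_integral_of_le (integrable_comp_of_bounded hmG hCG (by fun_prop)) fun _ => hεG _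
  have hU' : ∀ τ z, mehler G τ z ≤ C := fun τ z => (le_abs_self _).trans (abs_mehler_le hCG τ z)
  set M := |Real.log ε| + |Real.log C| with hM
  have hlog : ∀ τ z, |Real.log (mehler G τ z)| ≤ M := by
    intro τ z
    have h2 := Real.log_le_log hε (hU τ z)
    have h3 := Real.log_le_log (hε.trans_le (hU τ z)) (hU' τ z)
    rw [abs_le]
    constructor <;> [linarith [neg_abs_le (Real.log ε), abs_nonneg (Real.log C)];
      linarith [le_abs_self (Real.log C), abs_nonneg (Real.log ε)]]
  have hmU := fun τ => measurable_mehler hmG τ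
  have hmA := fun τ => measurable_mehler hmG' τ
  have hmB := fun τ => measurable_mehler hmG'' τ
  have hint : ∀ τ, Integrable (fun z => xlogx (mehler G τ z)) stdGaussian := fun τ =>
    Integrable.of_bound (continuous_xlogx.measurable.comp (hmU τ)).aestronglyMeasurable (C * M)
      (ae_of_all _ fun z => by
        rw [xlogx, norm_mul, Real.norm_eq_abs, Real.norm_eq_abs]
        exact mul_le_mul (abs_mehler_le hCG τ z) (hlog τ z) (abs_nonneg _) hC0)
  have h := (hasDerivAt_integral_of_dominated_loc_of_deriv_le (μ := stdGaussian)
    (F := fun τ z => xlogx (mehler G τ z))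
    (F' := fun τ z => (Real.log (mehler G τ z) + 1) * (z * mehler G' τ z - τ * mehler G'' τ z))
    (bound := fun z => (M + 1) * (|z| * C + C)) (x₀ := τ) (s := Ioo 0 1)
    (Ioo_mem_nhds h0 h1) (Eventually.of_forall fun τ' => (hint τ').1) (hint τ)
    (((hmU τ).log.add_const 1).mul
      ((measurable_id.mul (hmA τ)).sub ((hmB τ).const_mul τ))).aestronglyMeasurable
    (ae_of_all _ fun z τ' hτ' => by
      rw [norm_mul, Real.norm_eq_abs, Real.norm_eq_abs]
      refine mul_le_mul ((abs_add_le _ _).trans ?_) ((abs_sub _ _).trans ?_) (abs_nonneg _)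
        (by positivity)
      · rw [abs_one]; linarith [hlog τ' z]
      · rw [abs_mul, abs_mul, abs_of_pos hτ'.1]
        have h2 := abs_mehler_le hC' τ' z
        have h3 := abs_mehler_le hC'' τ' z
        have h4 : τ' * |mehler G'' τ' z| ≤ 1 * C :=
          mul_le_mul hτ'.2.le h3 (abs_nonneg _) zero_le_one
        have h5 : |z| * |mehler G' τ' z| ≤ |z| * C := mul_le_mul_of_nonneg_left h2 (abs_nonneg _)
        linarith)
    (((integrable_abs_stdGaussian.mul_const C).add (integrable_const C)).const_mul _)
    (ae_of_all _ fun z τ' hτ' => by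
      have h2 := hasDerivAt_mehler_time hG hG' hmG'' hCG hC' hC'' hτ'.1 hτ'.2 z
      exact (Real.hasDerivAt_mul_log (hε.trans_le (hU τ' z)).ne').comp τ' h2)).2
  refine h.congr_deriv ?_
  -- integration by parts in `z`
  set K : ℝ → ℝ := fun z => (Real.log (mehler G τ z) + 1) * mehler G' τ z with hK
  have hUd := fun z => hasDerivAt_mehler hG hmG' hCG hC' τ z
  have hAd := fun z => hasDerivAt_mehler hG' hmG'' hC' hC'' τ z
  have hKd : ∀ z, HasDerivAt K (τ * (mehler G' τ z ^ 2 / mehler G τ z) +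
      τ * ((Real.log (mehler G τ z) + 1) * mehler G'' τ z)) z := by
    intro z
    have hne := (hε.trans_le (hU τ z)).ne'
    refine ((((hUd z).log hne).add_const 1).mul (hAd z)).congr_deriv ?_
    field_simp
  have hKb : ∀ z, |K z| ≤ (M + 1) * C := fun z => by
    rw [hK, abs_mul]
    refine mul_le_mul ((abs_add_le _ _).trans ?_) (abs_mehler_le hC' τ z) (abs_nonneg _)
      (by positivity)
    rw [abs_one]; linarith [hlog τ z]
  have hKm : Measurable K := ((hmU τ).log.add_const 1).mul (hmA τ)
  have hi1 : Integrable K stdGaussian :=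
    Integrable.of_bound hKm.aestronglyMeasurable _ (ae_of_all _ hKb)
  have hi2 : Integrable (fun z => z * K z) stdGaussian :=
    integrable_id_stdGaussian.mul_bdd (c := (M + 1) * C) hKm.aestronglyMeasurable
      (ae_of_all _ hKb)
  have hi3 : Integrable (fun z => mehler G' τ z ^ 2 / mehler G τ z) stdGaussian :=
    Integrable.of_bound (((hmA τ).pow_const 2).div (hmU τ)).aestronglyMeasurable (C ^ 2 / ε)
      (ae_of_all _ fun z => by
        rw [norm_div, norm_pow, Real.norm_eq_abs, Real.norm_eq_abs,
          abs_of_pos (hε.trans_le (hU τ z))]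
        have h2 := abs_mehler_le hC' τ z
        have h3 := hU τ z
        gcongr)
  have hi4 : Integrable (fun z => (Real.log (mehler G τ z) + 1) * mehler G'' τ z) stdGaussian :=
    Integrable.of_bound (((hmU τ).log.add_const 1).mul (hmB τ)).aestronglyMeasurable ((M + 1) * C)
      (ae_of_all _ fun z => by
        rw [norm_mul, Real.norm_eq_abs, Real.norm_eq_abs]
        refine mul_le_mul ((abs_add_le _ _).trans ?_) (abs_mehler_le hC'' τ z) (abs_nonneg _)
          (by positivity)
        rw [abs_one]; linarith [hlog τ z])
  have hibp := integral_mul_self_stdGaussian hKd hi2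
    ((hi3.const_mul τ).add (hi4.const_mul τ)) hi1
  -- The integration by parts of `z K(z)` creates the same term with `G''`, with the opposite sign.
  -- Only the Fisher information is left.
  have e : ∀ z, (Real.log (mehler G τ z) + 1) * (z * mehler G' τ z - τ * mehler G'' τ z) =
      z * K z - τ * ((Real.log (mehler G τ z) + 1) * mehler G'' τ z) := by
    intro z; rw [hK]; ring
  simp_rw [e]
  rw [integral_sub hi2 (hi4.const_mul τ), hibp, integral_add (hi3.const_mul τ) (hi4.const_mul τ),
    integral_const_mul]
  ring

lemma continuousOn_entropy_mehler (hG : Continuous G) (hCG : ∀ x, |G x| ≤ C) :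
    Continuous (fun τ => ∫ z, xlogx (mehler G τ z) ∂stdGaussian) := by
  have hc : ∀ z, Continuous fun τ => mehler G τ z := by
    intro z
    refine continuous_of_dominated (bound := fun _ => C)
      (fun τ => (integrable_comp_of_bounded hG.measurable hCG (by fun_prop)).1)
      (fun τ => ae_of_all _ fun n => hCG _) (integrable_const _) (ae_of_all _ fun n => ?_)
    exact hG.comp (by fun_prop)
  obtain ⟨K, hK⟩ := (isCompact_Icc (a := -C) (b := C)).exists_bound_of_continuousOn
    continuous_xlogx.continuousOn
  refine continuous_of_dominated (bound := fun _ => K)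
    (fun τ => (continuous_xlogx.measurable.comp
      (measurable_mehler hG.measurable τ)).aestronglyMeasurable)
    (fun τ => ae_of_all _ fun z => hK _ (abs_le.1 (abs_mehler_le hCG τ z))) (integrable_const _)
    (ae_of_all _ fun z => continuous_xlogx.comp (hc z))

end Smooth

end SparseSuperposition

namespace SparseSuperposition

/-! ### The heat semigroup, its score and its Fisher information -/

/-- `∫ g(u) 𝒩(u | p, E) du`. -/
noncomputable def heat (g : ℝ → ℝ) (E p : ℝ) : ℝ := ∫ n, g (p + Real.sqrt E * n) ∂stdGaussian

/-- The derivative of `heat g E`. -/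
noncomputable def heatDeriv (g : ℝ → ℝ) (E p : ℝ) : ℝ :=
  (Real.sqrt E)⁻¹ * ∫ n, n * g (p + Real.sqrt E * n) ∂stdGaussian

/-- The second derivative of `heat g E`. -/
noncomputable def heatDeriv₂ (g : ℝ → ℝ) (E p : ℝ) : ℝ :=
  E⁻¹ * (∫ n, n ^ 2 * g (p + Real.sqrt E * n) ∂stdGaussian - heat g E p)

/-- The Fisher information density. -/
noncomputable def fisherFn (g : ℝ → ℝ) (E p : ℝ) : ℝ := heatDeriv g E p ^ 2 / heat g E p

/-- The Fisher information, averaged over `p ∼ 𝒩(0, 1 - E)`. -/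
noncomputable def meanFisher (g : ℝ → ℝ) (E : ℝ) : ℝ :=
  ∫ z, fisherFn g E (Real.sqrt (1 - E) * z) ∂stdGaussian

/-- `𝔼 f ln f` for `f = heat g E p` and `p ∼ 𝒩(0, 1 - E)`. -/
noncomputable def meanEntropy (g : ℝ → ℝ) (E : ℝ) : ℝ :=
  ∫ z, xlogx (heat g E (Real.sqrt (1 - E) * z)) ∂stdGaussian

/-- Functions which are integrable, with exponential weights, for all Gaussian measures of variance
at most one. -/
structure Tame (g : ℝ → ℝ) : Prop where
  measurable : Measurable g
  integrable : ∀ p : ℝ, ∀ E ∈ Ioc (0 : ℝ) 1, ∀ A : ℝ,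
    Integrable (fun n => g (p + Real.sqrt E * n) * Real.exp (A * |n|)) stdGaussian

lemma integrable_exp_abs (A : ℝ) : Integrable (fun n => Real.exp (A * |n|)) stdGaussian := by
  refine ((integrable_exp_mul_stdGaussian A).add (integrable_exp_mul_stdGaussian (-A))).mono
    (by fun_prop) (ae_of_all _ fun n => ?_)
  simp only [Pi.add_apply]
  rw [Real.norm_of_nonneg (Real.exp_pos _).le, Real.norm_of_nonneg (by positivity)]
  rcases abs_cases n with ⟨h, _⟩ | ⟨h, _⟩ <;> rw [h]
  · linarith [Real.exp_pos (-A * n)]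
  · have : A * -n = -A * n := by ring
    rw [this]; linarith [Real.exp_pos (A * n)]

lemma Tame.of_bounded {g : ℝ → ℝ} (hm : Measurable g) {C : ℝ} (hC : ∀ u, |g u| ≤ C) : Tame g :=
  ⟨hm, fun p E _ A => (integrable_exp_abs A).bdd_mul (c := C)
    (hm.comp (by fun_prop)).aestronglyMeasurable (ae_of_all _ fun _ => hC _)⟩

lemma pow_mul_exp_le (k : ℕ) (x : ℝ) : |x| ^ k ≤ Real.exp (k * |x|) := by
  rw [Real.exp_nat_mul]
  exact pow_le_pow_left₀ (abs_nonneg x) (by linarith [Real.add_one_le_exp |x|]) k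

lemma Tame.integrable_pow_mul {g : ℝ → ℝ} (hg : Tame g) (p : ℝ) {E : ℝ} (hE : E ∈ Ioc (0 : ℝ) 1)
    (k : ℕ) (A : ℝ) : Integrable (fun n => n ^ k * g (p + Real.sqrt E * n) * Real.exp (A * |n|))
      stdGaussian := by
  refine (hg.integrable p E hE (k + A)).mono ?_ (ae_of_all _ fun n => ?_)
  · have : Measurable fun n => g (p + Real.sqrt E * n) := hg.measurable.comp (by fun_prop)
    exact (((measurable_id.pow_const k).mul this).mul (by fun_prop)).aestronglyMeasurable
  · simp only [norm_mul, norm_pow, Real.norm_eq_abs, Real.abs_exp]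
    rw [add_mul, Real.exp_add]
    have := pow_mul_exp_le k n
    calc _ ≤ Real.exp (k * |n|) * |g (p + Real.sqrt E * n)| * Real.exp (A * |n|) := by gcongr
      _ = _ := by ring

lemma Tame.integrable_pow_mul' {g : ℝ → ℝ} (hg : Tame g) (p : ℝ) {E : ℝ} (hE : E ∈ Ioc (0 : ℝ) 1)
    (k : ℕ) : Integrable (fun n => n ^ k * g (p + Real.sqrt E * n)) stdGaussian := by
  simpa using hg.integrable_pow_mul p hE k 0

lemma Tame.integrable_comp {g : ℝ → ℝ} (hg : Tame g) (p : ℝ) {E : ℝ} (hE : E ∈ Ioc (0 : ℝ) 1) :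
    Integrable (fun n => g (p + Real.sqrt E * n)) stdGaussian := by
  simpa using hg.integrable_pow_mul' p hE 0

lemma Tame.integrable_mul_comp {g : ℝ → ℝ} (hg : Tame g) (p : ℝ) {E : ℝ}
    (hE : E ∈ Ioc (0 : ℝ) 1) :
    Integrable (fun n => n * g (p + Real.sqrt E * n)) stdGaussian := by
  simpa using hg.integrable_pow_mul' p hE 1

/-- By Cameron–Martin, translating the argument is an exponential tilt of the measure, so smoothed
functions can be differentiated without any regularity of the original one. One factor `exp |n|`
dominates the tilt for `|t| < 1`, the other one the factor `n - t`. -/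
lemma hasDerivAt_tilt {h : ℝ → ℝ} (hm : Measurable h)
    (hi : Integrable (fun n => h n * Real.exp (2 * |n|)) stdGaussian) :
    HasDerivAt (fun t => ∫ n, h n * Real.exp (t * n - t ^ 2 / 2) ∂stdGaussian)
      (∫ n, n * h n ∂stdGaussian) 0 := by
  have hi0 : Integrable (fun n => h n * Real.exp (0 * n - 0 ^ 2 / 2)) stdGaussian := by
    refine hi.mono (by fun_prop) (ae_of_all _ fun n => ?_)
    simp only [norm_mul, Real.norm_eq_abs, Real.abs_exp]
    gcongr
    simp
  have h := (hasDerivAt_integral_of_dominated_loc_of_deriv_le (μ := stdGaussian)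
    (F := fun t n => h n * Real.exp (t * n - t ^ 2 / 2))
    (F' := fun t n => h n * (Real.exp (t * n - t ^ 2 / 2) * (n - t)))
    (bound := fun n => |h n * Real.exp (2 * |n|)|) (x₀ := 0) (Metric.ball_mem_nhds 0 one_pos)
    (Eventually.of_forall fun t => by fun_prop) hi0 (by fun_prop)
    (ae_of_all _ fun n t ht => by
      rw [Metric.mem_ball, dist_zero_right, Real.norm_eq_abs] at ht
      rw [norm_mul, abs_mul, norm_mul]
      simp only [Real.norm_eq_abs, Real.abs_exp]
      refine mul_le_mul_of_nonneg_left ?_ (abs_nonneg _)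
      have h1 : |n - t| ≤ Real.exp |n| := by
        have := abs_sub n t
        linarith [Real.add_one_le_exp |n|]
      have h2 : Real.exp (t * n - t ^ 2 / 2) ≤ Real.exp |n| := by
        rw [Real.exp_le_exp]
        have h3 : t * n ≤ |t| * |n| := by rw [← abs_mul]; exact le_abs_self _
        have h4 : |t| * |n| ≤ 1 * |n| := mul_le_mul_of_nonneg_right ht.le (abs_nonneg _)
        nlinarith [sq_nonneg t]
      calc _ ≤ Real.exp |n| * Real.exp |n| := by gcongr
        _ = Real.exp (2 * |n|) := by rw [← Real.exp_add]; congr 1; ring)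
    hi.abs
    (ae_of_all _ fun n t _ => by
      have h1 : HasDerivAt (fun t : ℝ => t * n - t ^ 2 / 2) (n - t) t := by
        have := ((hasDerivAt_id t).mul_const n).sub ((hasDerivAt_pow 2 t).div_const 2)
        exact this.congr_deriv (by simp)
      exact (h1.exp).const_mul (h n))).2
  refine h.congr_deriv ?_
  congr 1; ext n; simp; ring

lemma heat_eq_tilt (g : ℝ → ℝ) (E p t : ℝ) : heat g E (p + Real.sqrt E * t) =
    ∫ n, g (p + Real.sqrt E * n) * Real.exp (t * n - t ^ 2 / 2) ∂stdGaussian := by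
  rw [← integral_add_stdGaussian (fun n => g (p + Real.sqrt E * n)) t, heat]
  congr 1; ext n; congr 1; ring

lemma hasDerivAt_of_comp_sqrt_mul {f : ℝ → ℝ} {E p d : ℝ} (hE : 0 < E)
    (h : HasDerivAt (fun t => f (p + Real.sqrt E * t)) d 0) :
    HasDerivAt f ((Real.sqrt E)⁻¹ * d) p := by
  have hs := (Real.sqrt_pos.2 hE).ne'
  have h1 : HasDerivAt (fun x => (Real.sqrt E)⁻¹ * (x - p)) (Real.sqrt E)⁻¹ p := by
    simpa using ((hasDerivAt_id p).sub_const p).const_mul (Real.sqrt E)⁻¹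
  have h2 := HasDerivAt.comp (h := fun x => (Real.sqrt E)⁻¹ * (x - p)) p (by simpa using h) h1
  have e : (fun t => f (p + Real.sqrt E * t)) ∘ (fun x => (Real.sqrt E)⁻¹ * (x - p)) = f := by
    ext x; simp only [Function.comp]; congr 1; field_simp; ring
  rw [e] at h2
  exact h2.congr_deriv (mul_comm _ _)

lemma Tame.hasDerivAt_heat {g : ℝ → ℝ} (hg : Tame g) {E : ℝ} (hE : E ∈ Ioc (0 : ℝ) 1) (p : ℝ) :
    HasDerivAt (heat g E) (heatDeriv g E p) p := by
  refine hasDerivAt_of_comp_sqrt_mul hE.1 ?_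
  simp_rw [heat_eq_tilt]
  exact hasDerivAt_tilt (hg.measurable.comp (by fun_prop)) (hg.integrable p E hE 2)

lemma Tame.hasDerivAt_heatDeriv {g : ℝ → ℝ} (hg : Tame g) {E : ℝ} (hE : E ∈ Ioc (0 : ℝ) 1)
    (p : ℝ) : HasDerivAt (heatDeriv g E) (heatDeriv₂ g E p) p := by
  have hs : Real.sqrt E ≠ 0 := (Real.sqrt_pos.2 hE.1).ne'
  have hm : Measurable fun n => g (p + Real.sqrt E * n) := hg.measurable.comp (by fun_prop)
  -- The weight `n` is moved by the shift as well, which accounts for the term `t * heat`.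
  have key : ∀ t, ∫ n, n * g (p + Real.sqrt E * t + Real.sqrt E * n) ∂stdGaussian =
      ∫ n, n * g (p + Real.sqrt E * n) * Real.exp (t * n - t ^ 2 / 2) ∂stdGaussian -
        t * heat g E (p + Real.sqrt E * t) := by
    intro t
    have h1 := integral_add_stdGaussian (fun n => n * g (p + Real.sqrt E * n)) t
    rw [← h1]
    have h2 : ∀ x, (x + t) * g (p + Real.sqrt E * (x + t)) =
        x * g (p + Real.sqrt E * t + Real.sqrt E * x) +
          t * g (p + Real.sqrt E * t + Real.sqrt E * x) := by
      intro x
      have : p + Real.sqrt E * (x + t) = p + Real.sqrt E * t + Real.sqrt E * x := by ring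
      rw [this]; ring
    simp_rw [h2]
    rw [integral_add (hg.integrable_mul_comp _ hE) ((hg.integrable_comp _ hE).const_mul t),
      integral_const_mul, heat]
    ring
  have h1 := hasDerivAt_tilt (h := fun n => n * g (p + Real.sqrt E * n)) (measurable_id.mul hm)
    (by simpa using hg.integrable_pow_mul p hE 1 2)
  have h2 : HasDerivAt (fun t => t * heat g E (p + Real.sqrt E * t)) (heat g E p) 0 := by
    have h3 : HasDerivAt (fun t => heat g E (p + Real.sqrt E * t))
        (∫ n, n * g (p + Real.sqrt E * n) ∂stdGaussian) 0 := by
      simp_rw [heat_eq_tilt]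
      exact hasDerivAt_tilt hm (hg.integrable p E hE 2)
    exact ((hasDerivAt_id (0 : ℝ)).mul h3).congr_deriv (by simp)
  have h3 := (h1.sub h2).const_mul (Real.sqrt E)⁻¹
  refine (hasDerivAt_of_comp_sqrt_mul (f := heatDeriv g E) hE.1
    (d := (Real.sqrt E)⁻¹ * (∫ n, n ^ 2 * g (p + Real.sqrt E * n) ∂stdGaussian - heat g E p))
    ?_).congr_deriv ?_
  · refine (h3.congr_of_eventuallyEq (Eventually.of_forall fun t => ?_)).congr_deriv ?_
    · simp only [heatDeriv, key]; rfl
    · congr 2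
      refine integral_congr_ae (ae_of_all _ fun n => ?_)
      ring
  · rw [heatDeriv₂, ← mul_assoc, ← mul_inv, Real.mul_self_sqrt hE.1.le]

/-! The semigroup property. -/

lemma sqrt_ratio {E₁ E₂ : ℝ} (h1 : 0 < E₁) (h2 : E₁ ≤ E₂) :
    Real.sqrt ((E₂ - E₁) / E₂) ^ 2 + Real.sqrt (E₁ / E₂) ^ 2 = 1 := by
  have hE2 : 0 < E₂ := by linarith
  rw [Real.sq_sqrt (div_nonneg (by linarith) hE2.le), Real.sq_sqrt (by positivity)]
  field_simp; ring

lemma sqrt_mul_sqrt_div {E a : ℝ} (hE : 0 < E) :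
    Real.sqrt E * Real.sqrt (a / E) = Real.sqrt a := by
  rw [← Real.sqrt_mul hE.le]; congr 1; field_simp

lemma Tame.integrable_heat_comp {g : ℝ → ℝ} (hg : Tame g) {E₁ E₂ : ℝ} (h1 : 0 < E₁) (h2 : E₁ ≤ E₂)
    (h3 : E₂ ≤ 1) (p : ℝ) : Integrable (fun x : ℝ × ℝ =>
      g (p + Real.sqrt (E₂ - E₁) * x.1 + Real.sqrt E₁ * x.2)) (stdGaussian.prod stdGaussian) := by
  have hE2 : 0 < E₂ := by linarith
  have hp := measurePreserving_linComb (Real.sqrt_nonneg _) (Real.sqrt_nonneg _) (sqrt_ratio h1 h2)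
  refine (hp.integrable_comp_of_integrable (hg.integrable_comp p ⟨hE2, h3⟩)).congr
    (ae_of_all _ fun x => ?_)
  simp only [Function.comp]
  congr 1
  rw [mul_add, ← mul_assoc, ← mul_assoc, sqrt_mul_sqrt_div hE2,
    sqrt_mul_sqrt_div hE2]
  ring

lemma Tame.heat_heat {g : ℝ → ℝ} (hg : Tame g) {E₁ E₂ : ℝ} (h1 : 0 < E₁) (h2 : E₁ ≤ E₂)
    (h3 : E₂ ≤ 1) (p : ℝ) :
    ∫ n, heat g E₁ (p + Real.sqrt (E₂ - E₁) * n) ∂stdGaussian = heat g E₂ p := by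
  have hE2 : 0 < E₂ := by linarith
  have hp := measurePreserving_linComb (Real.sqrt_nonneg _) (Real.sqrt_nonneg _) (sqrt_ratio h1 h2)
  have hm : Measurable fun x => g (p + Real.sqrt E₂ * x) := hg.measurable.comp (by fun_prop)
  simp_rw [heat]
  rw [← integral_prod (fun x : ℝ × ℝ => g (p + Real.sqrt (E₂ - E₁) * x.1 + Real.sqrt E₁ * x.2))
    (hg.integrable_heat_comp h1 h2 h3 p)]
  conv_rhs => rw [← hp.map_eq]
  rw [integral_map hp.aemeasurable hm.aestronglyMeasurable]
  congr 1; ext x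
  congr 1
  rw [mul_add, ← mul_assoc, ← mul_assoc, sqrt_mul_sqrt_div hE2,
    sqrt_mul_sqrt_div hE2]
  ring

/-- Rotate the pair so that the argument of `g` depends on the first new coordinate only. Then `x.2`
is `s` times the first plus `c` times the second, and the second one is independent and centered. -/
lemma Tame.integrable_mul_heat_comp {g : ℝ → ℝ} (hg : Tame g) {E₁ E₂ : ℝ} (h1 : 0 < E₁)
    (h2 : E₁ ≤ E₂) (h3 : E₂ ≤ 1) (p : ℝ) : Integrable (fun x : ℝ × ℝ =>
      x.2 * g (p + Real.sqrt (E₂ - E₁) * x.1 + Real.sqrt E₁ * x.2))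
        (stdGaussian.prod stdGaussian) ∧
      ∫ x : ℝ × ℝ, x.2 * g (p + Real.sqrt (E₂ - E₁) * x.1 + Real.sqrt E₁ * x.2)
        ∂(stdGaussian.prod stdGaussian) =
        Real.sqrt (E₁ / E₂) * ∫ n, n * g (p + Real.sqrt E₂ * n) ∂stdGaussian := by
  have hE2 : 0 < E₂ := by linarith
  set c := Real.sqrt ((E₂ - E₁) / E₂) with hc
  set s := Real.sqrt (E₁ / E₂) with hs
  have hcs : c ^ 2 + s ^ 2 = 1 := sqrt_ratio h1 h2
  have hp := measurePreserving_rotation (Real.sqrt_nonneg _) (Real.sqrt_nonneg _) hcs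
  have hi1 : Integrable (fun x : ℝ × ℝ => x.1 * g (p + Real.sqrt E₂ * x.1))
      (stdGaussian.prod stdGaussian) :=
    measurePreserving_fst.integrable_comp_of_integrable (hg.integrable_mul_comp p ⟨hE2, h3⟩)
  have hi2 : Integrable (fun x : ℝ × ℝ => g (p + Real.sqrt E₂ * x.1) * x.2)
      (stdGaussian.prod stdGaussian) :=
    (hg.integrable_comp p ⟨hE2, h3⟩).mul_prod integrable_id_stdGaussian
  have hi3 : Integrable (fun x : ℝ × ℝ => s * (x.1 * g (p + Real.sqrt E₂ * x.1)) +
      c * (g (p + Real.sqrt E₂ * x.1) * x.2)) (stdGaussian.prod stdGaussian) :=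
    (hi1.const_mul s).add (hi2.const_mul c)
  have e : ∀ x : ℝ × ℝ, s * ((c * x.1 + s * x.2) * g (p + Real.sqrt E₂ * (c * x.1 + s * x.2))) +
      c * (g (p + Real.sqrt E₂ * (c * x.1 + s * x.2)) * (-s * x.1 + c * x.2)) =
      x.2 * g (p + Real.sqrt (E₂ - E₁) * x.1 + Real.sqrt E₁ * x.2) := by
    intro x
    have : p + Real.sqrt E₂ * (c * x.1 + s * x.2) =
        p + Real.sqrt (E₂ - E₁) * x.1 + Real.sqrt E₁ * x.2 := by
      rw [mul_add, ← mul_assoc, ← mul_assoc, hc, hs, sqrt_mul_sqrt_div hE2,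
        sqrt_mul_sqrt_div hE2]
      ring
    rw [this]
    linear_combination (x.2 * g (p + Real.sqrt (E₂ - E₁) * x.1 + Real.sqrt E₁ * x.2)) * hcs
  constructor
  · refine (hp.integrable_comp_of_integrable hi3).congr (ae_of_all _ fun x => ?_)
    simp only [Function.comp]
    exact e x
  · have h4 : ∫ x : ℝ × ℝ, (s * (x.1 * g (p + Real.sqrt E₂ * x.1)) +
        c * (g (p + Real.sqrt E₂ * x.1) * x.2)) ∂(stdGaussian.prod stdGaussian) =
        s * ∫ n, n * g (p + Real.sqrt E₂ * n) ∂stdGaussian := by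
      rw [integral_add (hi1.const_mul s) (hi2.const_mul c), integral_const_mul,
        integral_const_mul, integral_prod_mul (fun x => g (p + Real.sqrt E₂ * x)) (fun y => y),
        integral_id_stdGaussian, integral_prod _ hi1]
      simp
    rw [← h4]
    conv_rhs => rw [← hp.map_eq]
    rw [integral_map hp.aemeasurable (by rw [hp.map_eq]; exact hi3.1)]
    congr 1; ext x
    exact (e x).symm

lemma Tame.heatDeriv_heatDeriv {g : ℝ → ℝ} (hg : Tame g) {E₁ E₂ : ℝ} (h1 : 0 < E₁) (h2 : E₁ ≤ E₂)
    (h3 : E₂ ≤ 1) (p : ℝ) :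
    ∫ n, heatDeriv g E₁ (p + Real.sqrt (E₂ - E₁) * n) ∂stdGaussian = heatDeriv g E₂ p := by
  have hE2 : 0 < E₂ := by linarith
  obtain ⟨hi, he⟩ := hg.integrable_mul_heat_comp h1 h2 h3 p
  simp_rw [heatDeriv]
  rw [integral_const_mul, ← integral_prod (fun x : ℝ × ℝ =>
    x.2 * g (p + Real.sqrt (E₂ - E₁) * x.1 + Real.sqrt E₁ * x.2)) hi, he, ← mul_assoc]
  congr 1
  rw [Real.sqrt_div h1.le]
  have := (Real.sqrt_pos.2 h1).ne'
  field_simp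

lemma Tame.integrable_heat {g : ℝ → ℝ} (hg : Tame g) {E₁ E₂ : ℝ} (h1 : 0 < E₁) (h2 : E₁ ≤ E₂)
    (h3 : E₂ ≤ 1) (p : ℝ) :
    Integrable (fun n => heat g E₁ (p + Real.sqrt (E₂ - E₁) * n)) stdGaussian :=
  (hg.integrable_heat_comp h1 h2 h3 p).integral_prod_left

lemma Tame.integrable_heatDeriv {g : ℝ → ℝ} (hg : Tame g) {E₁ E₂ : ℝ} (h1 : 0 < E₁) (h2 : E₁ ≤ E₂)
    (h3 : E₂ ≤ 1) (p : ℝ) :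
    Integrable (fun n => heatDeriv g E₁ (p + Real.sqrt (E₂ - E₁) * n)) stdGaussian :=
  ((hg.integrable_mul_heat_comp h1 h2 h3 p).1.integral_prod_left).const_mul _

end SparseSuperposition

/-! ### Monotonicity of the Fisher information and its equality case -/

namespace SparseSuperposition

lemma heat_nonneg {g : ℝ → ℝ} (h0 : ∀ u, 0 ≤ g u) (E p : ℝ) : 0 ≤ heat g E p :=
  integral_nonneg fun _ => h0 _

lemma fisherFn_nonneg {g : ℝ → ℝ} (h0 : ∀ u, 0 ≤ g u) (E p : ℝ) : 0 ≤ fisherFn g E p :=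
  div_nonneg (sq_nonneg _) (heat_nonneg h0 E p)

lemma meanFisher_nonneg {g : ℝ → ℝ} (h0 : ∀ u, 0 ≤ g u) (E : ℝ) : 0 ≤ meanFisher g E :=
  integral_nonneg fun _ => fisherFn_nonneg h0 _ _

lemma measurable_heat {g : ℝ → ℝ} (hg : Measurable g) (E : ℝ) : Measurable (heat g E) := by
  have : Measurable fun p : ℝ × ℝ => g (p.1 + Real.sqrt E * p.2) := hg.comp (by fun_prop)
  exact this.stronglyMeasurable.integral_prod_right.measurable

lemma measurable_heatDeriv {g : ℝ → ℝ} (hg : Measurable g) (E : ℝ) : Measurable (heatDeriv g E) := by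
  have : Measurable fun p : ℝ × ℝ => p.2 * g (p.1 + Real.sqrt E * p.2) :=
    measurable_snd.mul (hg.comp (by fun_prop))
  exact (this.stronglyMeasurable.integral_prod_right.measurable).const_mul _

lemma measurable_fisherFn {g : ℝ → ℝ} (hg : Measurable g) (E : ℝ) : Measurable (fisherFn g E) :=
  ((measurable_heatDeriv hg E).pow_const 2).div (measurable_heat hg E)

section Nonneg

variable {g : ℝ → ℝ} (hg : Tame g) (h0 : ∀ u, 0 ≤ g u)

/-- Cauchy–Schwarz for the weight `g`, read off from the discriminant of `x ↦ ∫ (n - x)² g`. It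
provides an integrable majorant of the Fisher density, and shows that the derivative vanishes
wherever `heat` does, so the convention `0 / 0 = 0` is harmless. -/
lemma Tame.sq_heatDeriv_le (hg : Tame g) (h0 : ∀ u, 0 ≤ g u) {E : ℝ} (hE : E ∈ Ioc (0 : ℝ) 1)
    (p : ℝ) : heatDeriv g E p ^ 2 ≤
      heat g E p * (E⁻¹ * ∫ n, n ^ 2 * g (p + Real.sqrt E * n) ∂stdGaussian) := by
  set m := ∫ n, n * g (p + Real.sqrt E * n) ∂stdGaussian with hm
  set k := ∫ n, n ^ 2 * g (p + Real.sqrt E * n) ∂stdGaussian with hk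
  have hi0 := hg.integrable_comp p hE
  have hi1 := hg.integrable_mul_comp p hE
  have hi2 := hg.integrable_pow_mul' p hE 2
  have h := discrim_le_zero (a := heat g E p) (b := -2 * m) (c := k) fun x => by
    have h1 : 0 ≤ ∫ n, (n - x) ^ 2 * g (p + Real.sqrt E * n) ∂stdGaussian :=
      integral_nonneg fun n => mul_nonneg (sq_nonneg _) (h0 _)
    have e : ∀ n, (n - x) ^ 2 * g (p + Real.sqrt E * n) = n ^ 2 * g (p + Real.sqrt E * n) +
        (-2 * x * (n * g (p + Real.sqrt E * n)) + x * x * g (p + Real.sqrt E * n)) := by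
      intro n; ring
    simp_rw [e] at h1
    have hi3 : Integrable (fun n => -2 * x * (n * g (p + Real.sqrt E * n)) +
        x * x * g (p + Real.sqrt E * n)) stdGaussian := (hi1.const_mul _).add (hi0.const_mul _)
    rw [integral_add hi2 hi3, integral_add (hi1.const_mul _) (hi0.const_mul _),
      integral_const_mul, integral_const_mul] at h1
    rw [heat]; linarith
  rw [discrim] at h
  rw [heatDeriv, ← hm, mul_pow, inv_pow, Real.sq_sqrt hE.1.le]
  have : m ^ 2 ≤ heat g E p * k := by linarith
  have h2 : 0 ≤ E⁻¹ := inv_nonneg.2 hE.1.le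
  calc E⁻¹ * m ^ 2 ≤ E⁻¹ * (heat g E p * k) := mul_le_mul_of_nonneg_left this h2
    _ = _ := by ring

lemma Tame.fisherFn_le (hg : Tame g) (h0 : ∀ u, 0 ≤ g u) {E : ℝ} (hE : E ∈ Ioc (0 : ℝ) 1)
    (p : ℝ) : fisherFn g E p ≤ E⁻¹ * ∫ n, n ^ 2 * g (p + Real.sqrt E * n) ∂stdGaussian := by
  have h := hg.sq_heatDeriv_le h0 hE p
  rcases (heat_nonneg h0 E p).eq_or_lt with h1 | h1
  · rw [fisherFn, ← h1, div_zero]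
    exact mul_nonneg (inv_nonneg.2 hE.1.le)
      (integral_nonneg fun n => mul_nonneg (sq_nonneg _) (h0 _))
  · rw [fisherFn, div_le_iff₀' h1]; exact h

lemma Tame.heatDeriv_eq_zero (hg : Tame g) (h0 : ∀ u, 0 ≤ g u) {E : ℝ} (hE : E ∈ Ioc (0 : ℝ) 1)
    {p : ℝ} (h : heat g E p = 0) : heatDeriv g E p = 0 := by
  have := hg.sq_heatDeriv_le h0 hE p
  rw [h, zero_mul] at this
  exact pow_eq_zero_iff two_ne_zero |>.1 (le_antisymm this (sq_nonneg _))

lemma Tame.integrable_sq_mul_comp (hg : Tame g) {E : ℝ} (hE : E ∈ Ioc (0 : ℝ) 1) :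
    Integrable (fun x : ℝ × ℝ => x.2 ^ 2 * g (Real.sqrt (1 - E) * x.1 + Real.sqrt E * x.2))
      (stdGaussian.prod stdGaussian) := by
  set c := Real.sqrt (1 - E) with hc
  set s := Real.sqrt E with hs
  have hcs : c ^ 2 + s ^ 2 = 1 := by
    rw [Real.sq_sqrt (by linarith [hE.2]), Real.sq_sqrt hE.1.le]; ring
  have hp := measurePreserving_rotation (Real.sqrt_nonneg _) (Real.sqrt_nonneg _) hcs
  have hi : ∀ k : ℕ, Integrable (fun x => x ^ k * g x) stdGaussian := fun k => by
    simpa using hg.integrable_pow_mul' 0 ⟨one_pos, le_rfl⟩ k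
  have hj : ∀ k : ℕ, Integrable (fun x : ℝ => x ^ k) stdGaussian := fun k => by
    simpa using (Tame.of_bounded (g := fun _ => 1) measurable_const (C := 1)
      (fun _ => by simp)).integrable_pow_mul' 0 ⟨one_pos, le_rfl⟩ k
  have h1 := ((hi 2).mul_prod (hj 0)).const_mul (s ^ 2)
  have h2 := ((hi 1).mul_prod (hj 1)).const_mul (2 * s * c)
  have h3 := ((hi 0).mul_prod (hj 2)).const_mul (c ^ 2)
  refine (hp.integrable_comp_of_integrable ((h1.add h2).add h3)).congr (ae_of_all _ fun x => ?_)
  simp only [Function.comp, Pi.add_apply]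
  linear_combination (x.2 ^ 2 * g (c * x.1 + s * x.2) * (c ^ 2 + s ^ 2 + 1)) * hcs

lemma Tame.integrable_fisherFn (hg : Tame g) (h0 : ∀ u, 0 ≤ g u) {E : ℝ}
    (hE : E ∈ Ioc (0 : ℝ) 1) :
    Integrable (fun z => fisherFn g E (Real.sqrt (1 - E) * z)) stdGaussian := by
  have h := ((hg.integrable_sq_mul_comp hE).integral_prod_left).const_mul E⁻¹
  refine h.mono ((measurable_fisherFn hg.measurable E).comp (by fun_prop)).aestronglyMeasurable
    (ae_of_all _ fun z => ?_)
  rw [Real.norm_of_nonneg (fisherFn_nonneg h0 _ _)]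
  exact (hg.fisherFn_le h0 hE _).trans (le_abs_self _)

/-- Revealing less: a Gaussian of variance `1 - E₁` is an independent sum of variances `1 - E₂` and
`E₂ - E₁`. The case `E₁ = 1` is apart because of the division by `1 - E₁`. -/
lemma rescale_gaussian {f : ℝ → ℝ} {E₁ E₂ : ℝ} (h1 : E₁ ≤ E₂) (h2 : E₂ ≤ 1)
    (hf : Integrable (fun z => f (Real.sqrt (1 - E₁) * z)) stdGaussian) :
    Integrable (fun x : ℝ × ℝ => f (Real.sqrt (1 - E₂) * x.1 + Real.sqrt (E₂ - E₁) * x.2))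
      (stdGaussian.prod stdGaussian) ∧
    ∫ x : ℝ × ℝ, f (Real.sqrt (1 - E₂) * x.1 + Real.sqrt (E₂ - E₁) * x.2)
      ∂(stdGaussian.prod stdGaussian) = ∫ z, f (Real.sqrt (1 - E₁) * z) ∂stdGaussian := by
  rcases (h1.trans h2).eq_or_lt with h3 | h3
  · obtain rfl : E₂ = 1 := le_antisymm h2 (h3 ▸ h1)
    subst h3
    simp
  · have hE : 0 < 1 - E₁ := by linarith
    have hcs : Real.sqrt ((1 - E₂) / (1 - E₁)) ^ 2 + Real.sqrt ((E₂ - E₁) / (1 - E₁)) ^ 2 = 1 := by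
      rw [Real.sq_sqrt (div_nonneg (by linarith) hE.le),
        Real.sq_sqrt (div_nonneg (by linarith) hE.le)]
      field_simp; ring
    have hp := measurePreserving_linComb (Real.sqrt_nonneg _) (Real.sqrt_nonneg _) hcs
    have e : ∀ x : ℝ × ℝ, Real.sqrt (1 - E₁) * (Real.sqrt ((1 - E₂) / (1 - E₁)) * x.1 +
        Real.sqrt ((E₂ - E₁) / (1 - E₁)) * x.2) =
        Real.sqrt (1 - E₂) * x.1 + Real.sqrt (E₂ - E₁) * x.2 := by
      intro x
      rw [mul_add, ← mul_assoc, ← mul_assoc, sqrt_mul_sqrt_div hE, sqrt_mul_sqrt_div hE]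
    constructor
    · refine (hp.integrable_comp_of_integrable hf).congr (ae_of_all _ fun x => ?_)
      simp only [Function.comp, e]
    · conv_rhs => rw [← hp.map_eq]
      rw [integral_map hp.aemeasurable (by rw [hp.map_eq]; exact hf.1)]
      simp_rw [e]

/-- The defect in the data processing inequality for the Fisher information. -/
lemma Tame.meanFisher_sub (hg : Tame g) (h0 : ∀ u, 0 ≤ g u) {E₁ E₂ : ℝ} (h1 : 0 < E₁)
    (h2 : E₁ ≤ E₂) (h3 : E₂ ≤ 1) :
    ∃ D : ℝ → ℝ, Integrable D stdGaussian ∧ (∀ᵐ z ∂stdGaussian, 0 ≤ D z) ∧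
      meanFisher g E₁ - meanFisher g E₂ = ∫ z, D z ∂stdGaussian ∧
      ∀ᵐ z ∂stdGaussian, D z = 0 → ∀ᵐ n ∂stdGaussian,
        heatDeriv g E₁ (Real.sqrt (1 - E₂) * z + Real.sqrt (E₂ - E₁) * n) =
          heatDeriv g E₂ (Real.sqrt (1 - E₂) * z) / heat g E₂ (Real.sqrt (1 - E₂) * z) *
            heat g E₁ (Real.sqrt (1 - E₂) * z + Real.sqrt (E₂ - E₁) * n) := by
  have hE1 : E₁ ∈ Ioc (0 : ℝ) 1 := ⟨h1, h2.trans h3⟩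
  have hE2 : E₂ ∈ Ioc (0 : ℝ) 1 := ⟨h1.trans_le h2, h3⟩
  obtain ⟨hi, he⟩ := rescale_gaussian h2 h3 (hg.integrable_fisherFn h0 hE1)
  set p₁ : ℝ → ℝ → ℝ := fun z n => Real.sqrt (1 - E₂) * z + Real.sqrt (E₂ - E₁) * n with hp₁
  set lam : ℝ → ℝ := fun z =>
    heatDeriv g E₂ (Real.sqrt (1 - E₂) * z) / heat g E₂ (Real.sqrt (1 - E₂) * z) with hlam
  -- This is `f (f'/f - lam)²` for `f = heat g E₁`, expanded so that it makes sense where `f = 0`.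
  -- Here `lam` is the score at noise `E₂`, the conditional mean of the score at `E₁`. The defect is
  -- thus a conditional variance.
  set r : ℝ → ℝ → ℝ := fun z n => fisherFn g E₁ (p₁ z n) + (-2 * lam z * heatDeriv g E₁ (p₁ z n) +
    lam z ^ 2 * heat g E₁ (p₁ z n)) with hr
  have hr' : ∀ z n, r z n * heat g E₁ (p₁ z n) =
      (heatDeriv g E₁ (p₁ z n) - lam z * heat g E₁ (p₁ z n)) ^ 2 ∧ 0 ≤ r z n := by
    intro z n
    rcases (heat_nonneg h0 E₁ (p₁ z n)).eq_or_lt with h | h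
    · have := hg.heatDeriv_eq_zero h0 hE1 h.symm
      simp [hr, fisherFn, ← h, this]
    · have e : r z n * heat g E₁ (p₁ z n) =
          (heatDeriv g E₁ (p₁ z n) - lam z * heat g E₁ (p₁ z n)) ^ 2 := by
        simp only [hr, fisherFn]; field_simp; ring
      refine ⟨e, ?_⟩
      by_contra hlt
      push Not at hlt
      nlinarith [sq_nonneg (heatDeriv g E₁ (p₁ z n) - lam z * heat g E₁ (p₁ z n))]
  have hir : ∀ᵐ z ∂stdGaussian, Integrable (r z) stdGaussian ∧ ∫ n, r z n ∂stdGaussian =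
      ∫ n, fisherFn g E₁ (p₁ z n) ∂stdGaussian - fisherFn g E₂ (Real.sqrt (1 - E₂) * z) := by
    filter_upwards [hi.prod_right_ae] with z hz
    have ha := (hg.integrable_heatDeriv h1 h2 h3 (Real.sqrt (1 - E₂) * z)).const_mul (-2 * lam z)
    have hb := (hg.integrable_heat h1 h2 h3 (Real.sqrt (1 - E₂) * z)).const_mul (lam z ^ 2)
    have hab : Integrable (fun n => -2 * lam z * heatDeriv g E₁ (p₁ z n) +
      lam z ^ 2 * heat g E₁ (p₁ z n)) stdGaussian := ha.add hb
    refine ⟨hz.add hab, ?_⟩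
    simp only [hr]
    rw [integral_add hz hab, integral_add ha hb, integral_const_mul, integral_const_mul,
      hg.heatDeriv_heatDeriv h1 h2 h3, hg.heat_heat h1 h2 h3]
    by_cases h : heat g E₂ (Real.sqrt (1 - E₂) * z) = 0
    · simp [hlam, fisherFn, hp₁, h]
    · simp only [hlam, fisherFn]; field_simp; ring
  refine ⟨fun z => ∫ n, fisherFn g E₁ (p₁ z n) ∂stdGaussian -
    fisherFn g E₂ (Real.sqrt (1 - E₂) * z), hi.integral_prod_left.sub
      (hg.integrable_fisherFn h0 hE2), ?_, ?_, ?_⟩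
  · filter_upwards [hir] with z hz
    rw [← hz.2]
    exact integral_nonneg fun n => (hr' z n).2
  · rw [integral_sub hi.integral_prod_left (hg.integrable_fisherFn h0 hE2)]
    rw [meanFisher, ← he, integral_prod _ hi, meanFisher]
  · filter_upwards [hir] with z hz hD
    rw [← hz.2, integral_eq_zero_iff_of_nonneg (fun n => (hr' z n).2) hz.1] at hD
    filter_upwards [hD] with n hn
    have := (hr' z n).1
    rw [hn, Pi.zero_apply, zero_mul] at this
    have := pow_eq_zero_iff two_ne_zero |>.1 this.symm
    linarith

lemma Tame.meanFisher_antitone (hg : Tame g) (h0 : ∀ u, 0 ≤ g u) {E₁ E₂ : ℝ} (h1 : 0 < E₁)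
    (h2 : E₁ ≤ E₂) (h3 : E₂ ≤ 1) : meanFisher g E₂ ≤ meanFisher g E₁ := by
  obtain ⟨D, _, hD, he, _⟩ := hg.meanFisher_sub h0 h1 h2 h3
  have := integral_nonneg_of_ae hD
  linarith

/-- If the Fisher information does not decrease, the function is an exponential. -/
lemma Tame.exists_heatDeriv_eq (hg : Tame g) (h0 : ∀ u, 0 ≤ g u) {E₁ E₂ : ℝ} (h1 : 0 < E₁)
    (h2 : E₁ < E₂) (h3 : E₂ ≤ 1) (heq : meanFisher g E₁ ≤ meanFisher g E₂) :
    ∃ c : ℝ, ∀ p, heatDeriv g E₁ p = c * heat g E₁ p := by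
  have hE1 : E₁ ∈ Ioc (0 : ℝ) 1 := ⟨h1, h2.le.trans h3⟩
  obtain ⟨D, hDi, hD, he, hD'⟩ := hg.meanFisher_sub h0 h1 h2.le h3
  have hz : ∫ z, D z ∂stdGaussian = 0 :=
    le_antisymm (by linarith) (integral_nonneg_of_ae hD)
  rw [integral_eq_zero_iff_of_nonneg_ae hD hDi] at hz
  obtain ⟨z, hz1, hz2⟩ := (hz.and hD').exists
  have hae := hz2 hz1
  refine ⟨heatDeriv g E₂ (Real.sqrt (1 - E₂) * z) / heat g E₂ (Real.sqrt (1 - E₂) * z), ?_⟩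
  -- The proportionality holds for almost every `n` only. Both sides are continuous and `n ↦ p` is
  -- an affine bijection, so it holds for every `p`.
  have hcont : Continuous fun p => heatDeriv g E₁ p -
      heatDeriv g E₂ (Real.sqrt (1 - E₂) * z) / heat g E₂ (Real.sqrt (1 - E₂) * z) *
        heat g E₁ p := by
    refine Continuous.sub ?_ (continuous_const.mul ?_)
    · exact continuous_iff_continuousAt.2 fun p => (hg.hasDerivAt_heatDeriv hE1 p).continuousAt
    · exact continuous_iff_continuousAt.2 fun p => (hg.hasDerivAt_heat hE1 p).continuousAt
  have hs : Real.sqrt (E₂ - E₁) ≠ 0 := (Real.sqrt_pos.2 (by linarith)).ne'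
  have hvol : ∀ᵐ n : ℝ, (fun n => heatDeriv g E₁ (Real.sqrt (1 - E₂) * z + Real.sqrt (E₂ - E₁) * n) -
      heatDeriv g E₂ (Real.sqrt (1 - E₂) * z) / heat g E₂ (Real.sqrt (1 - E₂) * z) *
        heat g E₁ (Real.sqrt (1 - E₂) * z + Real.sqrt (E₂ - E₁) * n)) n = (fun _ => (0 : ℝ)) n := by
    have hac : (volume : Measure ℝ) ≪ stdGaussian := by
      rw [stdGaussian]; exact gaussianReal_absolutelyContinuous' 0 one_ne_zero
    filter_upwards [hac.ae_le hae] with n hn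
    simp only [hn, sub_self]
  have hall := (Continuous.ae_eq_iff_eq volume
    (hcont.comp (by fun_prop : Continuous fun n : ℝ => Real.sqrt (1 - E₂) * z +
      Real.sqrt (E₂ - E₁) * n)) continuous_const).1 hvol
  intro p
  have := congrFun hall ((p - Real.sqrt (1 - E₂) * z) / Real.sqrt (E₂ - E₁))
  simp only [Function.comp] at this
  rw [mul_div_cancel₀ _ hs] at this
  rw [show Real.sqrt (1 - E₂) * z + (p - Real.sqrt (1 - E₂) * z) = p by ring] at this
  linarith

end Nonneg

/-! ### De Bruijn's identity in integrated form, for bounded functions -/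

lemma abs_integral_pow_mul_le {f : ℝ → ℝ} {C : ℝ} (hC : ∀ x, |f x| ≤ C) (k : ℕ) :
    |∫ n, n ^ k * f n ∂stdGaussian| ≤ C * ∫ n, Real.exp (k * |n|) ∂stdGaussian := by
  rw [← integral_const_mul, ← Real.norm_eq_abs]
  refine norm_integral_le_of_norm_le ((integrable_exp_abs k).const_mul C) (ae_of_all _ fun n => ?_)
  rw [norm_mul, norm_pow, Real.norm_eq_abs, Real.norm_eq_abs, mul_comm]
  exact mul_le_mul (hC n) (pow_mul_exp_le k n) (by positivity) ((abs_nonneg _).trans (hC n))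

/-- Run the Ornstein–Uhlenbeck semigroup from the already smooth function `heat g E₁`. In the
variable `τ` the derivative of the entropy is `(1 - E₁) τ` times the Fisher information, and
monotonicity of the latter allows a comparison with two quadratic functions of `τ`. -/
lemma meanEntropy_sub_bounds_of_bounded {g : ℝ → ℝ} (hm : Measurable g) {ε N : ℝ} (hε : 0 < ε)
    (hεg : ∀ u, ε ≤ g u) (hN : ∀ u, g u ≤ N) {E₁ E₂ : ℝ} (h1 : 0 < E₁) (h2 : E₁ ≤ E₂)
    (h3 : E₂ ≤ 1) :
    (E₂ - E₁) / 2 * meanFisher g E₂ ≤ meanEntropy g E₁ - meanEntropy g E₂ ∧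
      meanEntropy g E₁ - meanEntropy g E₂ ≤ (E₂ - E₁) / 2 * meanFisher g E₁ := by
  have h0 : ∀ u, 0 ≤ g u := fun u => hε.le.trans (hεg u)
  have hNg : ∀ u, |g u| ≤ N := fun u => by rw [abs_of_nonneg (h0 u)]; exact hN u
  have hg : Tame g := Tame.of_bounded hm hNg
  have hE1 : E₁ ∈ Ioc (0 : ℝ) 1 := ⟨h1, h2.trans h3⟩
  rcases (h2.trans h3).eq_or_lt with h4 | h4
  · obtain rfl : E₂ = E₁ := le_antisymm (h4 ▸ h3) h2
    simp
  set c := Real.sqrt (1 - E₁) with hc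
  have hcp : 0 < 1 - E₁ := by linarith
  have hc2 : c ^ 2 = 1 - E₁ := Real.sq_sqrt hcp.le
  have hc0 : 0 < c := Real.sqrt_pos.2 hcp
  set G : ℝ → ℝ := fun w => heat g E₁ (c * w) with hG
  set G' : ℝ → ℝ := fun w => c * heatDeriv g E₁ (c * w) with hG'
  set G'' : ℝ → ℝ := fun w => c ^ 2 * heatDeriv₂ g E₁ (c * w) with hG''
  have hlin : ∀ w : ℝ, HasDerivAt (fun w => c * w) c w := fun w => by
    simpa using (hasDerivAt_id w).const_mul c
  have hd : ∀ w, HasDerivAt G (G' w) w := fun w =>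
    ((hg.hasDerivAt_heat hE1 _).comp w (hlin w)).congr_deriv (by simp only [hG']; ring)
  have hd' : ∀ w, HasDerivAt G' (G'' w) w := fun w =>
    (((hg.hasDerivAt_heatDeriv hE1 _).comp w (hlin w)).const_mul c).congr_deriv
      (by simp only [hG'']; ring)
  have hmG'' : Measurable G'' := by
    have : Measurable fun p : ℝ × ℝ => p.2 ^ 2 * g (p.1 + Real.sqrt E₁ * p.2) :=
      (measurable_snd.pow_const 2).mul (hm.comp (by fun_prop))
    have h5 : Measurable (heatDeriv₂ g E₁) :=
      (this.stronglyMeasurable.integral_prod_right.measurable.sub (measurable_heat hm E₁)).const_mul _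
    exact (h5.comp (by fun_prop)).const_mul _
  have hbG : ∀ w, |G w| ≤ N := fun w => abs_integral_le_of_bounded fun n => hNg _
  obtain ⟨C, hC0, hC1, hC2⟩ : ∃ C, N ≤ C ∧ (∀ w, |G' w| ≤ C) ∧ ∀ w, |G'' w| ≤ C := by
    set M₁ := c * ((Real.sqrt E₁)⁻¹ * (N * ∫ n, Real.exp ((1 : ℕ) * |n|) ∂stdGaussian)) with hM₁
    set M₂ := c ^ 2 * (E₁⁻¹ * (N * ∫ n, Real.exp ((2 : ℕ) * |n|) ∂stdGaussian + N)) with hM₂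
    refine ⟨max N (max M₁ M₂), le_max_left _ _, fun w => ?_, fun w => ?_⟩
    · refine le_trans ?_ ((le_max_left _ _).trans (le_max_right _ _))
      rw [hG', abs_mul, abs_of_pos hc0, heatDeriv, abs_mul,
        abs_of_pos (inv_pos.2 (Real.sqrt_pos.2 h1))]
      have := abs_integral_pow_mul_le (f := fun n => g (c * w + Real.sqrt E₁ * n))
        (fun n => hNg _) 1
      simp only [pow_one] at this
      exact mul_le_mul_of_nonneg_left (mul_le_mul_of_nonneg_left this (by positivity)) hc0.le
    · refine le_trans ?_ ((le_max_right _ _).trans (le_max_right _ _))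
      rw [hG'', abs_mul, abs_of_pos (by positivity : 0 < c ^ 2), heatDeriv₂, abs_mul,
        abs_of_pos (inv_pos.2 h1)]
      have h6 := abs_integral_pow_mul_le (f := fun n => g (c * w + Real.sqrt E₁ * n))
        (fun n => hNg _) 2
      have h7 := hbG w
      have h8 := abs_sub (∫ n, n ^ 2 * g (c * w + Real.sqrt E₁ * n) ∂stdGaussian)
        (heat g E₁ (c * w))
      have h9 : |∫ n, n ^ 2 * g (c * w + Real.sqrt E₁ * n) ∂stdGaussian - heat g E₁ (c * w)| ≤
        N * ∫ n, Real.exp ((2 : ℕ) * |n|) ∂stdGaussian + N := h8.trans (add_le_add h6 h7)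
      exact mul_le_mul_of_nonneg_left (mul_le_mul_of_nonneg_left h9 (by positivity)) (by positivity)
  have hεG : ∀ w, ε ≤ G w := fun w => le_integral_of_le (hg.integrable_comp _ hE1) fun _ => hεg _
  -- the parametrization `E(τ) = 1 - (1 - E₁) τ²`
  set Eτ : ℝ → ℝ := fun τ => 1 - (1 - E₁) * τ ^ 2 with hEτ
  have hs1 : ∀ τ, 0 ≤ τ → Real.sqrt (1 - Eτ τ) = c * τ := by
    intro τ hτ
    have : 1 - Eτ τ = (c * τ) ^ 2 := by simp only [hEτ]; rw [mul_pow, hc2]; ring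
    rw [this, Real.sqrt_sq (by positivity)]
  have hs2 : ∀ τ, Real.sqrt (Eτ τ - E₁) = c * Real.sqrt (1 - τ ^ 2) := by
    intro τ
    have : Eτ τ - E₁ = (1 - E₁) * (1 - τ ^ 2) := by simp only [hEτ]; ring
    rw [this, Real.sqrt_mul hcp.le]
  have hrange : ∀ τ, 0 ≤ τ → τ ≤ 1 → E₁ ≤ Eτ τ ∧ Eτ τ ≤ 1 := by
    intro τ hτ hτ1
    have : τ ^ 2 ≤ 1 := pow_le_one₀ hτ hτ1
    simp only [hEτ]
    constructor <;> nlinarith [sq_nonneg τ]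
  have hmeh : ∀ τ, 0 ≤ τ → τ ≤ 1 → ∀ z,
      mehler G τ z = heat g (Eτ τ) (Real.sqrt (1 - Eτ τ) * z) := by
    intro τ hτ hτ1 z
    obtain ⟨h5, h6⟩ := hrange τ hτ hτ1
    rw [← hg.heat_heat h1 h5 h6, mehler, hs1 τ hτ, hs2]
    simp only [hG]
    congr 1; ext n; congr 1; ring
  have hmeh' : ∀ τ, 0 ≤ τ → τ ≤ 1 → ∀ z,
      mehler G' τ z = c * heatDeriv g (Eτ τ) (Real.sqrt (1 - Eτ τ) * z) := by
    intro τ hτ hτ1 z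
    obtain ⟨h5, h6⟩ := hrange τ hτ hτ1
    rw [← hg.heatDeriv_heatDeriv h1 h5 h6, mehler, hs1 τ hτ, hs2, ← integral_const_mul]
    simp only [hG']
    congr 1; ext n; congr 2; ring
  set D : ℝ → ℝ := fun τ => ∫ z, xlogx (mehler G τ z) ∂stdGaussian with hD
  have hDE : ∀ τ, 0 ≤ τ → τ ≤ 1 → D τ = meanEntropy g (Eτ τ) := by
    intro τ hτ hτ1
    simp only [hD, meanEntropy]
    simp_rw [hmeh τ hτ hτ1]
  have hDd : ∀ τ, 0 < τ → τ < 1 → HasDerivAt D (τ * ((1 - E₁) * meanFisher g (Eτ τ))) τ := by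
    intro τ hτ hτ1
    refine (hasDerivAt_entropy_mehler hd hd' hmG'' (fun x => (hbG x).trans hC0) hC1 hC2 hε hεG hτ
      hτ1).congr_deriv ?_
    congr 1
    rw [meanFisher, ← integral_const_mul]
    refine integral_congr_ae (ae_of_all _ fun z => ?_)
    simp only
    rw [hmeh τ hτ.le hτ1.le, hmeh' τ hτ.le hτ1.le, fisherFn, mul_pow, hc2]
    ring
  have hGc : Continuous G := continuous_iff_continuousAt.2 fun w => (hd w).continuousAt
  have hDc : Continuous D := continuousOn_entropy_mehler hGc hbG
  set τ₀ := Real.sqrt ((1 - E₂) / (1 - E₁)) with hτ₀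
  have hτ₀0 : 0 ≤ τ₀ := Real.sqrt_nonneg _
  have hτ₀2 : τ₀ ^ 2 = (1 - E₂) / (1 - E₁) := Real.sq_sqrt (div_nonneg (by linarith) hcp.le)
  have hτ₀1 : τ₀ ≤ 1 := Real.sqrt_le_one.2 (by rw [div_le_one hcp]; linarith)
  have hE2 : Eτ τ₀ = E₂ := by simp only [hEτ, hτ₀2]; field_simp; ring
  have hE1' : Eτ 1 = E₁ := by simp [hEτ]
  have hlo : D τ₀ = meanEntropy g E₂ := by rw [hDE _ hτ₀0 hτ₀1, hE2]
  have hhi : D 1 = meanEntropy g E₁ := by rw [hDE _ zero_le_one le_rfl, hE1']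
  have hq : ∀ a : ℝ, ∀ τ, HasDerivAt (fun τ : ℝ => (1 - E₁) / 2 * a * τ ^ 2)
      (τ * ((1 - E₁) * a)) τ := fun a τ =>
    ((hasDerivAt_pow 2 τ).const_mul ((1 - E₁) / 2 * a)).congr_deriv (by simp; ring)
  have hsq : (1 - E₁) * (1 - τ₀ ^ 2) = E₂ - E₁ := by rw [hτ₀2]; field_simp; ring
  constructor
  · have hmono : MonotoneOn (fun τ => D τ - (1 - E₁) / 2 * meanFisher g E₂ * τ ^ 2) (Icc τ₀ 1) := by
      refine monotoneOn_of_deriv_nonneg (convex_Icc _ _) (by fun_prop) ?_ ?_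
      · intro τ hτ
        rw [interior_Icc] at hτ
        exact ((hDd τ (hτ₀0.trans_lt hτ.1) hτ.2).sub
          (hq _ τ)).differentiableAt.differentiableWithinAt
      · intro τ hτ
        rw [interior_Icc] at hτ
        have hτp := hτ₀0.trans_lt hτ.1
        have hder : HasDerivAt (fun τ => D τ - (1 - E₁) / 2 * meanFisher g E₂ * τ ^ 2) _ τ :=
          (hDd τ hτp hτ.2).sub (hq _ τ)
        rw [hder.deriv]
        have h5 : Eτ τ ≤ E₂ := by
          rw [← hE2]
          have : τ₀ ^ 2 ≤ τ ^ 2 := pow_le_pow_left₀ hτ₀0 hτ.1.le 2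
          simp only [hEτ]; nlinarith
        have h6 := hg.meanFisher_antitone h0 (h1.trans_le (hrange τ hτp.le hτ.2.le).1) h5 h3
        rw [← mul_sub, ← mul_sub]
        exact mul_nonneg hτp.le (mul_nonneg hcp.le (by linarith))
    have := hmono ⟨le_rfl, hτ₀1⟩ ⟨hτ₀1, le_rfl⟩ hτ₀1
    simp only [hlo, hhi] at this
    linear_combination this - meanFisher g E₂ / 2 * hsq
  · have hanti : AntitoneOn (fun τ => D τ - (1 - E₁) / 2 * meanFisher g E₁ * τ ^ 2)
        (Icc τ₀ 1) := by
      refine antitoneOn_of_deriv_nonpos (convex_Icc _ _) (by fun_prop) ?_ ?_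
      · intro τ hτ
        rw [interior_Icc] at hτ
        exact ((hDd τ (hτ₀0.trans_lt hτ.1) hτ.2).sub
          (hq _ τ)).differentiableAt.differentiableWithinAt
      · intro τ hτ
        rw [interior_Icc] at hτ
        have hτp := hτ₀0.trans_lt hτ.1
        have hder : HasDerivAt (fun τ => D τ - (1 - E₁) / 2 * meanFisher g E₁ * τ ^ 2) _ τ :=
          (hDd τ hτp hτ.2).sub (hq _ τ)
        rw [hder.deriv]
        obtain ⟨h5, h6⟩ := hrange τ hτp.le hτ.2.le
        have h7 := hg.meanFisher_antitone h0 h1 h5 h6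
        rw [← mul_sub, ← mul_sub]
        exact mul_nonpos_of_nonneg_of_nonpos hτp.le
          (mul_nonpos_of_nonneg_of_nonpos hcp.le (by linarith))
    have := hanti ⟨le_rfl, hτ₀1⟩ ⟨hτ₀1, le_rfl⟩ hτ₀1
    simp only [hlo, hhi] at this
    linear_combination this + meanFisher g E₁ / 2 * hsq

end SparseSuperposition

namespace SparseSuperposition

/-! ### Removing the boundedness assumption -/

lemma integrable_comp_rotation {f : ℝ → ℝ} (hf : Integrable f stdGaussian) {E : ℝ}
    (hE : E ∈ Icc (0 : ℝ) 1) :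
    Integrable (fun x : ℝ × ℝ => f (Real.sqrt (1 - E) * x.1 + Real.sqrt E * x.2))
      (stdGaussian.prod stdGaussian) ∧
    ∫ x : ℝ × ℝ, f (Real.sqrt (1 - E) * x.1 + Real.sqrt E * x.2)
      ∂(stdGaussian.prod stdGaussian) = ∫ x, f x ∂stdGaussian := by
  have hcs : Real.sqrt (1 - E) ^ 2 + Real.sqrt E ^ 2 = 1 := by
    rw [Real.sq_sqrt (by linarith [hE.2]), Real.sq_sqrt hE.1]; ring
  have hp := measurePreserving_linComb (Real.sqrt_nonneg _) (Real.sqrt_nonneg _) hcs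
  refine ⟨hp.integrable_comp_of_integrable hf, ?_⟩
  conv_rhs => rw [← hp.map_eq]
  rw [integral_map hp.aemeasurable (by rw [hp.map_eq]; exact hf.1)]

lemma integral_heat {f : ℝ → ℝ} (hf : Integrable f stdGaussian) {E : ℝ} (hE : E ∈ Icc (0 : ℝ) 1) :
    ∫ z, heat f E (Real.sqrt (1 - E) * z) ∂stdGaussian = ∫ x, f x ∂stdGaussian := by
  obtain ⟨h1, h2⟩ := integrable_comp_rotation hf hE
  rw [← h2, integral_prod _ h1]
  rfl

lemma integrable_heat_sqrt {f : ℝ → ℝ} (hf : Integrable f stdGaussian) {E : ℝ}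
    (hE : E ∈ Icc (0 : ℝ) 1) :
    Integrable (fun z => heat f E (Real.sqrt (1 - E) * z)) stdGaussian :=
  (integrable_comp_rotation hf hE).1.integral_prod_left

/-- Jensen conditionally on `z`; the exceptional null set comes from Fubini, as only integrability
for the full Gaussian law is assumed. -/
lemma comp_heat_le {φ g : ℝ → ℝ} (hφ : ConvexOn ℝ (Ici 0) φ) (hc : Continuous φ)
    (h0 : ∀ u, 0 ≤ g u) (hgi : Integrable g stdGaussian)
    (hi : Integrable (fun x => φ (g x)) stdGaussian) {E : ℝ} (hE : E ∈ Icc (0 : ℝ) 1) :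
    ∀ᵐ z ∂stdGaussian, φ (heat g E (Real.sqrt (1 - E) * z)) ≤
      heat (fun x => φ (g x)) E (Real.sqrt (1 - E) * z) := by
  filter_upwards [(integrable_comp_rotation hgi hE).1.prod_right_ae,
    (integrable_comp_rotation hi hE).1.prod_right_ae] with z h1 h2
  exact hφ.map_integral_le hc.continuousOn isClosed_Ici (ae_of_all _ fun n => h0 _) h1 h2

lemma convexOn_xlogx : ConvexOn ℝ (Ici 0) xlogx := Real.convexOn_mul_log

lemma neg_one_le_xlogx (x : ℝ) (hx : 0 ≤ x) : -1 ≤ xlogx x := by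
  rcases hx.eq_or_lt with h | h
  · simp [xlogx, ← h]
  · have h1 := Real.one_sub_inv_le_log_of_pos h
    have h2 : x * (1 - x⁻¹) ≤ x * Real.log x := mul_le_mul_of_nonneg_left h1 hx
    rw [mul_sub, mul_inv_cancel₀ h.ne'] at h2
    rw [xlogx]; linarith

/-- `(x + 1) ln (x + 1)`, a monotone majorant. -/
lemma abs_xlogx_le {x h : ℝ} (hx : 0 ≤ x) (hxh : x ≤ h + 1) : |xlogx x| ≤ 1 + xlogx (h + 1) + 1 := by
  have hh : 0 ≤ h + 1 := hx.trans hxh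
  have h1 := neg_one_le_xlogx _ hh
  rw [abs_le]
  refine ⟨by linarith [neg_one_le_xlogx x hx], ?_⟩
  rcases le_total x 1 with h2 | h2
  · have : xlogx x ≤ 0 := mul_nonpos_of_nonneg_of_nonpos hx (Real.log_nonpos hx h2)
    linarith
  · have : xlogx x ≤ xlogx (h + 1) :=
      mul_le_mul hxh (Real.log_le_log (by linarith) hxh) (Real.log_nonneg h2) hh
    linarith

lemma xlogx_add_one_le {x : ℝ} (hx : 0 ≤ x) : xlogx (x + 1) ≤ xlogx x + 1 + x := by
  rcases hx.eq_or_lt with h | h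
  · simp [xlogx, ← h]
  · have h1 : Real.log (x + 1) ≤ Real.log x + x⁻¹ := by
      have : Real.log (x + 1) = Real.log x + Real.log (1 + x⁻¹) := by
        rw [← Real.log_mul h.ne' (by positivity)]; congr 1; field_simp
      rw [this]
      linarith [Real.log_le_sub_one_of_pos (by positivity : 0 < 1 + x⁻¹)]
    have h2 : x * Real.log (x + 1) ≤ x * (Real.log x + x⁻¹) := mul_le_mul_of_nonneg_left h1 hx
    rw [mul_add, mul_inv_cancel₀ h.ne'] at h2
    have h3 := Real.log_le_sub_one_of_pos (by positivity : 0 < x + 1)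
    simp only [xlogx]
    nlinarith

lemma continuous_xlogx_add_one : Continuous fun x : ℝ => xlogx (x + 1) :=
  continuous_xlogx.comp (by fun_prop)

lemma convexOn_xlogx_add_one : ConvexOn ℝ (Ici 0) fun x : ℝ => xlogx (x + 1) := by
  have := convexOn_xlogx.translate_left 1
  refine this.subset (fun x hx => ?_) (convex_Ici 0)
  simp only [mem_preimage, mem_Ici] at *
  linarith

lemma Tame.add {f g : ℝ → ℝ} (hf : Tame f) (hg : Tame g) : Tame fun u => f u + g u :=
  ⟨hf.measurable.add hg.measurable, fun p E hE A => by
    simp_rw [add_mul]; exact (hf.integrable p E hE A).add (hg.integrable p E hE A)⟩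

lemma Tame.integrable_self {g : ℝ → ℝ} (hg : Tame g) : Integrable g stdGaussian := by
  simpa using hg.integrable_comp 0 ⟨one_pos, le_rfl⟩

lemma integrable_xlogx_add_one {g : ℝ → ℝ} (hgi : Integrable g stdGaussian) (h0 : ∀ u, 0 ≤ g u)
    (hx : Integrable (fun u => xlogx (g u)) stdGaussian) :
    Integrable (fun u => xlogx (g u + 1)) stdGaussian := by
  refine ((hx.add (integrable_const (1 : ℝ))).add hgi).mono
    (continuous_xlogx_add_one.comp_aestronglyMeasurable hgi.1) (ae_of_all _ fun u => ?_)
  have h1 : 0 ≤ xlogx (g u + 1) :=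
    mul_nonneg (by linarith [h0 u]) (Real.log_nonneg (by linarith [h0 u]))
  rw [Real.norm_of_nonneg h1]
  exact (xlogx_add_one_le (h0 u)).trans (le_abs_self _)

lemma integrable_xlogx_heat_add_one {g : ℝ → ℝ} (hm : Measurable g)
    (hgi : Integrable g stdGaussian) (h0 : ∀ u, 0 ≤ g u)
    (hx : Integrable (fun u => xlogx (g u)) stdGaussian) {E : ℝ} (hE : E ∈ Icc (0 : ℝ) 1) :
    Integrable (fun z => xlogx (heat g E (Real.sqrt (1 - E) * z) + 1)) stdGaussian := by
  have h1 := integrable_xlogx_add_one hgi h0 hx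
  refine (integrable_heat_sqrt h1 hE).mono ?_ ?_
  · exact (continuous_xlogx_add_one.measurable.comp
      ((measurable_heat hm E).comp (by fun_prop))).aestronglyMeasurable
  · filter_upwards [comp_heat_le convexOn_xlogx_add_one continuous_xlogx_add_one h0 hgi h1 hE] with z hz
    have h2 : 0 ≤ heat g E (Real.sqrt (1 - E) * z) := heat_nonneg h0 _ _
    have h3 : 0 ≤ xlogx (heat g E (Real.sqrt (1 - E) * z) + 1) :=
      mul_nonneg (by linarith) (Real.log_nonneg (by linarith))
    rw [Real.norm_of_nonneg h3]
    exact hz.trans (le_abs_self _)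

lemma integrable_xlogx_heat {g : ℝ → ℝ} (hm : Measurable g)
    (hgi : Integrable g stdGaussian) (h0 : ∀ u, 0 ≤ g u)
    (hx : Integrable (fun u => xlogx (g u)) stdGaussian) {E : ℝ} (hE : E ∈ Icc (0 : ℝ) 1) :
    Integrable (fun z => xlogx (heat g E (Real.sqrt (1 - E) * z))) stdGaussian := by
  refine (((integrable_const (1 : ℝ)).add (integrable_xlogx_heat_add_one hm hgi h0 hx hE)).add
    (integrable_const (1 : ℝ))).mono' ?_ (ae_of_all _ fun z => ?_)
  · exact (continuous_xlogx.measurable.comp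
      ((measurable_heat hm E).comp (by fun_prop))).aestronglyMeasurable
  · exact abs_xlogx_le (heat_nonneg h0 _ _) (by linarith)

lemma meanEntropy_zero (g : ℝ → ℝ) : meanEntropy g 0 = ∫ x, xlogx (g x) ∂stdGaussian := by
  simp [meanEntropy, heat]

lemma meanEntropy_one (g : ℝ → ℝ) : meanEntropy g 1 = xlogx (∫ x, g x ∂stdGaussian) := by
  simp [meanEntropy, heat]

lemma meanEntropy_le_zero {g : ℝ → ℝ} (hm : Measurable g)
    (hgi : Integrable g stdGaussian) (h0 : ∀ u, 0 ≤ g u)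
    (hx : Integrable (fun u => xlogx (g u)) stdGaussian) {E : ℝ} (hE : E ∈ Icc (0 : ℝ) 1) :
    meanEntropy g E ≤ meanEntropy g 0 := by
  rw [meanEntropy_zero, ← integral_heat hx hE]
  exact integral_mono_ae (integrable_xlogx_heat hm hgi h0 hx hE) (integrable_heat_sqrt hx hE)
    (comp_heat_le convexOn_xlogx continuous_xlogx h0 hgi hx hE)

lemma meanEntropy_one_le {g : ℝ → ℝ} (hm : Measurable g)
    (hgi : Integrable g stdGaussian) (h0 : ∀ u, 0 ≤ g u)
    (hx : Integrable (fun u => xlogx (g u)) stdGaussian) {E : ℝ} (hE : E ∈ Icc (0 : ℝ) 1) :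
    meanEntropy g 1 ≤ meanEntropy g E := by
  rw [meanEntropy_one, ← integral_heat hgi hE]
  exact convexOn_xlogx.map_integral_le continuous_xlogx.continuousOn isClosed_Ici
    (ae_of_all _ fun n => heat_nonneg h0 _ _) (integrable_heat_sqrt hgi hE)
    (integrable_xlogx_heat hm hgi h0 hx hE)

/-- A bounded approximation of `g`, bounded away from `0`. -/
noncomputable def trunc (g : ℝ → ℝ) (n : ℕ) (u : ℝ) : ℝ := min (g u) (n + 1) + 1 / ((n : ℝ) + 1)

lemma measurable_trunc {g : ℝ → ℝ} (hm : Measurable g) (n : ℕ) : Measurable (trunc g n) :=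
  (hm.min measurable_const).add measurable_const

lemma trunc_le (g : ℝ → ℝ) (n : ℕ) (u : ℝ) : trunc g n u ≤ g u + 1 := by
  have : 1 / ((n : ℝ) + 1) ≤ 1 := by
    rw [div_le_one (by positivity)]; linarith [(Nat.cast_nonneg n : (0 : ℝ) ≤ n)]
  exact add_le_add (min_le_left _ _) this

lemma trunc_le_const (g : ℝ → ℝ) (n : ℕ) (u : ℝ) : trunc g n u ≤ n + 1 + 1 / ((n : ℝ) + 1) :=
  add_le_add (min_le_right _ _) le_rfl

lemma le_trunc {g : ℝ → ℝ} (h0 : ∀ u, 0 ≤ g u) (n : ℕ) (u : ℝ) : 1 / ((n : ℝ) + 1) ≤ trunc g n u := by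
  have : 0 ≤ min (g u) ((n : ℝ) + 1) := le_min (h0 u) (by positivity)
  rw [trunc]; linarith

lemma trunc_nonneg {g : ℝ → ℝ} (h0 : ∀ u, 0 ≤ g u) (n : ℕ) (u : ℝ) : 0 ≤ trunc g n u :=
  le_trans (by positivity) (le_trunc h0 n u)

lemma tendsto_trunc (g : ℝ → ℝ) (u : ℝ) : Tendsto (fun n => trunc g n u) atTop (𝓝 (g u)) := by
  have h1 : Tendsto (fun n : ℕ => min (g u) ((n : ℝ) + 1)) atTop (𝓝 (g u)) := by
    refine tendsto_const_nhds.congr' ?_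
    obtain ⟨N, hN⟩ := exists_nat_ge (g u)
    filter_upwards [eventually_ge_atTop N] with n hn
    have : (N : ℝ) ≤ n := by exact_mod_cast hn
    rw [min_eq_left (by linarith)]
  simpa [trunc] using h1.add tendsto_one_div_add_atTop_nhds_zero_nat

section Limit

variable {g : ℝ → ℝ}

lemma Tame.tendsto_moment_trunc (hg : Tame g) (h0 : ∀ u, 0 ≤ g u) {E : ℝ}
    (hE : E ∈ Ioc (0 : ℝ) 1) (p : ℝ) (k : ℕ) :
    Tendsto (fun N => ∫ n, n ^ k * trunc g N (p + Real.sqrt E * n) ∂stdGaussian) atTop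
      (𝓝 (∫ n, n ^ k * g (p + Real.sqrt E * n) ∂stdGaussian)) := by
  have h1 : Tame fun u => g u + 1 :=
    hg.add (Tame.of_bounded (C := 1) measurable_const fun _ => by simp)
  refine tendsto_integral_of_dominated_convergence
    (fun n => ‖n ^ k * (g (p + Real.sqrt E * n) + 1)‖) (fun N => ?_)
    (h1.integrable_pow_mul' p hE k).norm (fun N => ae_of_all _ fun n => ?_)
    (ae_of_all _ fun n => (tendsto_trunc g _).const_mul _)
  · have : Measurable fun n => trunc g N (p + Real.sqrt E * n) :=
      (measurable_trunc hg.measurable N).comp (by fun_prop)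
    exact ((measurable_id.pow_const k).mul this).aestronglyMeasurable
  · rw [norm_mul, norm_mul, Real.norm_of_nonneg (trunc_nonneg h0 _ _), Real.norm_of_nonneg
      (by linarith [h0 (p + Real.sqrt E * n)] : 0 ≤ g (p + Real.sqrt E * n) + 1)]
    exact mul_le_mul_of_nonneg_left (trunc_le _ _ _) (norm_nonneg _)

lemma Tame.tendsto_heat_trunc (hg : Tame g) (h0 : ∀ u, 0 ≤ g u) {E : ℝ}
    (hE : E ∈ Ioc (0 : ℝ) 1) (p : ℝ) :
    Tendsto (fun N => heat (trunc g N) E p) atTop (𝓝 (heat g E p)) := by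
  simpa [heat] using hg.tendsto_moment_trunc h0 hE p 0

lemma tame_trunc (hm : Measurable g) (h0 : ∀ u, 0 ≤ g u) (N : ℕ) : Tame (trunc g N) :=
  Tame.of_bounded (measurable_trunc hm N) fun u => by
    rw [abs_of_nonneg (trunc_nonneg h0 N u)]; exact trunc_le_const g N u

/-- The quotient is not continuous where `heat g E p = 0`. There the bound `fisherFn_le` by the
second moment, which also tends to `0`, replaces continuity. -/
lemma Tame.tendsto_fisherFn_trunc (hg : Tame g) (h0 : ∀ u, 0 ≤ g u) {E : ℝ}
    (hE : E ∈ Ioc (0 : ℝ) 1) (p : ℝ) :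
    Tendsto (fun N => fisherFn (trunc g N) E p) atTop (𝓝 (fisherFn g E p)) := by
  have hd : Tendsto (fun N => heatDeriv (trunc g N) E p) atTop (𝓝 (heatDeriv g E p)) := by
    have := hg.tendsto_moment_trunc h0 hE p 1
    simp only [pow_one] at this
    exact this.const_mul _
  by_cases h : heat g E p = 0
  · have h1 : fisherFn g E p = 0 := by simp [fisherFn, h]
    rw [h1]
    have h2 := (hg.tendsto_moment_trunc h0 hE p 2).const_mul E⁻¹
    have h3 : ∫ n, n ^ 2 * g (p + Real.sqrt E * n) ∂stdGaussian = 0 := by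
      rw [heat, integral_eq_zero_iff_of_nonneg (fun n => h0 _) (hg.integrable_comp p hE)] at h
      refine integral_eq_zero_of_ae ?_
      filter_upwards [h] with n hn
      rw [hn]; simp
    rw [h3, mul_zero] at h2
    exact squeeze_zero (fun N => fisherFn_nonneg (trunc_nonneg h0 N) _ _)
      (fun N => (tame_trunc hg.measurable h0 N).fisherFn_le (trunc_nonneg h0 N) hE p) h2
  · exact (hd.pow 2).div (hg.tendsto_heat_trunc h0 hE p) h

lemma Tame.tendsto_meanFisher_trunc (hg : Tame g) (h0 : ∀ u, 0 ≤ g u) {E : ℝ}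
    (hE : E ∈ Ioc (0 : ℝ) 1) :
    Tendsto (fun N => meanFisher (trunc g N) E) atTop (𝓝 (meanFisher g E)) := by
  have h1 : Tame fun u => g u + 1 :=
    hg.add (Tame.of_bounded (C := 1) measurable_const fun _ => by simp)
  refine tendsto_integral_of_dominated_convergence _ (fun N => ?_)
    ((h1.integrable_sq_mul_comp hE).integral_prod_left.const_mul E⁻¹)
    (fun N => ae_of_all _ fun z => ?_) (ae_of_all _ fun z => hg.tendsto_fisherFn_trunc h0 hE _)
  · exact ((measurable_fisherFn (measurable_trunc hg.measurable N) E).comp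
      (by fun_prop)).aestronglyMeasurable
  · rw [Real.norm_of_nonneg (fisherFn_nonneg (trunc_nonneg h0 N) _ _)]
    have hT := tame_trunc hg.measurable h0 N
    refine (hT.fisherFn_le (trunc_nonneg h0 N) hE _).trans ?_
    refine mul_le_mul_of_nonneg_left ?_ (inv_nonneg.2 hE.1.le)
    exact integral_mono (hT.integrable_pow_mul' _ hE 2) (h1.integrable_pow_mul' (Real.sqrt (1 - E) * z) hE 2) fun n =>
      mul_le_mul_of_nonneg_left (trunc_le _ _ _) (sq_nonneg _)

lemma Tame.tendsto_meanEntropy_trunc (hg : Tame g) (h0 : ∀ u, 0 ≤ g u)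
    (hx : Integrable (fun u => xlogx (g u)) stdGaussian) {E : ℝ} (hE : E ∈ Ioc (0 : ℝ) 1) :
    Tendsto (fun N => meanEntropy (trunc g N) E) atTop (𝓝 (meanEntropy g E)) := by
  have hgi := hg.integrable_self
  refine tendsto_integral_of_dominated_convergence
    (fun z => 1 + xlogx (heat g E (Real.sqrt (1 - E) * z) + 1) + 1) (fun N => ?_)
    (((integrable_const (1 : ℝ)).add (integrable_xlogx_heat_add_one hg.measurable hgi h0 hx
      ⟨hE.1.le, hE.2⟩)).add (integrable_const (1 : ℝ)))
    (fun N => ae_of_all _ fun z => ?_)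
    (ae_of_all _ fun z => (continuous_xlogx.tendsto _).comp (hg.tendsto_heat_trunc h0 hE _))
  · exact (continuous_xlogx.measurable.comp ((measurable_heat
      (measurable_trunc hg.measurable N) E).comp (by fun_prop))).aestronglyMeasurable
  · refine abs_xlogx_le (heat_nonneg (trunc_nonneg h0 N) _ _) ?_
    have h1 : heat (trunc g N) E (Real.sqrt (1 - E) * z) ≤
        ∫ n, (g (Real.sqrt (1 - E) * z + Real.sqrt E * n) + 1) ∂stdGaussian :=
      integral_mono ((tame_trunc hg.measurable h0 N).integrable_comp _ hE)
        ((hg.integrable_comp _ hE).add (integrable_const (1 : ℝ))) fun n => trunc_le _ _ _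
    rw [integral_add (hg.integrable_comp _ hE) (integrable_const (1 : ℝ))] at h1
    simpa [heat] using h1

/-- De Bruijn's identity, as bounds for increments. -/
lemma Tame.meanEntropy_sub_bounds (hg : Tame g) (h0 : ∀ u, 0 ≤ g u)
    (hx : Integrable (fun u => xlogx (g u)) stdGaussian) {E₁ E₂ : ℝ} (h1 : 0 < E₁)
    (h2 : E₁ ≤ E₂) (h3 : E₂ ≤ 1) :
    (E₂ - E₁) / 2 * meanFisher g E₂ ≤ meanEntropy g E₁ - meanEntropy g E₂ ∧
      meanEntropy g E₁ - meanEntropy g E₂ ≤ (E₂ - E₁) / 2 * meanFisher g E₁ := by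
  have hE1 : E₁ ∈ Ioc (0 : ℝ) 1 := ⟨h1, h2.trans h3⟩
  have hE2 : E₂ ∈ Ioc (0 : ℝ) 1 := ⟨h1.trans_le h2, h3⟩
  have hb := fun N : ℕ => meanEntropy_sub_bounds_of_bounded (measurable_trunc hg.measurable N)
    (by positivity : 0 < 1 / ((N : ℝ) + 1)) (le_trunc h0 N) (trunc_le_const g N) h1 h2 h3
  have ht := (hg.tendsto_meanEntropy_trunc h0 hx hE1).sub (hg.tendsto_meanEntropy_trunc h0 hx hE2)
  exact ⟨le_of_tendsto_of_tendsto' ((hg.tendsto_meanFisher_trunc h0 hE2).const_mul _) ht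
    fun N => (hb N).1, le_of_tendsto_of_tendsto' ht
      ((hg.tendsto_meanFisher_trunc h0 hE1).const_mul _) fun N => (hb N).2⟩

end Limit

end SparseSuperposition

namespace SparseSuperposition

/-- Fatou's lemma for Bochner integrals. -/
lemma integral_le_of_tendsto_ae {α : Type*} [MeasurableSpace α] {μ : Measure α} {F : ℕ → α → ℝ}
    {f : α → ℝ} {m : ℕ → ℝ} {M : ℝ} (hF : ∀ n, Integrable (F n) μ)
    (h0 : ∀ n, ∀ᵐ x ∂μ, 0 ≤ F n x) (hlim : ∀ᵐ x ∂μ, Tendsto (fun n => F n x) atTop (𝓝 (f x)))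
    (hm : ∀ n, ∫ x, F n x ∂μ ≤ m n) (hM : Tendsto m atTop (𝓝 M)) : ∫ x, f x ∂μ ≤ M := by
  have hf0 : ∀ᵐ x ∂μ, 0 ≤ f x := by
    filter_upwards [hlim, ae_all_iff.2 h0] with x hx h0x
    exact ge_of_tendsto' hx h0x
  have hfm := aestronglyMeasurable_of_tendsto_ae atTop (fun n => (hF n).1) hlim
  have hm0 : ∀ n, 0 ≤ m n := fun n => (integral_nonneg_of_ae (h0 n)).trans (hm n)
  have hM0 : 0 ≤ M := ge_of_tendsto' hM hm0
  rw [integral_eq_lintegral_of_nonneg_ae hf0 hfm]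
  refine ENNReal.toReal_le_of_le_ofReal hM0 ?_
  calc ∫⁻ x, ENNReal.ofReal (f x) ∂μ
      ≤ ∫⁻ x, liminf (fun n => ENNReal.ofReal (F n x)) atTop ∂μ := by
        refine lintegral_mono_ae ?_
        filter_upwards [hlim] with x hx
        have h2 : Tendsto (fun n => ENNReal.ofReal (F n x)) atTop (𝓝 (ENNReal.ofReal (f x))) :=
          (ENNReal.continuous_ofReal.tendsto _).comp hx
        rw [h2.liminf_eq]
    _ ≤ liminf (fun n => ∫⁻ x, ENNReal.ofReal (F n x) ∂μ) atTop :=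
        lintegral_liminf_le' fun n => (hF n).1.aemeasurable.ennreal_ofReal
    _ ≤ liminf (fun n => ENNReal.ofReal (m n)) atTop := by
        refine liminf_le_liminf (Eventually.of_forall fun n => ?_)
        rw [← ofReal_integral_eq_lintegral_ofReal (hF n) (h0 n)]
        exact ENNReal.ofReal_le_ofReal (hm n)
    _ = ENNReal.ofReal M := ((ENNReal.continuous_ofReal.tendsto _).comp hM).liminf_eq

/-! ### Vanishing noise -/

section Zero

variable {g : ℝ → ℝ}

lemma tendsto_heat_of_bounded_continuous {b : ℝ → ℝ} (hb : Continuous b) {C : ℝ}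
    (hC : ∀ x, |b x| ≤ C) (z : ℝ) {e : ℕ → ℝ} (he : Tendsto e atTop (𝓝 0)) :
    Tendsto (fun k => heat b (e k) (Real.sqrt (1 - e k) * z)) atTop (𝓝 (b z)) := by
  have h1 : ∫ _ : ℝ, b z ∂stdGaussian = b z := by simp
  conv => rhs; rw [← h1]
  refine tendsto_integral_of_dominated_convergence (fun _ => C) (fun k => ?_) (integrable_const C)
    (fun k => ae_of_all _ fun n => hC _) (ae_of_all _ fun n => ?_)
  · exact (hb.comp (by fun_prop)).aestronglyMeasurable
  · refine (hb.tendsto z).comp ?_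
    have : Continuous fun x : ℝ => Real.sqrt (1 - x) * z + Real.sqrt x * n := by fun_prop
    simpa [Function.comp_def] using (this.tendsto 0).comp he

/-- Strong continuity in `L¹`: smoothing is a contraction, and the statement is clear for bounded
continuous functions, which are dense. -/
lemma tendsto_integral_abs_heat_sub (hg : Integrable g stdGaussian) {e : ℕ → ℝ}
    (he : Tendsto e atTop (𝓝 0)) (he' : ∀ k, e k ∈ Icc (0 : ℝ) 1) :
    Tendsto (fun k => ∫ z, |heat g (e k) (Real.sqrt (1 - e k) * z) - g z| ∂stdGaussian) atTop
      (𝓝 0) := by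
  rw [Metric.tendsto_atTop]
  intro ε hε
  obtain ⟨b, hb, hbi⟩ := hg.exists_boundedContinuous_integral_sub_le (ε := ε / 3) (by positivity)
  have hbC : ∀ x, |b x| ≤ ‖b‖ := fun x => b.norm_coe_le_norm x
  have ht : Tendsto (fun k => ∫ z, |heat b (e k) (Real.sqrt (1 - e k) * z) - b z| ∂stdGaussian)
      atTop (𝓝 0) := by
    have h1 : ∫ _ : ℝ, (0 : ℝ) ∂stdGaussian = 0 := by simp
    conv => rhs; rw [← h1]
    refine tendsto_integral_of_dominated_convergence (fun _ => ‖b‖ + ‖b‖) (fun k => ?_)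
      (integrable_const _) (fun k => ae_of_all _ fun z => ?_) (ae_of_all _ fun z => ?_)
    · have := (measurable_heat b.continuous.measurable (e k)).comp
        (by fun_prop : Measurable fun z : ℝ => Real.sqrt (1 - e k) * z)
      exact (this.sub b.continuous.measurable).abs.aestronglyMeasurable
    · rw [Real.norm_eq_abs, abs_abs]
      exact (abs_sub _ _).trans (add_le_add (abs_integral_le_of_bounded fun n => hbC _) (hbC z))
    · have h2 := (tendsto_heat_of_bounded_continuous b.continuous hbC z he).sub_const (b z)
      rw [sub_self] at h2
      simpa using h2.abs
  obtain ⟨N, hN⟩ := Metric.tendsto_atTop.1 ht (ε / 3) (by positivity)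
  refine ⟨N, fun k hk => ?_⟩
  have h1 := hN k hk
  rw [Real.dist_eq, sub_zero, abs_of_nonneg (integral_nonneg fun _ => abs_nonneg _)] at h1 ⊢
  have hgb : Integrable (fun x => |g x - b x|) stdGaussian := (hg.sub hbi).abs
  have hb' : ∫ x, |g x - b x| ∂stdGaussian ≤ ε / 3 := hb
  have i1 := integrable_heat_sqrt hgb (he' k)
  have i2 : Integrable (fun z => |heat b (e k) (Real.sqrt (1 - e k) * z) - b z|) stdGaussian :=
    ((integrable_heat_sqrt hbi (he' k)).sub hbi).abs
  have hle : ∀ᵐ z ∂stdGaussian, |heat g (e k) (Real.sqrt (1 - e k) * z) - g z| ≤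
      heat (fun x => |g x - b x|) (e k) (Real.sqrt (1 - e k) * z) +
        (|heat b (e k) (Real.sqrt (1 - e k) * z) - b z| + |g z - b z|) := by
    filter_upwards [(integrable_comp_rotation hg (he' k)).1.prod_right_ae,
      (integrable_comp_rotation hbi (he' k)).1.prod_right_ae] with z hz1 hz2
    have h3 : |heat g (e k) (Real.sqrt (1 - e k) * z) - heat b (e k) (Real.sqrt (1 - e k) * z)| ≤
        heat (fun x => |g x - b x|) (e k) (Real.sqrt (1 - e k) * z) := by
      rw [heat, heat, ← integral_sub hz1 hz2]
      exact abs_integral_le_integral_abs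
    have h4 := abs_sub_le (heat g (e k) (Real.sqrt (1 - e k) * z))
      (heat b (e k) (Real.sqrt (1 - e k) * z)) (g z)
    have h5 := abs_sub_le (heat b (e k) (Real.sqrt (1 - e k) * z)) (b z) (g z)
    rw [abs_sub_comm (b z)] at h5
    linarith
  have i3 : Integrable (fun z => |heat b (e k) (Real.sqrt (1 - e k) * z) - b z| + |g z - b z|)
    stdGaussian := i2.add hgb
  have h6 := integral_mono_ae ((integrable_heat_sqrt hg (he' k)).sub hg).abs (i1.add i3) hle
  have h7 : ∫ z, (heat (fun x => |g x - b x|) (e k) (Real.sqrt (1 - e k) * z) +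
        (|heat b (e k) (Real.sqrt (1 - e k) * z) - b z| + |g z - b z|)) ∂stdGaussian =
      ∫ x, |g x - b x| ∂stdGaussian + (∫ z, |heat b (e k) (Real.sqrt (1 - e k) * z) - b z| ∂stdGaussian
        + ∫ x, |g x - b x| ∂stdGaussian) := by
    rw [integral_add i1 i3, integral_add i2 hgb, integral_heat hgb (he' k)]
  have h8 := h6.trans_eq h7
  refine h8.trans_lt ?_
  linarith

/-- Semicontinuity of the entropy at vanishing noise. Convergence in `L¹` gives almost sure
convergence along a subsequence, and Fatou applies to `x ln x + 1 ≥ 0`. -/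
lemma meanEntropy_zero_le (hm : Measurable g) (hg : Integrable g stdGaussian)
    (h0 : ∀ u, 0 ≤ g u) (hx : Integrable (fun u => xlogx (g u)) stdGaussian) {M : ℝ}
    (hM : ∀ E ∈ Ioc (0 : ℝ) 1, meanEntropy g E ≤ M) : meanEntropy g 0 ≤ M := by
  set e : ℕ → ℝ := fun k => 1 / ((k : ℝ) + 1) with he
  have het : Tendsto e atTop (𝓝 0) := tendsto_one_div_add_atTop_nhds_zero_nat
  have he1 : ∀ k, e k ∈ Ioc (0 : ℝ) 1 := fun k => ⟨by positivity, by
    simp only [he]; rw [div_le_one (by positivity)]; linarith [(Nat.cast_nonneg k : (0 : ℝ) ≤ k)]⟩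
  have he2 : ∀ k, e k ∈ Icc (0 : ℝ) 1 := fun k => Ioc_subset_Icc_self (he1 k)
  have hL := tendsto_integral_abs_heat_sub hg het he2
  have hmeas : TendstoInMeasure stdGaussian
      (fun k z => heat g (e k) (Real.sqrt (1 - e k) * z)) atTop g := by
    refine tendstoInMeasure_of_tendsto_eLpNorm (p := 1) one_ne_zero
      (fun k => (integrable_heat_sqrt hg (he2 k)).1) hg.1 ?_
    have : ∀ k, eLpNorm ((fun z => heat g (e k) (Real.sqrt (1 - e k) * z)) - g) 1 stdGaussian =
        ENNReal.ofReal (∫ z, |heat g (e k) (Real.sqrt (1 - e k) * z) - g z| ∂stdGaussian) := by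
      intro k
      rw [eLpNorm_one_eq_lintegral_enorm, ← ofReal_integral_norm_eq_lintegral_enorm
        ((integrable_heat_sqrt hg (he2 k)).sub hg)]
      rfl
    simp_rw [this]
    simpa [Function.comp_def] using (ENNReal.continuous_ofReal.tendsto _).comp hL
  obtain ⟨ns, -, hae⟩ := hmeas.exists_seq_tendsto_ae
  have hcx := fun k => integrable_xlogx_heat hm hg h0 hx (he2 k)
  have h1 := integral_le_of_tendsto_ae (μ := stdGaussian)
    (F := fun k z => xlogx (heat g (e (ns k)) (Real.sqrt (1 - e (ns k)) * z)) + 1)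
    (f := fun z => xlogx (g z) + 1) (m := fun _ => M + 1) (M := M + 1)
    (fun k => (hcx (ns k)).add (integrable_const 1))
    (fun k => ae_of_all _ fun z => by
      have := neg_one_le_xlogx _ (heat_nonneg h0 (e (ns k)) (Real.sqrt (1 - e (ns k)) * z))
      linarith)
    (by
      filter_upwards [hae] with z hz
      exact ((continuous_xlogx.tendsto _).comp hz).add_const 1)
    (fun k => by
      rw [integral_add (hcx (ns k)) (integrable_const 1)]
      have := hM _ (he1 (ns k))
      rw [meanEntropy] at this
      simpa using this) tendsto_const_nhds
  rw [integral_add hx (integrable_const 1)] at h1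
  rw [meanEntropy_zero]
  simpa using h1

end Zero

/-! ### Continuity at noise level one -/

section One

variable {g : ℝ → ℝ}

/-- Writing `𝒩(p, E)` as a density with respect to the standard Gaussian removes the parameters from
the argument of `F`. For a merely measurable function this is what makes dominated convergence in
`p` and `E` possible. -/
lemma integral_gaussian_tilt (F : ℝ → ℝ) {E : ℝ} (hE : 0 < E) (hF : Measurable F) (p : ℝ) :
    ∫ n, F (p + Real.sqrt E * n) ∂stdGaussian =
      ∫ u, (Real.sqrt E)⁻¹ * Real.exp (u ^ 2 / 2 - (u - p) ^ 2 / (2 * E)) * F u ∂stdGaussian := by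
  have h1 : ∫ n, F (p + Real.sqrt E * n) ∂stdGaussian = ∫ u, F u ∂gaussianReal p E.toNNReal := by
    rw [gaussianReal_eq_map, integral_map (by fun_prop) hF.aestronglyMeasurable]
  rw [h1, integral_gaussianReal_eq_integral_smul (by simpa using hE), stdGaussian,
    integral_gaussianReal_eq_integral_smul one_ne_zero]
  congr 1; ext u
  simp only [smul_eq_mul, gaussianPDFReal, Real.coe_toNNReal _ hE.le, NNReal.coe_one]
  rw [Real.sqrt_mul (by positivity : (0 : ℝ) ≤ 2 * Real.pi) E, mul_inv, mul_one]
  have : Real.exp (-(u - p) ^ 2 / (2 * E)) =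
      Real.exp (-(u - 0) ^ 2 / (2 * 1)) * Real.exp (u ^ 2 / 2 - (u - p) ^ 2 / (2 * E)) := by
    rw [← Real.exp_add]; congr 1; ring
  rw [this, mul_one]; ring

lemma Tame.tendsto_moment_one (hg : Tame g) {e p : ℕ → ℝ} (he : Tendsto e atTop (𝓝 1))
    (he' : ∀ k, e k ∈ Icc (1 / 2 : ℝ) 1) (hp : Tendsto p atTop (𝓝 0)) (j : ℕ) :
    Tendsto (fun k => ∫ n, n ^ j * g (p k + Real.sqrt (e k) * n) ∂stdGaussian) atTop
      (𝓝 (∫ n, n ^ j * g n ∂stdGaussian)) := by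
  have hpos : ∀ k, 0 < e k := fun k => by linarith [(he' k).1]
  have hs : ∀ k, Real.sqrt (e k) ≠ 0 := fun k => (Real.sqrt_pos.2 (hpos k)).ne'
  have e1 : ∀ k, ∫ n, n ^ j * g (p k + Real.sqrt (e k) * n) ∂stdGaussian =
      ∫ u, (Real.sqrt (e k))⁻¹ * Real.exp (u ^ 2 / 2 - (u - p k) ^ 2 / (2 * e k)) *
        (((u - p k) * (Real.sqrt (e k))⁻¹) ^ j * g u) ∂stdGaussian := by
    intro k
    rw [← integral_gaussian_tilt (fun u => ((u - p k) * (Real.sqrt (e k))⁻¹) ^ j * g u) (hpos k)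
      (((by fun_prop : Measurable fun u : ℝ => ((u - p k) * (Real.sqrt (e k))⁻¹) ^ j)).mul
        hg.measurable)]
    congr 1; ext n
    congr 2
    have := hs k
    field_simp; ring
  simp_rw [e1]
  have hp1 : ∀ᶠ k in atTop, |p k| ≤ 1 := by
    have := (hp.abs).eventually (gt_mem_nhds (by norm_num : |(0 : ℝ)| < 1))
    filter_upwards [this] with k hk using hk.le
  have hsq : ∀ k, (Real.sqrt (e k))⁻¹ ≤ 2 := by
    intro k
    rw [inv_le_comm₀ (Real.sqrt_pos.2 (hpos k)) two_pos]
    refine Real.le_sqrt_of_sq_le ?_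
    have := (he' k).1
    norm_num at this ⊢; linarith
  -- For `|p| ≤ 1` and `1/2 ≤ E ≤ 1` the density is at most `2 exp |u|`, and the moment factor at
  -- most `4 ^ j exp (j |u|)`.
  refine tendsto_integral_filter_of_dominated_convergence
    (fun u => ‖2 * 4 ^ j * (g u * Real.exp ((j + 1 : ℝ) * |u|))‖) (Eventually.of_forall fun k => ?_)
    ?_ ?_ (ae_of_all _ fun u => ?_)
  · refine Measurable.aestronglyMeasurable (Measurable.mul (by fun_prop) (Measurable.mul
      (by fun_prop) hg.measurable))
  · filter_upwards [hp1] with k hk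
    refine ae_of_all _ fun u => ?_
    have hk' := abs_le.1 hk
    rw [norm_mul, norm_mul, norm_mul, norm_mul, norm_mul, norm_pow, norm_mul, norm_pow,
      Real.norm_eq_abs (g u)]
    simp only [Real.norm_eq_abs, Real.abs_exp, abs_of_pos (inv_pos.2 (Real.sqrt_pos.2 (hpos k)))]
    have h1 : u ^ 2 / 2 - (u - p k) ^ 2 / (2 * e k) ≤ |u| := by
      have h2 : (u - p k) ^ 2 / 2 ≤ (u - p k) ^ 2 / (2 * e k) :=
        div_le_div_of_nonneg_left (sq_nonneg _) (by linarith [hpos k]) (by linarith [(he' k).2])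
      have h3 : u * p k ≤ |u| := by
        refine (le_abs_self _).trans ?_
        rw [abs_mul]
        exact mul_le_of_le_one_right (abs_nonneg u) hk
      nlinarith [sq_nonneg (p k)]
    have h4 : |u - p k| * (Real.sqrt (e k))⁻¹ ≤ 2 * (|u| + 1) := by
      have := abs_sub u (p k)
      rw [mul_comm 2]
      exact mul_le_mul (by linarith) (hsq k) (inv_pos.2 (Real.sqrt_pos.2 (hpos k))).le (by positivity)
    have h5 : (|u - p k| * (Real.sqrt (e k))⁻¹) ^ j ≤ 4 ^ j * Real.exp (j * |u|) := by
      calc _ ≤ (2 * (|u| + 1)) ^ j := pow_le_pow_left₀ (by positivity) h4 j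
        _ ≤ (4 * Real.exp |u|) ^ j := by
          refine pow_le_pow_left₀ (by positivity) ?_ j
          linarith [Real.add_one_le_exp |u|, Real.exp_pos |u|]
        _ = _ := by rw [mul_pow, ← Real.exp_nat_mul]
    have h6 : Real.exp ((j + 1 : ℝ) * |u|) = Real.exp |u| * Real.exp (j * |u|) := by
      rw [← Real.exp_add]; congr 1; ring
    calc _ ≤ 2 * Real.exp |u| * (4 ^ j * Real.exp (j * |u|) * |g u|) := by
          refine mul_le_mul (mul_le_mul (hsq k) (Real.exp_le_exp.2 h1) (Real.exp_pos _).le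
            zero_le_two) (mul_le_mul_of_nonneg_right h5 (abs_nonneg _)) (by positivity)
            (by positivity)
      _ = _ := by
        rw [h6, abs_of_pos (two_pos : (0 : ℝ) < 2), abs_of_pos (four_pos : (0 : ℝ) < 4),
          abs_mul, abs_of_pos (by positivity : 0 < Real.exp |u| * Real.exp (j * |u|))]
        ring
  · have := hg.integrable 0 1 ⟨one_pos, le_rfl⟩ (j + 1)
    simp only [Real.sqrt_one, one_mul, zero_add] at this
    exact (this.const_mul _).norm
  · have hsl : Tendsto (fun k => (Real.sqrt (e k))⁻¹) atTop (𝓝 1) := by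
      have := ((Real.continuous_sqrt.tendsto 1).comp he).inv₀ (by simp)
      simpa using this
    have h2 : Tendsto (fun k => u ^ 2 / 2 - (u - p k) ^ 2 / (2 * e k)) atTop
        (𝓝 (u ^ 2 / 2 - (u - 0) ^ 2 / (2 * 1))) :=
      tendsto_const_nhds.sub (((tendsto_const_nhds.sub hp).pow 2).div (he.const_mul 2) (by simp))
    have h3 := (hsl.mul ((Real.continuous_exp.tendsto _).comp h2)).mul
      ((((tendsto_const_nhds (x := u)).sub hp).mul hsl).pow j |>.mul_const (g u))
    simpa using h3

lemma Tame.tendsto_fisherFn_one (hg : Tame g) (h0 : ∀ u, 0 ≤ g u) {e p : ℕ → ℝ}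
    (he : Tendsto e atTop (𝓝 1)) (he' : ∀ k, e k ∈ Icc (1 / 2 : ℝ) 1)
    (hp : Tendsto p atTop (𝓝 0)) :
    Tendsto (fun k => fisherFn g (e k) (p k)) atTop (𝓝 (fisherFn g 1 0)) := by
  have hE : ∀ k, e k ∈ Ioc (0 : ℝ) 1 := fun k => ⟨by linarith [(he' k).1], (he' k).2⟩
  have ht := fun j => hg.tendsto_moment_one he he' hp j
  have hsl : Tendsto (fun k => (Real.sqrt (e k))⁻¹) atTop (𝓝 1) := by
    have := ((Real.continuous_sqrt.tendsto 1).comp he).inv₀ (by simp)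
    simpa using this
  have hh : Tendsto (fun k => heat g (e k) (p k)) atTop (𝓝 (heat g 1 0)) := by
    simpa [heat] using ht 0
  have hd : Tendsto (fun k => heatDeriv g (e k) (p k)) atTop (𝓝 (heatDeriv g 1 0)) := by
    simpa [heatDeriv] using hsl.mul (ht 1)
  by_cases h : heat g 1 0 = 0
  · have h1 : fisherFn g 1 0 = 0 := by simp [fisherFn, h]
    rw [h1]
    have h2 := (he.inv₀ one_ne_zero).mul (ht 2)
    have h3 : ∫ n, n ^ 2 * g n ∂stdGaussian = 0 := by
      have h4 : ∫ n, g n ∂stdGaussian = 0 := by simpa [heat] using h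
      rw [integral_eq_zero_iff_of_nonneg h0 hg.integrable_self] at h4
      refine integral_eq_zero_of_ae ?_
      filter_upwards [h4] with n hn
      rw [hn]; simp
    rw [h3, mul_zero] at h2
    exact squeeze_zero (fun k => fisherFn_nonneg h0 _ _) (fun k => hg.fisherFn_le h0 (hE k) _) h2
  · exact (hd.pow 2).div hh h

lemma Tame.integral_sq_mul_comp (hg : Tame g) {E : ℝ} (hE : E ∈ Ioc (0 : ℝ) 1) :
    ∫ z, ∫ n, n ^ 2 * g (Real.sqrt (1 - E) * z + Real.sqrt E * n) ∂stdGaussian ∂stdGaussian =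
      E * ∫ x, x ^ 2 * g x ∂stdGaussian + (1 - E) * ∫ x, g x ∂stdGaussian := by
  have h := hg.integrable_sq_mul_comp hE
  set c := Real.sqrt (1 - E) with hc
  set s := Real.sqrt E with hs
  have hc2 : c ^ 2 = 1 - E := Real.sq_sqrt (by linarith [hE.2])
  have hs2 : s ^ 2 = E := Real.sq_sqrt hE.1.le
  have hcs : c ^ 2 + s ^ 2 = 1 := by rw [hc2, hs2]; ring
  have hp := measurePreserving_rotation (Real.sqrt_nonneg _) (Real.sqrt_nonneg _) hcs
  have hi : ∀ k : ℕ, Integrable (fun x => x ^ k * g x) stdGaussian := fun k => by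
    simpa using hg.integrable_pow_mul' 0 ⟨one_pos, le_rfl⟩ k
  have hj : ∀ k : ℕ, Integrable (fun x : ℝ => x ^ k) stdGaussian := fun k => by
    simpa using (Tame.of_bounded (g := fun _ => 1) measurable_const (C := 1)
      (fun _ => by simp)).integrable_pow_mul' 0 ⟨one_pos, le_rfl⟩ k
  have h1 := ((hi 2).mul_prod (hj 0)).const_mul (s ^ 2)
  have h2 := ((hi 1).mul_prod (hj 1)).const_mul (2 * s * c)
  have h3 := ((hi 0).mul_prod (hj 2)).const_mul (c ^ 2)
  have h23 : Integrable (fun x : ℝ × ℝ => 2 * s * c * (x.1 ^ 1 * g x.1 * x.2 ^ 1) +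
    c ^ 2 * (x.1 ^ 0 * g x.1 * x.2 ^ 2)) (stdGaussian.prod stdGaussian) := h2.add h3
  have e1 : ∫ x : ℝ × ℝ, (s ^ 2 * (x.1 ^ 2 * g x.1 * x.2 ^ 0) +
      (2 * s * c * (x.1 ^ 1 * g x.1 * x.2 ^ 1) + c ^ 2 * (x.1 ^ 0 * g x.1 * x.2 ^ 2)))
        ∂(stdGaussian.prod stdGaussian) =
      E * ∫ x, x ^ 2 * g x ∂stdGaussian + (1 - E) * ∫ x, g x ∂stdGaussian := by
    rw [integral_add h1 h23, integral_add h2 h3, integral_const_mul, integral_const_mul,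
      integral_const_mul, integral_prod_mul (fun x => x ^ 2 * g x) (fun x => x ^ 0),
      integral_prod_mul (fun x => x ^ 1 * g x) (fun x => x ^ 1),
      integral_prod_mul (fun x => x ^ 0 * g x) (fun x => x ^ 2)]
    simp only [pow_zero, pow_one, one_mul, integral_id_stdGaussian, integral_sq_stdGaussian, hc2, hs2]
    simp
  rw [← e1, ← integral_prod (fun x : ℝ × ℝ => x.2 ^ 2 * g (c * x.1 + s * x.2)) h]
  conv_rhs => rw [← hp.map_eq]
  rw [integral_map hp.aemeasurable (by rw [hp.map_eq]; exact (h1.add h23).1)]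
  congr 1; ext x
  simp only
  linear_combination (-(x.2 ^ 2 * g (c * x.1 + s * x.2)) * (c ^ 2 + s ^ 2 + 1)) * hcs

/-- Upper semicontinuity of the Fisher information at `E = 1`. Fatou goes the wrong way for the
Fisher density itself, so it is applied to the nonnegative difference with the second moment bound
`κ`, whose integral is explicit and converges. -/
lemma Tame.le_meanFisher_one (hg : Tame g) (h0 : ∀ u, 0 ≤ g u) {M : ℝ}
    (hM : ∀ E ∈ Ioo (0 : ℝ) 1, M ≤ meanFisher g E) : M ≤ meanFisher g 1 := by
  set e : ℕ → ℝ := fun k => 1 - 1 / ((k : ℝ) + 2) with he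
  have hk : ∀ k : ℕ, 0 < 1 / ((k : ℝ) + 2) ∧ 1 / ((k : ℝ) + 2) ≤ 1 / 2 := fun k =>
    ⟨by positivity, div_le_div_of_nonneg_left zero_le_one two_pos
      (by linarith [(Nat.cast_nonneg k : (0 : ℝ) ≤ k)])⟩
  have het : Tendsto e atTop (𝓝 1) := by
    have h1 : Tendsto (fun k : ℕ => 1 / ((k : ℝ) + 2)) atTop (𝓝 0) := by
      have := (tendsto_add_atTop_iff_nat 1).2 (tendsto_one_div_add_atTop_nhds_zero_nat (𝕜 := ℝ))
      refine this.congr fun k => ?_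
      push_cast; congr 1; ring
    have h2 := h1.const_sub 1
    rw [sub_zero] at h2
    exact h2
  have he1 : ∀ k, e k ∈ Ioo (0 : ℝ) 1 := fun k =>
    ⟨by simp only [he]; linarith [(hk k).2], by simp only [he]; linarith [(hk k).1]⟩
  have he2 : ∀ k, e k ∈ Icc (1 / 2 : ℝ) 1 := fun k =>
    ⟨by simp only [he]; linarith [(hk k).2], (he1 k).2.le⟩
  have he3 : ∀ k, e k ∈ Ioc (0 : ℝ) 1 := fun k => Ioo_subset_Ioc_self (he1 k)
  set κ : ℝ → ℝ → ℝ := fun E z =>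
    E⁻¹ * ∫ n, n ^ 2 * g (Real.sqrt (1 - E) * z + Real.sqrt E * n) ∂stdGaussian with hκ
  have hκi : ∀ k, Integrable (κ (e k)) stdGaussian := fun k =>
    ((hg.integrable_sq_mul_comp (he3 k)).integral_prod_left).const_mul _
  have hp : ∀ z, Tendsto (fun k => Real.sqrt (1 - e k) * z) atTop (𝓝 0) := fun z => by
    have : Continuous fun x : ℝ => Real.sqrt (1 - x) * z := by fun_prop
    simpa [Function.comp_def] using (this.tendsto 1).comp het
  have hfi := fun k => hg.integrable_fisherFn h0 (he3 k)
  have hFi : ∀ k, Integrable (fun z => κ (e k) z - fisherFn g (e k) (Real.sqrt (1 - e k) * z))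
    stdGaussian := fun k => (hκi k).sub (hfi k)
  have hF0 : ∀ k, ∀ᵐ z ∂stdGaussian, 0 ≤ κ (e k) z - fisherFn g (e k) (Real.sqrt (1 - e k) * z) :=
    fun k => ae_of_all _ fun z => sub_nonneg.2 (hg.fisherFn_le h0 (he3 k) _)
  have hFl : ∀ᵐ z ∂stdGaussian,
      Tendsto (fun k => κ (e k) z - fisherFn g (e k) (Real.sqrt (1 - e k) * z)) atTop
        (𝓝 ((1 : ℝ)⁻¹ * ∫ n, n ^ 2 * g n ∂stdGaussian - fisherFn g 1 0)) :=
    ae_of_all _ fun z => ((het.inv₀ one_ne_zero).mul (hg.tendsto_moment_one het he2 (hp z) 2)).sub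
      (hg.tendsto_fisherFn_one h0 het he2 (hp z))
  have hFm : ∀ k, ∫ z, (κ (e k) z - fisherFn g (e k) (Real.sqrt (1 - e k) * z)) ∂stdGaussian ≤
      (e k)⁻¹ * (e k * ∫ x, x ^ 2 * g x ∂stdGaussian +
        (1 - e k) * ∫ x, g x ∂stdGaussian) - M := by
    intro k
    rw [integral_sub (hκi k) (hfi k), integral_const_mul, hg.integral_sq_mul_comp (he3 k)]
    have := hM _ (he1 k)
    rw [meanFisher] at this
    linarith
  have hlim := ((het.inv₀ one_ne_zero).mul ((het.mul_const (∫ x, x ^ 2 * g x ∂stdGaussian)).add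
    ((het.const_sub 1).mul_const (∫ x, g x ∂stdGaussian)))).sub_const M
  have h := integral_le_of_tendsto_ae hFi hF0 hFl hFm hlim
  rw [integral_const, probReal_univ, one_smul] at h
  have h1 : meanFisher g 1 = fisherFn g 1 0 := by simp [meanFisher]
  rw [h1]
  linarith

end One

end SparseSuperposition

/-! ### Injectivity of Gaussian smoothing, and integrability criteria for likelihoods -/

namespace SparseSuperposition

/-- Weierstrass transforms separate functions from constants. -/
lemma Tame.ae_eq_const {g : ℝ → ℝ} (hg : Tame g) (h0 : ∀ u, 0 ≤ g u) {E : ℝ}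
    (hE : E ∈ Ioc (0 : ℝ) 1) {a : ℝ} (h : ∀ p, heat g E p = a) : ∀ᵐ u ∂stdGaussian, g u = a := by
  set s := Real.sqrt E with hs
  have hs0 : 0 < s := Real.sqrt_pos.2 hE.1
  have ha : 0 ≤ a := by rw [← h 0]; exact heat_nonneg h0 _ _
  have hint : ∀ p, Integrable (fun n => g (p + s * n)) stdGaussian := fun p => hg.integrable_comp p hE
  have hmg : Measurable fun n => g (s * n) := hg.measurable.comp (by fun_prop)
  set μ₁ := stdGaussian.withDensity fun n => ENNReal.ofReal (g (s * n)) with hμ₁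
  set μ₂ := stdGaussian.withDensity fun _ => ENNReal.ofReal a with hμ₂
  have huniv : ∀ f : ℝ → ℝ, Integrable f stdGaussian → (∀ n, 0 ≤ f n) →
      (stdGaussian.withDensity fun n => ENNReal.ofReal (f n)) univ =
        ENNReal.ofReal (∫ n, f n ∂stdGaussian) := by
    intro f hf hf0
    rw [withDensity_apply _ MeasurableSet.univ, Measure.restrict_univ,
      ofReal_integral_eq_lintegral_ofReal hf (ae_of_all _ hf0)]
  have hint0 : Integrable (fun n => g (s * n)) stdGaussian := by simpa using hint 0
  have hu1 : μ₁ univ = ENNReal.ofReal a := by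
    rw [hμ₁, huniv _ hint0 fun n => h0 _, ← h 0]
    simp [heat, hs]
  have hu2 : μ₂ univ = ENNReal.ofReal a := by
    rw [hμ₂, huniv _ (integrable_const a) fun n => ha]
    simp
  have : IsFiniteMeasure μ₁ := ⟨by rw [hu1]; exact ENNReal.ofReal_lt_top⟩
  have : IsFiniteMeasure μ₂ := ⟨by rw [hu2]; exact ENNReal.ofReal_lt_top⟩
  have hwi : ∀ f : ℝ → ℝ, Measurable f → (∀ n, 0 ≤ f n) → ∀ k : ℝ → ℝ,
      ∫ n, k n ∂(stdGaussian.withDensity fun n => ENNReal.ofReal (f n)) =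
        ∫ n, f n * k n ∂stdGaussian := by
    intro f hf hf0 k
    rw [integral_withDensity_eq_integral_toReal_smul hf.ennreal_ofReal
      (ae_of_all _ fun _ => ENNReal.ofReal_lt_top)]
    congr 1; ext n
    rw [ENNReal.toReal_ofReal (hf0 n), smul_eq_mul]
  -- The values of `heat` at the points `s t` are, up to a Gaussian factor, the exponential moments
  -- of the measure with density `g (s ·)`.
  have hshift : ∀ t, Real.exp (-(t ^ 2 / 2)) * ∫ n, g (s * n) * Real.exp (t * n) ∂stdGaussian = a := by
    intro t
    rw [← h (s * t), heat, ← integral_const_mul]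
    have := integral_add_stdGaussian (fun n => g (s * n)) t
    rw [show (fun n => g (s * t + s * n)) = fun n => g (s * (n + t)) by ext n; congr 1; ring, this]
    congr 1; ext n
    rw [sub_eq_add_neg, Real.exp_add]; ring
  have hm : mgf id μ₁ = mgf id μ₂ := by
    ext t
    simp only [mgf, id]
    rw [hμ₁, hμ₂, hwi _ hmg (fun n => h0 _), hwi _ measurable_const (fun n => ha), integral_const_mul,
      integral_exp_mul_stdGaussian]
    have h1 := hshift t
    have h2 : Real.exp (-(t ^ 2 / 2)) * Real.exp (t ^ 2 / 2) = 1 := by rw [← Real.exp_add]; simp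
    linear_combination Real.exp (t ^ 2 / 2) * h1 -
      (∫ n, g (s * n) * Real.exp (t * n) ∂stdGaussian) * h2
  have hes : integrableExpSet id μ₁ = univ := by
    refine eq_univ_of_forall fun t => ?_
    simp only [integrableExpSet, mem_ofPred_eq, id]
    rw [hμ₁, integrable_withDensity_iff_integrable_smul' hmg.ennreal_ofReal
      (ae_of_all _ fun _ => ENNReal.ofReal_lt_top)]
    have h1 := hg.integrable 0 E hE |t|
    refine h1.mono (Measurable.aestronglyMeasurable ?_) (ae_of_all _ fun n => ?_)
    · exact hmg.ennreal_ofReal.ennreal_toReal.smul (by fun_prop)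
    · rw [smul_eq_mul, norm_mul, norm_mul, ENNReal.toReal_ofReal (h0 _), zero_add]
      refine mul_le_mul_of_nonneg_left ?_ (norm_nonneg _)
      rw [Real.norm_eq_abs, Real.norm_eq_abs, Real.abs_exp, Real.abs_exp, ← abs_mul]
      exact Real.exp_le_exp.2 (le_abs_self _)
  -- The moment generating functions are finite everywhere, so their equality extends analytically
  -- to the complex plane and identifies the measures.
  have hEq := eqOn_complexMGF_of_mgf' hm
    (by rw [← Measure.measure_univ_eq_zero, ← Measure.measure_univ_eq_zero, hu1, hu2])
  rw [hes, interior_univ] at hEq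
  have hμ := Measure.ext_of_complexMGF_id_eq (funext fun z => hEq (mem_univ _))
  rw [hμ₁, hμ₂, withDensity_eq_iff_of_sigmaFinite hmg.ennreal_ofReal.aemeasurable
    measurable_const.aemeasurable] at hμ
  have hae : ∀ᵐ n ∂stdGaussian, g (s * n) = a := by
    filter_upwards [hμ] with n hn
    exact (ENNReal.ofReal_eq_ofReal_iff (h0 _) ha).1 hn
  have hmap := gaussianReal_eq_map 0 E
  have h2 : ∀ᵐ u ∂(gaussianReal 0 E.toNNReal), g u = a := by
    rw [hmap, ae_map_iff (by fun_prop) (measurableSet_eq_fun hg.measurable measurable_const)]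
    simpa using hae
  have hne : E.toNNReal ≠ 0 := by simpa using hE.1
  have hac : stdGaussian ≪ gaussianReal 0 E.toNNReal :=
    (gaussianReal_absolutelyContinuous 0 one_ne_zero).trans
      (gaussianReal_absolutelyContinuous' 0 hne)
  exact hac.ae_le h2

/-- The variance `4` leaves room: for `E ≤ 1` the density of `𝒩(p, E)` times any exponential weight
is at most a constant times that of `𝒩(0, 4)`. A single integrability condition then covers all `p`,
`E` and `A`. -/
lemma tame_of_integrable {g : ℝ → ℝ} (hm : Measurable g)
    (hg : Integrable g (gaussianReal 0 4)) : Tame g := by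
  refine ⟨hm, fun p E hE A => ?_⟩
  set s := Real.sqrt E with hs
  have hs0 : 0 < s := Real.sqrt_pos.2 hE.1
  have hs2 : s ^ 2 = E := Real.sq_sqrt hE.1.le
  have hEne : E.toNNReal ≠ 0 := by simpa using hE.1
  have hF : Measurable fun u => g u * Real.exp (A * |(u - p) / s|) := hm.mul (by fun_prop)
  have key : Integrable (fun u => g u * Real.exp (A * |(u - p) / s|)) (gaussianReal p E.toNNReal) := by
    rw [gaussianReal_of_var_ne_zero _ hEne, integrable_withDensity_iff_integrable_smul'
      (measurable_gaussianPDF _ _) (ae_of_all _ fun _ => gaussianPDF_lt_top)]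
    rw [gaussianReal_of_var_ne_zero _ (by norm_num), integrable_withDensity_iff_integrable_smul'
      (measurable_gaussianPDF _ _) (ae_of_all _ fun _ => gaussianPDF_lt_top)] at hg
    simp only [toReal_gaussianPDF, smul_eq_mul] at hg ⊢
    refine (hg.const_mul ((Real.sqrt (2 * Real.pi * E))⁻¹ * Real.sqrt (2 * Real.pi * 4) *
      Real.exp (A ^ 2 + p ^ 2 / 4))).mono
      ((measurable_gaussianPDFReal _ _).mul hF).aestronglyMeasurable (ae_of_all _ fun u => ?_)
    have e1 : ‖gaussianPDFReal p E.toNNReal u * (g u * Real.exp (A * |(u - p) / s|))‖ =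
        gaussianPDFReal p E.toNNReal u * (‖g u‖ * Real.exp (A * |(u - p) / s|)) := by
      rw [norm_mul, norm_mul, Real.norm_of_nonneg (gaussianPDFReal_nonneg _ _ _),
        Real.norm_of_nonneg (Real.exp_pos _).le]
    have e2 : ‖(Real.sqrt (2 * Real.pi * E))⁻¹ * Real.sqrt (2 * Real.pi * 4) *
        Real.exp (A ^ 2 + p ^ 2 / 4) * (gaussianPDFReal 0 4 u * g u)‖ =
        (Real.sqrt (2 * Real.pi * E))⁻¹ * Real.sqrt (2 * Real.pi * 4) *
        Real.exp (A ^ 2 + p ^ 2 / 4) * (gaussianPDFReal 0 4 u * ‖g u‖) := by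
      rw [norm_mul, norm_mul (gaussianPDFReal 0 4 u), Real.norm_of_nonneg (by positivity),
        Real.norm_of_nonneg (gaussianPDFReal_nonneg _ _ _)]
    rw [e1, e2]
    simp only [gaussianPDFReal, Real.coe_toNNReal _ hE.1.le]
    have h4 : ((4 : ℝ≥0) : ℝ) = 4 := rfl
    rw [h4]
    have hex : Real.exp (-(u - p) ^ 2 / (2 * E)) * Real.exp (A * |(u - p) / s|) ≤
        Real.exp (A ^ 2 + p ^ 2 / 4) * Real.exp (-(u - 0) ^ 2 / (2 * 4)) := by
      rw [← Real.exp_add, ← Real.exp_add]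
      refine Real.exp_le_exp.2 ?_
      set x := (u - p) / s with hx
      have hu : u = s * x + p := by rw [hx]; field_simp; ring
      have h5 : -(u - p) ^ 2 / (2 * E) = -x ^ 2 / 2 := by
        rw [hu, ← hs2]; field_simp; ring
      have h6 : x ^ 2 = |x| ^ 2 := (sq_abs x).symm
      have h7 : (s * x) ^ 2 ≤ |x| ^ 2 := by
        rw [mul_pow, hs2, ← h6]
        exact mul_le_of_le_one_left (sq_nonneg _) hE.2
      rw [h5, h6, hu]
      nlinarith [sq_nonneg (s * x - p), sq_nonneg (|x| / 2 - A)]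
    have hne4 : Real.sqrt (2 * Real.pi * 4) ≠ 0 := (Real.sqrt_pos.2 (by positivity)).ne'
    calc _ = (Real.sqrt (2 * Real.pi * E))⁻¹ * ‖g u‖ * (Real.exp (-(u - p) ^ 2 / (2 * E)) *
          Real.exp (A * |(u - p) / s|)) := by ring
      _ ≤ (Real.sqrt (2 * Real.pi * E))⁻¹ * ‖g u‖ * (Real.exp (A ^ 2 + p ^ 2 / 4) *
          Real.exp (-(u - 0) ^ 2 / (2 * 4))) := mul_le_mul_of_nonneg_left hex (by positivity)
      _ = _ := by field_simp
  rw [gaussianReal_eq_map, integrable_map_measure hF.aestronglyMeasurable (by fun_prop)] at key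
  refine key.congr (ae_of_all _ fun n => ?_)
  simp only [Function.comp, ← hs]
  rw [add_sub_cancel_left, mul_div_cancel_left₀ _ hs0.ne']

lemma xlogx_ge_tangent {x q : ℝ} (hx : 0 ≤ x) (hq : 0 < q) :
    x * Real.log q + x - q ≤ xlogx x := by
  rcases hx.eq_or_lt with h | h
  · rw [← h, xlogx]; simp; exact hq.le
  · have h1 := Real.log_le_sub_one_of_pos (div_pos hq h)
    rw [Real.log_div hq.ne' h.ne'] at h1
    have h2 := mul_le_mul_of_nonneg_left h1 hx
    rw [mul_sub, mul_sub, mul_div_cancel₀ _ h.ne'] at h2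
    rw [xlogx]; linarith

/-- The bound from above is Jensen, the one from below is the tangent of `x ln x` at the mean `q` of
`g`. Each term on the right is integrable over the outputs, which justifies exchanging the integrals
over `z` and `y`. -/
lemma integral_abs_xlogx_heat_le {g : ℝ → ℝ} (hm : Measurable g)
    (hgi : Integrable g stdGaussian) (h0 : ∀ u, 0 ≤ g u)
    (hx : Integrable (fun u => xlogx (g u)) stdGaussian) {E : ℝ} (hE : E ∈ Icc (0 : ℝ) 1) :
    ∫ z, |xlogx (heat g E (Real.sqrt (1 - E) * z))| ∂stdGaussian ≤
      ∫ u, |xlogx (g u)| ∂stdGaussian + |xlogx (∫ u, g u ∂stdGaussian)| +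
        2 * ∫ u, g u ∂stdGaussian := by
  set q := ∫ u, g u ∂stdGaussian with hq
  have hq0 : 0 ≤ q := integral_nonneg h0
  have ih := integrable_heat_sqrt hgi hE
  have ihq : ∫ z, heat g E (Real.sqrt (1 - E) * z) ∂stdGaussian = q := integral_heat hgi hE
  rcases hq0.eq_or_lt with h | h
  · rw [← h, integral_eq_zero_iff_of_nonneg (fun z => heat_nonneg h0 _ _) ih] at ihq
    have : ∫ z, |xlogx (heat g E (Real.sqrt (1 - E) * z))| ∂stdGaussian = 0 := by
      refine integral_eq_zero_of_ae ?_
      filter_upwards [ihq] with z hz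
      rw [hz]; simp [xlogx]
    rw [this]
    have : 0 ≤ ∫ u, |xlogx (g u)| ∂stdGaussian := integral_nonneg fun _ => abs_nonneg _
    positivity
  · have hle : ∀ᵐ z ∂stdGaussian, |xlogx (heat g E (Real.sqrt (1 - E) * z))| ≤
        heat (fun u => |xlogx (g u)|) E (Real.sqrt (1 - E) * z) +
          ((|Real.log q| + 1) * heat g E (Real.sqrt (1 - E) * z) + q) := by
      filter_upwards [comp_heat_le convexOn_xlogx continuous_xlogx h0 hgi hx hE,
        (integrable_comp_rotation hx hE).1.prod_right_ae] with z hz hz'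
      have h1 := heat_nonneg h0 E (Real.sqrt (1 - E) * z)
      have h2 := xlogx_ge_tangent h1 h
      have h3 : heat (fun x => xlogx (g x)) E (Real.sqrt (1 - E) * z) ≤
          heat (fun u => |xlogx (g u)|) E (Real.sqrt (1 - E) * z) :=
        (le_abs_self _).trans abs_integral_le_integral_abs
      have h4 : 0 ≤ heat (fun u => |xlogx (g u)|) E (Real.sqrt (1 - E) * z) :=
        heat_nonneg (fun _ => abs_nonneg _) _ _
      have h5 := mul_nonneg (abs_nonneg (Real.log q)) h1
      have h6 : -(|Real.log q| * heat g E (Real.sqrt (1 - E) * z)) ≤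
          heat g E (Real.sqrt (1 - E) * z) * Real.log q := by
        rw [mul_comm, ← mul_neg]
        exact mul_le_mul_of_nonneg_left (neg_abs_le _) h1
      rw [abs_le]
      constructor
      · linarith
      · linarith
    have i1 := integrable_heat_sqrt hx.abs hE
    have i2 : Integrable (fun z => (|Real.log q| + 1) * heat g E (Real.sqrt (1 - E) * z) + q)
      stdGaussian := (ih.const_mul _).add (integrable_const _)
    refine (integral_mono_ae (integrable_xlogx_heat hm hgi h0 hx hE).abs (i1.add i2) hle).trans ?_
    have h7 : ∫ z, (heat (fun u => |xlogx (g u)|) E (Real.sqrt (1 - E) * z) +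
          ((|Real.log q| + 1) * heat g E (Real.sqrt (1 - E) * z) + q)) ∂stdGaussian =
        ∫ u, |xlogx (g u)| ∂stdGaussian + ((|Real.log q| + 1) * q + q) := by
      rw [integral_add i1 i2, integral_add (ih.const_mul _) (integrable_const _),
        integral_const_mul, ihq, integral_heat hx.abs hE]
      simp
    refine h7.le.trans ?_
    rw [xlogx, abs_mul, abs_of_pos h]
    linarith

end SparseSuperposition

/-! ### Likelihoods of a channel: integration over the outputs -/

namespace SparseSuperposition

namespace MemorylessChannel

section Real

variable {𝓑 : Type*} [MeasurableSpace 𝓑] {ν : Measure 𝓑}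

/-- The likelihood of the output `y`, as a function of the input. -/
noncomputable def slice (P : MemorylessChannel ℝ 𝓑 ν) (y : 𝓑) (u : ℝ) : ℝ := P.density u y

variable (P : MemorylessChannel ℝ 𝓑 ν)

lemma slice_nonneg (y : 𝓑) (u : ℝ) : 0 ≤ P.slice y u := P.density_nonneg u y

lemma measurable_slice (y : 𝓑) : Measurable (P.slice y) :=
  P.measurable_density.comp (measurable_id.prodMk measurable_const)

lemma measurable_slice_uncurry {α : Type*} [MeasurableSpace α] {f : α → 𝓑} {k : α → ℝ}
    (hf : Measurable f) (hk : Measurable k) : Measurable fun x => P.slice (f x) (k x) :=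
  P.measurable_density.comp (hk.prodMk hf)

lemma measurable_heat_slice (E : ℝ) : Measurable fun x : 𝓑 × ℝ => heat (P.slice x.1) E x.2 := by
  have : Measurable fun x : (𝓑 × ℝ) × ℝ => P.slice x.1.1 (x.1.2 + Real.sqrt E * x.2) :=
    P.measurable_slice_uncurry (by fun_prop) (by fun_prop)
  exact this.stronglyMeasurable.integral_prod_right.measurable

lemma measurable_heatDeriv_slice (E : ℝ) :
    Measurable fun x : 𝓑 × ℝ => heatDeriv (P.slice x.1) E x.2 := by
  have : Measurable fun x : (𝓑 × ℝ) × ℝ => x.2 * P.slice x.1.1 (x.1.2 + Real.sqrt E * x.2) :=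
    measurable_snd.mul (P.measurable_slice_uncurry (by fun_prop) (by fun_prop))
  exact this.stronglyMeasurable.integral_prod_right.measurable.const_mul _

lemma measurable_fisherFn_slice (E : ℝ) :
    Measurable fun x : 𝓑 × ℝ => fisherFn (P.slice x.1) E x.2 :=
  ((P.measurable_heatDeriv_slice E).pow_const 2).div (P.measurable_heat_slice E)

lemma measurable_meanFisher_slice (E : ℝ) : Measurable fun y => meanFisher (P.slice y) E := by
  unfold meanFisher
  have h1 : Measurable fun x : 𝓑 × ℝ => (x.1, Real.sqrt (1 - E) * x.2) := by fun_prop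
  have h2 := P.measurable_fisherFn_slice E
  generalize fisherFn = F at *
  have : Measurable fun x : 𝓑 × ℝ => F (P.slice x.1) E (Real.sqrt (1 - E) * x.2) := h2.comp h1
  exact this.stronglyMeasurable.integral_prod_right.measurable

lemma measurable_xlogx_heat_slice (E : ℝ) :
    Measurable fun x : 𝓑 × ℝ => xlogx (heat (P.slice x.1) E (Real.sqrt (1 - E) * x.2)) := by
  have h1 : Measurable fun x : 𝓑 × ℝ => (x.1, Real.sqrt (1 - E) * x.2) := by fun_prop
  exact continuous_xlogx.measurable.comp (Measurable.comp
    (g := fun x : 𝓑 × ℝ => heat (P.slice x.1) E x.2) (P.measurable_heat_slice E) h1)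

lemma measurable_meanEntropy_slice (E : ℝ) : Measurable fun y => meanEntropy (P.slice y) E :=
  (P.measurable_xlogx_heat_slice E).stronglyMeasurable.integral_prod_right.measurable

lemma smoothed_eq_heat (E p : ℝ) (y : 𝓑) : P.smoothed E p y = heat (P.slice y) E p := by
  have h := integral_map (μ := stdGaussian) (φ := fun n => p + Real.sqrt E * n) (by fun_prop)
    (P.measurable_slice y).aestronglyMeasurable
  rw [← gaussianReal_eq_map] at h
  exact h

lemma phi_eq_heat (E z : ℝ) (y : 𝓑) : P.phi E z y = heat (P.slice y) E (Real.sqrt (1 - E) * z) := by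
  rw [mul_comm, ← smoothed_eq_heat]; rfl

lemma lintegral_lintegral_slice [SFinite ν] (μ : Measure ℝ) [SFinite μ] {f : ℝ → ℝ≥0∞}
    (hf : Measurable f) :
    ∫⁻ y, ∫⁻ u, f u * ENNReal.ofReal (P.slice y u) ∂μ ∂ν = ∫⁻ u, f u ∂μ := by
  rw [lintegral_lintegral_swap]
  · refine lintegral_congr fun u => ?_
    have hm : Measurable fun y => ENNReal.ofReal (P.density u y) :=
      (P.measurable_density.comp (measurable_const.prodMk measurable_id)).ennreal_ofReal
    simp only [slice]
    rw [lintegral_const_mul _ hm, P.lintegral_density, mul_one]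
  · exact ((hf.comp measurable_snd).mul
      (P.measurable_slice_uncurry measurable_fst measurable_snd).ennreal_ofReal).aemeasurable

/-- The likelihoods integrate to `1` over outputs and `𝒩(0, 4)` inputs, so by Fubini almost every
one is integrable for `𝒩(0, 4)`. -/
lemma ae_tame [SFinite ν] : ∀ᵐ y ∂ν, Tame (P.slice y) := by
  have h := P.lintegral_lintegral_slice (gaussianReal 0 4) (f := 1) measurable_const
  simp only [Pi.one_apply, one_mul, lintegral_const, measure_univ] at h
  have hm : Measurable fun y => ∫⁻ u, ENNReal.ofReal (P.slice y u) ∂(gaussianReal 0 4) :=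
    (P.measurable_slice_uncurry measurable_fst measurable_snd).ennreal_ofReal.lintegral_prod_right'
  filter_upwards [ae_lt_top hm (by rw [h]; exact ENNReal.one_ne_top)] with y hy
  refine tame_of_integrable (P.measurable_slice y) ⟨(P.measurable_slice y).aestronglyMeasurable, ?_⟩
  rw [hasFiniteIntegral_iff_ofReal (ae_of_all _ (P.slice_nonneg y))]
  exact hy

lemma fisherInfo_eq [SFinite ν] {E : ℝ} (hE : E ∈ Ioc (0 : ℝ) 1) (p : ℝ) :
    P.fisherInfo E p = ∫⁻ y, ENNReal.ofReal (fisherFn (P.slice y) E p) ∂ν := by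
  refine lintegral_congr_ae ?_
  filter_upwards [P.ae_tame] with y hy
  congr 1
  simp_rw [smoothed_eq_heat]
  -- Where the density vanishes both sides are `0`, whatever the derivative of the logarithm is.
  by_cases h : heat (P.slice y) E p = 0
  · simp [h, fisherFn]
  · rw [((hy.hasDerivAt_heat hE p).log h).deriv, fisherFn]
    field_simp

lemma avgFisher_eq [SFinite ν] {E : ℝ} (hE : E ∈ Ioc (0 : ℝ) 1) :
    P.avgFisher E = ∫⁻ y, ENNReal.ofReal (meanFisher (P.slice y) E) ∂ν := by
  rw [avgFisher, if_neg hE.1.ne']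
  simp_rw [P.fisherInfo_eq hE]
  have hm := (P.measurable_fisherFn_slice E).ennreal_ofReal
  have hm' : Measurable fun p => ∫⁻ y, ENNReal.ofReal (fisherFn (P.slice y) E p) ∂ν :=
    hm.lintegral_prod_left'
  rw [gaussianReal_eq_map, lintegral_map hm' (by fun_prop), lintegral_lintegral_swap]
  · refine lintegral_congr_ae ?_
    filter_upwards [P.ae_tame] with y hy
    rw [meanFisher, ofReal_integral_eq_lintegral_ofReal (hy.integrable_fisherFn (P.slice_nonneg y) hE)
      (ae_of_all _ fun z => fisherFn_nonneg (P.slice_nonneg y) _ _)]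
    simp
  · exact (hm.comp (by fun_prop : Measurable fun x : ℝ × 𝓑 =>
      (x.2, 0 + Real.sqrt (1 - E) * x.1))).aemeasurable

lemma lintegral_moment_slice [SFinite ν] (j : ℕ) (hj : Even j) :
    ∫⁻ y, ENNReal.ofReal (∫ u, u ^ j * P.slice y u ∂stdGaussian) ∂ν =
      ∫⁻ u, ENNReal.ofReal (u ^ j) ∂stdGaussian := by
  rw [← P.lintegral_lintegral_slice stdGaussian (f := fun u => ENNReal.ofReal (u ^ j)) (by fun_prop)]
  refine lintegral_congr_ae ?_
  filter_upwards [P.ae_tame] with y hy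
  have hi : Integrable (fun u => u ^ j * P.slice y u) stdGaussian := by
    simpa using hy.integrable_pow_mul' 0 ⟨one_pos, le_rfl⟩ j
  rw [ofReal_integral_eq_lintegral_ofReal hi
    (ae_of_all _ fun u => mul_nonneg (hj.pow_nonneg u) (P.slice_nonneg y u))]
  simp_rw [ENNReal.ofReal_mul (hj.pow_nonneg _)]

/-- The Fisher information of the output is at most that of the Gaussian smoothing, which is `1/E`.
Consequently `J` can be infinite only at `E = 0`. -/
lemma avgFisher_le [SFinite ν] {E : ℝ} (hE : E ∈ Ioc (0 : ℝ) 1) :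
    P.avgFisher E ≤ ENNReal.ofReal E⁻¹ := by
  have h2 : ∫⁻ u : ℝ, ENNReal.ofReal (u ^ 2) ∂stdGaussian = 1 := by
    rw [← ofReal_integral_eq_lintegral_ofReal integrable_sq_stdGaussian
      (ae_of_all _ fun u => sq_nonneg u), integral_sq_stdGaussian, ENNReal.ofReal_one]
  have e2 := P.lintegral_moment_slice 2 even_two
  have e0 := P.lintegral_moment_slice 0 Even.zero
  rw [h2] at e2
  simp only [pow_zero, one_mul, ENNReal.ofReal_one, lintegral_const, measure_univ] at e0
  have hm2 : Measurable fun y => ENNReal.ofReal (∫ u, u ^ 2 * P.slice y u ∂stdGaussian) := by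
    have : Measurable fun x : 𝓑 × ℝ => x.2 ^ 2 * P.slice x.1 x.2 :=
      (measurable_snd.pow_const 2).mul (P.measurable_slice_uncurry measurable_fst measurable_snd)
    exact this.stronglyMeasurable.integral_prod_right.measurable.ennreal_ofReal
  have hm0 : Measurable fun y => ENNReal.ofReal (∫ u, P.slice y u ∂stdGaussian) :=
    (P.measurable_slice_uncurry measurable_fst
      measurable_snd).stronglyMeasurable.integral_prod_right.measurable.ennreal_ofReal
  rw [P.avgFisher_eq hE]
  calc _ ≤ ∫⁻ y, (ENNReal.ofReal (∫ u, u ^ 2 * P.slice y u ∂stdGaussian) +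
        ENNReal.ofReal (E⁻¹ * (1 - E)) * ENNReal.ofReal (∫ u, P.slice y u ∂stdGaussian)) ∂ν := by
        refine lintegral_mono_ae ?_
        filter_upwards [P.ae_tame] with y hy
        have h0 := P.slice_nonneg y
        have hc : 0 ≤ E⁻¹ * (1 - E) := mul_nonneg (inv_nonneg.2 hE.1.le) (by linarith [hE.2])
        have ha : 0 ≤ ∫ u, u ^ 2 * P.slice y u ∂stdGaussian :=
          integral_nonneg fun u => mul_nonneg (sq_nonneg u) (h0 u)
        have hb : 0 ≤ ∫ u, P.slice y u ∂stdGaussian := integral_nonneg h0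
        rw [← ENNReal.ofReal_mul hc, ← ENNReal.ofReal_add ha (mul_nonneg hc hb)]
        refine ENNReal.ofReal_le_ofReal ?_
        have h3 : meanFisher (P.slice y) E ≤ E⁻¹ * ∫ z, ∫ n, n ^ 2 *
            P.slice y (Real.sqrt (1 - E) * z + Real.sqrt E * n) ∂stdGaussian ∂stdGaussian := by
          rw [← integral_const_mul]
          exact integral_mono (hy.integrable_fisherFn h0 hE)
            ((hy.integrable_sq_mul_comp hE).integral_prod_left.const_mul _)
            fun z => hy.fisherFn_le h0 hE _
        rw [hy.integral_sq_mul_comp hE, mul_add, ← mul_assoc, inv_mul_cancel₀ hE.1.ne', one_mul,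
          ← mul_assoc] at h3
        exact h3
    _ = 1 + ENNReal.ofReal (E⁻¹ * (1 - E)) := by
        rw [lintegral_add_left hm2, lintegral_const_mul _ hm0, e2, e0, mul_one]
    _ = ENNReal.ofReal E⁻¹ := by
        rw [← ENNReal.ofReal_one, ← ENNReal.ofReal_add zero_le_one
          (mul_nonneg (inv_nonneg.2 hE.1.le) (by linarith [hE.2]))]
        congr 1
        have := hE.1.ne'
        field_simp; ring

lemma avgFisher_ne_top [SFinite ν] {E : ℝ} (hE : E ∈ Ioc (0 : ℝ) 1) : P.avgFisher E ≠ ∞ :=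
  ((P.avgFisher_le hE).trans_lt ENNReal.ofReal_lt_top).ne

lemma integrable_meanFisher_slice [SFinite ν] {E : ℝ} (hE : E ∈ Ioc (0 : ℝ) 1) :
    Integrable (fun y => meanFisher (P.slice y) E) ν := by
  refine ⟨(P.measurable_meanFisher_slice E).aestronglyMeasurable, ?_⟩
  rw [hasFiniteIntegral_iff_ofReal (ae_of_all _ fun y => meanFisher_nonneg (P.slice_nonneg y) E),
    ← P.avgFisher_eq hE]
  exact (P.avgFisher_ne_top hE).lt_top

lemma toReal_avgFisher [SFinite ν] {E : ℝ} (hE : E ∈ Ioc (0 : ℝ) 1) :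
    (P.avgFisher E).toReal = ∫ y, meanFisher (P.slice y) E ∂ν := by
  rw [integral_eq_lintegral_of_nonneg_ae
    (ae_of_all _ fun y => meanFisher_nonneg (P.slice_nonneg y) E)
    (P.measurable_meanFisher_slice E).aestronglyMeasurable, P.avgFisher_eq hE]

/-- `E ↦ 𝔼_z ∫ φ ln φ dy`, with the opposite sign: the output entropy in nats at noise `E`. -/
noncomputable def outEntropy (E : ℝ) : ℝ := -∫ y, meanEntropy (P.slice y) E ∂ν

lemma xlogx_eq_logb (x : ℝ) : xlogx x = Real.log 2 * (x * Real.logb 2 x) := by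
  rw [xlogx, Real.logb]
  have : Real.log 2 ≠ 0 := (Real.log_pos one_lt_two).ne'
  field_simp

lemma integrable_xlogx_slice (hH : P.FiniteEntropies stdGaussian) :
    Integrable (fun x : ℝ × 𝓑 => xlogx (P.slice x.2 x.1)) (stdGaussian.prod ν) := by
  simp_rw [xlogx_eq_logb]
  exact hH.2.const_mul _

lemma ae_integrable_xlogx_slice [SFinite ν] (hH : P.FiniteEntropies stdGaussian) :
    ∀ᵐ y ∂ν, Integrable (fun u => xlogx (P.slice y u)) stdGaussian :=
  (P.integrable_xlogx_slice hH).prod_left_ae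

lemma integrable_meanEntropy_zero [SFinite ν] (hH : P.FiniteEntropies stdGaussian) :
    Integrable (fun y => meanEntropy (P.slice y) 0) ν := by
  simp_rw [meanEntropy_zero]
  exact (P.integrable_xlogx_slice hH).integral_prod_right

lemma integrable_meanEntropy_one (hH : P.FiniteEntropies stdGaussian) :
    Integrable (fun y => meanEntropy (P.slice y) 1) ν := by
  simp_rw [meanEntropy_one, xlogx_eq_logb]
  exact hH.1.const_mul _

lemma ae_meanEntropy_mem [SFinite ν] (hH : P.FiniteEntropies stdGaussian) :
    ∀ᵐ y ∂ν, ∀ E ∈ Icc (0 : ℝ) 1, meanEntropy (P.slice y) 1 ≤ meanEntropy (P.slice y) E ∧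
      meanEntropy (P.slice y) E ≤ meanEntropy (P.slice y) 0 := by
  filter_upwards [P.ae_tame, P.ae_integrable_xlogx_slice hH] with y hy hx E hE
  exact ⟨meanEntropy_one_le (P.measurable_slice y) hy.integrable_self (P.slice_nonneg y) hx hE,
    meanEntropy_le_zero (P.measurable_slice y) hy.integrable_self (P.slice_nonneg y) hx hE⟩

lemma ae_abs_meanEntropy_le [SFinite ν] (hH : P.FiniteEntropies stdGaussian) :
    ∀ᵐ y ∂ν, ∀ E ∈ Icc (0 : ℝ) 1, ‖meanEntropy (P.slice y) E‖ ≤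
      ‖meanEntropy (P.slice y) 0‖ + ‖meanEntropy (P.slice y) 1‖ := by
  filter_upwards [P.ae_meanEntropy_mem hH] with y hy E hE
  obtain ⟨h1, h2⟩ := hy E hE
  simp only [Real.norm_eq_abs]
  rw [abs_le]
  constructor
  · linarith [neg_abs_le (meanEntropy (P.slice y) 1), abs_nonneg (meanEntropy (P.slice y) 0)]
  · linarith [le_abs_self (meanEntropy (P.slice y) 0), abs_nonneg (meanEntropy (P.slice y) 1)]

lemma integrable_meanEntropy [SFinite ν] (hH : P.FiniteEntropies stdGaussian) {E : ℝ}
    (hE : E ∈ Icc (0 : ℝ) 1) : Integrable (fun y => meanEntropy (P.slice y) E) ν := by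
  refine ((P.integrable_meanEntropy_zero hH).norm.add
    (P.integrable_meanEntropy_one hH).norm).mono'
    (P.measurable_meanEntropy_slice E).aestronglyMeasurable ?_
  filter_upwards [P.ae_abs_meanEntropy_le hH] with y hy using hy E hE

lemma integrable_xlogx_heat_slice [SFinite ν] (hH : P.FiniteEntropies stdGaussian) {E : ℝ}
    (hE : E ∈ Icc (0 : ℝ) 1) :
    Integrable (fun x : ℝ × 𝓑 => xlogx (heat (P.slice x.2) E (Real.sqrt (1 - E) * x.1)))
      (stdGaussian.prod ν) := by
  have hm := P.measurable_xlogx_heat_slice E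
  have hm' : Measurable fun x : ℝ × 𝓑 =>
      xlogx (heat (P.slice x.2) E (Real.sqrt (1 - E) * x.1)) := hm.comp measurable_swap
  rw [integrable_prod_iff' hm'.aestronglyMeasurable]
  constructor
  · filter_upwards [P.ae_tame, P.ae_integrable_xlogx_slice hH] with y hy hx
    exact integrable_xlogx_heat (P.measurable_slice y) hy.integrable_self (P.slice_nonneg y) hx hE
  · have hi2 : Integrable (fun y => ∫ u, P.slice y u ∂stdGaussian) ν := by
      refine ⟨(P.measurable_slice_uncurry measurable_fst
        measurable_snd).stronglyMeasurable.integral_prod_right.aestronglyMeasurable, ?_⟩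
      rw [hasFiniteIntegral_iff_ofReal (ae_of_all _ fun y => integral_nonneg (P.slice_nonneg y))]
      have e0 := P.lintegral_moment_slice 0 Even.zero
      simp only [pow_zero, one_mul, ENNReal.ofReal_one, lintegral_const, measure_univ] at e0
      rw [e0]; exact ENNReal.one_lt_top
    have hi1 : Integrable (fun y => ∫ u, |xlogx (P.slice y u)| ∂stdGaussian) ν :=
      (P.integrable_xlogx_slice hH).abs.integral_prod_right
    have hi3 : Integrable (fun y => |xlogx (∫ u, P.slice y u ∂stdGaussian)|) ν := by
      simp_rw [← meanEntropy_one]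
      exact (P.integrable_meanEntropy_one hH).abs
    refine ((hi1.add hi3).add (hi2.const_mul 2)).mono' ?_ ?_
    · exact hm.norm.stronglyMeasurable.integral_prod_right.aestronglyMeasurable
    · filter_upwards [P.ae_tame, P.ae_integrable_xlogx_slice hH] with y hy hx
      rw [Real.norm_of_nonneg (integral_nonneg fun _ => norm_nonneg _)]
      exact integral_abs_xlogx_heat_le (P.measurable_slice y) hy.integrable_self
        (P.slice_nonneg y) hx hE

lemma integral_phi [SFinite ν] (hH : P.FiniteEntropies stdGaussian) {E : ℝ}
    (hE : E ∈ Icc (0 : ℝ) 1) :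
    ∫ z, ∫ y, P.phi E z y * Real.logb 2 (P.phi E z y) ∂ν ∂stdGaussian =
      -(P.outEntropy E / Real.log 2) := by
  have h := integral_integral_swap (f := fun z y =>
    xlogx (heat (P.slice y) E (Real.sqrt (1 - E) * z))) (P.integrable_xlogx_heat_slice hH hE)
  have hl : Real.log 2 ≠ 0 := (Real.log_pos one_lt_two).ne'
  simp_rw [xlogx_eq_logb, integral_const_mul, ← phi_eq_heat] at h
  rw [outEntropy]
  simp_rw [meanEntropy, xlogx_eq_logb, integral_const_mul, ← phi_eq_heat]
  rw [← mul_left_cancel₀ hl h]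
  field_simp

/-- Multiplied by `R ln 2`, the energy is `H - E J/2`. If `J(0) = ∞`, then `toReal` gives `0`, which
the factor `E = 0` makes irrelevant. -/
lemma energyTerm_eq [SFinite ν] (hH : P.FiniteEntropies stdGaussian) {R E : ℝ} (hR : 0 < R)
    (hE : E ∈ Icc (0 : ℝ) 1) :
    P.energyTerm R E = (P.outEntropy E - E * ((P.avgFisher E).toReal / 2)) / (R * Real.log 2) := by
  rw [energyTerm, P.integral_phi hH hE, invNoise, ENNReal.toReal_div, ENNReal.toReal_ofReal hR.le]
  have hl : Real.log 2 ≠ 0 := (Real.log_pos one_lt_two).ne'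
  field_simp
  ring

end Real

end MemorylessChannel

end SparseSuperposition

/-! ### Output entropy and Fisher information as functions of the noise -/

namespace SparseSuperposition

lemma Tame.heat_eq_exp {g : ℝ → ℝ} (hg : Tame g) {E c : ℝ} (hE : E ∈ Ioc (0 : ℝ) 1)
    (h : ∀ p, heatDeriv g E p = c * heat g E p) (p : ℝ) :
    heat g E p = heat g E 0 * Real.exp (c * p) := by
  have hd : ∀ p, HasDerivAt (fun p => heat g E p * Real.exp (-c * p)) 0 p := fun p => by
    have h1 : HasDerivAt (fun p : ℝ => Real.exp (-c * p)) (Real.exp (-c * p) * (-c)) p := by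
      simpa using ((hasDerivAt_id p).const_mul (-c)).exp
    refine ((hg.hasDerivAt_heat hE p).mul h1).congr_deriv ?_
    rw [h p]; ring
  have hc := is_const_of_deriv_eq_zero (fun p => (hd p).differentiableAt) (fun p => (hd p).deriv) p 0
  simp only [mul_zero, Real.exp_zero, mul_one] at hc
  rw [← hc, mul_assoc, ← Real.exp_add]
  simp

/-- By the differential equation, `heat g E` is a multiple of `exp (c p)`. This is strictly convex
unless it vanishes or `c = 0`, and in both of these cases it is constant. -/
lemma Tame.ae_eq_const_of_second_difference {g : ℝ → ℝ} (hg : Tame g) (h0 : ∀ u, 0 ≤ g u)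
    {E c : ℝ} (hE : E ∈ Ioc (0 : ℝ) 1) (h : ∀ p, heatDeriv g E p = c * heat g E p)
    (h2 : heat g E 1 + heat g E (-1) - 2 * heat g E 0 ≤ 0) :
    ∀ᵐ u ∂stdGaussian, g u = heat g E 0 := by
  refine hg.ae_eq_const h0 hE fun p => ?_
  have he := hg.heat_eq_exp hE h
  rcases (heat_nonneg h0 E 0).eq_or_lt with h3 | h3
  · rw [he p, ← h3, zero_mul]
  · have hc : c = 0 := by
      by_contra hc
      rw [he 1, he (-1)] at h2
      have h4 := Real.add_one_lt_exp hc
      have h5 := Real.add_one_lt_exp (neg_ne_zero.2 hc)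
      rw [mul_one, mul_neg, mul_one] at h2
      nlinarith [mul_pos h3 (by linarith : 0 < Real.exp c + Real.exp (-c) - 2)]
    rw [he p, hc]; simp

lemma Tame.second_difference_nonneg {g : ℝ → ℝ} (hg : Tame g) (h0 : ∀ u, 0 ≤ g u)
    {E c : ℝ} (hE : E ∈ Ioc (0 : ℝ) 1) (h : ∀ p, heatDeriv g E p = c * heat g E p) :
    0 ≤ heat g E 1 + heat g E (-1) - 2 * heat g E 0 := by
  have he := hg.heat_eq_exp hE h
  rw [he 1, he (-1), mul_one, mul_neg, mul_one]
  have h3 := heat_nonneg h0 E 0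
  have h4 := Real.add_one_le_exp c
  have h5 := Real.add_one_le_exp (-c)
  nlinarith [mul_nonneg h3 (by linarith : 0 ≤ Real.exp c + Real.exp (-c) - 2)]

namespace MemorylessChannel

variable {𝓑 : Type*} [MeasurableSpace 𝓑] {ν : Measure 𝓑} (P : MemorylessChannel ℝ 𝓑 ν)

/-- Half of the averaged Fisher information, as a real number. -/
noncomputable def halfFisher (E : ℝ) : ℝ := (P.avgFisher E).toReal / 2

lemma halfFisher_nonneg (E : ℝ) : 0 ≤ P.halfFisher E := by unfold halfFisher; positivity

lemma halfFisher_eq [SFinite ν] {E : ℝ} (hE : E ∈ Ioc (0 : ℝ) 1) :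
    P.halfFisher E = (∫ y, meanFisher (P.slice y) E ∂ν) / 2 := by
  rw [halfFisher, P.toReal_avgFisher hE]

/-- The integrated form of the I-MMSE relation `H' = J / 2`. -/
lemma outEntropy_sub_bounds [SFinite ν] (hH : P.FiniteEntropies stdGaussian) {E₁ E₂ : ℝ}
    (h1 : 0 < E₁) (h2 : E₁ ≤ E₂) (h3 : E₂ ≤ 1) :
    (E₂ - E₁) * P.halfFisher E₂ ≤ P.outEntropy E₂ - P.outEntropy E₁ ∧
      P.outEntropy E₂ - P.outEntropy E₁ ≤ (E₂ - E₁) * P.halfFisher E₁ := by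
  have hE1 : E₁ ∈ Ioc (0 : ℝ) 1 := ⟨h1, h2.trans h3⟩
  have hE2 : E₂ ∈ Ioc (0 : ℝ) 1 := ⟨h1.trans_le h2, h3⟩
  have i1 := P.integrable_meanEntropy hH (Ioc_subset_Icc_self hE1)
  have i2 := P.integrable_meanEntropy hH (Ioc_subset_Icc_self hE2)
  have e : P.outEntropy E₂ - P.outEntropy E₁ =
      ∫ y, (meanEntropy (P.slice y) E₁ - meanEntropy (P.slice y) E₂) ∂ν := by
    rw [integral_sub i1 i2, outEntropy, outEntropy]; ring
  have hb : ∀ᵐ y ∂ν, (E₂ - E₁) / 2 * meanFisher (P.slice y) E₂ ≤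
      meanEntropy (P.slice y) E₁ - meanEntropy (P.slice y) E₂ ∧
      meanEntropy (P.slice y) E₁ - meanEntropy (P.slice y) E₂ ≤
        (E₂ - E₁) / 2 * meanFisher (P.slice y) E₁ := by
    filter_upwards [P.ae_tame, P.ae_integrable_xlogx_slice hH] with y hy hx
    exact hy.meanEntropy_sub_bounds (P.slice_nonneg y) hx h1 h2 h3
  have i12 : Integrable (fun y => meanEntropy (P.slice y) E₁ - meanEntropy (P.slice y) E₂) ν :=
    i1.sub i2
  rw [e, P.halfFisher_eq hE1, P.halfFisher_eq hE2]
  constructor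
  · have := integral_mono_ae ((P.integrable_meanFisher_slice hE2).const_mul ((E₂ - E₁) / 2))
      i12 (hb.mono fun y hy => hy.1)
    rw [integral_const_mul] at this
    linarith
  · have := integral_mono_ae i12
      ((P.integrable_meanFisher_slice hE1).const_mul ((E₂ - E₁) / 2)) (hb.mono fun y hy => hy.2)
    rw [integral_const_mul] at this
    linarith

lemma outEntropy_mem [SFinite ν] (hH : P.FiniteEntropies stdGaussian) {E : ℝ}
    (hE : E ∈ Icc (0 : ℝ) 1) :
    P.outEntropy 0 ≤ P.outEntropy E ∧ P.outEntropy E ≤ P.outEntropy 1 := by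
  have hi := P.integrable_meanEntropy hH hE
  constructor
  · refine neg_le_neg (integral_mono_ae hi (P.integrable_meanEntropy_zero hH) ?_)
    filter_upwards [P.ae_meanEntropy_mem hH] with y hy using (hy E hE).2
  · refine neg_le_neg (integral_mono_ae (P.integrable_meanEntropy_one hH) hi ?_)
    filter_upwards [P.ae_meanEntropy_mem hH] with y hy using (hy E hE).1

/-- For each output the entropy is monotone in `E` by de Bruijn's identity and semicontinuous at `0`
by `meanEntropy_zero_le`. The entropies at `0` and `1` dominate. -/
lemma tendsto_outEntropy_zero [SFinite ν] (hH : P.FiniteEntropies stdGaussian) :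
    Tendsto P.outEntropy (𝓝[>] 0) (𝓝 (P.outEntropy 0)) := by
  have hIoo : ∀ᶠ E : ℝ in 𝓝[>] 0, E ∈ Ioo (0 : ℝ) 1 := Ioo_mem_nhdsGT one_pos
  refine (tendsto_integral_filter_of_dominated_convergence
    (fun y => ‖meanEntropy (P.slice y) 0‖ + ‖meanEntropy (P.slice y) 1‖)
    (Eventually.of_forall fun E => (P.measurable_meanEntropy_slice E).aestronglyMeasurable) ?_
    ((P.integrable_meanEntropy_zero hH).norm.add (P.integrable_meanEntropy_one hH).norm) ?_).neg
  · filter_upwards [hIoo] with E hE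
    filter_upwards [P.ae_abs_meanEntropy_le hH] with y hy using hy E ⟨hE.1.le, hE.2.le⟩
  · filter_upwards [P.ae_tame, P.ae_integrable_xlogx_slice hH, P.ae_meanEntropy_mem hH] with y hy hx hm
    rw [tendsto_order]
    refine ⟨fun a ha => ?_, fun a ha => ?_⟩
    · obtain ⟨E₀, hE₀, hlt⟩ : ∃ E ∈ Ioc (0 : ℝ) 1, a < meanEntropy (P.slice y) E := by
        by_contra hcon
        push Not at hcon
        exact absurd (meanEntropy_zero_le (P.measurable_slice y) hy.integrable_self
          (P.slice_nonneg y) hx hcon) (not_le.2 ha)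
      filter_upwards [Ioo_mem_nhdsGT hE₀.1] with E hE
      have h1 := (hy.meanEntropy_sub_bounds (P.slice_nonneg y) hx hE.1 hE.2.le hE₀.2).1
      have h2 : 0 ≤ (E₀ - E) / 2 * meanFisher (P.slice y) E₀ :=
        mul_nonneg (by linarith [hE.2]) (meanFisher_nonneg (P.slice_nonneg y) _)
      linarith
    · filter_upwards [hIoo] with E hE
      exact (hm E ⟨hE.1.le, hE.2.le⟩).2.trans_lt ha

lemma halfFisher_antitone [SFinite ν] {E₁ E₂ : ℝ} (h1 : 0 < E₁) (h2 : E₁ ≤ E₂) (h3 : E₂ ≤ 1) :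
    P.halfFisher E₂ ≤ P.halfFisher E₁ := by
  rw [P.halfFisher_eq ⟨h1, h2.trans h3⟩, P.halfFisher_eq ⟨h1.trans_le h2, h3⟩]
  have : ∫ y, meanFisher (P.slice y) E₂ ∂ν ≤ ∫ y, meanFisher (P.slice y) E₁ ∂ν := by
    refine integral_mono_ae (P.integrable_meanFisher_slice ⟨h1.trans_le h2, h3⟩)
      (P.integrable_meanFisher_slice ⟨h1, h2.trans h3⟩) ?_
    filter_upwards [P.ae_tame] with y hy
    exact hy.meanFisher_antitone (P.slice_nonneg y) h1 h2 h3
  linarith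

lemma integrable_heat_slice [SFinite ν] {E : ℝ} (hE : E ∈ Ioc (0 : ℝ) 1) (p : ℝ) :
    Integrable (fun y => heat (P.slice y) E p) ν ∧ ∫ y, heat (P.slice y) E p ∂ν = 1 := by
  have hm : Measurable fun y => heat (P.slice y) E p :=
    (P.measurable_heat_slice E).comp (by fun_prop : Measurable fun y : 𝓑 => (y, p))
  have h0 : ∀ y, 0 ≤ heat (P.slice y) E p := fun y => heat_nonneg (P.slice_nonneg y) _ _
  have h1 : ∫⁻ y, ENNReal.ofReal (heat (P.slice y) E p) ∂ν = 1 := by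
    have h := P.lintegral_lintegral_slice (gaussianReal p E.toNNReal) (f := 1) measurable_const
    simp only [Pi.one_apply, one_mul, lintegral_const, measure_univ] at h
    rw [← h]
    refine lintegral_congr_ae ?_
    filter_upwards [P.ae_tame] with y hy
    rw [heat, ofReal_integral_eq_lintegral_ofReal (hy.integrable_comp p hE)
      (ae_of_all _ fun n => P.slice_nonneg y _), gaussianReal_eq_map,
      lintegral_map (P.measurable_slice y).ennreal_ofReal (by fun_prop)]
  refine ⟨⟨hm.aestronglyMeasurable, ?_⟩, ?_⟩
  · rw [hasFiniteIntegral_iff_ofReal (ae_of_all _ h0), h1]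
    exact ENNReal.one_lt_top
  · rw [integral_eq_lintegral_of_nonneg_ae (ae_of_all _ h0) hm.aestronglyMeasurable, h1]
    simp

/-- If `J` took equal values, almost every smoothed likelihood would be of the form `A exp (c p)`,
hence convex in `p`. The likelihoods have total mass `1` for each `p`, so their second differences
integrate to `0` and vanish. Then almost every likelihood is constant, and the output carries no
information. -/
lemma halfFisher_strictAnti [SFinite ν] (hI : P.outEntropy 0 < P.outEntropy 1) {E₁ E₂ : ℝ}
    (h1 : 0 < E₁) (h2 : E₁ < E₂) (h3 : E₂ ≤ 1) : P.halfFisher E₂ < P.halfFisher E₁ := by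
  by_contra hcon
  have hE1 : E₁ ∈ Ioc (0 : ℝ) 1 := ⟨h1, h2.le.trans h3⟩
  have hE2 : E₂ ∈ Ioc (0 : ℝ) 1 := ⟨h1.trans h2, h3⟩
  rw [P.halfFisher_eq hE1, P.halfFisher_eq hE2] at hcon
  have i1 := P.integrable_meanFisher_slice hE1
  have i2 := P.integrable_meanFisher_slice hE2
  have hle : ∀ᵐ y ∂ν, 0 ≤ meanFisher (P.slice y) E₁ - meanFisher (P.slice y) E₂ := by
    filter_upwards [P.ae_tame] with y hy
    exact sub_nonneg.2 (hy.meanFisher_antitone (P.slice_nonneg y) h1 h2.le h3)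
  have hz : ∫ y, (meanFisher (P.slice y) E₁ - meanFisher (P.slice y) E₂) ∂ν = 0 := by
    refine le_antisymm ?_ (integral_nonneg_of_ae hle)
    rw [integral_sub i1 i2]; linarith
  have i12 : Integrable (fun y => meanFisher (P.slice y) E₁ - meanFisher (P.slice y) E₂) ν := i1.sub i2
  rw [integral_eq_zero_iff_of_nonneg_ae hle i12] at hz
  have hc : ∀ᵐ y ∂ν, ∃ c : ℝ, ∀ p, heatDeriv (P.slice y) E₁ p = c * heat (P.slice y) E₁ p := by
    filter_upwards [P.ae_tame, hz] with y hy hzy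
    simp only [Pi.zero_apply] at hzy
    exact hy.exists_heatDeriv_eq (P.slice_nonneg y) h1 h2 h3 (by linarith)
  obtain ⟨ia, ea⟩ := P.integrable_heat_slice hE1 1
  obtain ⟨ib, eb⟩ := P.integrable_heat_slice hE1 (-1)
  obtain ⟨ic, ec⟩ := P.integrable_heat_slice hE1 0
  have iab : Integrable (fun y => heat (P.slice y) E₁ 1 + heat (P.slice y) E₁ (-1)) ν := ia.add ib
  have iabc : Integrable (fun y => heat (P.slice y) E₁ 1 + heat (P.slice y) E₁ (-1) -
    2 * heat (P.slice y) E₁ 0) ν := iab.sub (ic.const_mul 2)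
  have hs0 : ∀ᵐ y ∂ν, 0 ≤ heat (P.slice y) E₁ 1 + heat (P.slice y) E₁ (-1) -
      2 * heat (P.slice y) E₁ 0 := by
    filter_upwards [P.ae_tame, hc] with y hy ⟨c, hc⟩
    exact hy.second_difference_nonneg (P.slice_nonneg y) hE1 hc
  have hsz : ∫ y, (heat (P.slice y) E₁ 1 + heat (P.slice y) E₁ (-1) -
      2 * heat (P.slice y) E₁ 0) ∂ν = 0 := by
    rw [integral_sub iab (ic.const_mul 2), integral_add ia ib, integral_const_mul, ea, eb, ec]
    norm_num
  rw [integral_eq_zero_iff_of_nonneg_ae hs0 iabc] at hsz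
  have hconst : ∀ᵐ y ∂ν, meanEntropy (P.slice y) 0 = meanEntropy (P.slice y) 1 := by
    filter_upwards [P.ae_tame, hc, hsz] with y hy ⟨c, hc⟩ hzy
    have hae := hy.ae_eq_const_of_second_difference (P.slice_nonneg y) hE1 hc hzy.le
    rw [meanEntropy_zero, meanEntropy_one, integral_congr_ae hae,
      integral_congr_ae (hae.mono fun u hu => congrArg xlogx hu)]
    simp
  rw [outEntropy, outEntropy, integral_congr_ae hconst] at hI
  exact lt_irrefl _ hI

/-- Monotonicity bounds the left limit from below, `le_meanFisher_one` from above. This continuity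
extends a strict inequality at `E = 1` to nearby `E`. -/
lemma tendsto_halfFisher_one [SFinite ν] :
    Tendsto P.halfFisher (𝓝[<] 1) (𝓝 (P.halfFisher 1)) := by
  have hmem : ∀ᶠ E : ℝ in 𝓝[<] 1, E ∈ Ioo (1 / 2 : ℝ) 1 := Ioo_mem_nhdsLT (by norm_num)
  have h1 : (1 : ℝ) ∈ Ioc (0 : ℝ) 1 := ⟨one_pos, le_rfl⟩
  have h2 : (1 / 2 : ℝ) ∈ Ioc (0 : ℝ) 1 := by norm_num
  have key : Tendsto (fun E => ∫ y, meanFisher (P.slice y) E ∂ν) (𝓝[<] 1)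
      (𝓝 (∫ y, meanFisher (P.slice y) 1 ∂ν)) := by
    refine tendsto_integral_filter_of_dominated_convergence
      (fun y => meanFisher (P.slice y) (1 / 2))
      (Eventually.of_forall fun E => (P.measurable_meanFisher_slice E).aestronglyMeasurable) ?_
      (P.integrable_meanFisher_slice h2) ?_
    · filter_upwards [hmem] with E hE
      filter_upwards [P.ae_tame] with y hy
      rw [Real.norm_of_nonneg (meanFisher_nonneg (P.slice_nonneg y) E)]
      exact hy.meanFisher_antitone (P.slice_nonneg y) (by norm_num) hE.1.le hE.2.le
    · filter_upwards [P.ae_tame] with y hy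
      rw [tendsto_order]
      refine ⟨fun a ha => ?_, fun a ha => ?_⟩
      · filter_upwards [hmem] with E hE
        exact ha.trans_le (hy.meanFisher_antitone (P.slice_nonneg y) (by linarith [hE.1])
          hE.2.le le_rfl)
      · obtain ⟨E₀, hE₀, hlt⟩ : ∃ E ∈ Ioo (0 : ℝ) 1, meanFisher (P.slice y) E < a := by
          by_contra hcon
          push Not at hcon
          exact absurd (hy.le_meanFisher_one (P.slice_nonneg y) hcon) (not_le.2 ha)
        filter_upwards [Ioo_mem_nhdsLT hE₀.2] with E hE
        exact (hy.meanFisher_antitone (P.slice_nonneg y) hE₀.1 hE.1.le hE.2.le).trans_lt hlt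
  rw [P.halfFisher_eq h1]
  refine (key.div_const 2).congr' ?_
  filter_upwards [hmem] with E hE
  rw [P.halfFisher_eq ⟨by linarith [hE.1], hE.2.le⟩]

lemma avgFisher_eq_ofReal [SFinite ν] {E : ℝ} (hE : E ∈ Ioc (0 : ℝ) 1) :
    P.avgFisher E = ENNReal.ofReal (2 * P.halfFisher E) := by
  rw [halfFisher, mul_div_cancel₀ _ two_ne_zero, ENNReal.ofReal_toReal (P.avgFisher_ne_top hE)]

lemma avgFisher_zero_eq : P.avgFisher 0 = liminf P.avgFisher (𝓝[>] 0) := by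
  conv_lhs => rw [avgFisher, if_pos rfl]
  refine liminf_congr ?_
  filter_upwards [self_mem_nhdsWithin] with e he
  rw [avgFisher, if_neg (ne_of_gt he)]

lemma avgFisher_le_zero [SFinite ν] {E : ℝ} (hE : E ∈ Ioc (0 : ℝ) 1) :
    P.avgFisher E ≤ P.avgFisher 0 := by
  rw [avgFisher_zero_eq]
  refine le_liminf_of_le (by isBoundedDefault) ?_
  filter_upwards [Ioo_mem_nhdsGT hE.1] with e he
  rw [P.avgFisher_eq_ofReal hE, P.avgFisher_eq_ofReal ⟨he.1, he.2.le.trans hE.2⟩]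
  exact ENNReal.ofReal_le_ofReal (by linarith [P.halfFisher_antitone he.1 he.2.le hE.2])

/-- As `J` is monotone, the lower limit in the definition of `J(0)` is a limit and a supremum. -/
lemma tendsto_avgFisher_zero [SFinite ν] :
    Tendsto P.avgFisher (𝓝[>] 0) (𝓝 (P.avgFisher 0)) := by
  have hIoo : ∀ᶠ E : ℝ in 𝓝[>] 0, E ∈ Ioo (0 : ℝ) 1 := Ioo_mem_nhdsGT one_pos
  refine tendsto_of_le_liminf_of_limsup_le P.avgFisher_zero_eq.le ?_ (by isBoundedDefault)
    (by isBoundedDefault)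
  refine limsup_le_of_le (by isBoundedDefault) ?_
  filter_upwards [hIoo] with E hE
  exact P.avgFisher_le_zero ⟨hE.1, hE.2.le⟩

/-- It converts conditions on the possibly infinite `J(0)` into conditions at some `E > 0`, where
`J` is finite. -/
lemma lt_avgFisher_zero_iff [SFinite ν] {a : ℝ≥0∞} :
    a < P.avgFisher 0 ↔ ∃ E ∈ Ioc (0 : ℝ) 1, a < P.avgFisher E := by
  constructor
  · intro h
    have hIoo : ∀ᶠ E : ℝ in 𝓝[>] 0, E ∈ Ioo (0 : ℝ) 1 := Ioo_mem_nhdsGT one_pos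
    obtain ⟨E, h1, h2⟩ := ((P.tendsto_avgFisher_zero.eventually (lt_mem_nhds h)).and hIoo).exists
    exact ⟨E, ⟨h2.1, h2.2.le⟩, h1⟩
  · rintro ⟨E, hE, h⟩
    exact h.trans_le (P.avgFisher_le_zero hE)

end MemorylessChannel

end SparseSuperposition

namespace SparseSuperposition

namespace MemorylessChannel

/-! ### Mutual information as a difference of entropies -/

section Info

variable {𝓐 𝓑 : Type*} [MeasurableSpace 𝓐] [MeasurableSpace 𝓑] {ν : Measure 𝓑}
  (W : MemorylessChannel 𝓐 𝓑 ν) (μ : Measure 𝓐)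

lemma measurable_density_prod : Measurable fun x : 𝓐 × 𝓑 => W.density x.1 x.2 :=
  W.measurable_density

lemma ae_prod_of_ae_ae_swap {μ : Measure 𝓐} [SFinite μ] [SFinite ν] {p : 𝓐 × 𝓑 → Prop}
    (hp : MeasurableSet {x | p x}) (h : ∀ᵐ y ∂ν, ∀ᵐ a ∂μ, p (a, y)) : ∀ᵐ x ∂(μ.prod ν), p x := by
  rw [← Measure.prod_swap, ae_map_iff measurable_swap.aemeasurable hp]
  exact (Measure.ae_prod_iff_ae_ae (hp.preimage measurable_swap)).2 h

lemma measurable_density_left (y : 𝓑) : Measurable fun a => W.density a y :=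
  W.measurable_density.comp (measurable_id.prodMk measurable_const)

lemma integrable_density [SFinite ν] [IsProbabilityMeasure μ] :
    Integrable (fun x : 𝓐 × 𝓑 => W.density x.1 x.2) (μ.prod ν) := by
  refine ⟨W.measurable_density.aestronglyMeasurable, ?_⟩
  rw [hasFiniteIntegral_iff_ofReal (ae_of_all _ fun x => W.density_nonneg _ _),
    lintegral_prod _ W.measurable_density_prod.ennreal_ofReal.aemeasurable]
  simp [W.lintegral_density]

lemma outDensity_nonneg (y : 𝓑) : 0 ≤ W.outDensity μ y :=
  integral_nonneg fun _ => W.density_nonneg _ _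

lemma measurable_outDensity [SFinite μ] : Measurable (W.outDensity μ) := by
  have : Measurable fun x : 𝓑 × 𝓐 => W.density x.2 x.1 := W.measurable_density.comp measurable_swap
  exact this.stronglyMeasurable.integral_prod_right.measurable

/-- `W ln W`, `W ln q` and `q ln q` are integrable. -/
lemma integrable_density_mul_log [SFinite ν] [IsProbabilityMeasure μ] (hH : W.FiniteEntropies μ) :
    Integrable (fun x : 𝓐 × 𝓑 => W.density x.1 x.2 * Real.logb 2 (W.outDensity μ x.2))
      (μ.prod ν) := by
  have hm : Measurable fun x : 𝓐 × 𝓑 => W.density x.1 x.2 * Real.logb 2 (W.outDensity μ x.2) :=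
    W.measurable_density.mul ((Real.measurable_log.comp
      ((W.measurable_outDensity μ).comp measurable_snd)).div_const _)
  rw [integrable_prod_iff' hm.aestronglyMeasurable]
  have hi := (W.integrable_density μ).prod_left_ae
  refine ⟨hi.mono fun y hy => Integrable.mul_const hy (Real.logb 2 (W.outDensity μ y)), ?_⟩
  refine hH.1.norm.congr (hi.mono fun y hy => ?_)
  simp only [norm_mul]
  rw [integral_mul_const]
  simp_rw [Real.norm_of_nonneg (W.density_nonneg _ _)]
  rw [Real.norm_of_nonneg (W.outDensity_nonneg μ y)]
  rfl

lemma integral_density_mul_log [SFinite ν] [IsProbabilityMeasure μ] (hH : W.FiniteEntropies μ) :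
    ∫ a, ∫ y, W.density a y * Real.logb 2 (W.outDensity μ y) ∂ν ∂μ =
      ∫ y, W.outDensity μ y * Real.logb 2 (W.outDensity μ y) ∂ν := by
  rw [integral_integral_swap (f := fun a y => W.density a y * Real.logb 2 (W.outDensity μ y))
    (W.integrable_density_mul_log μ hH)]
  congr 1; ext y
  rw [integral_mul_const]; rfl

lemma jointLaw_map_snd [SFinite ν] [IsProbabilityMeasure μ] :
    (W.jointLaw μ).map Prod.snd = ν.withDensity fun y => ENNReal.ofReal (W.outDensity μ y) := by
  ext s hs
  rw [Measure.map_apply measurable_snd hs, jointLaw, withDensity_apply _ (measurable_snd hs),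
    withDensity_apply _ hs, ← lintegral_indicator (measurable_snd hs), ← lintegral_indicator hs,
    lintegral_prod_symm]
  · refine lintegral_congr_ae ?_
    filter_upwards [(W.integrable_density μ).prod_left_ae] with y hy
    by_cases h : y ∈ s
    · simp only [indicator_of_mem h, outDensity]
      rw [ofReal_integral_eq_lintegral_ofReal hy (ae_of_all _ fun a => W.density_nonneg a y)]
      refine lintegral_congr fun a => ?_
      rw [indicator_of_mem (by exact h)]
    · simp only [indicator_of_notMem h]
      refine (lintegral_congr fun a => ?_).trans lintegral_zero
      rw [indicator_of_notMem (by exact h)]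
  · exact (W.measurable_density.ennreal_ofReal.indicator (measurable_snd hs)).aemeasurable

instance [SFinite ν] [IsProbabilityMeasure μ] : IsProbabilityMeasure (W.jointLaw μ) := by
  refine ⟨?_⟩
  rw [jointLaw, withDensity_apply _ MeasurableSet.univ, Measure.restrict_univ,
    lintegral_prod _ W.measurable_density_prod.ennreal_ofReal.aemeasurable]
  simp [W.lintegral_density]

/-- The density of the joint law with respect to the product of the marginals is `W / q`. Where the
output density `q` vanishes, so does `W` almost everywhere, hence nothing is lost by the division.
-/
lemma jointLaw_eq_withDensity [SigmaFinite ν] [IsProbabilityMeasure μ] :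
    W.jointLaw μ = (μ.prod ((W.jointLaw μ).map Prod.snd)).withDensity
      fun x => ENNReal.ofReal (W.density x.1 x.2 / W.outDensity μ x.2) := by
  have hmq := (W.measurable_outDensity μ).ennreal_ofReal
  have hmr : Measurable fun x : 𝓐 × 𝓑 => ENNReal.ofReal (W.density x.1 x.2 / W.outDensity μ x.2) :=
    (W.measurable_density.div ((W.measurable_outDensity μ).comp measurable_snd)).ennreal_ofReal
  have hmd : Measurable fun x : 𝓐 × 𝓑 => ENNReal.ofReal (W.density x.1 x.2) :=
    W.measurable_density.ennreal_ofReal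
  have hmq' : Measurable fun x : 𝓐 × 𝓑 => ENNReal.ofReal (W.outDensity μ x.2) :=
    hmq.comp measurable_snd
  rw [jointLaw_map_snd, prod_withDensity_right hmq, ← withDensity_mul _ hmq' hmr, jointLaw]
  refine withDensity_congr_ae ?_
  have hms : MeasurableSet {x : 𝓐 × 𝓑 | W.outDensity μ x.2 = 0 → W.density x.1 x.2 = 0} := by
    have h1 := measurableSet_eq_fun ((W.measurable_outDensity μ).comp
      (measurable_snd : Measurable (Prod.snd : 𝓐 × 𝓑 → 𝓑))) (measurable_const (a := (0 : ℝ)))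
    have h2 := measurableSet_eq_fun W.measurable_density (measurable_const (a := (0 : ℝ)))
    exact h1.imp h2
  have hz : ∀ᵐ x ∂(μ.prod ν), W.outDensity μ x.2 = 0 → W.density x.1 x.2 = 0 := by
    refine ae_prod_of_ae_ae_swap hms ?_
    filter_upwards [(W.integrable_density μ).prod_left_ae] with y hy
    by_cases h : W.outDensity μ y = 0
    · have h' := h
      rw [outDensity, integral_eq_zero_iff_of_nonneg (fun a => W.density_nonneg a y) hy] at h'
      filter_upwards [h'] with a ha _ using ha
    · exact ae_of_all _ fun a h' => absurd h' h
  filter_upwards [hz] with x hx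
  simp only [Pi.mul_apply]
  rw [← ENNReal.ofReal_mul (W.outDensity_nonneg μ _)]
  by_cases h : W.outDensity μ x.2 = 0
  · rw [hx h, h]; simp
  · rw [mul_div_cancel₀ _ h]

/-- The mutual information as a difference of entropies. -/
lemma mutualInfo_eq [SigmaFinite ν] [IsProbabilityMeasure μ] (hH : W.FiniteEntropies μ) :
    W.mutualInfo μ = ENNReal.ofReal (W.infoIntegral μ) := by
  have hJ := W.jointLaw_eq_withDensity μ
  have : IsProbabilityMeasure ((W.jointLaw μ).map Prod.snd) :=
    Measure.isProbabilityMeasure_map measurable_snd.aemeasurable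
  set M := μ.prod ((W.jointLaw μ).map Prod.snd) with hM
  set r : 𝓐 × 𝓑 → ℝ := fun x => W.density x.1 x.2 / W.outDensity μ x.2 with hr
  have hr0 : ∀ x, 0 ≤ r x := fun x => div_nonneg (W.density_nonneg _ _) (W.outDensity_nonneg μ _)
  have hmr : Measurable r :=
    W.measurable_density.div ((W.measurable_outDensity μ).comp measurable_snd)
  have hac : W.jointLaw μ ≪ M := by rw [hJ]; exact withDensity_absolutelyContinuous _ _
  have hrn : (W.jointLaw μ).rnDeriv M =ᵐ[M] fun x => ENNReal.ofReal (r x) := by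
    conv_lhs => rw [hJ]
    exact Measure.rnDeriv_withDensity M hmr.ennreal_ofReal
  have hllr : llr (W.jointLaw μ) M =ᵐ[W.jointLaw μ] fun x => Real.log (r x) := by
    filter_upwards [hac.ae_le hrn] with x hx
    rw [llr, hx, ENNReal.toReal_ofReal (hr0 x)]
  have hl : Real.log 2 ≠ 0 := (Real.log_pos one_lt_two).ne'
  -- integrals against the joint law
  have hwd : ∀ x : 𝓐 × 𝓑, (ENNReal.ofReal (W.density x.1 x.2)).toReal = W.density x.1 x.2 :=
    fun x => ENNReal.toReal_ofReal (W.density_nonneg _ _)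
  -- The logarithm of the quotient splits where `W` and `q` are nonzero. If `W = 0` both sides are
  -- `0`, and `q = 0 < W` occurs only on a null set.
  have hq0 : ∀ᵐ x ∂(μ.prod ν), W.density x.1 x.2 * Real.log (r x) =
      Real.log 2 * (W.density x.1 x.2 * Real.logb 2 (W.density x.1 x.2) -
        W.density x.1 x.2 * Real.logb 2 (W.outDensity μ x.2)) := by
    have hms : MeasurableSet {x : 𝓐 × 𝓑 | W.density x.1 x.2 * Real.log (r x) =
      Real.log 2 * (W.density x.1 x.2 * Real.logb 2 (W.density x.1 x.2) -
        W.density x.1 x.2 * Real.logb 2 (W.outDensity μ x.2))} := by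
      have m1 : Measurable fun x : 𝓐 × 𝓑 => W.density x.1 x.2 := W.measurable_density
      have m2 : Measurable fun x : 𝓐 × 𝓑 => W.outDensity μ x.2 :=
        (W.measurable_outDensity μ).comp measurable_snd
      have m3 : Measurable fun x : 𝓐 × 𝓑 => Real.logb 2 (W.density x.1 x.2) :=
        (Real.measurable_log.comp m1).div_const _
      have m4 : Measurable fun x : 𝓐 × 𝓑 => Real.logb 2 (W.outDensity μ x.2) :=
        (Real.measurable_log.comp m2).div_const _
      exact measurableSet_eq_fun (m1.mul (Real.measurable_log.comp hmr))
        (((m1.mul m3).sub (m1.mul m4)).const_mul _)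
    refine ae_prod_of_ae_ae_swap hms ?_
    filter_upwards [(W.integrable_density μ).prod_left_ae] with y hy
    by_cases h : W.outDensity μ y = 0
    · have h' := h
      rw [outDensity, integral_eq_zero_iff_of_nonneg (fun a => W.density_nonneg a y) hy] at h'
      filter_upwards [h'] with a ha
      simp only [Pi.zero_apply] at ha
      simp [ha]
    · refine ae_of_all _ fun a => ?_
      by_cases ha : W.density a y = 0
      · simp [ha]
      · simp only [hr, Real.logb]
        rw [Real.log_div ha h]
        field_simp
  have i1 := hH.2
  have i2 := W.integrable_density_mul_log μ hH
  have i3 : Integrable (fun x => W.density x.1 x.2 * Real.log (r x)) (μ.prod ν) :=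
    ((i1.sub i2).const_mul (Real.log 2)).congr (hq0.mono fun x hx => hx.symm)
  have iJ : Integrable (fun x => Real.log (r x)) (W.jointLaw μ) := by
    rw [jointLaw, integrable_withDensity_iff_integrable_smul' W.measurable_density_prod.ennreal_ofReal
      (ae_of_all _ fun _ => ENNReal.ofReal_lt_top)]
    refine i3.congr (ae_of_all _ fun x => ?_)
    simp only [smul_eq_mul]
    rw [hwd]
  have eJ : ∫ x, Real.log (r x) ∂(W.jointLaw μ) = Real.log 2 * W.infoIntegral μ := by
    rw [jointLaw, integral_withDensity_eq_integral_toReal_smul W.measurable_density_prod.ennreal_ofReal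
      (ae_of_all _ fun _ => ENNReal.ofReal_lt_top)]
    simp only [smul_eq_mul, hwd]
    rw [integral_congr_ae hq0, integral_const_mul, integral_sub i1 i2, integral_prod _ i1,
      integral_prod _ i2, infoIntegral]
    simp only [outDensity]
    ring
  rw [mutualInfo, InformationTheory.klDiv_of_ac_of_integrable hac (iJ.congr hllr.symm),
    integral_congr_ae hllr, eJ, probReal_univ, probReal_univ, add_sub_cancel_right,
    ← ENNReal.ofReal_div_of_pos (Real.log_pos one_lt_two), mul_div_cancel_left₀ _ hl]

end Info

section Map

variable {𝓐 𝓑 : Type*} [MeasurableSpace 𝓐] [MeasurableSpace 𝓑] {ν : Measure 𝓑}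
  (W : MemorylessChannel 𝓐 𝓑 ν) (μ : Measure ℝ) (π : ℝ → 𝓐) (hπ : Measurable π)

lemma outDensity_withMap (hπ : Measurable π) :
    (W.withMap π hπ).outDensity μ = W.outDensity (μ.map π) := by
  ext y
  rw [outDensity, outDensity, integral_map hπ.aemeasurable
    (W.measurable_density_left y).aestronglyMeasurable]
  rfl

lemma finiteEntropies_withMap [SigmaFinite ν] [IsProbabilityMeasure μ] (hπ : Measurable π)
    (hH : W.FiniteEntropies (μ.map π)) : (W.withMap π hπ).FiniteEntropies μ := by
  refine ⟨?_, ?_⟩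
  · rw [outDensity_withMap]; exact hH.1
  · have hmp := Measure.map_prod_map μ ν hπ measurable_id
    rw [Measure.map_id] at hmp
    have h2 := hH.2
    rw [hmp] at h2
    exact h2.comp_measurable (hπ.prodMap measurable_id)

lemma infoIntegral_withMap [SigmaFinite ν] [IsProbabilityMeasure μ] (hπ : Measurable π) :
    (W.withMap π hπ).infoIntegral μ = W.infoIntegral (μ.map π) := by
  have : IsProbabilityMeasure (μ.map π) := Measure.isProbabilityMeasure_map hπ.aemeasurable
  have m1 : Measurable fun x : 𝓐 × 𝓑 => W.density x.1 x.2 := W.measurable_density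
  have m2 : Measurable fun x : 𝓐 × 𝓑 => W.outDensity (μ.map π) x.2 :=
    (W.measurable_outDensity _).comp measurable_snd
  have m3 : Measurable fun x : 𝓐 × 𝓑 => Real.logb 2 (W.density x.1 x.2) :=
    (Real.measurable_log.comp m1).div_const _
  have m4 : Measurable fun x : 𝓐 × 𝓑 => Real.logb 2 (W.outDensity (μ.map π) x.2) :=
    (Real.measurable_log.comp m2).div_const _
  have m5 : Measurable fun x : 𝓐 × 𝓑 =>
      W.density x.1 x.2 * Real.logb 2 (W.density x.1 x.2) := m1.mul m3
  have m6 : Measurable fun x : 𝓐 × 𝓑 =>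
      W.density x.1 x.2 * Real.logb 2 (W.outDensity (μ.map π) x.2) := m1.mul m4
  have h1 := integral_map hπ.aemeasurable
    (m5.stronglyMeasurable.integral_prod_right' (ν := ν)).aestronglyMeasurable (μ := μ)
  have h2 := integral_map hπ.aemeasurable
    (m6.stronglyMeasurable.integral_prod_right' (ν := ν)).aestronglyMeasurable (μ := μ)
  have e := fun y => congrFun (outDensity_withMap W μ π hπ) y
  simp only [outDensity] at e
  simp only [outDensity] at h2
  rw [infoIntegral, infoIntegral]
  simp_rw [e]
  exact congrArg₂ (fun a b => -a + b) h2.symm h1.symm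

end Map

section Real

variable {𝓑 : Type*} [MeasurableSpace 𝓑] {ν : Measure 𝓑} (P : MemorylessChannel ℝ 𝓑 ν)

/-- At `E = 1` the smoothed likelihood is the output density, at `E = 0` it is the likelihood
itself. So `outEntropy` interpolates between `H(Y|A)` and `H(Y)`, in nats. -/
lemma infoIntegral_eq [SigmaFinite ν] (hH : P.FiniteEntropies stdGaussian) :
    P.infoIntegral stdGaussian = (P.outEntropy 1 - P.outEntropy 0) / Real.log 2 := by
  have hl : Real.log 2 ≠ 0 := (Real.log_pos one_lt_two).ne'
  have h1 := P.integral_density_mul_log stdGaussian hH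
  have h2 := integral_integral_swap (f := fun a y => P.density a y * Real.logb 2 (P.density a y)) hH.2
  rw [infoIntegral, h2]
  have e1 : P.outEntropy 1 = -(Real.log 2 * ∫ y, P.outDensity stdGaussian y *
      Real.logb 2 (P.outDensity stdGaussian y) ∂ν) := by
    rw [outEntropy, ← integral_const_mul]
    congr 2; ext y
    rw [meanEntropy_one, xlogx_eq_logb]; rfl
  have e0 : P.outEntropy 0 = -(Real.log 2 * ∫ y, ∫ a, P.density a y *
      Real.logb 2 (P.density a y) ∂stdGaussian ∂ν) := by
    rw [outEntropy, ← integral_const_mul]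
    congr 2; ext y
    rw [meanEntropy_zero, ← integral_const_mul]
    simp_rw [xlogx_eq_logb]; rfl
  rw [e1, e0, ← h1]
  simp only [outDensity]
  field_simp
  ring

end Real

end MemorylessChannel

end SparseSuperposition

namespace SparseSuperposition

/-! ### The large alphabet limit of the entropy term -/

lemma tendsto_redEntropy (v : ℝ≥0∞) : Tendsto (fun B : ℕ => redEntropy B v) atTop
    (𝓝 ((1 - v / ENNReal.ofReal (2 * Real.log 2)).toReal)) := by
  have hl : 0 < 2 * Real.log 2 := by have := Real.log_pos one_lt_two; linarith
  by_cases hv : v = ∞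
  · subst hv
    rw [ENNReal.top_div_of_ne_top ENNReal.ofReal_ne_top]
    refine tendsto_const_nhds.congr' ?_
    filter_upwards [eventually_ge_atTop 2] with B hB
    rw [redEntropy_top hB]; simp
  · have e : (1 - v / ENNReal.ofReal (2 * Real.log 2)).toReal =
        max 0 (1 - v.toReal / (2 * Real.log 2)) := by
      rw [← ENNReal.ofReal_toReal hv, ← ENNReal.ofReal_div_of_pos hl, ← ENNReal.ofReal_one,
        ← ENNReal.ofReal_sub _ (by positivity), ENNReal.toReal_ofReal',
        ENNReal.toReal_ofReal ENNReal.toReal_nonneg, max_comm]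
    rw [e]
    have hlog : Tendsto (fun B : ℕ => Real.log (B : ℝ)) atTop atTop :=
      Real.tendsto_log_atTop.comp tendsto_natCast_atTop_atTop
    have hup : Tendsto (fun B : ℕ => max 0 (1 - v.toReal / (2 * Real.log 2)) +
        ((1 + Real.log 2) / Real.log B + Real.sqrt (v.toReal / Real.log 2) *
          (∫ x, |x| ∂stdGaussian) / Real.sqrt (Real.log B))) atTop
        (𝓝 (max 0 (1 - v.toReal / (2 * Real.log 2)) + (0 + 0))) :=
      tendsto_const_nhds.add ((hlog.const_div_atTop _).add
        ((Real.tendsto_sqrt_atTop.comp hlog).const_div_atTop _))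
    rw [add_zero, add_zero] at hup
    refine tendsto_of_tendsto_of_tendsto_of_le_of_le' tendsto_const_nhds hup ?_ ?_
    · filter_upwards [eventually_ge_atTop 2] with B hB
      exact max_le (redEntropy_nonneg hB _) (redEntropy_ge hB hv)
    · filter_upwards [eventually_ge_atTop 2] with B hB
      exact redEntropy_le hB hv

namespace MemorylessChannel

variable {𝓑 : Type*} [MeasurableSpace 𝓑] {ν : Measure 𝓑} (P : MemorylessChannel ℝ 𝓑 ν)

lemma potential_eq (B : ℕ) (R E : ℝ) : P.potential B R E - (1 + (B : ℝ) / (2 * Real.log B)) =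
    P.energyTerm R E - redEntropy B (P.invNoise R E) := by
  rw [potential, redEntropy]; ring

theorem tendsto_potential (R E : ℝ) :
    Tendsto (fun B : ℕ => P.potential B R E - (1 + (B : ℝ) / (2 * Real.log B))) atTop
      (𝓝 (P.largePotential R E)) := by
  simp_rw [potential_eq]
  exact tendsto_const_nhds.sub (tendsto_redEntropy _)

/-! ### Entropy inequalities at vanishing noise -/

lemma mul_halfFisher_le [SFinite ν] (hH : P.FiniteEntropies stdGaussian) {E : ℝ}
    (hE : E ∈ Ioc (0 : ℝ) 1) : E * P.halfFisher E ≤ P.outEntropy E - P.outEntropy 0 := by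
  have h1 : Tendsto (fun e => (E - e) * P.halfFisher E) (𝓝[>] 0) (𝓝 ((E - 0) * P.halfFisher E)) :=
    ((tendsto_const_nhds.sub (tendsto_id.mono_left nhdsWithin_le_nhds)).mul_const _)
  have h2 := (tendsto_const_nhds (x := P.outEntropy E)).sub (P.tendsto_outEntropy_zero hH)
  rw [sub_zero] at h1
  refine le_of_tendsto_of_tendsto h1 h2 ?_
  filter_upwards [Ioo_mem_nhdsGT hE.1] with e he
  exact (P.outEntropy_sub_bounds hH he.1 he.2.le hE.2).1

lemma outEntropy_one_sub_le [SFinite ν] (hH : P.FiniteEntropies stdGaussian) {E : ℝ}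
    (hE : E ∈ Ioc (0 : ℝ) 1) :
    P.outEntropy 1 - P.outEntropy E ≤ (1 - E) * P.halfFisher E :=
  (P.outEntropy_sub_bounds hH hE.1 hE.2 le_rfl).2

lemma halfFisher_le_zero [SFinite ν] (h0 : P.avgFisher 0 ≠ ∞) {E : ℝ} (hE : E ∈ Ioc (0 : ℝ) 1) :
    P.halfFisher E ≤ P.halfFisher 0 := by
  have := ENNReal.toReal_mono h0 (P.avgFisher_le_zero hE)
  unfold halfFisher; linarith

lemma outEntropy_sub_zero_le [SFinite ν] (hH : P.FiniteEntropies stdGaussian)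
    (h0 : P.avgFisher 0 ≠ ∞) {E : ℝ} (hE : E ∈ Ioc (0 : ℝ) 1) :
    P.outEntropy E - P.outEntropy 0 ≤ E * P.halfFisher 0 := by
  have h2 := (tendsto_const_nhds (x := P.outEntropy E)).sub (P.tendsto_outEntropy_zero hH)
  refine le_of_tendsto h2 ?_
  filter_upwards [Ioo_mem_nhdsGT hE.1] with e he
  refine (P.outEntropy_sub_bounds hH he.1 he.2.le hE.2).2.trans ?_
  exact mul_le_mul (by linarith [he.1]) (P.halfFisher_le_zero h0 ⟨he.1, he.2.le.trans hE.2⟩)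
    (P.halfFisher_nonneg _) hE.1.le

/-- The mean value bound on `[0, 1]`, split at `1/2` so that the strict decrease of `j` makes it
strict: the increment is at least `(j(1/2) + j(1)) / 2`. -/
lemma halfFisher_one_lt [SFinite ν] (hH : P.FiniteEntropies stdGaussian)
    (hI : P.outEntropy 0 < P.outEntropy 1) :
    P.halfFisher 1 < P.outEntropy 1 - P.outEntropy 0 := by
  have h1 := P.mul_halfFisher_le hH (E := 1 / 2) (by norm_num)
  have h2 := (P.outEntropy_sub_bounds hH (E₁ := 1 / 2) (E₂ := 1) (by norm_num) (by norm_num) le_rfl).1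
  have h3 := P.halfFisher_strictAnti hI (E₁ := 1 / 2) (E₂ := 1) (by norm_num) (by norm_num) le_rfl
  linarith

lemma lt_halfFisher_zero [SFinite ν] (hH : P.FiniteEntropies stdGaussian)
    (hI : P.outEntropy 0 < P.outEntropy 1) (h0 : P.avgFisher 0 ≠ ∞) :
    P.outEntropy 1 - P.outEntropy 0 < P.halfFisher 0 := by
  have h1 := P.outEntropy_sub_zero_le hH h0 (E := 1 / 2) (by norm_num)
  have h2 := P.outEntropy_one_sub_le hH (E := 1 / 2) (by norm_num)
  have h3 := P.halfFisher_strictAnti hI (E₁ := 1 / 4) (E₂ := 1 / 2) (by norm_num) (by norm_num)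
    (by norm_num)
  have h4 := P.halfFisher_le_zero h0 (E := 1 / 4) (by norm_num)
  linarith

lemma ofReal_halfFisher_zero (h0 : P.avgFisher 0 ≠ ∞) :
    P.avgFisher 0 = ENNReal.ofReal (2 * P.halfFisher 0) := by
  rw [halfFisher, mul_div_cancel₀ _ two_ne_zero, ENNReal.ofReal_toReal h0]

lemma lt_avgFisher_zero [SFinite ν] (hH : P.FiniteEntropies stdGaussian)
    (hI : P.outEntropy 0 < P.outEntropy 1) :
    ENNReal.ofReal (2 * (P.outEntropy 1 - P.outEntropy 0)) < P.avgFisher 0 := by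
  by_cases h0 : P.avgFisher 0 = ∞
  · rw [h0]; exact ENNReal.ofReal_lt_top
  · have := P.lt_halfFisher_zero hH hI h0
    rw [P.ofReal_halfFisher_zero h0]
    exact (ENNReal.ofReal_lt_ofReal_iff (by linarith)).2 (by linarith)

/-! ### The large alphabet potential -/

lemma relSnr_eq {R : ℝ} (hR : 0 < R) {E : ℝ} (h : P.avgFisher E ≠ ∞) :
    P.relSnr R E = ENNReal.ofReal (P.halfFisher E / (R * Real.log 2)) := by
  have hl := Real.log_pos one_lt_two
  rw [relSnr, invNoise, ← ENNReal.ofReal_toReal h, ← ENNReal.ofReal_div_of_pos hR,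
    ← ENNReal.ofReal_div_of_pos (by linarith), halfFisher]
  congr 1
  field_simp

lemma one_lt_relSnr_iff {R : ℝ} (hR : 0 < R) (E : ℝ) :
    1 < P.relSnr R E ↔ ENNReal.ofReal (2 * (R * Real.log 2)) < P.avgFisher E := by
  have hl := Real.log_pos one_lt_two
  by_cases h : P.avgFisher E = ∞
  · rw [relSnr, invNoise, h, ENNReal.top_div_of_ne_top ENNReal.ofReal_ne_top,
      ENNReal.top_div_of_ne_top ENNReal.ofReal_ne_top]
    exact ⟨fun _ => ENNReal.ofReal_lt_top, fun _ => ENNReal.one_lt_top⟩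
  · rw [P.relSnr_eq hR h, ← ENNReal.ofReal_one, ← ENNReal.ofReal_toReal h,
      ENNReal.ofReal_lt_ofReal_iff_of_nonneg zero_le_one,
      ENNReal.ofReal_lt_ofReal_iff_of_nonneg (by positivity), lt_div_iff₀ (by positivity), halfFisher]
    constructor <;> intro h <;> linarith

lemma relSnr_one_lt_iff [SFinite ν] {R : ℝ} (hR : 0 < R) :
    P.relSnr R 1 < 1 ↔ P.halfFisher 1 < R * Real.log 2 := by
  have hl := Real.log_pos one_lt_two
  rw [P.relSnr_eq hR (P.avgFisher_ne_top ⟨one_pos, le_rfl⟩), ENNReal.ofReal_lt_one,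
    div_lt_one (by positivity)]

lemma mul_largePotential [SFinite ν] (hH : P.FiniteEntropies stdGaussian) {R : ℝ} (hR : 0 < R)
    {E : ℝ} (hE : E ∈ Icc (0 : ℝ) 1) (h : P.avgFisher E ≠ ∞) :
    R * Real.log 2 * P.largePotential R E =
      P.outEntropy E - E * P.halfFisher E - max 0 (R * Real.log 2 - P.halfFisher E) := by
  have hl := Real.log_pos one_lt_two
  have hK : 0 < R * Real.log 2 := by positivity
  have hj := P.halfFisher_nonneg E
  rw [largePotential, P.energyTerm_eq hH hR hE, P.relSnr_eq hR h, ← ENNReal.ofReal_one,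
    ← ENNReal.ofReal_sub _ (by positivity), ENNReal.toReal_ofReal', mul_sub, mul_div_cancel₀ _ hK.ne']
  rw [← halfFisher, mul_max_of_nonneg _ _ hK.le, mul_zero, mul_sub, mul_one, mul_div_cancel₀ _ hK.ne',
    max_comm]

lemma mul_largePotential_zero [SFinite ν] (hH : P.FiniteEntropies stdGaussian) {R : ℝ} (hR : 0 < R)
    (h : 1 ≤ P.relSnr R 0) : R * Real.log 2 * P.largePotential R 0 = P.outEntropy 0 := by
  have hl := Real.log_pos one_lt_two
  have hK : 0 < R * Real.log 2 := by positivity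
  rw [largePotential, P.energyTerm_eq hH hR ⟨le_rfl, zero_le_one⟩, tsub_eq_zero_of_le h]
  simp only [zero_mul, sub_zero, ENNReal.toReal_zero]
  field_simp

section Minima

variable [SFinite ν] (hH : P.FiniteEntropies stdGaussian) (hI : P.outEntropy 0 < P.outEntropy 1)

/-- Where `j ≥ K` the scaled potential is `H - E j`, whose increment is at least `E₁ (j(E₁) -
j(E₂))`. Formally its derivative is `-E j'`. -/
lemma largePotential_lt_of_le (hH : P.FiniteEntropies stdGaussian)
    (hI : P.outEntropy 0 < P.outEntropy 1) {R : ℝ} (hR : 0 < R) {E₁ E₂ : ℝ} (h1 : 0 < E₁)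
    (h2 : E₁ < E₂) (h3 : E₂ ≤ 1) (hK : R * Real.log 2 ≤ P.halfFisher E₂) :
    P.largePotential R E₁ < P.largePotential R E₂ := by
  have hKp : 0 < R * Real.log 2 := mul_pos hR (Real.log_pos one_lt_two)
  have hE1 : E₁ ∈ Ioc (0 : ℝ) 1 := ⟨h1, h2.le.trans h3⟩
  have hE2 : E₂ ∈ Ioc (0 : ℝ) 1 := ⟨h1.trans h2, h3⟩
  have hs := P.halfFisher_strictAnti hI h1 h2 h3
  have hb := (P.outEntropy_sub_bounds hH h1 h2.le h3).1
  refine lt_of_mul_lt_mul_left ?_ hKp.le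
  rw [P.mul_largePotential hH hR (Ioc_subset_Icc_self hE1) (P.avgFisher_ne_top hE1),
    P.mul_largePotential hH hR (Ioc_subset_Icc_self hE2) (P.avgFisher_ne_top hE2),
    max_eq_left (by linarith), max_eq_left (by linarith)]
  nlinarith [mul_pos h1 (sub_pos.2 hs)]

/-- Where `j ≤ K` the scaled potential is `H + (1 - E) j - K`, with formal derivative `(1 - E) j'`.
-/
lemma largePotential_le_of_ge (hH : P.FiniteEntropies stdGaussian) {R : ℝ} (hR : 0 < R) {E₁ E₂ : ℝ}
    (h1 : 0 < E₁) (h2 : E₁ ≤ E₂) (h3 : E₂ ≤ 1) (hK : P.halfFisher E₁ ≤ R * Real.log 2) :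
    R * Real.log 2 * P.largePotential R E₂ +
      (1 - E₂) * (P.halfFisher E₁ - P.halfFisher E₂) ≤ R * Real.log 2 * P.largePotential R E₁ := by
  have hE1 : E₁ ∈ Ioc (0 : ℝ) 1 := ⟨h1, h2.trans h3⟩
  have hE2 : E₂ ∈ Ioc (0 : ℝ) 1 := ⟨h1.trans_le h2, h3⟩
  have hs := P.halfFisher_antitone h1 h2 h3
  have hb := (P.outEntropy_sub_bounds hH h1 h2 h3).2
  rw [P.mul_largePotential hH hR (Ioc_subset_Icc_self hE1) (P.avgFisher_ne_top hE1),
    P.mul_largePotential hH hR (Ioc_subset_Icc_self hE2) (P.avgFisher_ne_top hE2),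
    max_eq_right (by linarith), max_eq_right (by linarith)]
  linarith

lemma largePotential_lt_of_ge (hH : P.FiniteEntropies stdGaussian)
    (hI : P.outEntropy 0 < P.outEntropy 1) {R : ℝ} (hR : 0 < R) {E₁ E₂ : ℝ} (h1 : 0 < E₁)
    (h2 : E₁ < E₂) (h3 : E₂ ≤ 1) (hK : P.halfFisher E₁ ≤ R * Real.log 2) :
    P.largePotential R E₂ < P.largePotential R E₁ := by
  have hKp : 0 < R * Real.log 2 := mul_pos hR (Real.log_pos one_lt_two)
  -- The quantified decrease has the factor `1 - E₂`, which is `0` at `E₂ = 1`. Strictness is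
  -- obtained on the first half of the interval.
  set E₃ := (E₁ + E₂) / 2 with h4
  have h5 : E₁ < E₃ := by rw [h4]; linarith
  have h6 : E₃ < E₂ := by rw [h4]; linarith
  have hs := P.halfFisher_strictAnti hI h1 h5 (h6.le.trans h3)
  have hs2 := P.halfFisher_antitone (h1.trans h5) h6.le h3
  have a1 := P.largePotential_le_of_ge hH hR h1 h5.le (h6.le.trans h3) hK
  have a2 := P.largePotential_le_of_ge hH hR (h1.trans h5) h6.le h3 (by linarith)
  refine lt_of_mul_lt_mul_left ?_ hKp.le
  nlinarith [mul_pos (by linarith : 0 < 1 - E₃) (sub_pos.2 hs),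
    mul_nonneg (sub_nonneg.2 h3) (sub_nonneg.2 hs2)]

lemma largePotential_zero_le (hH : P.FiniteEntropies stdGaussian) {R : ℝ} (hR : 0 < R) {E : ℝ}
    (hE : E ∈ Ioc (0 : ℝ) 1) (h0 : 1 ≤ P.relSnr R 0) (hK : R * Real.log 2 ≤ P.halfFisher E) :
    P.largePotential R 0 ≤ P.largePotential R E := by
  have hKp : 0 < R * Real.log 2 := mul_pos hR (Real.log_pos one_lt_two)
  refine le_of_mul_le_mul_left ?_ hKp
  rw [P.mul_largePotential_zero hH hR h0,
    P.mul_largePotential hH hR (Ioc_subset_Icc_self hE) (P.avgFisher_ne_top hE),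
    max_eq_left (by linarith)]
  linarith [P.mul_halfFisher_le hH hE]

lemma halfFisher_lt_of_relSnr_le (hI : P.outEntropy 0 < P.outEntropy 1) {R : ℝ} (hR : 0 < R)
    (h0 : P.relSnr R 0 ≤ 1) {E : ℝ} (hE : E ∈ Ioc (0 : ℝ) 1) :
    P.halfFisher E < R * Real.log 2 := by
  have hl := Real.log_pos one_lt_two
  have h1 := mt (P.one_lt_relSnr_iff hR 0).2 (not_lt.2 h0)
  have hE2 : E / 2 ∈ Ioc (0 : ℝ) 1 := ⟨by linarith [hE.1], by linarith [hE.2, hE.1]⟩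
  have h2 := (P.avgFisher_le_zero hE2).trans (not_lt.1 h1)
  rw [P.avgFisher_eq_ofReal hE2, ENNReal.ofReal_le_ofReal_iff (by positivity)] at h2
  have := P.halfFisher_strictAnti hI hE2.1 (by linarith [hE.1]) hE.2
  linarith

lemma one_lt_relSnr_of_le (hI : P.outEntropy 0 < P.outEntropy 1) {R : ℝ} (hR : 0 < R) {E : ℝ}
    (hE : E ∈ Ioc (0 : ℝ) 1) (hK : R * Real.log 2 ≤ P.halfFisher E) : 1 < P.relSnr R 0 := by
  by_contra h
  linarith [P.halfFisher_lt_of_relSnr_le hI hR (not_lt.1 h) hE]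

lemma largePotential_lt_zero (hH : P.FiniteEntropies stdGaussian)
    (hI : P.outEntropy 0 < P.outEntropy 1) {R : ℝ} (hR : 0 < R) (h0 : P.relSnr R 0 ≤ 1) {E : ℝ}
    (hE : E ∈ Ioc (0 : ℝ) 1) : P.largePotential R E < P.largePotential R 0 := by
  have hl := Real.log_pos one_lt_two
  have hKp : 0 < R * Real.log 2 := mul_pos hR hl
  have h1 := not_lt.1 (mt (P.one_lt_relSnr_iff hR 0).2 (not_lt.2 h0))
  have htop : P.avgFisher 0 ≠ ∞ := (h1.trans_lt ENNReal.ofReal_lt_top).ne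
  rw [P.ofReal_halfFisher_zero htop, ENNReal.ofReal_le_ofReal_iff (by positivity)] at h1
  have hE2 : E / 2 ∈ Ioc (0 : ℝ) 1 := ⟨by linarith [hE.1], by linarith [hE.2, hE.1]⟩
  refine (P.largePotential_lt_of_ge hH hI hR hE2.1 (by linarith [hE.1]) hE.2
    (P.halfFisher_lt_of_relSnr_le hI hR h0 hE2).le).trans_le ?_
  refine le_of_mul_le_mul_left ?_ hKp
  have h3 := P.halfFisher_lt_of_relSnr_le hI hR h0 hE2
  rw [P.mul_largePotential hH hR ⟨le_rfl, zero_le_one⟩ htop,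
    P.mul_largePotential hH hR (Ioc_subset_Icc_self hE2) (P.avgFisher_ne_top hE2),
    max_eq_right (by linarith), max_eq_right (by linarith)]
  have h4 := P.outEntropy_sub_zero_le hH htop hE2
  have h5 := P.halfFisher_le_zero htop hE2
  nlinarith [mul_nonneg (sub_nonneg.2 hE2.2) (sub_nonneg.2 h5)]

theorem isLocalMinOn_largePotential_iff (hH : P.FiniteEntropies stdGaussian)
    (hI : P.outEntropy 0 < P.outEntropy 1) {R : ℝ} (hR : 0 < R) {E : ℝ} (hE : E ∈ Icc (0 : ℝ) 1) :
    IsLocalMinOn (P.largePotential R) (Icc 0 1) E ↔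
      (E = 0 ∧ 1 < P.relSnr R 0) ∨ (E = 1 ∧ P.relSnr R 1 < 1) := by
  -- Since `j` decreases, it exceeds `K` to the left of such an `E` as well, and the potential is
  -- lower there.
  have hdec : ∀ E ∈ Ioc (0 : ℝ) 1, R * Real.log 2 ≤ P.halfFisher E →
      ¬ IsLocalMinOn (P.largePotential R) (Icc 0 1) E := by
    intro E hE hK hmin
    have h1 : ∀ᶠ e in 𝓝[<] E, e ∈ Ioo 0 E := Ioo_mem_nhdsLT hE.1
    have h2 : 𝓝[<] E ≤ 𝓝[Icc 0 1] E := by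
      refine le_inf nhdsWithin_le_nhds (le_principal_iff.2 ?_)
      exact mem_of_superset h1 fun e he => ⟨he.1.le, he.2.le.trans hE.2⟩
    obtain ⟨e, he1, he2⟩ := ((hmin.filter_mono h2).and h1).exists
    exact absurd he1 (not_le.2 (P.largePotential_lt_of_le hH hI hR he2.1 he2.2 hE.2 hK))
  constructor
  · intro hmin
    rcases hE.1.eq_or_lt with h | h
    · left
      refine ⟨h.symm, ?_⟩
      subst h
      by_contra h0
      have h1 : ∀ᶠ e : ℝ in 𝓝[>] 0, e ∈ Ioo (0 : ℝ) 1 := Ioo_mem_nhdsGT one_pos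
      have h2 : 𝓝[>] (0 : ℝ) ≤ 𝓝[Icc 0 1] 0 := by
        refine le_inf nhdsWithin_le_nhds (le_principal_iff.2 ?_)
        exact mem_of_superset h1 fun e he => ⟨he.1.le, he.2.le⟩
      obtain ⟨e, he1, he2⟩ := ((hmin.filter_mono h2).and h1).exists
      exact absurd he1 (not_le.2 (P.largePotential_lt_zero hH hI hR (not_lt.1 h0) ⟨he2.1, he2.2.le⟩))
    · right
      have hlt : P.halfFisher E < R * Real.log 2 := by
        by_contra hK
        exact hdec E ⟨h, hE.2⟩ (not_lt.1 hK) hmin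
      rcases hE.2.eq_or_lt with h1 | h1
      · subst h1
        exact ⟨rfl, (P.relSnr_one_lt_iff hR).2 hlt⟩
      · exfalso
        have h2 : ∀ᶠ e in 𝓝[>] E, e ∈ Ioo E 1 := Ioo_mem_nhdsGT h1
        have h3 : 𝓝[>] E ≤ 𝓝[Icc 0 1] E := by
          refine le_inf nhdsWithin_le_nhds (le_principal_iff.2 ?_)
          exact mem_of_superset h2 fun e he => ⟨h.le.trans he.1.le, he.2.le⟩
        obtain ⟨e, he1, he2⟩ := ((hmin.filter_mono h3).and h2).exists
        exact absurd he1 (not_le.2 (P.largePotential_lt_of_ge hH hI hR h he2.1 he2.2.le hlt.le))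
  · rintro (⟨rfl, h0⟩ | ⟨rfl, h1⟩)
    · obtain ⟨E', hE', hlt⟩ := P.lt_avgFisher_zero_iff.1 ((P.one_lt_relSnr_iff hR 0).1 h0)
      rw [P.avgFisher_eq_ofReal hE', ENNReal.ofReal_lt_ofReal_iff_of_nonneg (by
        have := Real.log_pos one_lt_two; positivity)] at hlt
      have h3 : ∀ᶠ e in 𝓝[Icc 0 1] (0 : ℝ), e < E' :=
        nhdsWithin_le_nhds (gt_mem_nhds hE'.1)
      filter_upwards [h3, self_mem_nhdsWithin] with e he1 he2
      rcases he2.1.eq_or_lt with h | h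
      · rw [← h]
      · refine P.largePotential_zero_le hH hR ⟨h, he2.2⟩ h0.le ?_
        have := P.halfFisher_antitone h he1.le hE'.2
        linarith
    · rw [P.relSnr_one_lt_iff hR] at h1
      have h2 := P.tendsto_halfFisher_one.eventually (gt_mem_nhds h1)
      rw [eventually_nhdsWithin_iff] at h2
      have h3 : ∀ᶠ e in 𝓝[Icc 0 1] (1 : ℝ), e < 1 → P.halfFisher e < R * Real.log 2 :=
        nhdsWithin_le_nhds h2
      have h4 : ∀ᶠ e in 𝓝[Icc 0 1] (1 : ℝ), 0 < e := nhdsWithin_le_nhds (lt_mem_nhds one_pos)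
      filter_upwards [h3, h4, self_mem_nhdsWithin] with e he1 he2 he3
      rcases he3.2.eq_or_lt with h | h
      · rw [h]
      · exact (P.largePotential_lt_of_ge hH hI hR he2 h le_rfl (he1 h).le).le

theorem exists_isMinOn_largePotential (hH : P.FiniteEntropies stdGaussian)
    (hI : P.outEntropy 0 < P.outEntropy 1) {R : ℝ} (hR : 0 < R) :
    ∃ E ∈ ({0, 1} : Set ℝ), IsMinOn (P.largePotential R) (Icc 0 1) E := by
  have key : ∀ E ∈ Icc (0 : ℝ) 1, P.largePotential R 0 ≤ P.largePotential R E ∨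
      P.largePotential R 1 ≤ P.largePotential R E := by
    intro E hE
    rcases hE.1.eq_or_lt with h | h
    · left; rw [h]
    · rcases le_total (R * Real.log 2) (P.halfFisher E) with hK | hK
      · exact Or.inl (P.largePotential_zero_le hH hR ⟨h, hE.2⟩
          (P.one_lt_relSnr_of_le hI hR ⟨h, hE.2⟩ hK).le hK)
      · right
        rcases hE.2.eq_or_lt with h1 | h1
        · rw [h1]
        · exact (P.largePotential_lt_of_ge hH hI hR h h1 le_rfl hK).le
  rcases le_total (P.largePotential R 0) (P.largePotential R 1) with h | h
  · exact ⟨0, by simp, fun E hE => (key E hE).elim id h.trans⟩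
  · exact ⟨1, by simp, fun E hE => (key E hE).elim h.trans id⟩

/-- The scaled values at the endpoints are `H(1) - max (K, j(1))` and `H(0) - max (0, K - j(0))`. As
`j(1) < H(1) - H(0) < j(0)`, they can agree only when `j(1) < K < j(0)`, where they are `H(1) - K`
and `H(0)`. -/
theorem largePotential_one_eq_zero_iff (hH : P.FiniteEntropies stdGaussian)
    (hI : P.outEntropy 0 < P.outEntropy 1) {R : ℝ} (hR : 0 < R) :
    P.largePotential R 1 = P.largePotential R 0 ↔
      R * Real.log 2 = P.outEntropy 1 - P.outEntropy 0 := by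
  have hl := Real.log_pos one_lt_two
  have hKp : 0 < R * Real.log 2 := mul_pos hR hl
  have h1 := P.mul_largePotential hH hR ⟨zero_le_one, le_rfl⟩ (P.avgFisher_ne_top ⟨one_pos, le_rfl⟩)
  have h2 := P.halfFisher_one_lt hH hI
  rw [← mul_right_inj' hKp.ne', h1]
  by_cases h0 : 1 < P.relSnr R 0
  · rw [P.mul_largePotential_zero hH hR h0.le]
    rcases le_total (R * Real.log 2) (P.halfFisher 1) with h | h
    · rw [max_eq_left (by linarith)]
      constructor <;> intro h' <;> linarith
    · rw [max_eq_right (by linarith)]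
      constructor <;> intro h' <;> linarith
  · have h3 := not_lt.1 (mt (P.one_lt_relSnr_iff hR 0).2 h0)
    have htop : P.avgFisher 0 ≠ ∞ := (h3.trans_lt ENNReal.ofReal_lt_top).ne
    have h4 := P.lt_halfFisher_zero hH hI htop
    rw [P.ofReal_halfFisher_zero htop, ENNReal.ofReal_le_ofReal_iff (by positivity)] at h3
    rw [P.mul_largePotential hH hR ⟨le_rfl, zero_le_one⟩ htop, max_eq_right (by linarith),
      max_eq_right (by linarith)]
    constructor <;> intro h' <;> linarith

end Minima

end MemorylessChannel

end SparseSuperposition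

namespace SparseSuperposition

/-! ### Iterates of monotone maps of the unit interval -/

section Iterate

variable {f : ℝ → ℝ}

lemma iterate_mem_Icc (hm : MapsTo f (Icc 0 1) (Icc 0 1)) {x : ℝ} (hx : x ∈ Icc (0 : ℝ) 1) (n : ℕ) :
    f^[n] x ∈ Icc (0 : ℝ) 1 := hm.iterate n hx

lemma iterate_le_iterate (hf : MonotoneOn f (Icc 0 1)) (hm : MapsTo f (Icc 0 1) (Icc 0 1))
    {x y : ℝ} (hx : x ∈ Icc (0 : ℝ) 1) (hy : y ∈ Icc (0 : ℝ) 1) (h : x ≤ y) (n : ℕ) :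
    f^[n] x ≤ f^[n] y := by
  induction n with
  | zero => exact h
  | succ n ih =>
    rw [Function.iterate_succ_apply', Function.iterate_succ_apply']
    exact hf (hm.iterate n hx) (hm.iterate n hy) ih

lemma monotone_iterate_of_le (hf : MonotoneOn f (Icc 0 1)) (hm : MapsTo f (Icc 0 1) (Icc 0 1))
    {x : ℝ} (hx : x ∈ Icc (0 : ℝ) 1) (h : x ≤ f x) : Monotone fun n => f^[n] x :=
  monotone_nat_of_le_succ fun n => by
    rw [Function.iterate_succ_apply]; exact iterate_le_iterate hf hm hx (hm hx) h n

lemma antitone_iterate_of_le (hf : MonotoneOn f (Icc 0 1)) (hm : MapsTo f (Icc 0 1) (Icc 0 1))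
    {x : ℝ} (hx : x ∈ Icc (0 : ℝ) 1) (h : f x ≤ x) : Antitone fun n => f^[n] x :=
  antitone_nat_of_succ_le fun n => by
    rw [Function.iterate_succ_apply]; exact iterate_le_iterate hf hm (hm hx) hx h n

lemma tendsto_iterate_limUnder (hf : MonotoneOn f (Icc 0 1)) (hm : MapsTo f (Icc 0 1) (Icc 0 1))
    {x : ℝ} (hx : x ∈ Icc (0 : ℝ) 1) :
    Tendsto (fun n => f^[n] x) atTop (𝓝 (limUnder atTop fun n => f^[n] x)) := by
  apply tendsto_nhds_limUnder
  rcases le_total x (f x) with h | h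
  · exact ⟨_, tendsto_atTop_ciSup (monotone_iterate_of_le hf hm hx h)
      ⟨1, by rintro _ ⟨n, rfl⟩; exact (hm.iterate n hx).2⟩⟩
  · exact ⟨_, tendsto_atTop_ciInf (antitone_iterate_of_le hf hm hx h)
      ⟨0, by rintro _ ⟨n, rfl⟩; exact (hm.iterate n hx).1⟩⟩

end Iterate

/-- The exponent `θ = δ / (2 (1 + δ))` solves `(1 - 2 θ) (1 + δ) = 1`. Hence `(1 - 2 θ) x ≥ 1`, and
`θ (1 - θ) x - θ ≥ θ² x`: the exponent stays proportional to `x`, which matters when `J(E)`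
diverges. -/
lemma sectionMSE_le_exp_neg {B : ℕ} (hB : 2 ≤ B) {v : ℝ≥0∞} (hv : v ≠ ∞) {δ : ℝ} (hδ : 0 < δ)
    (h : 1 + δ ≤ v.toReal / (2 * Real.log 2)) :
    sectionMSE B v ≤
      Real.exp (-(Real.log B * ((δ / (2 * (1 + δ))) ^ 2 * (v.toReal / (2 * Real.log 2))))) := by
  set x := v.toReal / (2 * Real.log 2) with hx
  set θ := δ / (2 * (1 + δ)) with hθ
  have h1 : θ * (2 * (1 + δ)) = δ := by rw [hθ]; field_simp
  have h0 : 0 < θ := by positivity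
  have h2 : θ ≤ 1 := by rw [hθ, div_le_one (by positivity)]; linarith
  refine (sectionMSE_le_exp hB hv h0.le h2).trans (Real.exp_le_exp.2 ?_)
  rw [← mul_neg]
  refine mul_le_mul_of_nonneg_left ?_ (log_cast_pos hB).le
  rw [← hx]
  have h3 : 1 ≤ (1 - 2 * θ) * x := by
    have h4 : (1 - 2 * θ) * (1 + δ) = 1 := by linarith
    have h5 : 0 < 1 - 2 * θ := by
      by_contra hc
      nlinarith
    linarith [mul_le_mul_of_nonneg_left h h5.le]
  nlinarith

/-- The bound `B ^ (-κ)` on the mean square error for an effective noise bounded away from the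
critical one. -/
noncomputable def floorBound (δ : ℝ) (B : ℕ) : ℝ :=
  Real.exp (-(Real.log B * (δ / (2 * (1 + δ))) ^ 2))

lemma floorBound_pos (δ : ℝ) (B : ℕ) : 0 < floorBound δ B := Real.exp_pos _

lemma tendsto_floorBound {δ : ℝ} (hδ : 0 < δ) : Tendsto (floorBound δ) atTop (𝓝 0) := by
  have hlog : Tendsto (fun B : ℕ => Real.log (B : ℝ)) atTop atTop :=
    Real.tendsto_log_atTop.comp tendsto_natCast_atTop_atTop
  exact Real.tendsto_exp_neg_atTop_nhds_zero.comp (hlog.atTop_mul_const (by positivity))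

lemma sectionMSE_le_floorBound {B : ℕ} (hB : 2 ≤ B) {v : ℝ≥0∞} (hv : v ≠ ∞) {δ : ℝ} (hδ : 0 < δ)
    (h : 1 + δ ≤ v.toReal / (2 * Real.log 2)) : sectionMSE B v ≤ floorBound δ B := by
  refine (sectionMSE_le_exp_neg hB hv hδ h).trans (Real.exp_le_exp.2 ?_)
  refine neg_le_neg (mul_le_mul_of_nonneg_left ?_ (log_cast_pos hB).le)
  exact le_mul_of_one_le_right (by positivity) (by linarith)

namespace MemorylessChannel

variable {𝓑 : Type*} [MeasurableSpace 𝓑] {ν : Measure 𝓑} (P : MemorylessChannel ℝ 𝓑 ν)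

/-! ### The underlying state evolution -/

lemma invNoise_toReal {R : ℝ} (hR : 0 < R) (E : ℝ) :
    (P.invNoise R E).toReal = 2 * P.halfFisher E / R := by
  rw [invNoise, ENNReal.toReal_div, ENNReal.toReal_ofReal hR.le, halfFisher]; ring

lemma invNoise_toReal_div {R : ℝ} (hR : 0 < R) (E : ℝ) :
    (P.invNoise R E).toReal / (2 * Real.log 2) = P.halfFisher E / (R * Real.log 2) := by
  have hl := Real.log_pos one_lt_two
  rw [P.invNoise_toReal hR]; field_simp

lemma invNoise_ne_top_of {R : ℝ} (hR : 0 < R) {E : ℝ} (h : P.avgFisher E ≠ ∞) :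
    P.invNoise R E ≠ ∞ :=
  ENNReal.div_ne_top h (ENNReal.ofReal_pos.2 hR).ne'

lemma seOp_mapsTo (B : ℕ) (R : ℝ) : MapsTo (P.seOp B R) (Icc 0 1) (Icc 0 1) :=
  fun _ _ => ⟨sectionMSE_nonneg _ _, sectionMSE_le_one _ _⟩

lemma zero_mem_basin (B : ℕ) (R : ℝ) : (0 : ℝ) ∈ P.basin B R := ⟨⟨le_rfl, zero_le_one⟩, rfl⟩

section

variable [SFinite ν]

lemma invNoise_ne_top {R : ℝ} (hR : 0 < R) {E : ℝ} (hE : E ∈ Ioc (0 : ℝ) 1) :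
    P.invNoise R E ≠ ∞ := P.invNoise_ne_top_of hR (P.avgFisher_ne_top hE)

lemma avgFisher_antitoneOn : AntitoneOn P.avgFisher (Icc 0 1) := by
  intro E hE E' hE' h
  rcases hE.1.eq_or_lt with h0 | h0
  · subst h0
    rcases hE'.1.eq_or_lt with h1 | h1
    · subst h1; exact le_rfl
    · exact P.avgFisher_le_zero ⟨h1, hE'.2⟩
  · rw [P.avgFisher_eq_ofReal ⟨h0, hE.2⟩, P.avgFisher_eq_ofReal ⟨h0.trans_le h, hE'.2⟩]
    exact ENNReal.ofReal_le_ofReal (by linarith [P.halfFisher_antitone h0 h hE'.2])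

lemma invNoise_antitoneOn (R : ℝ) : AntitoneOn (P.invNoise R) (Icc 0 1) :=
  fun _ hE _ hE' h => ENNReal.div_le_div_right (P.avgFisher_antitoneOn hE hE' h) _

lemma seOp_monotoneOn {B : ℕ} (hB : 2 ≤ B) (R : ℝ) : MonotoneOn (P.seOp B R) (Icc 0 1) :=
  fun _ hE _ hE' h => sectionMSE_antitone hB (P.invNoise_antitoneOn R hE hE' h)

lemma seOp_pos {B : ℕ} (hB : 2 ≤ B) {R : ℝ} (hR : 0 < R) {E : ℝ} (hE : E ∈ Ioc (0 : ℝ) 1) :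
    0 < P.seOp B R E := sectionMSE_pos hB (P.invNoise_ne_top hR hE)

lemma tendsto_seLimit {B : ℕ} (hB : 2 ≤ B) (R : ℝ) {E : ℝ} (hE : E ∈ Icc (0 : ℝ) 1) :
    Tendsto (fun n => (P.seOp B R)^[n] E) atTop (𝓝 (P.seLimit B R E)) :=
  tendsto_iterate_limUnder (P.seOp_monotoneOn hB R) (P.seOp_mapsTo B R) hE

lemma seLimit_mem {B : ℕ} (hB : 2 ≤ B) (R : ℝ) {E : ℝ} (hE : E ∈ Icc (0 : ℝ) 1) :
    P.seLimit B R E ∈ Icc (0 : ℝ) 1 :=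
  isClosed_Icc.mem_of_tendsto (P.tendsto_seLimit hB R hE)
    (Eventually.of_forall fun n => iterate_mem_Icc (P.seOp_mapsTo B R) hE n)

lemma seLimit_mono {B : ℕ} (hB : 2 ≤ B) (R : ℝ) : MonotoneOn (P.seLimit B R) (Icc 0 1) :=
  fun _ hE _ hE' h => le_of_tendsto_of_tendsto' (P.tendsto_seLimit hB R hE)
    (P.tendsto_seLimit hB R hE') fun n =>
      iterate_le_iterate (P.seOp_monotoneOn hB R) (P.seOp_mapsTo B R) hE hE' h n

lemma seLimit_seOp {B : ℕ} (hB : 2 ≤ B) (R : ℝ) {E : ℝ} (hE : E ∈ Icc (0 : ℝ) 1) :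
    P.seLimit B R (P.seOp B R E) = P.seLimit B R E := by
  have h1 := P.tendsto_seLimit hB R (P.seOp_mapsTo B R hE)
  have h2 := (tendsto_add_atTop_iff_nat 1).2 (P.tendsto_seLimit hB R hE)
  exact tendsto_nhds_unique h1 h2

lemma seLimit_le {B : ℕ} (hB : 2 ≤ B) {R E : ℝ} (hE : E ∈ Icc (0 : ℝ) 1) (h : P.seOp B R E ≤ E) :
    P.seLimit B R E ≤ E :=
  le_of_tendsto' (P.tendsto_seLimit hB R hE) fun n =>
    antitone_iterate_of_le (P.seOp_monotoneOn hB R) (P.seOp_mapsTo B R) hE h (Nat.zero_le n)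

lemma le_seLimit {B : ℕ} (hB : 2 ≤ B) {R E : ℝ} (hE : E ∈ Icc (0 : ℝ) 1) (h : E ≤ P.seOp B R E) :
    E ≤ P.seLimit B R E :=
  ge_of_tendsto' (P.tendsto_seLimit hB R hE) fun n =>
    monotone_iterate_of_le (P.seOp_monotoneOn hB R) (P.seOp_mapsTo B R) hE h (Nat.zero_le n)

lemma mseFloor_nonneg {B : ℕ} (hB : 2 ≤ B) (R : ℝ) : 0 ≤ P.mseFloor B R :=
  (P.seLimit_mem hB R ⟨le_rfl, zero_le_one⟩).1

lemma mseFloor_le_seLimit {B : ℕ} (hB : 2 ≤ B) (R : ℝ) {E : ℝ} (hE : E ∈ Icc (0 : ℝ) 1) :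
    P.mseFloor B R ≤ P.seLimit B R E := P.seLimit_mono hB R ⟨le_rfl, zero_le_one⟩ hE hE.1

lemma seOp_le_floorBound {B : ℕ} (hB : 2 ≤ B) {R : ℝ} (hR : 0 < R) {δ E : ℝ} (hδ : 0 < δ)
    (hE : E ∈ Ioc (0 : ℝ) 1) (h : (1 + δ) * (R * Real.log 2) ≤ P.halfFisher E) :
    P.seOp B R E ≤ floorBound δ B := by
  refine sectionMSE_le_floorBound hB (P.invNoise_ne_top hR hE) hδ ?_
  rw [P.invNoise_toReal_div hR, le_div_iff₀ (mul_pos hR (Real.log_pos one_lt_two))]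
  exact h

/-- Once `floorBound` is below `E`, it is mapped below itself by the state evolution, so the
monotone iteration started at `0` cannot pass it. -/
lemma mseFloor_le_floorBound {B : ℕ} (hB : 2 ≤ B) {R : ℝ} (hR : 0 < R) {δ E : ℝ} (hδ : 0 < δ)
    (hE : E ∈ Ioc (0 : ℝ) 1) (h : (1 + δ) * (R * Real.log 2) ≤ P.halfFisher E)
    (hBE : floorBound δ B ≤ E) : P.mseFloor B R ≤ floorBound δ B := by
  have hm : floorBound δ B ∈ Ioc (0 : ℝ) 1 := ⟨floorBound_pos δ B, hBE.trans hE.2⟩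
  have h1 : P.seOp B R (floorBound δ B) ≤ floorBound δ B :=
    P.seOp_le_floorBound hB hR hδ hm (h.trans (P.halfFisher_antitone hm.1 hBE hE.2))
  exact (P.mseFloor_le_seLimit hB R (Ioc_subset_Icc_self hm)).trans
    (P.seLimit_le hB (Ioc_subset_Icc_self hm) h1)

theorem tendsto_mseFloor {R : ℝ} (hR : 0 < R) (h : 1 < P.relSnr R 0) :
    Tendsto (fun B : ℕ => P.mseFloor B R) atTop (𝓝 0) := by
  have hl := Real.log_pos one_lt_two
  have hK : 0 < R * Real.log 2 := mul_pos hR hl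
  obtain ⟨E, hE, h1⟩ := P.lt_avgFisher_zero_iff.1 ((P.one_lt_relSnr_iff hR 0).1 h)
  rw [P.avgFisher_eq_ofReal hE, ENNReal.ofReal_lt_ofReal_iff_of_nonneg (by positivity)] at h1
  set δ := P.halfFisher E / (R * Real.log 2) - 1 with hδ
  have hδ0 : 0 < δ := by rw [hδ, sub_pos, one_lt_div hK]; linarith
  have h2 : (1 + δ) * (R * Real.log 2) ≤ P.halfFisher E := by
    rw [hδ]; field_simp; simp
  refine tendsto_of_tendsto_of_tendsto_of_le_of_le' tendsto_const_nhds (tendsto_floorBound hδ0)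
    ?_ ?_
  · filter_upwards [eventually_ge_atTop 2] with B hB using P.mseFloor_nonneg hB R
  · filter_upwards [eventually_ge_atTop 2,
      (tendsto_floorBound hδ0).eventually (eventually_le_nhds hE.1)] with B hB h3
    exact P.mseFloor_le_floorBound hB hR hδ0 hE h2 h3

lemma halfFisher_half_pos (hI : P.outEntropy 0 < P.outEntropy 1) : 0 < P.halfFisher (1 / 2) :=
  (P.halfFisher_nonneg 1).trans_lt
    (P.halfFisher_strictAnti hI (by norm_num) (by norm_num) le_rfl)

/-- Contraction of the state evolution in the distance `|ln ln (1 / E₁) - ln ln (1 / E₂)|`. -/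
lemma log_log_seOp_sub_le {B : ℕ} (hB : 2 ≤ B) {R : ℝ} (hR : 0 < R) {δ ε E₁ E₂ : ℝ} (hδ : 0 < δ)
    (h1 : 0 < E₁) (h2 : E₁ ≤ E₂) (h3 : E₂ ≤ 1 / 2)
    (hx : (1 + δ) * (R * Real.log 2) ≤ P.halfFisher E₂)
    (hε' : 4 * ε ≤ (δ / (2 * (1 + δ))) ^ 2 * P.halfFisher (1 / 2))
    (hJ : (P.avgFisher E₁).toReal - (P.avgFisher E₂).toReal ≤
      ε * Real.log (Real.log (1 / E₁) / Real.log (1 / E₂))) :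
    Real.log (Real.log (1 / P.seOp B R E₁) / Real.log (1 / P.seOp B R E₂)) ≤
      1 / 2 * Real.log (Real.log (1 / E₁) / Real.log (1 / E₂)) := by
  have hl := Real.log_pos one_lt_two
  have hlB := log_cast_pos hB
  have hE1 : E₁ ∈ Ioc (0 : ℝ) 1 := ⟨h1, by linarith⟩
  have hE2 : E₂ ∈ Ioc (0 : ℝ) 1 := ⟨by linarith, by linarith⟩
  have hK : 0 < R * Real.log 2 := mul_pos hR hl
  set D := Real.log (Real.log (1 / E₁) / Real.log (1 / E₂)) with hD
  set κ := (δ / (2 * (1 + δ))) ^ 2 with hκ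
  have hκ0 : 0 < κ := by positivity
  have hj := P.halfFisher_antitone hE2.1 h3 (by norm_num)
  have hjK : 0 < P.halfFisher E₂ := lt_of_lt_of_le (by positivity) hx
  have hD0 : 0 ≤ D := by
    have e2 : 0 < Real.log (1 / E₂) := Real.log_pos (by rw [lt_div_iff₀ hE2.1]; linarith)
    refine Real.log_nonneg ((one_le_div e2).2 (Real.log_le_log (by have := hE2.1; positivity) ?_))
    exact one_div_le_one_div_of_le h1 h2
  have hT1 := P.seOp_pos hB hR hE1
  have hT2 := P.seOp_pos hB hR hE2
  have hΛ2 : Real.log B * (κ * (P.halfFisher E₂ / (R * Real.log 2))) ≤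
      Real.log (1 / P.seOp B R E₂) := by
    rw [one_div, Real.log_inv, le_neg, Real.log_le_iff_le_exp hT2, ← P.invNoise_toReal_div hR E₂]
    refine sectionMSE_le_exp_neg hB (P.invNoise_ne_top hR hE2) hδ ?_
    rw [P.invNoise_toReal_div hR, le_div_iff₀ hK]
    exact hx
  have hΛ2' : 0 < Real.log (1 / P.seOp B R E₂) := lt_of_lt_of_le (by positivity) hΛ2
  have hΛ1 : Real.log (1 / P.seOp B R E₁) - Real.log (1 / P.seOp B R E₂) ≤
      2 * (Real.log B / Real.log 2 * (ε * D / R)) := by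
    have e1 := exp_mul_sectionMSE_le hB (P.invNoise_ne_top hR hE1)
      (P.invNoise_antitoneOn R (Ioc_subset_Icc_self hE1) (Ioc_subset_Icc_self hE2) h2)
    have e2 := Real.log_le_log (mul_pos (Real.exp_pos _) hT2) e1
    rw [Real.log_mul (Real.exp_pos _).ne' hT2.ne', Real.log_exp] at e2
    have e3 : (P.invNoise R E₁).toReal - (P.invNoise R E₂).toReal ≤ ε * D / R := by
      rw [P.invNoise_toReal hR, P.invNoise_toReal hR, ← sub_div]
      refine div_le_div_of_nonneg_right ?_ hR.le
      rw [halfFisher, halfFisher]; linarith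
    have e4 := mul_le_mul_of_nonneg_left e3 (div_pos hlB hl).le
    rw [one_div, one_div, Real.log_inv, Real.log_inv]
    change _ ≤ Real.log (P.seOp B R E₁) at e2
    change _ + Real.log (P.seOp B R E₂) ≤ _ at e2
    linarith
  have hm1 : Real.log (1 / P.seOp B R E₂) ≤ Real.log (1 / P.seOp B R E₁) :=
    Real.log_le_log (by positivity) (one_div_le_one_div_of_le hT1
      (P.seOp_monotoneOn hB R (Ioc_subset_Icc_self hE1) (Ioc_subset_Icc_self hE2) h2))
  -- Put `Λ = ln (1 / T)`. Then `ln (Λ₁ / Λ₂) ≤ (Λ₁ - Λ₂) / Λ₂`. The difference is at most of order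
  -- `ε D ln B`, and `Λ₂` is at least of order `ln B`, so `B` cancels and a small `ε` gives the
  -- factor `1/2`.
  have hlog := Real.log_le_sub_one_of_pos (div_pos (hΛ2'.trans_le hm1) hΛ2')
  refine hlog.trans ?_
  rw [div_sub_one hΛ2'.ne', div_le_iff₀ hΛ2']
  refine hΛ1.trans ?_
  have e5 : 2 * (Real.log B / Real.log 2 * (ε * D / R)) =
      1 / 2 * D * (Real.log B * (4 * ε / (R * Real.log 2))) := by field_simp; ring
  rw [e5]
  refine mul_le_mul_of_nonneg_left (le_trans ?_ hΛ2) (by positivity)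
  refine mul_le_mul_of_nonneg_left ?_ hlB.le
  rw [← mul_div_assoc]
  refine div_le_div_of_nonneg_right (hε'.trans ?_) hK.le
  exact mul_le_mul_of_nonneg_left hj hκ0.le

/-- The orbits of `0` and of `E` approach each other, as their doubly logarithmic distance is halved
at each step. -/
lemma seLimit_le_mseFloor_of_contraction {B : ℕ} (hB : 2 ≤ B) {R : ℝ} (hR : 0 < R)
    (h0 : P.avgFisher 0 < ∞) {δ ε η E : ℝ} (hδ : 0 < δ) (hE : E ∈ Ioc (0 : ℝ) (1 / 2)) (hEη : E ≤ η)
    (hx : (1 + δ) * (R * Real.log 2) ≤ P.halfFisher E) (hTE : P.seOp B R E ≤ E)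
    (hε' : 4 * ε ≤ (δ / (2 * (1 + δ))) ^ 2 * P.halfFisher (1 / 2))
    (hJ : ∀ E₁ E₂ : ℝ, 0 < E₁ → E₁ ≤ E₂ → E₂ ≤ η →
        (P.avgFisher E₁).toReal - (P.avgFisher E₂).toReal ≤
          ε * Real.log (Real.log (1 / E₁) / Real.log (1 / E₂))) :
    P.seLimit B R E ≤ P.mseFloor B R := by
  have hz : (0 : ℝ) ∈ Icc (0 : ℝ) 1 := ⟨le_rfl, zero_le_one⟩
  have hE1 : E ∈ Icc (0 : ℝ) 1 := ⟨hE.1.le, by linarith [hE.2]⟩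
  have hmon := P.seOp_monotoneOn hB R
  have hmap := P.seOp_mapsTo B R
  -- The point `0` is at infinite distance. After one step the orbit is positive because `J(0) < ∞`.
  set a : ℕ → ℝ := fun n => (P.seOp B R)^[n + 1] 0 with ha
  set b : ℕ → ℝ := fun n => (P.seOp B R)^[n + 1] E with hb
  have hanti := antitone_iterate_of_le hmon hmap hE1 hTE
  have hmono := monotone_iterate_of_le hmon hmap hz (hmap hz).1
  have ha0 : 0 < a 0 := sectionMSE_pos hB (P.invNoise_ne_top_of hR h0.ne)
  have han : ∀ n, a 0 ≤ a n := fun n => hmono (by omega)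
  have hbn : ∀ n, b n ≤ E := fun n => hanti (Nat.zero_le (n + 1))
  have hab : ∀ n, a n ≤ b n := fun n => iterate_le_iterate hmon hmap hz hE1 hE.1.le _
  have hstep : ∀ n, Real.log (Real.log (1 / a n) / Real.log (1 / b n)) ≤
      (1 / 2) ^ n * Real.log (Real.log (1 / a 0) / Real.log (1 / b 0)) := by
    intro n
    induction n with
    | zero => simp
    | succ n ih =>
      have hbp : 0 < b n := (ha0.trans_le (han n)).trans_le (hab n)
      have := P.log_log_seOp_sub_le hB hR hδ (ha0.trans_le (han n)) (hab n)
        ((hbn n).trans hE.2) (hx.trans (P.halfFisher_antitone hbp (hbn n) hE1.2)) hε'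
        (hJ _ _ (ha0.trans_le (han n)) (hab n) ((hbn n).trans hEη))
      have ea : a (n + 1) = P.seOp B R (a n) := Function.iterate_succ_apply' _ _ _
      have eb : b (n + 1) = P.seOp B R (b n) := Function.iterate_succ_apply' _ _ _
      rw [ea, eb, pow_succ]
      linarith
  have hla : Tendsto a atTop (𝓝 (P.mseFloor B R)) :=
    (tendsto_add_atTop_iff_nat 1).2 (P.tendsto_seLimit hB R hz)
  have hlb : Tendsto b atTop (𝓝 (P.seLimit B R E)) :=
    (tendsto_add_atTop_iff_nat 1).2 (P.tendsto_seLimit hB R hE1)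
  have hA : 0 < P.mseFloor B R := ha0.trans_le (ge_of_tendsto' hla han)
  have hAB := le_of_tendsto_of_tendsto' hla hlb hab
  have hBE : P.seLimit B R E ≤ 1 / 2 := le_of_tendsto' hlb fun n => (hbn n).trans hE.2
  have hLB : 0 < Real.log (1 / P.seLimit B R E) :=
    Real.log_pos (by rw [lt_div_iff₀ (hA.trans_le hAB)]; linarith)
  have hLA : Real.log (1 / P.seLimit B R E) ≤ Real.log (1 / P.mseFloor B R) :=
    Real.log_le_log (by have := hA.trans_le hAB; positivity) (one_div_le_one_div_of_le hA hAB)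
  have h1 : Tendsto (fun n => Real.log (1 / a n)) atTop (𝓝 (Real.log (1 / P.mseFloor B R))) :=
    (tendsto_const_nhds.div hla hA.ne').log (by positivity)
  have h2 : Tendsto (fun n => Real.log (1 / b n)) atTop (𝓝 (Real.log (1 / P.seLimit B R E))) :=
    (tendsto_const_nhds.div hlb (hA.trans_le hAB).ne').log
      (by have := hA.trans_le hAB; positivity)
  have h3 := (h1.div h2 hLB.ne').log (div_pos (hLB.trans_le hLA) hLB).ne'
  have h4 : Tendsto (fun n : ℕ =>
      (1 / 2 : ℝ) ^ n * Real.log (Real.log (1 / a 0) / Real.log (1 / b 0))) atTop (𝓝 0) := by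
    simpa using (tendsto_pow_atTop_nhds_zero_of_lt_one (by norm_num : (0 : ℝ) ≤ 1 / 2)
      (by norm_num)).mul_const (Real.log (Real.log (1 / a 0) / Real.log (1 / b 0)))
  have h5 := le_of_tendsto_of_tendsto' h3 h4 hstep
  have h6 : Real.log (1 / P.mseFloor B R) / Real.log (1 / P.seLimit B R E) ≤ 1 := by
    by_contra hc
    linarith [Real.log_pos (not_le.1 hc)]
  rw [div_le_one hLB, Real.log_le_log_iff (by positivity)
    (by have := hA.trans_le hAB; positivity)] at h6
  exact (one_div_le_one_div (by linarith) (by linarith)).1 h6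

/-- If `J` grows logarithmically, the exponential bound on the error reads `T(e) ≤ e²` as soon as
`ln B` is large, and `e² ≤ e/2` since `e ≤ 1/2`. The constant `4` is twice the exponent `2`, because
`j = J/2`. -/
lemma seLimit_eq_zero_of_log_le {B : ℕ} (hB : 2 ≤ B) {R : ℝ} (hR : 0 < R) {δ c η E : ℝ} (hδ : 0 < δ)
    (hE : E ∈ Ioc (0 : ℝ) (1 / 2)) (hEη : E ≤ η)
    (hx : (1 + δ) * (R * Real.log 2) ≤ P.halfFisher E) (hTE : P.seOp B R E ≤ E)
    (hc : 4 * (R * Real.log 2) ≤ Real.log B * ((δ / (2 * (1 + δ))) ^ 2 * c))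
    (hJ : ∀ E ∈ Ioc (0 : ℝ) η, ENNReal.ofReal (c * Real.log (1 / E)) ≤ P.avgFisher E) :
    P.seLimit B R E = 0 := by
  have hl := Real.log_pos one_lt_two
  have hlB := log_cast_pos hB
  have hK : 0 < R * Real.log 2 := mul_pos hR hl
  have hE1 : E ∈ Icc (0 : ℝ) 1 := ⟨hE.1.le, by linarith [hE.2]⟩
  have hmon := P.seOp_monotoneOn hB R
  have hmap := P.seOp_mapsTo B R
  have hanti := antitone_iterate_of_le hmon hmap hE1 hTE
  have hpos : ∀ n, 0 < (P.seOp B R)^[n] E := by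
    intro n
    induction n with
    | zero => exact hE.1
    | succ n ih =>
      rw [Function.iterate_succ_apply']
      exact P.seOp_pos hB hR ⟨ih, (hmap.iterate n hE1).2⟩
  have hsq : ∀ e, 0 < e → e ≤ E → P.seOp B R e ≤ 1 / 2 * e := by
    intro e he heE
    have he1 : e ∈ Ioc (0 : ℝ) 1 := ⟨he, heE.trans hE1.2⟩
    have h1 : c * Real.log (1 / e) ≤ 2 * P.halfFisher e := by
      have h2 := hJ e ⟨he, heE.trans hEη⟩
      rw [P.avgFisher_eq_ofReal he1] at h2
      by_contra hcon
      push Not at hcon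
      rw [ENNReal.ofReal_le_ofReal_iff (by linarith [P.halfFisher_nonneg e])] at h2
      linarith
    have hle : 0 ≤ Real.log (1 / e) := Real.log_nonneg (by rw [le_div_iff₀ he]; linarith [he1.2])
    have h3 : P.seOp B R e ≤
        Real.exp (-(Real.log B * ((δ / (2 * (1 + δ))) ^ 2 * (P.halfFisher e / (R * Real.log 2))))) := by
      rw [← P.invNoise_toReal_div hR]
      refine sectionMSE_le_exp_neg hB (P.invNoise_ne_top hR he1) hδ ?_
      rw [P.invNoise_toReal_div hR, le_div_iff₀ hK]
      exact hx.trans (P.halfFisher_antitone he heE hE1.2)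
    have h4 : 2 * Real.log (1 / e) ≤
        Real.log B * ((δ / (2 * (1 + δ))) ^ 2 * (P.halfFisher e / (R * Real.log 2))) := by
      have h5 : 4 * (R * Real.log 2) * Real.log (1 / e) ≤
          Real.log B * ((δ / (2 * (1 + δ))) ^ 2 * (2 * P.halfFisher e)) := by
        refine (mul_le_mul_of_nonneg_right hc hle).trans ?_
        have := mul_le_mul_of_nonneg_left h1
          (mul_nonneg hlB.le (sq_nonneg (δ / (2 * (1 + δ)))))
        linarith
      rw [← mul_div_assoc, ← mul_div_assoc, le_div_iff₀ hK]
      linarith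
    refine h3.trans ((Real.exp_le_exp.2 (neg_le_neg h4)).trans ?_)
    have h6 : Real.exp (-(2 * Real.log (1 / e))) = e * e := by
      rw [one_div, Real.log_inv, mul_neg, neg_neg, two_mul, Real.exp_add, Real.exp_log he]
    rw [h6]
    exact mul_le_mul_of_nonneg_right (heE.trans hE.2) he.le
  have hbd : ∀ n, (P.seOp B R)^[n] E ≤ (1 / 2) ^ n * E := by
    intro n
    induction n with
    | zero => simp
    | succ n ih =>
      rw [Function.iterate_succ_apply', pow_succ]
      refine (hsq _ (hpos n) (hanti (Nat.zero_le n))).trans ?_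
      linarith
  have h4 : Tendsto (fun n : ℕ => (1 / 2 : ℝ) ^ n * E) atTop (𝓝 0) := by
    simpa using (tendsto_pow_atTop_nhds_zero_of_lt_one (by norm_num : (0 : ℝ) ≤ 1 / 2)
      (by norm_num)).mul_const E
  exact le_antisymm (le_of_tendsto_of_tendsto' (P.tendsto_seLimit hB R hE1) h4 hbd)
    (P.seLimit_mem hB R hE1).1

/-- For a regular Fisher information, every point at which the effective noise is smaller than the
critical one is in the basin of the MSE floor, when the alphabet is large. -/
theorem eventually_seLimit_eq_mseFloor (hreg : P.RegularFisher)
    (hI : P.outEntropy 0 < P.outEntropy 1) {δ Rm Em : ℝ} (hδ : 0 < δ)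
    (hEm : Em ∈ Ioc (0 : ℝ) 1) (hm : (1 + δ) * (Rm * Real.log 2) ≤ P.halfFisher Em) :
    ∀ᶠ B : ℕ in atTop, ∀ R ∈ Ioc 0 Rm, ∀ E ∈ Ioc (0 : ℝ) 1,
      (1 + δ) * (R * Real.log 2) ≤ P.halfFisher E → P.seLimit B R E = P.mseFloor B R := by
  have hl := Real.log_pos one_lt_two
  have hsmall : ∀ η : ℝ, 0 < η → ∀ᶠ B : ℕ in atTop, floorBound δ B ≤ η := fun η hη =>
    (tendsto_floorBound hδ).eventually (eventually_le_nhds hη)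
  have hκ : 0 < (δ / (2 * (1 + δ))) ^ 2 := by positivity
  have key : ∀ᶠ B : ℕ in atTop, ∀ R ∈ Ioc 0 Rm,
      P.seLimit B R (floorBound δ B) ≤ P.mseFloor B R := by
    have hT : ∀ᶠ B : ℕ in atTop, ∀ R ∈ Ioc 0 Rm,
        (1 + δ) * (R * Real.log 2) ≤ P.halfFisher (floorBound δ B) ∧
        P.seOp B R (floorBound δ B) ≤ floorBound δ B := by
      filter_upwards [eventually_ge_atTop 2, hsmall Em hEm.1] with B hB h1 R hR
      have h2 : (1 + δ) * (R * Real.log 2) ≤ P.halfFisher (floorBound δ B) := by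
        refine le_trans ?_ (hm.trans (P.halfFisher_antitone (floorBound_pos δ B) h1 hEm.2))
        have := hR.2
        gcongr
      exact ⟨h2, P.seOp_le_floorBound hB hR.1 hδ ⟨floorBound_pos δ B, h1.trans hEm.2⟩ h2⟩
    rcases hreg with ⟨h0, hJ⟩ | ⟨c, hc, η, hη, hJ⟩
    · have hj := P.halfFisher_half_pos hI
      obtain ⟨η, hη, hJ⟩ := hJ ((δ / (2 * (1 + δ))) ^ 2 * P.halfFisher (1 / 2) / 4) (by positivity)
      filter_upwards [eventually_ge_atTop 2, hsmall η hη.1, hsmall (1 / 2) (by norm_num), hT]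
        with B hB h1 h2 h3 R hR
      exact P.seLimit_le_mseFloor_of_contraction hB hR.1 h0 hδ ⟨floorBound_pos δ B, h2⟩ h1
        (h3 R hR).1 (h3 R hR).2 (by linarith) hJ
    · have hlog : Tendsto (fun B : ℕ => Real.log (B : ℝ) * ((δ / (2 * (1 + δ))) ^ 2 * c)) atTop
          atTop := (Real.tendsto_log_atTop.comp tendsto_natCast_atTop_atTop).atTop_mul_const
            (by positivity)
      filter_upwards [eventually_ge_atTop 2, hsmall η hη.1, hsmall (1 / 2) (by norm_num), hT,
        hlog.eventually_ge_atTop (4 * (Rm * Real.log 2))] with B hB h1 h2 h3 h4 R hR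
      rw [P.seLimit_eq_zero_of_log_le hB hR.1 hδ ⟨floorBound_pos δ B, h2⟩ h1 (h3 R hR).1
        (h3 R hR).2 (le_trans (by have := hR.2; gcongr) h4) hJ]
      exact P.mseFloor_nonneg hB R
  filter_upwards [eventually_ge_atTop 2, hsmall 1 one_pos, key] with B hB h1 h2 R hR E hE h3
  have hE' := Ioc_subset_Icc_self hE
  refine le_antisymm ?_ (P.mseFloor_le_seLimit hB R hE')
  -- One step brings `E` below `floorBound`, so by monotonicity only the orbit of `floorBound` has
  -- to be controlled.
  rw [← P.seLimit_seOp hB R hE']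
  exact (P.seLimit_mono hB R (P.seOp_mapsTo B R hE') ⟨(floorBound_pos δ B).le, h1⟩
    (P.seOp_le_floorBound hB hR.1 hδ hE h3)).trans (h2 R hR)

end

end MemorylessChannel
end SparseSuperposition

/-! ### Large alphabet bounds for a section, and the potential threshold -/

namespace SparseSuperposition

lemma redEntropy_antitone {B : ℕ} (hB : 2 ≤ B) : Antitone (redEntropy B) := by
  intro v w h
  by_cases hw : w = ∞
  · rw [hw, redEntropy_top hB]; exact redEntropy_nonneg hB v
  · have hv := ne_top_of_le_ne_top hw h
    have h1 := redEntropy_sub_ge hB hw hv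
    have h2 := ENNReal.toReal_mono hw h
    have h3 : 0 ≤ sectionMSE B w / (2 * Real.log 2) :=
      div_nonneg (sectionMSE_nonneg B w) (by have := Real.log_pos one_lt_two; linarith)
    nlinarith

/-- The error of the denoiser tends to `1` when the effective noise is above the critical one. -/
lemma tendsto_sectionMSE_one {v : ℝ≥0∞} (hv : v < ENNReal.ofReal (2 * Real.log 2)) :
    Tendsto (fun B : ℕ => sectionMSE B v) atTop (𝓝 1) := by
  have hl : 0 < 2 * Real.log 2 := by have := Real.log_pos one_lt_two; linarith
  have hvt := hv.ne_top
  set w := ENNReal.ofReal (2 * Real.log 2) with hw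
  have hwt : w ≠ ∞ := ENNReal.ofReal_ne_top
  have hw2 : w.toReal = 2 * Real.log 2 := ENNReal.toReal_ofReal hl.le
  have hv2 : v.toReal < 2 * Real.log 2 := by
    rw [← hw2]; exact (ENNReal.toReal_lt_toReal hvt hwt).2 hv
  -- The error at `v` is at least the slope of the chord of the entropy from `v` to the critical
  -- value `w`, in absolute value and normalized. In the limit the entropy is affine there and the
  -- normalized slope is `1`.
  have h1 := ((tendsto_redEntropy v).sub (tendsto_redEntropy w)).mul_const
    (2 * Real.log 2 / (2 * Real.log 2 - v.toReal))
  have e : ((1 - v / ENNReal.ofReal (2 * Real.log 2)).toReal -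
      (1 - w / ENNReal.ofReal (2 * Real.log 2)).toReal) *
      (2 * Real.log 2 / (2 * Real.log 2 - v.toReal)) = 1 := by
    rw [← hw, ENNReal.div_self (by rw [hw]; exact (ENNReal.ofReal_pos.2 hl).ne') hwt, tsub_self,
      ENNReal.toReal_sub_of_le (ENNReal.div_le_of_le_mul (by rw [one_mul]; exact hv.le))
      ENNReal.one_ne_top, ENNReal.toReal_div, hw2, ENNReal.toReal_one, ENNReal.toReal_zero]
    have : 2 * Real.log 2 - v.toReal ≠ 0 := by linarith
    field_simp
    ring
  rw [e] at h1
  refine tendsto_of_tendsto_of_tendsto_of_le_of_le' h1 tendsto_const_nhds ?_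
    (Eventually.of_forall fun B => sectionMSE_le_one B v)
  filter_upwards [eventually_ge_atTop 2] with B hB
  have h2 := redEntropy_sub_ge hB hvt hwt
  rw [hw2] at h2
  have h3 : 0 < 2 * Real.log 2 - v.toReal := by linarith
  rw [← mul_div_assoc, div_le_iff₀ h3, ← le_div_iff₀ hl]
  have h4 : sectionMSE B v / (2 * Real.log 2) * (2 * Real.log 2 - v.toReal) =
    sectionMSE B v * (2 * Real.log 2 - v.toReal) / (2 * Real.log 2) := by ring
  linarith

lemma tendsto_ofReal_of_bounds {f : ℕ → ℝ≥0∞} {c d : ℝ} (hc : 0 < c) (hd : c < d)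
    (h1 : ∀ R ∈ Ioo 0 c, ∀ᶠ B in atTop, ENNReal.ofReal R ≤ f B)
    (h2 : ∀ R ∈ Ioo c d, ∀ᶠ B in atTop, f B ≤ ENNReal.ofReal R) :
    Tendsto f atTop (𝓝 (ENNReal.ofReal c)) := by
  refine tendsto_order.2 ⟨fun a ha => ?_, fun a ha => ?_⟩
  · have hc1 := (ENNReal.continuous_ofReal.tendsto c).mono_left (nhdsWithin_le_nhds (s := Iio c))
    obtain ⟨R, h3, h4⟩ := ((hc1.eventually (lt_mem_nhds ha)).and (Ioo_mem_nhdsLT hc)).exists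
    filter_upwards [h1 R h4] with B hB using h3.trans_le hB
  · have hc1 := (ENNReal.continuous_ofReal.tendsto c).mono_left (nhdsWithin_le_nhds (s := Ioi c))
    obtain ⟨R, h3, h4⟩ := ((hc1.eventually (gt_mem_nhds ha)).and (Ioo_mem_nhdsGT hd)).exists
    filter_upwards [h2 R h4] with B hB using hB.trans_lt h3

/-- A bound on the deviation of the entropy of a section from its large alphabet limit. -/
noncomputable def entropyBound (δ : ℝ) (B : ℕ) : ℝ :=
  (1 + Real.log 2) / Real.log B +
    Real.sqrt (2 * (1 + δ)) * (∫ x, |x| ∂stdGaussian) / Real.sqrt (Real.log B)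

lemma tendsto_entropyBound (δ : ℝ) : Tendsto (entropyBound δ) atTop (𝓝 0) := by
  have hlog : Tendsto (fun B : ℕ => Real.log (B : ℝ)) atTop atTop :=
    Real.tendsto_log_atTop.comp tendsto_natCast_atTop_atTop
  have := (hlog.const_div_atTop (1 + Real.log 2)).add
    ((Real.tendsto_sqrt_atTop.comp hlog).const_div_atTop
      (Real.sqrt (2 * (1 + δ)) * (∫ x, |x| ∂stdGaussian)))
  rw [add_zero] at this
  exact this

/-- The deviation is uniform in `v` on this range, as needed for thresholds that involve all rates
and all `E` at a given `B`. -/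
lemma redEntropy_le_entropyBound {B : ℕ} (hB : 2 ≤ B) {v : ℝ≥0∞} (hv : v ≠ ∞) {δ : ℝ}
    (h : v.toReal / (2 * Real.log 2) ≤ 1 + δ) :
    redEntropy B v ≤ max 0 (1 - v.toReal / (2 * Real.log 2)) + entropyBound δ B := by
  have hl := Real.log_pos one_lt_two
  refine (redEntropy_le hB hv).trans ?_
  have h1 : v.toReal / Real.log 2 ≤ 2 * (1 + δ) := by
    have : v.toReal / Real.log 2 = 2 * (v.toReal / (2 * Real.log 2)) := by field_simp
    linarith
  have h2 : 0 ≤ ∫ x, |x| ∂stdGaussian := integral_nonneg fun x => abs_nonneg x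
  unfold entropyBound
  gcongr

namespace MemorylessChannel

variable {𝓑 : Type*} [MeasurableSpace 𝓑] {ν : Measure 𝓑} (P : MemorylessChannel ℝ 𝓑 ν)

/-! ### The potential threshold -/

/-- The potential in nats per unit of `R ln 2`, up to a constant. -/
noncomputable def natPotential (B : ℕ) (R E : ℝ) : ℝ :=
  P.outEntropy E - E * P.halfFisher E - R * Real.log 2 * redEntropy B (P.invNoise R E)

lemma natPotential_le {B : ℕ} (hB : 2 ≤ B) {R : ℝ}
    (hR : 0 < R) {E : ℝ} (hE : E ∈ Icc (0 : ℝ) 1) : P.natPotential B R E ≤ P.outEntropy E := by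
  have h1 := mul_nonneg (mul_pos hR (Real.log_pos one_lt_two)).le
    (redEntropy_nonneg hB (P.invNoise R E))
  have h2 := mul_nonneg hE.1 (P.halfFisher_nonneg E)
  unfold natPotential; linarith

section

variable [SFinite ν]

lemma mul_potential_sub (hH : P.FiniteEntropies stdGaussian) (B : ℕ) {R : ℝ} (hR : 0 < R)
    {E E' : ℝ} (hE : E ∈ Icc (0 : ℝ) 1) (hE' : E' ∈ Icc (0 : ℝ) 1) :
    R * Real.log 2 * (P.potential B R E - P.potential B R E') =
      P.natPotential B R E - P.natPotential B R E' := by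
  have hK : R * Real.log 2 ≠ 0 := (mul_pos hR (Real.log_pos one_lt_two)).ne'
  have h1 := P.potential_eq B R E
  have h2 := P.potential_eq B R E'
  have e1 := P.energyTerm_eq hH hR hE
  have e2 := P.energyTerm_eq hH hR hE'
  rw [eq_div_iff hK] at e1 e2
  unfold natPotential halfFisher
  linear_combination R * Real.log 2 * h1 - R * Real.log 2 * h2 + e1 - e2

/-- Where the effective noise is not much smaller than the critical one, the potential exceeds its
value at `0` by a constant. -/
lemma natPotential_ge (hH : P.FiniteEntropies stdGaussian) {B : ℕ} (hB : 2 ≤ B) {R : ℝ}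
    (hR : 0 < R) {δ E : ℝ} (hδ : 0 ≤ δ) (hE : E ∈ Ioc (0 : ℝ) 1)
    (h : P.halfFisher E ≤ (1 + δ) * (R * Real.log 2)) :
    P.outEntropy 1 - (1 + δ) * (R * Real.log 2) - R * Real.log 2 * entropyBound δ B ≤
      P.natPotential B R E := by
  have hK : 0 < R * Real.log 2 := mul_pos hR (Real.log_pos one_lt_two)
  have hx : (P.invNoise R E).toReal / (2 * Real.log 2) ≤ 1 + δ := by
    rw [P.invNoise_toReal_div hR, div_le_iff₀ hK]; exact h
  have h1 := mul_le_mul_of_nonneg_left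
    (redEntropy_le_entropyBound hB (P.invNoise_ne_top hR hE) hx) hK.le
  rw [P.invNoise_toReal_div hR, mul_add, mul_max_of_nonneg _ _ hK.le, mul_zero, mul_sub, mul_one,
    mul_div_cancel₀ _ hK.ne'] at h1
  have h2 := P.outEntropy_one_sub_le hH hE
  -- The left side is the maximum of `j` and `K`. It is to be combined with `H(E) - E j ≥ H(1) - j`.
  have h3 : P.halfFisher E + max 0 (R * Real.log 2 - P.halfFisher E) ≤
      (1 + δ) * (R * Real.log 2) := by
    rw [← le_sub_iff_add_le']
    refine max_le (by linarith) ?_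
    nlinarith
  unfold natPotential
  linarith

lemma outEntropy_sub_halfFisher_le (hH : P.FiniteEntropies stdGaussian) {E : ℝ}
    (hE : E ∈ Icc (0 : ℝ) 1) : P.outEntropy 0 ≤ P.outEntropy E - E * P.halfFisher E := by
  rcases hE.1.eq_or_lt with h | h
  · subst h; simp
  · linarith [P.mul_halfFisher_le hH ⟨h, hE.2⟩]

lemma exists_halfFisher_gt (hH : P.FiniteEntropies stdGaussian)
    (hI : P.outEntropy 0 < P.outEntropy 1) :
    ∃ E ∈ Ioc (0 : ℝ) 1, P.outEntropy 1 - P.outEntropy 0 < P.halfFisher E := by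
  obtain ⟨E, hE, h⟩ := P.lt_avgFisher_zero_iff.1 (P.lt_avgFisher_zero hH hI)
  rw [P.avgFisher_eq_ofReal hE, ENNReal.ofReal_lt_ofReal_iff_of_nonneg (by linarith)] at h
  exact ⟨E, hE, by linarith⟩

lemma outEntropy_mono (hH : P.FiniteEntropies stdGaussian) : MonotoneOn P.outEntropy (Icc 0 1) := by
  intro E hE E' hE' h
  rcases hE.1.eq_or_lt with h0 | h0
  · subst h0; exact (P.outEntropy_mem hH hE').1
  · have := (P.outEntropy_sub_bounds hH h0 h hE'.2).1
    have := mul_nonneg (sub_nonneg.2 h) (P.halfFisher_nonneg E')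
    linarith

/-- For all rates up to `Rm < I`, the MSE floor is small, uniformly. -/
lemma eventually_mseFloor_le (hH : P.FiniteEntropies stdGaussian)
    (hI : P.outEntropy 0 < P.outEntropy 1) {δ Rm η : ℝ} (hδ : 0 < δ) (hη : 0 < η)
    (hRm : (1 + δ) * (Rm * Real.log 2) ≤ P.outEntropy 1 - P.outEntropy 0) :
    ∀ᶠ B : ℕ in atTop, ∀ R ∈ Ioc 0 Rm, P.mseFloor B R ≤ η := by
  obtain ⟨Em, hEm, h⟩ := P.exists_halfFisher_gt hH hI
  filter_upwards [eventually_ge_atTop 2,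
    (tendsto_floorBound hδ).eventually (eventually_le_nhds hEm.1),
    (tendsto_floorBound hδ).eventually (eventually_le_nhds hη)] with B hB h1 h2 R hR
  refine (P.mseFloor_le_floorBound hB hR.1 hδ hEm (le_trans ?_ (hRm.trans h.le)) h1).trans h2
  have := hR.2
  have := Real.log_pos one_lt_two
  gcongr

lemma exists_margin {Rm I : ℝ} (hRm : 0 < Rm) (h : Rm < I / Real.log 2) :
    ∃ δ : ℝ, 0 < δ ∧ (1 + δ) * (Rm * Real.log 2) < I := by
  have hK : 0 < Rm * Real.log 2 := mul_pos hRm (Real.log_pos one_lt_two)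
  rw [lt_div_iff₀ (Real.log_pos one_lt_two)] at h
  refine ⟨(I - Rm * Real.log 2) / (2 * (Rm * Real.log 2)), by
    have := sub_pos.2 h; positivity, ?_⟩
  have : (1 + (I - Rm * Real.log 2) / (2 * (Rm * Real.log 2))) * (Rm * Real.log 2) =
      Rm * Real.log 2 + (I - Rm * Real.log 2) / 2 := by field_simp
  rw [this]; linarith

/-- Outside of the basin `j ≤ (1 + δ) K`, so the scaled potential is at least `H(1) - (1 + δ) K -
o(1)`. At the floor it is at most `H(η)` for a small `η`, which is close to `H(0)`. All bounds are
uniform over the rates up to `Rm`. -/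
lemma eventually_le_potThreshold (hreg : P.RegularFisher) (hH : P.FiniteEntropies stdGaussian)
    (hI : P.outEntropy 0 < P.outEntropy 1) {Rm : ℝ} (hRm : 0 < Rm)
    (hRI : Rm < (P.outEntropy 1 - P.outEntropy 0) / Real.log 2) :
    ∀ᶠ B : ℕ in atTop, ENNReal.ofReal Rm ≤ P.potThreshold B := by
  have hl := Real.log_pos one_lt_two
  obtain ⟨δ, hδ, hgap⟩ := exists_margin hRm hRI
  obtain ⟨Em, hEm, hjm⟩ := P.exists_halfFisher_gt hH hI
  set gap := P.outEntropy 1 - P.outEntropy 0 - (1 + δ) * (Rm * Real.log 2) with hg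
  have hgap0 : 0 < gap := sub_pos.2 hgap
  have hcont := (P.tendsto_outEntropy_zero hH).eventually
    (gt_mem_nhds (show P.outEntropy 0 < P.outEntropy 0 + gap / 4 by linarith))
  obtain ⟨η, hη, hη1, hηH⟩ : ∃ η, 0 < η ∧ η < 1 ∧ P.outEntropy η < P.outEntropy 0 + gap / 4 := by
    obtain ⟨η, h1, h2⟩ := (hcont.and (Ioo_mem_nhdsGT one_pos)).exists
    exact ⟨η, h2.1, h2.2, h1⟩
  have hsm := ((tendsto_entropyBound δ).const_mul (Rm * Real.log 2)).eventually
    (gt_mem_nhds (show Rm * Real.log 2 * 0 < gap / 4 by rw [mul_zero]; linarith))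
  filter_upwards [eventually_ge_atTop 2, hsm, P.eventually_mseFloor_le hH hI hδ hη hgap.le,
    P.eventually_seLimit_eq_mseFloor hreg hI (Rm := Rm) hδ hEm (hgap.trans hjm).le]
    with B hB h1 h2 h3
  refine le_iSup₂_of_le Rm ⟨hRm, fun R hR => ?_⟩ le_rfl
  have hK : 0 < R * Real.log 2 := mul_pos hR.1 hl
  have hKm : R * Real.log 2 ≤ Rm * Real.log 2 := mul_le_mul_of_nonneg_right hR.2 hl.le
  -- An infimum of positive numbers may be `0`, whence a lower bound independent of `E`.
  have hle : (((gap / 2 / (Rm * Real.log 2) : ℝ)) : EReal) ≤ P.freeEnergyGap B R := by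
    refine le_iInf₂ fun E hE => ?_
    rw [EReal.coe_le_coe_iff]
    have hE0 : E ∈ Ioc (0 : ℝ) 1 := by
      refine ⟨lt_of_le_of_ne hE.1.1 fun h => hE.2 ?_, hE.1.2⟩
      rw [← h]; exact P.zero_mem_basin B R
    have hjE : P.halfFisher E ≤ (1 + δ) * (R * Real.log 2) := by
      by_contra hc
      exact hE.2 ⟨hE.1, h3 R hR E hE0 (not_le.1 hc).le⟩
    have hF : P.mseFloor B R ∈ Icc (0 : ℝ) 1 := P.seLimit_mem hB R ⟨le_rfl, zero_le_one⟩
    have e1 := P.mul_potential_sub hH B hR.1 hE.1 hF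
    have e2 := P.natPotential_ge hH hB hR.1 hδ.le hE0 hjE
    have e3 := P.natPotential_le hB hR.1 hF
    have e4 := P.outEntropy_mono hH hF ⟨hη.le, hη1.le⟩ (h2 R hR)
    have e5 : (1 + δ) * (R * Real.log 2) ≤ (1 + δ) * (Rm * Real.log 2) := by gcongr
    have e6 : R * Real.log 2 * entropyBound δ B ≤ Rm * Real.log 2 * entropyBound δ B := by
      have : 0 ≤ entropyBound δ B := by
        have h4 : 0 ≤ ∫ x, |x| ∂stdGaussian := integral_nonneg fun x => abs_nonneg x
        have := log_cast_pos hB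
        unfold entropyBound; positivity
      gcongr
    have e7 : gap / 2 ≤ R * Real.log 2 * (P.potential B R E - P.potential B R (P.mseFloor B R)) := by
      rw [e1]; linarith
    have e8 : 0 ≤ P.potential B R E - P.potential B R (P.mseFloor B R) := by
      by_contra hc
      nlinarith
    rw [div_le_iff₀ (by positivity)]
    nlinarith
  refine lt_of_lt_of_le ?_ hle
  exact_mod_cast (by positivity : 0 < gap / 2 / (Rm * Real.log 2))

lemma seOp_ge_of_halfFisher_lt {R : ℝ} (hR : 0 < R) {E : ℝ} (hE : E ∈ Ioo (0 : ℝ) 1)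
    (h : P.halfFisher E < R * Real.log 2) : ∀ᶠ B : ℕ in atTop, E ≤ P.seOp B R E := by
  have hE' : E ∈ Ioc (0 : ℝ) 1 := ⟨hE.1, hE.2.le⟩
  have hv : P.invNoise R E < ENNReal.ofReal (2 * Real.log 2) := by
    rw [← ENNReal.ofReal_toReal (P.invNoise_ne_top hR hE'), P.invNoise_toReal hR]
    refine (ENNReal.ofReal_lt_ofReal_iff (by have := Real.log_pos one_lt_two; linarith)).2 ?_
    rw [div_lt_iff₀ hR]; linarith
  exact (tendsto_sectionMSE_one hv).eventually (eventually_ge_nhds hE.2)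

lemma one_lt_relSnr_zero {R E : ℝ} (hR : 0 < R) (hE : E ∈ Ioc (0 : ℝ) 1)
    (h : R * Real.log 2 < P.halfFisher E) : 1 < P.relSnr R 0 := by
  rw [P.one_lt_relSnr_iff hR]
  refine P.lt_avgFisher_zero_iff.2 ⟨E, hE, ?_⟩
  have := mul_pos hR (Real.log_pos one_lt_two)
  rw [P.avgFisher_eq_ofReal hE, ENNReal.ofReal_lt_ofReal_iff_of_nonneg (by linarith)]
  linarith

lemma tendsto_redEntropy_invNoise {R : ℝ} (hR : 0 < R) {E : ℝ} (hE : E ∈ Ioc (0 : ℝ) 1) :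
    Tendsto (fun B : ℕ => R * Real.log 2 * redEntropy B (P.invNoise R E)) atTop
      (𝓝 (max 0 (R * Real.log 2 - P.halfFisher E))) := by
  have hK := mul_pos hR (Real.log_pos one_lt_two)
  have h1 := (tendsto_redEntropy (P.invNoise R E)).const_mul (R * Real.log 2)
  have h2 : (1 - P.invNoise R E / ENNReal.ofReal (2 * Real.log 2)) = 1 - P.relSnr R E := rfl
  rw [h2, P.relSnr_eq hR (P.avgFisher_ne_top hE), ← ENNReal.ofReal_one,
    ← ENNReal.ofReal_sub _ (div_nonneg (P.halfFisher_nonneg E) hK.le), ENNReal.toReal_ofReal',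
    mul_max_of_nonneg _ _ hK.le, mul_sub, mul_div_cancel₀ _ hK.ne', mul_zero, mul_one, max_comm] at h1
  exact h1

/-- The infimum is tested at `E = 1`. Near `1` there is an `E₁` with `j(E₁) < K`, where the error
tends to `1`; the orbit of `1` is stopped above `E₁` and misses the floor. The scaled potential
difference is at most `H(1) - H(0) - K + o(1)`, the entropy at the floor being controlled by its
value at `Em`. -/
lemma eventually_freeEnergyGap_nonpos (hH : P.FiniteEntropies stdGaussian)
    (hI : P.outEntropy 0 < P.outEntropy 1) {R Em : ℝ} (hR : 0 < R)
    (hRI : P.outEntropy 1 - P.outEntropy 0 < R * Real.log 2) (hEm : Em ∈ Ioc (0 : ℝ) 1)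
    (hm : R * Real.log 2 < P.halfFisher Em) : ∀ᶠ B : ℕ in atTop, P.freeEnergyGap B R ≤ 0 := by
  have hl := Real.log_pos one_lt_two
  have hK := mul_pos hR hl
  have hj1 := (P.halfFisher_one_lt hH hI).trans hRI
  obtain ⟨E₁, h1, hE₁⟩ := ((P.tendsto_halfFisher_one.eventually (gt_mem_nhds hj1)).and
    (Ioo_mem_nhdsLT one_pos)).exists
  have hfl := P.tendsto_mseFloor hR (P.one_lt_relSnr_zero hR hEm hm)
  have hone : (1 : ℝ) ∈ Ioc (0 : ℝ) 1 := ⟨one_pos, le_rfl⟩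
  have hlim := (P.tendsto_redEntropy_invNoise hR hEm).sub (P.tendsto_redEntropy_invNoise hR hone)
  rw [max_eq_left (by linarith), max_eq_right (by linarith), zero_sub] at hlim
  filter_upwards [eventually_ge_atTop 2, P.seOp_ge_of_halfFisher_lt hR hE₁ h1,
    hfl.eventually (gt_mem_nhds hE₁.1), hfl.eventually (gt_mem_nhds hEm.1),
    hlim.eventually (gt_mem_nhds (show -(R * Real.log 2 - P.halfFisher 1) <
      P.outEntropy 0 - P.outEntropy 1 + P.halfFisher 1 by linarith))] with B hB h2 h3 h4 h5
  have hone' : (1 : ℝ) ∈ Icc (0 : ℝ) 1 := ⟨zero_le_one, le_rfl⟩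
  have hE₁' : E₁ ∈ Icc (0 : ℝ) 1 := ⟨hE₁.1.le, hE₁.2.le⟩
  have hnb : (1 : ℝ) ∉ P.basin B R := by
    intro hb
    have e1 := P.le_seLimit hB hE₁' h2
    have e2 := P.seLimit_mono hB R hE₁' hone' hE₁.2.le
    rw [hb.2] at e2
    linarith
  refine iInf₂_le_of_le 1 ⟨hone', hnb⟩ ?_
  have hF : P.mseFloor B R ∈ Icc (0 : ℝ) 1 := P.seLimit_mem hB R ⟨le_rfl, zero_le_one⟩
  have e1 := P.mul_potential_sub hH B hR hone' hF
  have e2 := P.outEntropy_sub_halfFisher_le hH hF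
  have e3 := mul_le_mul_of_nonneg_left (redEntropy_antitone hB
    (P.invNoise_antitoneOn R hF (Ioc_subset_Icc_self hEm) h4.le)) hK.le
  have e4 : R * Real.log 2 * (P.potential B R 1 - P.potential B R (P.mseFloor B R)) ≤ 0 := by
    rw [e1]; unfold natPotential; linarith
  have e5 : P.potential B R 1 - P.potential B R (P.mseFloor B R) ≤ 0 := by
    by_contra hc
    nlinarith
  exact_mod_cast e5

theorem tendsto_potThreshold (hreg : P.RegularFisher) (hH : P.FiniteEntropies stdGaussian)
    (hI : P.outEntropy 0 < P.outEntropy 1) :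
    Tendsto P.potThreshold atTop
      (𝓝 (ENNReal.ofReal ((P.outEntropy 1 - P.outEntropy 0) / Real.log 2))) := by
  have hl := Real.log_pos one_lt_two
  obtain ⟨Em, hEm, hjm⟩ := P.exists_halfFisher_gt hH hI
  refine tendsto_ofReal_of_bounds (d := P.halfFisher Em / Real.log 2)
    (div_pos (sub_pos.2 hI) hl) (by gcongr)
    (fun R hR => P.eventually_le_potThreshold hreg hH hI hR.1 hR.2) fun R hR => ?_
  have hR0 : 0 < R := (div_pos (sub_pos.2 hI) hl).trans hR.1
  filter_upwards [P.eventually_freeEnergyGap_nonpos hH hI hR0 ((div_lt_iff₀ hl).1 hR.1) hEm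
    ((lt_div_iff₀ hl).1 hR.2)] with B hB
  refine iSup₂_le fun R' hR' => ENNReal.ofReal_le_ofReal ?_
  by_contra hc
  exact absurd (hR'.2 R ⟨hR0, (not_le.1 hc).le⟩) (not_lt.2 hB)

end

end MemorylessChannel
end SparseSuperposition

namespace SparseSuperposition

/-! ### Fronts of the coupled state evolution -/

/-- Weights `α₀, …, α_{2w}` of a moving average, at most `a`. -/
structure IsWindow (α : ℕ → ℝ) (w : ℕ) (a : ℝ) : Prop where
  nonneg : ∀ k ∈ Finset.range (2 * w + 1), 0 ≤ α k
  sum_eq : ∑ k ∈ Finset.range (2 * w + 1), α k = 1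
  le : ∀ k ∈ Finset.range (2 * w + 1), α k ≤ a

/-- Profiles on `ℕ` increasing from `ε`, its value on `[0, 3w)`, to their value at `N`. -/
structure IsFront (ε : ℝ) (w N : ℕ) (X : ℕ → ℝ) : Prop where
  mono : Monotone X
  le_one : ∀ r, X r ≤ 1
  left : ∀ r < 3 * w, X r = ε
  right : ∀ r, N ≤ r → X r = X N

lemma IsFront.ge {ε : ℝ} {w N : ℕ} {X : ℕ → ℝ} (h : IsFront ε w N X) (hw : 0 < w) (r : ℕ) :
    ε ≤ X r := by
  rw [← h.left 0 (by omega)]; exact h.mono (Nat.zero_le r)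

lemma IsFront.mem {ε : ℝ} {w N : ℕ} {X : ℕ → ℝ} (h : IsFront ε w N X) (hw : 0 < w) (hε : 0 < ε)
    (r : ℕ) : X r ∈ Ioc (0 : ℝ) 1 := ⟨hε.trans_le (h.ge hw r), h.le_one r⟩

/-- A translation without boundary terms, as `d` vanishes at both ends. The truncation in `r - k`
occurs only where `d r = 0`. -/
lemma sum_range_shift {N k : ℕ} {F d : ℕ → ℝ} (h1 : ∀ r < k, d r = 0) (h2 : ∀ r, N ≤ r → d r = 0) :
    ∑ r ∈ Finset.range N, F (r - k) * d r = ∑ u ∈ Finset.range N, F u * d (u + k) := by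
  have e1 : ∑ r ∈ Finset.range (N + k), F (r - k) * d r =
      ∑ r ∈ Finset.range N, F (r - k) * d r := by
    rw [Finset.sum_range_add, add_eq_left]
    exact Finset.sum_eq_zero fun i _ => by rw [h2 _ (by omega), mul_zero]
  have e2 : ∑ r ∈ Finset.range (k + N), F (r - k) * d r =
      ∑ u ∈ Finset.range N, F u * d (u + k) := by
    rw [Finset.sum_range_add, Finset.sum_eq_zero fun i hi => by
      rw [h1 _ (Finset.mem_range.1 hi), mul_zero], zero_add]
    exact Finset.sum_congr rfl fun u _ => by rw [Nat.add_sub_cancel_left, add_comm k u]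
  rw [← e1, add_comm N k, e2]

namespace MemorylessChannel

variable {𝓑 : Type*} [MeasurableSpace 𝓑] {ν : Measure 𝓑} (P : MemorylessChannel ℝ 𝓑 ν)

/-- The moving average of the inverse effective noise. -/
noncomputable def winNoise (α : ℕ → ℝ) (w : ℕ) (R : ℝ) (X : ℕ → ℝ) (u : ℕ) : ℝ≥0∞ :=
  ∑ k ∈ Finset.range (2 * w + 1), ENNReal.ofReal (α k) * P.invNoise R (X (u + k))

/-- The coupled state evolution operator away from the boundary. -/
noncomputable def winOp (α : ℕ → ℝ) (B w : ℕ) (R : ℝ) (X : ℕ → ℝ) (r : ℕ) : ℝ :=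
  ∑ k ∈ Finset.range (2 * w + 1), α k * sectionMSE B (P.winNoise α w R X (r - k))

section

variable {α : ℕ → ℝ} {w N : ℕ} {a ε R : ℝ} {X : ℕ → ℝ}

lemma winNoise_eq_of_const (hα : IsWindow α w a) {u : ℕ} {x : ℝ}
    (h : ∀ k ∈ Finset.range (2 * w + 1), X (u + k) = x) :
    P.winNoise α w R X u = P.invNoise R x := by
  rw [winNoise, Finset.sum_congr rfl fun k hk => by rw [h k hk], ← Finset.sum_mul,
    ← ENNReal.ofReal_sum_of_nonneg hα.nonneg, hα.sum_eq, ENNReal.ofReal_one, one_mul]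

lemma winOp_mem (hα : IsWindow α w a) (B r : ℕ) : P.winOp α B w R X r ∈ Icc (0 : ℝ) 1 := by
  refine ⟨Finset.sum_nonneg fun k hk => mul_nonneg (hα.nonneg k hk) (sectionMSE_nonneg _ _), ?_⟩
  rw [← hα.sum_eq]
  exact Finset.sum_le_sum fun k hk =>
    mul_le_of_le_one_right (hα.nonneg k hk) (sectionMSE_le_one _ _)

variable [SFinite ν]

lemma winNoise_ne_top (hR : 0 < R) (hX : ∀ r, X r ∈ Ioc (0 : ℝ) 1) (u : ℕ) :
    P.winNoise α w R X u ≠ ∞ :=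
  ENNReal.sum_ne_top.2 fun _ _ => ENNReal.mul_ne_top ENNReal.ofReal_ne_top
    (P.invNoise_ne_top hR (hX _))

lemma winNoise_toReal (hα : IsWindow α w a) (hR : 0 < R) (hX : ∀ r, X r ∈ Ioc (0 : ℝ) 1) (u : ℕ) :
    (P.winNoise α w R X u).toReal =
      2 / R * ∑ k ∈ Finset.range (2 * w + 1), α k * P.halfFisher (X (u + k)) := by
  rw [winNoise, ENNReal.toReal_sum fun _ _ => ENNReal.mul_ne_top ENNReal.ofReal_ne_top
    (P.invNoise_ne_top hR (hX _)), Finset.mul_sum]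
  refine Finset.sum_congr rfl fun k hk => ?_
  rw [ENNReal.toReal_mul, ENNReal.toReal_ofReal (hα.nonneg k hk), P.invNoise_toReal hR]
  ring

lemma winNoise_anti {Y : ℕ → ℝ} (hX : ∀ r, X r ∈ Icc (0 : ℝ) 1) (hY : ∀ r, Y r ∈ Icc (0 : ℝ) 1)
    {u v : ℕ} (h : ∀ k, X (u + k) ≤ Y (v + k)) :
    P.winNoise α w R Y v ≤ P.winNoise α w R X u := by
  unfold winNoise
  gcongr with k
  exact P.invNoise_antitoneOn R (hX _) (hY _) (h k)

lemma winNoise_antitone (hX : ∀ r, X r ∈ Icc (0 : ℝ) 1) (hm : Monotone X) :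
    Antitone (P.winNoise α w R X) := fun _ _ h => P.winNoise_anti hX hX fun _ => hm (by omega)

lemma winOp_mono {B : ℕ} (hB : 2 ≤ B) (hα : IsWindow α w a) {Y : ℕ → ℝ}
    (hX : ∀ r, X r ∈ Icc (0 : ℝ) 1) (hY : ∀ r, Y r ∈ Icc (0 : ℝ) 1) (h : ∀ r, X r ≤ Y r) (r : ℕ) :
    P.winOp α B w R X r ≤ P.winOp α B w R Y r :=
  Finset.sum_le_sum fun k hk => mul_le_mul_of_nonneg_left
    (sectionMSE_antitone hB (P.winNoise_anti hX hY fun _ => h _)) (hα.nonneg k hk)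

lemma winOp_monotone {B : ℕ} (hB : 2 ≤ B) (hα : IsWindow α w a)
    (hX : ∀ r, X r ∈ Icc (0 : ℝ) 1) (hm : Monotone X) : Monotone (P.winOp α B w R X) :=
  fun _ _ h => Finset.sum_le_sum fun k hk => mul_le_mul_of_nonneg_left
    (sectionMSE_antitone hB (P.winNoise_antitone hX hm (by omega))) (hα.nonneg k hk)

/-- The energy balance of an almost stationary front: the potential cannot be much larger behind the
front than ahead of it. -/
theorem natPotential_front_le (hH : P.FiniteEntropies stdGaussian) {B : ℕ} (hB : 2 ≤ B)
    (hα : IsWindow α w a) (ha : 0 ≤ a) (hR : 0 < R) (hw : 0 < w) (hε : 0 < ε)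
    (hX : IsFront ε w N X) {κ : ℝ} (hκ : 0 ≤ κ)
    (hstep : ∀ r, 3 * w ≤ r → r ≤ N → X r ≤ P.winOp α B w R X r + κ) :
    P.natPotential B R (X N) ≤ P.natPotential B R ε + (a + κ) * P.halfFisher ε := by
  have hl := Real.log_pos one_lt_two
  have hm := hX.mem hw hε
  have hm' : ∀ r, X r ∈ Icc (0 : ℝ) 1 := fun r => Ioc_subset_Icc_self (hm r)
  set d : ℕ → ℝ := fun r => P.halfFisher (X r) - P.halfFisher (X (r + 1)) with hd
  set y : ℕ → ℝ≥0∞ := P.winNoise α w R X with hy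
  have hyt : ∀ u, y u ≠ ∞ := P.winNoise_ne_top hR hm
  have hya : Antitone y := P.winNoise_antitone hm' hX.mono
  have hd0 : ∀ r, 0 ≤ d r := fun r => sub_nonneg.2
    (P.halfFisher_antitone (hm r).1 (hX.mono (Nat.le_succ r)) (hX.le_one _))
  have hdl : ∀ r, r + 1 < 3 * w → d r = 0 := fun r hr => by
    simp only [hd]; rw [hX.left r (by omega), hX.left _ hr, sub_self]
  have hdr : ∀ r, N ≤ r → d r = 0 := fun r hr => by
    simp only [hd]; rw [hX.right r hr, hX.right (r + 1) (by omega), sub_self]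
  have hjε : ∀ r, P.halfFisher (X r) ≤ P.halfFisher ε := fun r =>
    P.halfFisher_antitone hε (hX.ge hw r) (hX.le_one r)
  have hx0 : X 0 = ε := hX.left 0 (by omega)
  -- the left-hand side
  have h1 : (P.outEntropy (X N) - X N * P.halfFisher (X N)) -
      (P.outEntropy ε - ε * P.halfFisher ε) ≤ ∑ r ∈ Finset.range N, X (r + 1) * d r := by
    have := Finset.sum_range_sub (fun r => P.outEntropy (X r) - X r * P.halfFisher (X r)) N
    rw [hx0] at this
    rw [← this]
    refine Finset.sum_le_sum fun r _ => ?_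
    have := (P.outEntropy_sub_bounds hH (hm r).1 (hX.mono (Nat.le_succ r)) (hX.le_one _)).2
    simp only [hd]
    linarith
  -- Almost stationarity replaces the profile by its image. On the flat left part, where it is not
  -- available, `d` is `0`.
  have h2 : ∑ r ∈ Finset.range N, X (r + 1) * d r ≤
      ∑ r ∈ Finset.range N, P.winOp α B w R X (r + 1) * d r + κ * P.halfFisher ε := by
    have e1 : ∑ r ∈ Finset.range N, d r ≤ P.halfFisher ε := by
      have := Finset.sum_range_sub' (fun r => P.halfFisher (X r)) N
      rw [this, hx0]; linarith [P.halfFisher_nonneg (X N)]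
    refine le_trans ?_ (add_le_add_right (mul_le_mul_of_nonneg_left e1 hκ) _)
    rw [Finset.mul_sum, ← Finset.sum_add_distrib]
    refine Finset.sum_le_sum fun r hr => ?_
    rw [← add_mul]
    rcases lt_or_ge (r + 1) (3 * w) with h | h
    · rw [hdl r h, mul_zero, mul_zero]
    · exact mul_le_mul_of_nonneg_right (hstep _ h (Finset.mem_range.1 hr)) (hd0 r)
  have hdiff : ∀ u, R / 2 * ((y u).toReal - (y (u + 1)).toReal) =
      ∑ k ∈ Finset.range (2 * w + 1), α k * d (u + k) := fun u => by
    have e : ∀ k, u + 1 + k = u + k + 1 := fun k => by omega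
    rw [hy, P.winNoise_toReal hα hR hm, P.winNoise_toReal hα hR hm, ← mul_sub,
      ← Finset.sum_sub_distrib, ← mul_assoc, div_mul_div_cancel₀ two_ne_zero, div_self hR.ne',
      one_mul]
    refine Finset.sum_congr rfl fun k _ => ?_
    rw [← mul_sub, e k]
  -- The averages over columns and over rows use the same weights and are adjoint to each other. So
  -- the sum over rows becomes a sum of errors times the increments of the averaged inverse noise.
  have h3 : ∑ r ∈ Finset.range N, P.winOp α B w R X (r + 1) * d r =
      ∑ u ∈ Finset.range N, sectionMSE B (y (u + 1)) *
        (R / 2 * ((y u).toReal - (y (u + 1)).toReal)) := by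
    simp_rw [hdiff, winOp, Finset.sum_mul, Finset.mul_sum]
    rw [Finset.sum_comm]
    conv_rhs => rw [Finset.sum_comm]
    refine Finset.sum_congr rfl fun k hk => ?_
    have hk' := Finset.mem_range.1 hk
    have := sum_range_shift (N := N) (k := k) (F := fun u => α k * sectionMSE B (y (u + 1)))
      (fun r hr => hdl r (by omega)) hdr
    rw [← hy]
    calc _ = ∑ r ∈ Finset.range N, α k * sectionMSE B (y (r - k + 1)) * d r := by
          refine Finset.sum_congr rfl fun r _ => ?_
          rcases lt_or_ge r k with h | h
          · rw [hdl r (by omega), mul_zero, mul_zero]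
          · rw [show r + 1 - k = r - k + 1 by omega]
      _ = _ := this
      _ = _ := Finset.sum_congr rfl fun u _ => by ring
  -- With the error at `y u` this would be the subgradient inequality for the entropy. Passing from
  -- `y (u + 1)` to `y u` costs at most an increment `a j(ε)` of the noise times an increment of the
  -- error, and the latter telescopes.
  have h4 : ∑ u ∈ Finset.range N, sectionMSE B (y (u + 1)) *
        (R / 2 * ((y u).toReal - (y (u + 1)).toReal)) ≤
      R * Real.log 2 * (redEntropy B (y N) - redEntropy B (y 0)) +
        a * P.halfFisher ε * (sectionMSE B (y N) - sectionMSE B (y 0)) := by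
    rw [← Finset.sum_range_sub (fun u => redEntropy B (y u)),
      ← Finset.sum_range_sub (fun u => sectionMSE B (y u)), Finset.mul_sum, Finset.mul_sum,
      ← Finset.sum_add_distrib]
    refine Finset.sum_le_sum fun u _ => ?_
    have e1 := mul_le_mul_of_nonneg_left (redEntropy_sub_ge hB (hyt u) (hyt (u + 1)))
      (mul_pos hR hl).le
    have e2 : R * Real.log 2 * (-(sectionMSE B (y u) / (2 * Real.log 2)) *
        ((y (u + 1)).toReal - (y u).toReal)) =
        sectionMSE B (y u) * (R / 2 * ((y u).toReal - (y (u + 1)).toReal)) := by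
      field_simp; ring
    have e3 : R / 2 * ((y u).toReal - (y (u + 1)).toReal) ≤ a * P.halfFisher ε := by
      rw [hdiff]
      calc _ ≤ ∑ k ∈ Finset.range (2 * w + 1), a * d (u + k) :=
            Finset.sum_le_sum fun k hk => mul_le_mul_of_nonneg_right (hα.le k hk) (hd0 _)
        _ = a * (P.halfFisher (X u) - P.halfFisher (X (u + (2 * w + 1)))) := by
            rw [← Finset.mul_sum]
            congr 1
            exact Finset.sum_range_sub' (fun k => P.halfFisher (X (u + k))) _
        _ ≤ _ := mul_le_mul_of_nonneg_left
            (by linarith [hjε u, P.halfFisher_nonneg (X (u + (2 * w + 1)))]) ha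
    have e4 := mul_le_mul_of_nonneg_left e3
      (sub_nonneg.2 (sectionMSE_antitone hB (hya (Nat.le_succ u))))
    simp only [Nat.succ_eq_add_one] at e4
    rw [e2] at e1
    linarith
  have hy0 : y 0 = P.invNoise R ε := P.winNoise_eq_of_const hα fun k hk =>
    hX.left _ (by have := Finset.mem_range.1 hk; omega)
  have hyN : y N = P.invNoise R (X N) := P.winNoise_eq_of_const hα fun k _ =>
    hX.right _ (by omega)
  have h5 : a * P.halfFisher ε * (sectionMSE B (y N) - sectionMSE B (y 0)) ≤
      a * P.halfFisher ε := mul_le_of_le_one_right (mul_nonneg ha (P.halfFisher_nonneg ε))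
    (by linarith [sectionMSE_nonneg B (y 0), sectionMSE_le_one B (y N)])
  rw [hy0, hyN] at h4 h5
  unfold natPotential
  linarith

end

end MemorylessChannel
end SparseSuperposition

namespace SparseSuperposition

/-! ### The coupling matrix -/

lemma sum_fin_eq_sum_range {M : Type*} [AddCommMonoid M] {n Γ : ℕ} {F : Fin Γ → M} {f : ℕ → M}
    {p : ℕ → ℕ} (hp : ∀ k < n, p k < Γ) (hinj : ∀ k < n, ∀ l < n, p k = p l → k = l)
    (hf : ∀ k < n, ∀ i : Fin Γ, (i : ℕ) = p k → F i = f k)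
    (h0 : ∀ i : Fin Γ, (∀ k < n, p k ≠ i) → F i = 0) :
    ∑ i, F i = ∑ k ∈ Finset.range n, f k := by
  rw [← Fin.sum_univ_eq_sum_range]
  refine (Fintype.sum_of_injective (fun k : Fin n => (⟨p k, hp k k.2⟩ : Fin Γ)) ?_ _ _ ?_ ?_).symm
  · intro k l hkl
    exact Fin.ext (hinj k k.2 l l.2 (by simpa using hkl))
  · intro i hi
    refine h0 i fun k hk hki => hi ⟨⟨k, hk⟩, Fin.ext hki⟩
  · intro k
    exact (hf k k.2 _ rfl).symm

/-- The design functions with the constants made explicit, at a fixed window. -/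
structure IsDesignAt (g : ℝ → ℝ) (g₀ : ℝ) (gL : ℝ≥0) : Prop where
  pos : 0 < g₀
  zero : ∀ x, 1 < |x| → g x = 0
  ge : ∀ x, |x| ≤ 1 → g₀ ≤ g x
  lip : LipschitzOnWith gL g (Icc (-1) 1)

lemma IsDesign.exists_isDesignAt {g : ℕ → ℝ → ℝ} (hg : IsDesign g) :
    ∃ (g₀ : ℝ) (gL : ℝ≥0), ∀ w, IsDesignAt (g w) g₀ gL := by
  obtain ⟨g₀, h0, gL, h⟩ := hg
  exact ⟨g₀, gL, fun w => ⟨h0, (h w).1, (h w).2.1, (h w).2.2⟩⟩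

lemma IsDesignAt.nonneg {g : ℝ → ℝ} {g₀ : ℝ} {gL : ℝ≥0} (h : IsDesignAt g g₀ gL) (x : ℝ) :
    0 ≤ g x := by
  rcases le_or_gt |x| 1 with hx | hx
  · exact h.pos.le.trans (h.ge x hx)
  · exact (h.zero x hx).ge

/-- The coupling weights in the bulk of the chain. -/
noncomputable def winWeight (g : ℕ → ℝ → ℝ) (w k : ℕ) : ℝ :=
  g w (((k : ℝ) - w) / w) / ∑ l ∈ Finset.range (2 * w + 1), g w (((l : ℝ) - w) / w)

section Coupling

variable {g : ℕ → ℝ → ℝ} {g₀ : ℝ} {gL : ℝ≥0} {w Γ : ℕ}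

lemma abs_sub_div_le_one (hw : 0 < w) {k : ℕ} (hk : k ∈ Finset.range (2 * w + 1)) :
    |((k : ℝ) - w) / w| ≤ 1 := by
  have hw' : (0 : ℝ) < w := by exact_mod_cast hw
  have h1 : (k : ℝ) ≤ 2 * w := by
    have := Finset.mem_range.1 hk
    exact_mod_cast (by omega : k ≤ 2 * w)
  have h2 : (0 : ℝ) ≤ k := by positivity
  rw [abs_div, abs_of_pos hw', div_le_one hw', abs_le]
  constructor <;> linarith

lemma winWeight_den_pos (hg : IsDesignAt (g w) g₀ gL) (hw : 0 < w) :
    0 < ∑ l ∈ Finset.range (2 * w + 1), g w (((l : ℝ) - w) / w) :=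
  Finset.sum_pos (fun _ hk => hg.pos.trans_le (hg.ge _ (abs_sub_div_le_one hw hk))) (by simp)

/-- On `[-1, 1]` the design function varies by at most `2 gL`, so any two values have ratio at most
`1 + 2 gL / g₀`. Each of the `2 w + 1` weights is therefore of order `1/w`. -/
lemma isWindow_winWeight (hg : IsDesignAt (g w) g₀ gL) (hw : 0 < w) :
    IsWindow (winWeight g w) w ((1 + 2 * gL / g₀) / (2 * w + 1)) := by
  have hS := winWeight_den_pos hg hw
  refine ⟨fun k _ => div_nonneg (hg.nonneg _) hS.le, ?_, fun k hk => ?_⟩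
  · simp_rw [winWeight, ← Finset.sum_div]
    exact div_self hS.ne'
  · rw [winWeight, div_le_div_iff₀ hS (by positivity)]
    have h0 := hg.pos
    have h1 : ∀ l ∈ Finset.range (2 * w + 1), g w (((k : ℝ) - w) / w) ≤
        (1 + 2 * gL / g₀) * g w (((l : ℝ) - w) / w) := by
      intro l hl
      have e1 := abs_sub_div_le_one hw hk
      have e2 := abs_sub_div_le_one hw hl
      have e3 := hg.lip.dist_le_mul _ (abs_le.1 e1) _ (abs_le.1 e2)
      rw [Real.dist_eq, Real.dist_eq] at e3
      have e4 : |((k : ℝ) - w) / w - ((l : ℝ) - w) / w| ≤ 2 := by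
        refine (abs_sub _ _).trans (by linarith)
      have e5 := hg.ge _ e2
      have e6 : (gL : ℝ) * |((k : ℝ) - w) / w - ((l : ℝ) - w) / w| ≤ gL * 2 := by gcongr
      have e7 : (2 : ℝ) * gL ≤ 2 * gL / g₀ * g w (((l : ℝ) - w) / w) := by
        rw [div_mul_eq_mul_div, le_div_iff₀ h0]; gcongr
      have e8 := le_abs_self (g w (((k : ℝ) - w) / w) - g w (((l : ℝ) - w) / w))
      linarith
    have h2 := Finset.sum_le_sum h1
    rw [Finset.sum_const, Finset.card_range, nsmul_eq_mul, ← Finset.mul_sum] at h2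
    push_cast at h2
    linarith

lemma rawCoupling_nonneg (hg : IsDesignAt (g w) g₀ gL) (r c : Fin Γ) :
    0 ≤ rawCoupling g w Γ r c := div_nonneg (hg.nonneg _) (by positivity)

lemma rawCoupling_eq_zero (hg : IsDesignAt (g w) g₀ gL) (hw : 0 < w) {r c : Fin Γ}
    (h : (r : ℕ) + w < c ∨ (c : ℕ) + w < r) : rawCoupling g w Γ r c = 0 := by
  have hw' : (0 : ℝ) < w := by exact_mod_cast hw
  rw [rawCoupling, hg.zero, zero_div]
  rw [abs_div, abs_of_pos hw', one_lt_div hw', lt_abs]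
  rcases h with h | h
  · right
    have : (r : ℝ) + w < c := by exact_mod_cast h
    linarith
  · left
    have : (c : ℝ) + w < r := by exact_mod_cast h
    linarith

lemma rawCoupling_sum_pos (hg : IsDesignAt (g w) g₀ gL) (r : Fin Γ) :
    0 < ∑ c, rawCoupling g w Γ r c := by
  refine Finset.sum_pos' (fun c _ => rawCoupling_nonneg hg r c) ⟨r, Finset.mem_univ _, ?_⟩
  rw [rawCoupling, sub_self, zero_div]
  exact div_pos (hg.pos.trans_le (hg.ge 0 (by simp))) (by positivity)

/-- The coupling matrix `J_{r,c} / Γ`. -/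
noncomputable def coupling (g : ℕ → ℝ → ℝ) (w Γ : ℕ) (r c : Fin Γ) : ℝ :=
  blockVariance g w Γ r c / Γ

lemma coupling_eq (r c : Fin Γ) :
    coupling g w Γ r c = rawCoupling g w Γ r c / ∑ c', rawCoupling g w Γ r c' := by
  have hΓ : (Γ : ℝ) ≠ 0 := by
    have := r.pos
    exact_mod_cast this.ne'
  rw [coupling, blockVariance]
  field_simp

lemma coupling_nonneg (hg : IsDesignAt (g w) g₀ gL) (r c : Fin Γ) : 0 ≤ coupling g w Γ r c := by
  rw [coupling_eq]
  exact div_nonneg (rawCoupling_nonneg hg r c) (rawCoupling_sum_pos hg r).le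

lemma coupling_sum (hg : IsDesignAt (g w) g₀ gL) (r : Fin Γ) : ∑ c, coupling g w Γ r c = 1 := by
  simp_rw [coupling_eq, ← Finset.sum_div]
  exact div_self (rawCoupling_sum_pos hg r).ne'

lemma coupling_eq_zero (hg : IsDesignAt (g w) g₀ gL) (hw : 0 < w) {r c : Fin Γ}
    (h : (r : ℕ) + w < c ∨ (c : ℕ) + w < r) : coupling g w Γ r c = 0 := by
  rw [coupling_eq, rawCoupling_eq_zero hg hw h, zero_div]

/-- A row at distance at least `w` from both ends sees its whole window, so its normalization does
not depend on the row. -/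
lemma coupling_eq_winWeight (hg : IsDesignAt (g w) g₀ gL) (hw : 0 < w) {r c : Fin Γ}
    (h1 : w ≤ r) (h2 : (r : ℕ) + w < Γ) {k : ℕ} (hk : (r : ℕ) + w = c + k) :
    coupling g w Γ r c = winWeight g w k := by
  have hraw : ∀ (c : Fin Γ) (k : ℕ), (r : ℕ) + w = c + k →
      rawCoupling g w Γ r c = g w (((k : ℝ) - w) / w) / (2 * w + 1) := by
    intro c k hk
    have : (r : ℝ) + w = c + k := by exact_mod_cast hk
    rw [rawCoupling, show (r : ℝ) - c = k - w by linarith]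
  have hsum : ∑ c', rawCoupling g w Γ r c' =
      ∑ k ∈ Finset.range (2 * w + 1), g w (((k : ℝ) - w) / w) / (2 * w + 1) := by
    refine sum_fin_eq_sum_range (p := fun k => r + w - k) (fun k hk => by omega)
      (fun k hk l hl h => by omega) (fun k hk i hi => hraw i k (by omega)) fun i hi => ?_
    refine rawCoupling_eq_zero hg hw ?_
    by_contra hc
    exact hi (r + w - i) (by omega) (by omega)
  rw [coupling_eq, hsum, hraw c k hk, ← Finset.sum_div, winWeight,
    div_div_div_cancel_right₀ (by positivity)]

end Coupling

namespace MemorylessChannel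

variable {𝓑 : Type*} [MeasurableSpace 𝓑] {ν : Measure 𝓑} (P : MemorylessChannel ℝ 𝓑 ν)

/-! ### The coupled state evolution -/

section

variable {g : ℕ → ℝ → ℝ} {g₀ : ℝ} {gL : ℝ≥0} {w Γ B : ℕ} {R : ℝ}

open Classical in
/-- The initial profile of the coupled state evolution. -/
noncomputable def coupledInit (w Γ : ℕ) (r : Fin Γ) : ℝ := if IsPinned w Γ r then 0 else 1

lemma coupledInit_mem (r : Fin Γ) : coupledInit w Γ r ∈ Icc (0 : ℝ) 1 := by
  unfold coupledInit; split_ifs <;> simp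

lemma coupledStep_pinned {E : Fin Γ → ℝ} {r : Fin Γ} (h : IsPinned w Γ r) :
    P.coupledStep g B w Γ R E r = 0 := if_pos h

lemma coupledStep_free {E : Fin Γ → ℝ} {r : Fin Γ} (h : ¬ IsPinned w Γ r) :
    P.coupledStep g B w Γ R E r =
      ∑ c, coupling g w Γ r c * sectionMSE B (P.blockInvNoise g w Γ R E c) := if_neg h

lemma blockInvNoise_eq (E : Fin Γ → ℝ) (c : Fin Γ) : P.blockInvNoise g w Γ R E c =
    ∑ r, ENNReal.ofReal (coupling g w Γ r c) * P.invNoise R (E r) := rfl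

lemma coupledStep_mem (hg : IsDesignAt (g w) g₀ gL) (E : Fin Γ → ℝ) (r : Fin Γ) :
    P.coupledStep g B w Γ R E r ∈ Icc (0 : ℝ) 1 := by
  by_cases h : IsPinned w Γ r
  · rw [P.coupledStep_pinned h]; simp
  · rw [P.coupledStep_free h]
    refine ⟨Finset.sum_nonneg fun c _ => mul_nonneg (coupling_nonneg hg r c)
      (sectionMSE_nonneg _ _), ?_⟩
    rw [← coupling_sum hg r]
    exact Finset.sum_le_sum fun c _ =>
      mul_le_of_le_one_right (coupling_nonneg hg r c) (sectionMSE_le_one _ _)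

lemma coupledIter_mem (hg : IsDesignAt (g w) g₀ gL) (t : ℕ) (r : Fin Γ) :
    (P.coupledStep g B w Γ R)^[t] (coupledInit w Γ) r ∈ Icc (0 : ℝ) 1 := by
  cases t with
  | zero => exact coupledInit_mem r
  | succ t => rw [Function.iterate_succ_apply']; exact P.coupledStep_mem hg _ r

variable [SFinite ν]

lemma coupledStep_mono (hB : 2 ≤ B) (hg : IsDesignAt (g w) g₀ gL) {E E' : Fin Γ → ℝ}
    (hE : ∀ r, E r ∈ Icc (0 : ℝ) 1) (hE' : ∀ r, E' r ∈ Icc (0 : ℝ) 1) (h : ∀ r, E r ≤ E' r)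
    (r : Fin Γ) : P.coupledStep g B w Γ R E r ≤ P.coupledStep g B w Γ R E' r := by
  by_cases hr : IsPinned w Γ r
  · rw [P.coupledStep_pinned hr, P.coupledStep_pinned hr]
  · rw [P.coupledStep_free hr, P.coupledStep_free hr]
    refine Finset.sum_le_sum fun c _ => mul_le_mul_of_nonneg_left (sectionMSE_antitone hB ?_)
      (coupling_nonneg hg r c)
    rw [blockInvNoise_eq, blockInvNoise_eq]
    gcongr with r
    exact P.invNoise_antitoneOn R (hE _) (hE' _) (h _)

lemma coupledIter_succ_le (hB : 2 ≤ B) (hg : IsDesignAt (g w) g₀ gL) (t : ℕ) (r : Fin Γ) :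
    (P.coupledStep g B w Γ R)^[t + 1] (coupledInit w Γ) r ≤
      (P.coupledStep g B w Γ R)^[t] (coupledInit w Γ) r := by
  induction t generalizing r with
  | zero =>
    by_cases h : IsPinned w Γ r
    · exact (P.coupledStep_pinned h).trans_le (coupledInit_mem r).1
    · refine (P.coupledStep_mem hg _ r).2.trans ?_
      simp [coupledInit, h]
  | succ t ih =>
    have h := P.coupledStep_mono (R := R) hB hg (P.coupledIter_mem hg (t + 1))
      (P.coupledIter_mem hg t) ih r
    rwa [← Function.iterate_succ_apply' (P.coupledStep g B w Γ R),
      ← Function.iterate_succ_apply' (P.coupledStep g B w Γ R)] at h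

lemma tendsto_coupledLimit (hB : 2 ≤ B) (hg : IsDesignAt (g w) g₀ gL) :
    Tendsto (fun t => (P.coupledStep g B w Γ R)^[t] (coupledInit w Γ)) atTop
      (𝓝 (P.coupledLimit g B w Γ R)) := by
  refine tendsto_nhds_limUnder ⟨fun r => ⨅ t, (P.coupledStep g B w Γ R)^[t] (coupledInit w Γ) r,
    tendsto_pi_nhds.2 fun r => ?_⟩
  have h1 : Antitone fun t => (P.coupledStep g B w Γ R)^[t] (coupledInit w Γ) r :=
    antitone_nat_of_succ_le fun t => P.coupledIter_succ_le hB hg t r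
  have h2 : BddBelow (range fun t => (P.coupledStep g B w Γ R)^[t] (coupledInit w Γ) r) :=
    ⟨0, forall_mem_range.2 fun t => (P.coupledIter_mem hg t r).1⟩
  exact tendsto_atTop_ciInf h1 h2

/-- Away from the boundary the inverse effective noise is a moving average. -/
lemma winNoise_le_blockInvNoise (hg : IsDesignAt (g w) g₀ gL) (hw : 0 < w)
    {E : Fin Γ → ℝ} {X : ℕ → ℝ} (hE : ∀ r, E r ∈ Icc (0 : ℝ) 1) (hX : ∀ r, X r ∈ Icc (0 : ℝ) 1)
    (h : ∀ r : Fin Γ, E r ≤ X r) {c : Fin Γ} (h1 : 2 * w ≤ c) (h2 : (c : ℕ) + 2 * w < Γ) :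
    P.winNoise (winWeight g w) w R X (c - w) ≤ P.blockInvNoise g w Γ R E c := by
  have e : ∑ r : Fin Γ, ENNReal.ofReal (coupling g w Γ r c) * P.invNoise R (X r) =
      P.winNoise (winWeight g w) w R X (c - w) := by
    refine sum_fin_eq_sum_range (p := fun k => c - w + k) (fun k hk => by omega)
      (fun k hk l hl h => by omega) (fun k hk i hi => ?_) fun i hi => ?_
    · rw [coupling_eq_winWeight hg hw (k := k) (by omega) (by omega) (by omega), hi]
    · rw [coupling_eq_zero hg hw, ENNReal.ofReal_zero, zero_mul]
      by_contra hc
      exact hi (i + w - c) (by omega) (by omega)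
  rw [← e, blockInvNoise_eq]
  gcongr with r
  exact P.invNoise_antitoneOn R (hE _) (hX _) (h _)

/-- Away from the boundary the coupled state evolution is a moving average. -/
lemma coupledStep_le_winOp (hB : 2 ≤ B) (hg : IsDesignAt (g w) g₀ gL) (hw : 0 < w)
    {E : Fin Γ → ℝ} {X : ℕ → ℝ} (hE : ∀ r, E r ∈ Icc (0 : ℝ) 1) (hX : ∀ r, X r ∈ Icc (0 : ℝ) 1)
    (h : ∀ r : Fin Γ, E r ≤ X r) {r : Fin Γ} (hr : ¬ IsPinned w Γ r) :
    P.coupledStep g B w Γ R E r ≤ P.winOp (winWeight g w) B w R X r := by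
  -- Free rows are at distance at least `3 w` from the ends, the columns they see at least `2 w`,
  -- and the rows seen by these at least `w`, so all weights involved are those of the bulk. The
  -- column `c = r + w - k` averages the rows starting from `c - w = r - k`.
  rw [IsPinned] at hr
  have e : ∑ c : Fin Γ, coupling g w Γ r c *
      sectionMSE B (P.winNoise (winWeight g w) w R X (c - w)) =
      P.winOp (winWeight g w) B w R X r := by
    refine sum_fin_eq_sum_range (p := fun k => r + w - k) (fun k hk => by omega)
      (fun k hk l hl h => by omega) (fun k hk i hi => ?_) fun i hi => ?_
    · rw [coupling_eq_winWeight hg hw (k := k) (by omega) (by omega) (by omega),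
        show (i : ℕ) - w = r - k by omega]
    · rw [coupling_eq_zero hg hw, zero_mul]
      by_contra hc
      exact hi (r + w - i) (by omega) (by omega)
  rw [P.coupledStep_free (by rwa [IsPinned]), ← e]
  refine Finset.sum_le_sum fun c _ => ?_
  by_cases hc : (r : ℕ) + w < c ∨ (c : ℕ) + w < r
  · rw [coupling_eq_zero hg hw hc, zero_mul, zero_mul]
  · exact mul_le_mul_of_nonneg_left (sectionMSE_antitone hB
      (P.winNoise_le_blockInvNoise hg hw hE hX h (by omega) (by omega))) (coupling_nonneg hg r c)

lemma coupledStep_le_seOp (hB : 2 ≤ B) (hg : IsDesignAt (g w) g₀ gL) (hw : 0 < w)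
    {E : Fin Γ → ℝ} {x : ℝ} (hE : ∀ r, E r ∈ Icc (0 : ℝ) 1) (hx : x ∈ Icc (0 : ℝ) 1)
    (h : ∀ r : Fin Γ, E r ≤ x) (r : Fin Γ) : P.coupledStep g B w Γ R E r ≤ P.seOp B R x := by
  by_cases hr : IsPinned w Γ r
  · rw [P.coupledStep_pinned hr]; exact sectionMSE_nonneg _ _
  · refine (P.coupledStep_le_winOp hB hg hw (X := fun _ => x) hE (fun _ => hx) h hr).trans ?_
    rw [winOp]
    simp_rw [P.winNoise_eq_of_const (isWindow_winWeight hg hw) (X := fun _ => x)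
      (fun _ _ => rfl), ← Finset.sum_mul]
    rw [(isWindow_winWeight hg hw).sum_eq, one_mul, seOp]

/-- Once the profile is below a constant, it is dominated by the uncoupled evolution of this
constant, as the bulk weights sum to `1`. -/
lemma coupledLimit_le_seLimit (hB : 2 ≤ B) (hg : IsDesignAt (g w) g₀ gL) (hw : 0 < w)
    {x : ℝ} (hx : x ∈ Icc (0 : ℝ) 1) {t : ℕ}
    (h : ∀ r, (P.coupledStep g B w Γ R)^[t] (coupledInit w Γ) r ≤ x) (r : Fin Γ) :
    P.coupledLimit g B w Γ R r ≤ P.seLimit B R x := by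
  have h1 : ∀ n, ∀ r, (P.coupledStep g B w Γ R)^[n + t] (coupledInit w Γ) r ≤
      (P.seOp B R)^[n] x := by
    intro n
    induction n with
    | zero => simpa using h
    | succ n ih =>
      intro r
      rw [Nat.add_right_comm, Function.iterate_succ_apply', Function.iterate_succ_apply']
      exact P.coupledStep_le_seOp hB hg hw (P.coupledIter_mem hg _)
        (iterate_mem_Icc (P.seOp_mapsTo B R) hx n) ih r
  have h2 := (tendsto_add_atTop_iff_nat t).2
    (tendsto_pi_nhds.1 (P.tendsto_coupledLimit (Γ := Γ) (R := R) hB hg) r)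
  exact le_of_tendsto_of_tendsto' h2 (P.tendsto_seLimit hB R hx) fun n => h1 n r

/-! ### The saturated one-sided system -/

/-- One step of the state evolution of a one-sided chain, saturated at `ε` from below and constant
beyond `N`. -/
noncomputable def upperStep (α : ℕ → ℝ) (B w N : ℕ) (R ε : ℝ) (X : ℕ → ℝ) (r : ℕ) : ℝ :=
  if r < 3 * w then ε else max ε (P.winOp α B w R X (min r N))

/-- The value `ε > 0` in place of the pinned `0` keeps the inverse noise finite even if `J(0) = ∞`.
Dropping the right boundary makes the profile monotone. Both changes only raise it. -/
noncomputable def upperInit (w : ℕ) (ε : ℝ) (r : ℕ) : ℝ := if r < 3 * w then ε else 1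

variable {α : ℕ → ℝ} {N : ℕ} {a ε : ℝ}

lemma isFront_upperInit (hN : 3 * w ≤ N) (hε : ε ≤ 1) : IsFront ε w N (upperInit w ε) := by
  refine ⟨fun r s h => ?_, fun r => ?_, fun r hr => if_pos hr, fun r hr => ?_⟩
  · unfold upperInit; split_ifs <;> first | exact le_rfl | exact hε | omega
  · unfold upperInit; split_ifs <;> first | exact le_rfl | exact hε
  · rw [upperInit, upperInit, if_neg (by omega), if_neg (by omega)]

lemma isFront_upperStep (hB : 2 ≤ B) (hα : IsWindow α w a) (hw : 0 < w) (hN : 3 * w ≤ N)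
    (hε : ε ∈ Ioc (0 : ℝ) 1) {X : ℕ → ℝ} (hX : IsFront ε w N X) :
    IsFront ε w N (P.upperStep α B w N R ε X) := by
  have hm := fun r => Ioc_subset_Icc_self (hX.mem hw hε.1 r)
  refine ⟨fun r s h => ?_, fun r => ?_, fun r hr => if_pos hr, fun r hr => ?_⟩
  · unfold upperStep
    split_ifs with h1 h2
    · exact le_rfl
    · exact le_max_left _ _
    · omega
    · exact max_le_max le_rfl (P.winOp_monotone hB hα hm hX.mono (min_le_min h le_rfl))
  · unfold upperStep
    split_ifs with h1
    · exact hε.2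
    · exact max_le hε.2 (P.winOp_mem hα _ _).2
  · rw [upperStep, upperStep, if_neg (by omega), if_neg (by omega), min_eq_right hr, min_self]

lemma upperStep_mono (hB : 2 ≤ B) (hα : IsWindow α w a) (hw : 0 < w) (hε : 0 < ε) {X Y : ℕ → ℝ}
    (hX : IsFront ε w N X) (hY : IsFront ε w N Y) (h : ∀ r, X r ≤ Y r) (r : ℕ) :
    P.upperStep α B w N R ε X r ≤ P.upperStep α B w N R ε Y r := by
  unfold upperStep
  split_ifs
  · exact le_rfl
  · exact max_le_max le_rfl (P.winOp_mono hB hα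
      (fun r => Ioc_subset_Icc_self (hX.mem hw hε r))
      (fun r => Ioc_subset_Icc_self (hY.mem hw hε r)) h _)

lemma isFront_upperIter (hB : 2 ≤ B) (hα : IsWindow α w a) (hw : 0 < w) (hN : 3 * w ≤ N)
    (hε : ε ∈ Ioc (0 : ℝ) 1) (t : ℕ) :
    IsFront ε w N ((P.upperStep α B w N R ε)^[t] (upperInit w ε)) := by
  induction t with
  | zero => exact isFront_upperInit hN hε.2
  | succ t ih =>
    rw [Function.iterate_succ_apply']; exact P.isFront_upperStep hB hα hw hN hε ih

lemma upperIter_succ_le (hB : 2 ≤ B) (hα : IsWindow α w a) (hw : 0 < w) (hN : 3 * w ≤ N)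
    (hε : ε ∈ Ioc (0 : ℝ) 1) (t r : ℕ) :
    (P.upperStep α B w N R ε)^[t + 1] (upperInit w ε) r ≤
      (P.upperStep α B w N R ε)^[t] (upperInit w ε) r := by
  induction t generalizing r with
  | zero =>
    have h1 := P.isFront_upperIter (R := R) hB hα hw hN hε 1
    by_cases hr : r < 3 * w
    · rw [zero_add, h1.left r hr, Function.iterate_zero_apply, upperInit, if_pos hr]
    · refine (h1.le_one r).trans ?_
      rw [Function.iterate_zero_apply, upperInit, if_neg hr]
  | succ t ih =>
    have h := P.upperStep_mono (R := R) hB hα hw hε.1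
      (P.isFront_upperIter hB hα hw hN hε (t + 1)) (P.isFront_upperIter hB hα hw hN hε t) ih r
    rwa [← Function.iterate_succ_apply' (P.upperStep α B w N R ε),
      ← Function.iterate_succ_apply' (P.upperStep α B w N R ε)] at h

/-- The iterates decrease, so at a late time finitely many coordinates move by at most `δ`. Such an
almost stationary front is enough for the energy balance; no continuity of the operator is needed to
produce a fixed point. -/
lemma exists_upperIter_sub_le (hB : 2 ≤ B) (hα : IsWindow α w a) (hw : 0 < w) (hN : 3 * w ≤ N)
    (hε : ε ∈ Ioc (0 : ℝ) 1) {δ : ℝ} (hδ : 0 < δ) :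
    ∃ t, ∀ r ≤ N, (P.upperStep α B w N R ε)^[t] (upperInit w ε) r ≤
      (P.upperStep α B w N R ε)^[t + 1] (upperInit w ε) r + δ := by
  have h : ∀ r, Tendsto (fun t => (P.upperStep α B w N R ε)^[t] (upperInit w ε) r -
      (P.upperStep α B w N R ε)^[t + 1] (upperInit w ε) r) atTop (𝓝 0) := by
    intro r
    have h3 : Antitone fun t => (P.upperStep α B w N R ε)^[t] (upperInit w ε) r :=
      antitone_nat_of_succ_le fun t => P.upperIter_succ_le hB hα hw hN hε t r
    have h4 : BddBelow (range fun t => (P.upperStep α B w N R ε)^[t] (upperInit w ε) r) :=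
      ⟨0, forall_mem_range.2 fun t =>
        ((P.isFront_upperIter hB hα hw hN hε t).mem hw hε.1 r).1.le⟩
    have h1 := tendsto_atTop_ciInf h3 h4
    have h2 := h1.sub ((tendsto_add_atTop_iff_nat 1).2 h1)
    rwa [sub_self] at h2
  have h2 : ∀ᶠ t in atTop, ∀ r ∈ Finset.range (N + 1),
      (P.upperStep α B w N R ε)^[t] (upperInit w ε) r -
        (P.upperStep α B w N R ε)^[t + 1] (upperInit w ε) r ≤ δ :=
    (Finset.eventually_all _).2 fun r _ => (h r).eventually (eventually_le_nhds hδ)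
  obtain ⟨t, ht⟩ := h2.exists
  exact ⟨t, fun r hr => by linarith [ht r (Finset.mem_range.2 (by omega))]⟩

lemma coupledIter_le_upperIter (hB : 2 ≤ B) (hg : IsDesignAt (g w) g₀ gL) (hw : 0 < w)
    (hN : 3 * w ≤ N) (hΓ : Γ ≤ N) (hε : ε ∈ Ioc (0 : ℝ) 1) (t : ℕ) (r : Fin Γ) :
    (P.coupledStep g B w Γ R)^[t] (coupledInit w Γ) r ≤
      (P.upperStep (winWeight g w) B w N R ε)^[t] (upperInit w ε) r := by
  have hα := isWindow_winWeight hg hw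
  have hfr := P.isFront_upperIter (R := R) hB hα hw hN hε
  induction t generalizing r with
  | zero =>
    by_cases h : IsPinned w Γ r
    · rw [Function.iterate_zero_apply, coupledInit, if_pos h]
      exact ((hfr 0).mem hw hε.1 r).1.le
    · have h' := h
      rw [IsPinned] at h'
      rw [Function.iterate_zero_apply, coupledInit, if_neg h, Function.iterate_zero_apply,
        upperInit, if_neg (by omega)]
  | succ t ih =>
    by_cases h : IsPinned w Γ r
    · rw [Function.iterate_succ_apply', P.coupledStep_pinned h]
      exact ((hfr (t + 1)).mem hw hε.1 r).1.le
    · have h' := h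
      rw [IsPinned] at h'
      rw [Function.iterate_succ_apply', Function.iterate_succ_apply', upperStep,
        if_neg (by omega), min_eq_left (by omega)]
      exact (P.coupledStep_le_winOp hB hg hw (P.coupledIter_mem hg t)
        (fun r => Ioc_subset_Icc_self ((hfr t).mem hw hε.1 r)) ih h).trans (le_max_right _ _)

/-- The coupled state evolution gets below a level at which the potential is not much larger than
at `0`. -/
lemma exists_coupledIter_le (hH : P.FiniteEntropies stdGaussian) (hB : 2 ≤ B)
    (hg : IsDesignAt (g w) g₀ gL) (hR : 0 < R) (hw : 0 < w) (hε : ε ∈ Ioc (0 : ℝ) 1) :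
    ∃ t, ∃ x ∈ Ioc (0 : ℝ) 1,
      (∀ r, (P.coupledStep g B w Γ R)^[t] (coupledInit w Γ) r ≤ x) ∧
      P.natPotential B R x ≤ P.outEntropy ε +
        ((1 + 2 * gL / g₀) / (2 * w + 1) + 2 * ε) * P.halfFisher ε := by
  have hα := isWindow_winWeight hg hw
  set N := Γ + 3 * w with hN'
  have hN : 3 * w ≤ N := by omega
  obtain ⟨t, ht⟩ := P.exists_upperIter_sub_le (R := R) hB hα hw hN hε hε.1
  have hfr := P.isFront_upperIter (R := R) hB hα hw hN hε
  refine ⟨t, _, (hfr t).mem hw hε.1 N, fun r => ?_, ?_⟩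
  · exact (P.coupledIter_le_upperIter hB hg hw hN (by omega) hε t r).trans
      ((hfr t).mono (by have := r.2; omega))
  · have h0 := hg.pos
    -- One `ε` comes from the time step, the other from the saturation at `ε`.
    refine (P.natPotential_front_le hH hB hα (by positivity) hR hw hε.1 (hfr t) (κ := 2 * ε)
      (by linarith [hε.1]) fun r h1 h2 => ?_).trans
      (add_le_add_left (P.natPotential_le hB hR (Ioc_subset_Icc_self hε)) _)
    refine (ht r h2).trans ?_
    rw [Function.iterate_succ_apply', upperStep, if_neg (by omega), min_eq_left h2]
    have := max_le_add_of_nonneg hε.1.le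
      (P.winOp_mem hα (X := (P.upperStep (winWeight g w) B w N R ε)^[t] (upperInit w ε))
        (R := R) B r).1
    linarith

/-- Choose `ε` with `H(ε)` close to `H(0)`, which also makes `ε j(ε)` small, then `w` large compared
with `j(ε)`. The plateau `x` of the front then has scaled potential below `H(0) + gap/2`, whereas
`j(x) < (1 + δ) K` would force at least `H(0) + 3 gap/4`. So `x` is in the basin of the floor, for
every chain length `Γ`. -/
theorem eventually_le_coupledThreshold (hreg : P.RegularFisher)
    (hH : P.FiniteEntropies stdGaussian) (hI : P.outEntropy 0 < P.outEntropy 1)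
    (hg : IsDesign g) {Rm : ℝ} (hRm : 0 < Rm)
    (hRI : Rm < (P.outEntropy 1 - P.outEntropy 0) / Real.log 2) :
    ∀ᶠ B : ℕ in atTop, ENNReal.ofReal Rm ≤ P.coupledThreshold g B := by
  have hl := Real.log_pos one_lt_two
  obtain ⟨g₀, gL, hg⟩ := hg.exists_isDesignAt
  obtain ⟨δ, hδ, hgap⟩ := exists_margin hRm hRI
  obtain ⟨Em, hEm, hjm⟩ := P.exists_halfFisher_gt hH hI
  set gap := P.outEntropy 1 - P.outEntropy 0 - (1 + δ) * (Rm * Real.log 2) with hgp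
  have hgap0 : 0 < gap := sub_pos.2 hgap
  have hcont := (P.tendsto_outEntropy_zero hH).eventually
    (gt_mem_nhds (show P.outEntropy 0 < P.outEntropy 0 + gap / 8 by linarith))
  obtain ⟨ε, hε, hεH⟩ : ∃ ε ∈ Ioc (0 : ℝ) 1, P.outEntropy ε < P.outEntropy 0 + gap / 8 := by
    obtain ⟨ε, h1, h2⟩ := (hcont.and (Ioo_mem_nhdsGT one_pos)).exists
    exact ⟨ε, ⟨h2.1, h2.2.le⟩, h1⟩
  have hεj := P.mul_halfFisher_le hH hε
  have hw : ∀ᶠ w : ℕ in atTop, (1 + 2 * gL / g₀) / (2 * w + 1) * P.halfFisher ε < gap / 8 := by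
    have h1 : Tendsto (fun w : ℕ => (1 + 2 * gL / g₀) / (2 * (w : ℝ) + 1)) atTop (𝓝 0) :=
      ((tendsto_natCast_atTop_atTop.const_mul_atTop two_pos).atTop_add
        tendsto_const_nhds).const_div_atTop _
    have h2 := h1.mul_const (P.halfFisher ε)
    rw [zero_mul] at h2
    exact h2.eventually (gt_mem_nhds (by linarith))
  have hsm := ((tendsto_entropyBound δ).const_mul (Rm * Real.log 2)).eventually
    (gt_mem_nhds (show Rm * Real.log 2 * 0 < gap / 4 by rw [mul_zero]; linarith))
  filter_upwards [eventually_ge_atTop 2, hsm,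
    P.eventually_seLimit_eq_mseFloor hreg hI (Rm := Rm) hδ hEm (hgap.trans hjm).le]
    with B hB h1 h3
  refine le_liminf_of_le (by isBoundedDefault) ?_
  filter_upwards [hw, eventually_gt_atTop 0] with w hw hw0
  refine le_liminf_of_le (by isBoundedDefault) (Eventually.of_forall fun Γ => ?_)
  refine le_iSup₂_of_le Rm ⟨hRm, fun R hR r => ?_⟩ le_rfl
  obtain ⟨t, x, hx, hle, hpot⟩ := P.exists_coupledIter_le (Γ := Γ) hH hB (hg w) hR.1 hw0 hε
  have hKm : R * Real.log 2 ≤ Rm * Real.log 2 := mul_le_mul_of_nonneg_right hR.2 hl.le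
  have hjx : (1 + δ) * (R * Real.log 2) ≤ P.halfFisher x := by
    by_contra hc
    have e2 := P.natPotential_ge hH hB hR.1 hδ.le hx (not_le.1 hc).le
    have e5 : (1 + δ) * (R * Real.log 2) ≤ (1 + δ) * (Rm * Real.log 2) := by gcongr
    have e6 : R * Real.log 2 * entropyBound δ B ≤ Rm * Real.log 2 * entropyBound δ B := by
      have : 0 ≤ entropyBound δ B := by
        have h4 : 0 ≤ ∫ x, |x| ∂stdGaussian := integral_nonneg fun x => abs_nonneg x
        have := log_cast_pos hB
        unfold entropyBound; positivity
      gcongr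
    linarith
  rw [← h3 R hR x hx hjx]
  exact P.coupledLimit_le_seLimit hB (hg w) hw0 (Ioc_subset_Icc_self hx) hle r

end

end MemorylessChannel
end SparseSuperposition

/-! ### The coupled threshold from above -/

namespace SparseSuperposition

/-- The free rows. -/
def freeRows (w Γ : ℕ) : Finset (Fin Γ) :=
  Finset.univ.filter fun r => 3 * w ≤ r ∧ (r : ℕ) + 3 * w < Γ

/-- The columns which are coupled to free rows only. -/
def bulkColumns (w Γ : ℕ) : Finset (Fin Γ) :=
  Finset.univ.filter fun c => 4 * w ≤ c ∧ (c : ℕ) + 4 * w < Γ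

section Bulk

variable {g : ℕ → ℝ → ℝ} {g₀ : ℝ} {gL : ℝ≥0} {w Γ : ℕ}

lemma mem_freeRows {r : Fin Γ} : r ∈ freeRows w Γ ↔ 3 * w ≤ r ∧ (r : ℕ) + 3 * w < Γ := by
  simp [freeRows]

lemma mem_bulkColumns {c : Fin Γ} : c ∈ bulkColumns w Γ ↔ 4 * w ≤ c ∧ (c : ℕ) + 4 * w < Γ := by
  simp [bulkColumns]

lemma mem_freeRows_iff_not_isPinned {r : Fin Γ} : r ∈ freeRows w Γ ↔ ¬ IsPinned w Γ r := by
  rw [mem_freeRows, IsPinned]; omega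

lemma le_card_bulkColumns (w Γ : ℕ) : (Γ : ℝ) - 8 * w ≤ (bulkColumns w Γ).card := by
  have h : Finset.Ico (4 * w) (Γ - 4 * w) ⊆ (bulkColumns w Γ).image Fin.val := by
    intro c hc
    rw [Finset.mem_Ico] at hc
    exact Finset.mem_image.2 ⟨⟨c, by omega⟩, mem_bulkColumns.2 (by simp only []; omega), rfl⟩
  have h1 := (Finset.card_le_card h).trans Finset.card_image_le
  rw [Nat.card_Ico] at h1
  have h2 : (Γ : ℝ) ≤ (bulkColumns w Γ).card + 8 * w := by
    exact_mod_cast (by omega : Γ ≤ (bulkColumns w Γ).card + 8 * w)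
  linarith

lemma coupling_eq_zero_of_bulk (hg : IsDesignAt (g w) g₀ gL) (hw : 0 < w) {r c : Fin Γ}
    (hc : c ∈ bulkColumns w Γ) (hr : r ∉ freeRows w Γ) : coupling g w Γ r c = 0 := by
  rw [mem_bulkColumns] at hc
  rw [mem_freeRows] at hr
  exact coupling_eq_zero hg hw (by omega)

lemma coupling_pos (hg : IsDesignAt (g w) g₀ gL) (hw : 0 < w) {r c : Fin Γ}
    (h1 : (r : ℕ) ≤ c + w) (h2 : (c : ℕ) ≤ r + w) : 0 < coupling g w Γ r c := by
  have hw' : (0 : ℝ) < w := by exact_mod_cast hw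
  rw [coupling_eq]
  refine div_pos (div_pos (hg.pos.trans_le (hg.ge _ ?_)) (by positivity)) (rawCoupling_sum_pos hg r)
  have e1 : (r : ℝ) ≤ c + w := by exact_mod_cast h1
  have e2 : (c : ℝ) ≤ r + w := by exact_mod_cast h2
  rw [abs_div, abs_of_pos hw', div_le_one hw', abs_le]
  constructor <;> linarith

/-- From a free row, moving by `w` to the right, or to the left near the right end, leads to a bulk
column. This keeps the lower iterates positive. -/
lemma exists_bulk_coupling_pos (hg : IsDesignAt (g w) g₀ gL) (hw : 0 < w) (hΓ : 10 * w ≤ Γ)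
    {r : Fin Γ} (hr : r ∈ freeRows w Γ) : ∃ c ∈ bulkColumns w Γ, 0 < coupling g w Γ r c := by
  rw [mem_freeRows] at hr
  by_cases h : (r : ℕ) + 5 * w < Γ
  · exact ⟨⟨r + w, by omega⟩, mem_bulkColumns.2 (by simp only []; omega),
      coupling_pos hg hw (by simp only []; omega) le_rfl⟩
  · exact ⟨⟨r - w, by omega⟩, mem_bulkColumns.2 (by simp only []; omega),
      coupling_pos hg hw (by simp only []; omega) (by simp only []; omega)⟩

end Bulk

namespace MemorylessChannel

variable {𝓑 : Type*} [MeasurableSpace 𝓑] {ν : Measure 𝓑} (P : MemorylessChannel ℝ 𝓑 ν)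

/-! ### A lower bound on the coupled state evolution -/

/-- The coupled state evolution operator with the contributions of the boundary columns omitted. -/
noncomputable def lowerStep (g : ℕ → ℝ → ℝ) (B w Γ : ℕ) (R : ℝ) (E : Fin Γ → ℝ) (r : Fin Γ) : ℝ :=
  if r ∈ freeRows w Γ then
    ∑ c ∈ bulkColumns w Γ, coupling g w Γ r c * sectionMSE B (P.blockInvNoise g w Γ R E c)
  else 0

/-- The Bethe free energy of a profile. -/
noncomputable def bethe (g : ℕ → ℝ → ℝ) (B w Γ : ℕ) (R : ℝ) (E : Fin Γ → ℝ) : ℝ :=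
  ∑ r ∈ freeRows w Γ, (P.outEntropy (E r) - P.outEntropy 0 - E r * P.halfFisher (E r)) +
    R * Real.log 2 * ∑ c ∈ bulkColumns w Γ, (1 - redEntropy B (P.blockInvNoise g w Γ R E c))

section

variable {g : ℕ → ℝ → ℝ} {g₀ : ℝ} {gL : ℝ≥0} {w Γ B : ℕ} {R : ℝ} {E E' : Fin Γ → ℝ}

lemma lowerStep_le_coupledStep (hg : IsDesignAt (g w) g₀ gL) (E : Fin Γ → ℝ) (r : Fin Γ) :
    P.lowerStep g B w Γ R E r ≤ P.coupledStep g B w Γ R E r := by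
  by_cases hr : r ∈ freeRows w Γ
  · rw [lowerStep, if_pos hr, P.coupledStep_free (mem_freeRows_iff_not_isPinned.1 hr)]
    exact Finset.sum_le_sum_of_subset_of_nonneg (Finset.subset_univ _) fun c _ _ =>
      mul_nonneg (coupling_nonneg hg r c) (sectionMSE_nonneg _ _)
  · rw [lowerStep, if_neg hr]
    exact (P.coupledStep_mem hg E r).1

lemma lowerStep_mem (hg : IsDesignAt (g w) g₀ gL) (E : Fin Γ → ℝ) (r : Fin Γ) :
    P.lowerStep g B w Γ R E r ∈ Icc (0 : ℝ) 1 := by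
  refine ⟨?_, (P.lowerStep_le_coupledStep hg E r).trans (P.coupledStep_mem hg E r).2⟩
  unfold lowerStep
  split_ifs
  · exact Finset.sum_nonneg fun c _ => mul_nonneg (coupling_nonneg hg r c) (sectionMSE_nonneg _ _)
  · exact le_rfl

lemma lowerIter_mem (hg : IsDesignAt (g w) g₀ gL) (t : ℕ) (r : Fin Γ) :
    (P.lowerStep g B w Γ R)^[t] (coupledInit w Γ) r ∈ Icc (0 : ℝ) 1 := by
  cases t with
  | zero => exact coupledInit_mem r
  | succ t => rw [Function.iterate_succ_apply']; exact P.lowerStep_mem hg _ r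

variable [SFinite ν]

lemma blockInvNoise_anti (hE : ∀ r, E r ∈ Icc (0 : ℝ) 1)
    (hE' : ∀ r, E' r ∈ Icc (0 : ℝ) 1) (h : ∀ r, E r ≤ E' r) (c : Fin Γ) :
    P.blockInvNoise g w Γ R E' c ≤ P.blockInvNoise g w Γ R E c := by
  rw [blockInvNoise_eq, blockInvNoise_eq]
  gcongr with r
  exact P.invNoise_antitoneOn R (hE _) (hE' _) (h _)

lemma lowerStep_mono (hB : 2 ≤ B) (hg : IsDesignAt (g w) g₀ gL)
    (hE : ∀ r, E r ∈ Icc (0 : ℝ) 1) (hE' : ∀ r, E' r ∈ Icc (0 : ℝ) 1) (h : ∀ r, E r ≤ E' r)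
    (r : Fin Γ) : P.lowerStep g B w Γ R E r ≤ P.lowerStep g B w Γ R E' r := by
  unfold lowerStep
  split_ifs
  · exact Finset.sum_le_sum fun c _ => mul_le_mul_of_nonneg_left
      (sectionMSE_antitone hB (P.blockInvNoise_anti hE hE' h c)) (coupling_nonneg hg r c)
  · exact le_rfl

lemma lowerIter_le_coupledIter (hB : 2 ≤ B) (hg : IsDesignAt (g w) g₀ gL) (t : ℕ) (r : Fin Γ) :
    (P.lowerStep g B w Γ R)^[t] (coupledInit w Γ) r ≤
      (P.coupledStep g B w Γ R)^[t] (coupledInit w Γ) r := by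
  induction t generalizing r with
  | zero => exact le_rfl
  | succ t ih =>
    rw [Function.iterate_succ_apply', Function.iterate_succ_apply']
    exact (P.lowerStep_le_coupledStep hg _ r).trans
      (P.coupledStep_mono hB hg (P.lowerIter_mem hg t) (P.coupledIter_mem hg t) ih r)

lemma lowerIter_succ_le (hB : 2 ≤ B) (hg : IsDesignAt (g w) g₀ gL) (t : ℕ) (r : Fin Γ) :
    (P.lowerStep g B w Γ R)^[t + 1] (coupledInit w Γ) r ≤
      (P.lowerStep g B w Γ R)^[t] (coupledInit w Γ) r := by
  induction t generalizing r with
  | zero =>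
    exact (P.lowerStep_le_coupledStep hg _ r).trans (P.coupledIter_succ_le hB hg 0 r)
  | succ t ih =>
    have h := P.lowerStep_mono (R := R) hB hg (P.lowerIter_mem hg (t + 1))
      (P.lowerIter_mem hg t) ih r
    rwa [← Function.iterate_succ_apply' (P.lowerStep g B w Γ R),
      ← Function.iterate_succ_apply' (P.lowerStep g B w Γ R)] at h

/-- This is the reason for omitting the boundary columns: a bulk column gives weight `0` to the
pinned rows, where the inverse noise may be infinite. -/
lemma coupling_mul_invNoise_ne_top (hg : IsDesignAt (g w) g₀ gL) (hw : 0 < w) (hR : 0 < R)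
    (hE : ∀ r ∈ freeRows w Γ, E r ∈ Ioc (0 : ℝ) 1) {c : Fin Γ} (hc : c ∈ bulkColumns w Γ) :
    ∀ r, ENNReal.ofReal (coupling g w Γ r c) * P.invNoise R (E r) ≠ ∞ := by
  intro r
  by_cases hr : r ∈ freeRows w Γ
  · exact ENNReal.mul_ne_top ENNReal.ofReal_ne_top (P.invNoise_ne_top hR (hE r hr))
  · rw [coupling_eq_zero_of_bulk hg hw hc hr]; simp

lemma blockInvNoise_ne_top (hg : IsDesignAt (g w) g₀ gL) (hw : 0 < w) (hR : 0 < R)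
    (hE : ∀ r ∈ freeRows w Γ, E r ∈ Ioc (0 : ℝ) 1) {c : Fin Γ} (hc : c ∈ bulkColumns w Γ) :
    P.blockInvNoise g w Γ R E c ≠ ∞ :=
  ENNReal.sum_ne_top.2 fun r _ => P.coupling_mul_invNoise_ne_top hg hw hR hE hc r

lemma blockInvNoise_toReal (hg : IsDesignAt (g w) g₀ gL) (hw : 0 < w) (hR : 0 < R)
    (hE : ∀ r ∈ freeRows w Γ, E r ∈ Ioc (0 : ℝ) 1) {c : Fin Γ} (hc : c ∈ bulkColumns w Γ) :
    R / 2 * (P.blockInvNoise g w Γ R E c).toReal =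
      ∑ r ∈ freeRows w Γ, coupling g w Γ r c * P.halfFisher (E r) := by
  rw [blockInvNoise_eq, ENNReal.toReal_sum fun r _ => P.coupling_mul_invNoise_ne_top hg hw hR hE hc r,
    Finset.mul_sum, ← Finset.sum_subset (Finset.subset_univ (freeRows w Γ)) fun r _ hr => by
      rw [coupling_eq_zero_of_bulk hg hw hc hr]; simp]
  refine Finset.sum_congr rfl fun r _ => ?_
  rw [ENNReal.toReal_mul, ENNReal.toReal_ofReal (coupling_nonneg hg r c), P.invNoise_toReal hR]
  field_simp

lemma lowerStep_pos (hB : 2 ≤ B) (hg : IsDesignAt (g w) g₀ gL) (hw : 0 < w) (hΓ : 10 * w ≤ Γ)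
    (hR : 0 < R) (hE : ∀ r ∈ freeRows w Γ, E r ∈ Ioc (0 : ℝ) 1) {r : Fin Γ}
    (hr : r ∈ freeRows w Γ) : 0 < P.lowerStep g B w Γ R E r := by
  obtain ⟨c, hc, hpos⟩ := exists_bulk_coupling_pos hg hw hΓ hr
  rw [lowerStep, if_pos hr]
  refine Finset.sum_pos' (fun c _ => mul_nonneg (coupling_nonneg hg r c) (sectionMSE_nonneg _ _))
    ⟨c, hc, mul_pos hpos (sectionMSE_pos hB (P.blockInvNoise_ne_top hg hw hR hE hc))⟩

lemma lowerIter_pos (hB : 2 ≤ B) (hg : IsDesignAt (g w) g₀ gL) (hw : 0 < w) (hΓ : 10 * w ≤ Γ)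
    (hR : 0 < R) (t : ℕ) : ∀ r ∈ freeRows w Γ,
      (P.lowerStep g B w Γ R)^[t] (coupledInit w Γ) r ∈ Ioc (0 : ℝ) 1 := by
  induction t with
  | zero =>
    intro r hr
    rw [Function.iterate_zero_apply, coupledInit, if_neg (mem_freeRows_iff_not_isPinned.1 hr)]
    simp
  | succ t ih =>
    intro r hr
    refine ⟨?_, (P.lowerIter_mem hg (t + 1) r).2⟩
    rw [Function.iterate_succ_apply']
    exact P.lowerStep_pos hB hg hw hΓ hR ih hr

/-- The Bethe free energy does not increase along the state evolution. -/
lemma bethe_lowerStep_le (hH : P.FiniteEntropies stdGaussian) (hB : 2 ≤ B)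
    (hg : IsDesignAt (g w) g₀ gL) (hw : 0 < w) (hΓ : 10 * w ≤ Γ) (hR : 0 < R)
    (hE : ∀ r ∈ freeRows w Γ, E r ∈ Ioc (0 : ℝ) 1)
    (hle : ∀ r, P.lowerStep g B w Γ R E r ≤ E r) :
    P.bethe g B w Γ R (P.lowerStep g B w Γ R E) ≤ P.bethe g B w Γ R E := by
  have hl := Real.log_pos one_lt_two
  set E' := P.lowerStep g B w Γ R E with hE'
  have hE'm : ∀ r ∈ freeRows w Γ, E' r ∈ Ioc (0 : ℝ) 1 := fun r hr =>
    ⟨P.lowerStep_pos hB hg hw hΓ hR hE hr, (P.lowerStep_mem hg E r).2⟩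
  have h1 : ∀ r ∈ freeRows w Γ,
      P.outEntropy (E' r) - P.outEntropy 0 - E' r * P.halfFisher (E' r) ≤
        P.outEntropy (E r) - P.outEntropy 0 - E r * P.halfFisher (E r) +
          E' r * (P.halfFisher (E r) - P.halfFisher (E' r)) := by
    intro r hr
    have := (P.outEntropy_sub_bounds hH (hE'm r hr).1 (hle r) (hE r hr).2).1
    linarith
  have h2 : ∀ c ∈ bulkColumns w Γ,
      R * Real.log 2 * (1 - redEntropy B (P.blockInvNoise g w Γ R E' c)) ≤
        R * Real.log 2 * (1 - redEntropy B (P.blockInvNoise g w Γ R E c)) +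
          ∑ r ∈ freeRows w Γ, (P.halfFisher (E' r) - P.halfFisher (E r)) *
            (coupling g w Γ r c * sectionMSE B (P.blockInvNoise g w Γ R E c)) := by
    intro c hc
    have e1 := redEntropy_sub_ge hB (P.blockInvNoise_ne_top hg hw hR hE hc)
      (P.blockInvNoise_ne_top hg hw hR hE'm hc)
    have e2 := mul_le_mul_of_nonneg_left e1 (mul_pos hR hl).le
    have e3 : ∑ r ∈ freeRows w Γ, (P.halfFisher (E' r) - P.halfFisher (E r)) *
        (coupling g w Γ r c * sectionMSE B (P.blockInvNoise g w Γ R E c)) =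
        sectionMSE B (P.blockInvNoise g w Γ R E c) *
          (R / 2 * (P.blockInvNoise g w Γ R E' c).toReal -
            R / 2 * (P.blockInvNoise g w Γ R E c).toReal) := by
      rw [P.blockInvNoise_toReal hg hw hR hE hc, P.blockInvNoise_toReal hg hw hR hE'm hc,
        ← Finset.sum_sub_distrib, Finset.mul_sum]
      exact Finset.sum_congr rfl fun r _ => by ring
    have e4 : R * Real.log 2 * (-(sectionMSE B (P.blockInvNoise g w Γ R E c) / (2 * Real.log 2)) *
        ((P.blockInvNoise g w Γ R E' c).toReal - (P.blockInvNoise g w Γ R E c).toReal)) =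
        -(sectionMSE B (P.blockInvNoise g w Γ R E c) *
          (R / 2 * (P.blockInvNoise g w Γ R E' c).toReal -
            R / 2 * (P.blockInvNoise g w Γ R E c).toReal)) := by
      field_simp
    rw [e3]
    rw [e4] at e2
    linarith
  -- Summed over the bulk columns, the first order terms of the entropies reproduce `E'`, the image
  -- of `E`. They cancel those of the row terms.
  have h3 : ∑ c ∈ bulkColumns w Γ, ∑ r ∈ freeRows w Γ,
      (P.halfFisher (E' r) - P.halfFisher (E r)) *
        (coupling g w Γ r c * sectionMSE B (P.blockInvNoise g w Γ R E c)) =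
      ∑ r ∈ freeRows w Γ, (P.halfFisher (E' r) - P.halfFisher (E r)) * E' r := by
    rw [Finset.sum_comm]
    refine Finset.sum_congr rfl fun r hr => ?_
    rw [← Finset.mul_sum, hE', lowerStep, if_pos hr]
  have h4 := Finset.sum_le_sum h1
  have h5 := Finset.sum_le_sum h2
  rw [Finset.sum_add_distrib] at h4 h5
  have h6 : ∑ r ∈ freeRows w Γ, E' r * (P.halfFisher (E r) - P.halfFisher (E' r)) =
      -∑ r ∈ freeRows w Γ, (P.halfFisher (E' r) - P.halfFisher (E r)) * E' r := by
    rw [← Finset.sum_neg_distrib]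
    exact Finset.sum_congr rfl fun r _ => by ring
  unfold bethe
  rw [Finset.mul_sum, Finset.mul_sum]
  linarith

/-- Each free row contributes `H(1) - H(0) - j(1)`. The columns contribute at most the average of
`j(1)` they receive, by `redEntropy_ge`, that is, at most `j(1)` per row in total. -/
lemma bethe_init_le (hH : P.FiniteEntropies stdGaussian) (hB : 2 ≤ B)
    (hg : IsDesignAt (g w) g₀ gL) (hw : 0 < w) (hR : 0 < R) :
    P.bethe g B w Γ R (coupledInit w Γ) ≤ Γ * (P.outEntropy 1 - P.outEntropy 0) := by
  have hl := Real.log_pos one_lt_two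
  have hone : ∀ r ∈ freeRows w Γ, coupledInit w Γ r = 1 := fun r hr =>
    if_neg (mem_freeRows_iff_not_isPinned.1 hr)
  have hE : ∀ r ∈ freeRows w Γ, coupledInit w Γ r ∈ Ioc (0 : ℝ) 1 := fun r hr => by
    rw [hone r hr]; exact ⟨one_pos, le_rfl⟩
  have h1 : ∀ c ∈ bulkColumns w Γ,
      R * Real.log 2 * (1 - redEntropy B (P.blockInvNoise g w Γ R (coupledInit w Γ) c)) ≤
        ∑ r ∈ freeRows w Γ, coupling g w Γ r c * P.halfFisher 1 := by
    intro c hc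
    have e1 := redEntropy_ge hB (P.blockInvNoise_ne_top hg hw hR hE hc)
    have e2 : ∑ r ∈ freeRows w Γ, coupling g w Γ r c * P.halfFisher 1 =
        R / 2 * (P.blockInvNoise g w Γ R (coupledInit w Γ) c).toReal := by
      rw [P.blockInvNoise_toReal hg hw hR hE hc]
      exact Finset.sum_congr rfl fun r hr => by rw [hone r hr]
    have e3 : R / 2 * (P.blockInvNoise g w Γ R (coupledInit w Γ) c).toReal = R * Real.log 2 *
        ((P.blockInvNoise g w Γ R (coupledInit w Γ) c).toReal / (2 * Real.log 2)) := by
      field_simp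
    rw [e2, e3]
    exact mul_le_mul_of_nonneg_left (by linarith) (mul_pos hR hl).le
  have h2 := Finset.sum_le_sum h1
  rw [Finset.sum_comm] at h2
  have h3 : ∑ r ∈ freeRows w Γ, ∑ c ∈ bulkColumns w Γ, coupling g w Γ r c * P.halfFisher 1 ≤
      ∑ r ∈ freeRows w Γ, P.halfFisher 1 := by
    refine Finset.sum_le_sum fun r _ => ?_
    rw [← Finset.sum_mul]
    refine mul_le_of_le_one_left (P.halfFisher_nonneg 1) ?_
    rw [← coupling_sum hg r]
    exact Finset.sum_le_sum_of_subset_of_nonneg (Finset.subset_univ _) fun c _ _ =>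
      coupling_nonneg hg r c
  have h4 : ∑ r ∈ freeRows w Γ, (P.outEntropy (coupledInit w Γ r) - P.outEntropy 0 -
      coupledInit w Γ r * P.halfFisher (coupledInit w Γ r)) =
      ∑ r ∈ freeRows w Γ, (P.outEntropy 1 - P.outEntropy 0 - P.halfFisher 1) :=
    Finset.sum_congr rfl fun r hr => by rw [hone r hr, one_mul]
  have h5 : ((freeRows w Γ).card : ℝ) ≤ Γ := by
    have := Finset.card_le_univ (freeRows w Γ)
    rw [Fintype.card_fin] at this
    exact_mod_cast this
  have h6 := mul_le_mul_of_nonneg_right h5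
    (sub_nonneg.2 (P.outEntropy_mem hH (E := 0) (by simp)).2)
  rw [bethe, h4, Finset.mul_sum]
  rw [Finset.sum_const, nsmul_eq_mul] at h3 ⊢
  linarith

/-- The row terms are nonnegative since `H(E) - E j(E) ≥ H(0)`. In a bulk column the inverse noise
is at least its value for the constant profile `x`, and the entropy decreases. -/
lemma le_bethe (hH : P.FiniteEntropies stdGaussian) (hB : 2 ≤ B)
    (hg : IsDesignAt (g w) g₀ gL) (hw : 0 < w) (hR : 0 < R) {x : ℝ} (hx : x ∈ Icc (0 : ℝ) 1)
    (hE : ∀ r, E r ∈ Icc (0 : ℝ) 1) (hle : ∀ r, E r ≤ x) :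
    (bulkColumns w Γ).card * (R * Real.log 2 * (1 - redEntropy B (P.invNoise R x))) ≤
      P.bethe g B w Γ R E := by
  have hl := Real.log_pos one_lt_two
  have h1 : 0 ≤ ∑ r ∈ freeRows w Γ,
      (P.outEntropy (E r) - P.outEntropy 0 - E r * P.halfFisher (E r)) :=
    Finset.sum_nonneg fun r _ => by
      linarith [P.outEntropy_sub_halfFisher_le hH (hE r)]
  have h2 : ∀ c ∈ bulkColumns w Γ, R * Real.log 2 * (1 - redEntropy B (P.invNoise R x)) ≤
      R * Real.log 2 * (1 - redEntropy B (P.blockInvNoise g w Γ R E c)) := by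
    intro c hc
    refine mul_le_mul_of_nonneg_left ?_ (mul_pos hR hl).le
    rw [mem_bulkColumns] at hc
    have e := P.winNoise_le_blockInvNoise (R := R) hg hw (X := fun _ => x) hE (fun _ => hx) hle
      (c := c) (by omega) (by omega)
    rw [P.winNoise_eq_of_const (isWindow_winWeight hg hw) (X := fun _ => x)
      (fun _ _ => rfl)] at e
    linarith [redEntropy_antitone hB e]
  have h3 := Finset.sum_le_sum h2
  rw [Finset.sum_const, nsmul_eq_mul] at h3
  rw [bethe, Finset.mul_sum]
  linarith

/-- If the limit is below `x`, so is some iterate, and with it the lower iterate at the same time.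
The Bethe free energy there is at most its initial value. -/
lemma card_bulkColumns_mul_le (hH : P.FiniteEntropies stdGaussian) (hB : 2 ≤ B)
    (hg : IsDesignAt (g w) g₀ gL) (hw : 0 < w) (hΓ : 10 * w ≤ Γ) (hR : 0 < R) {x : ℝ}
    (hx : x ∈ Icc (0 : ℝ) 1) (hlim : ∀ r, P.coupledLimit g B w Γ R r < x) :
    (bulkColumns w Γ).card * (R * Real.log 2 * (1 - redEntropy B (P.invNoise R x))) ≤
      Γ * (P.outEntropy 1 - P.outEntropy 0) := by
  have h1 : ∀ t, P.bethe g B w Γ R ((P.lowerStep g B w Γ R)^[t] (coupledInit w Γ)) ≤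
      P.bethe g B w Γ R (coupledInit w Γ) := by
    intro t
    induction t with
    | zero => exact le_rfl
    | succ t ih =>
      have h := P.bethe_lowerStep_le hH hB hg hw hΓ hR (P.lowerIter_pos hB hg hw hΓ hR t) fun r => by
        have := P.lowerIter_succ_le (R := R) hB hg t r
        rwa [Function.iterate_succ_apply'] at this
      rw [Function.iterate_succ_apply']
      exact h.trans ih
  have h2 : ∀ᶠ t in atTop, ∀ r, (P.coupledStep g B w Γ R)^[t] (coupledInit w Γ) r < x :=
    eventually_all.2 fun r => (tendsto_pi_nhds.1 (P.tendsto_coupledLimit hB hg) r).eventually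
      (gt_mem_nhds (hlim r))
  obtain ⟨t, ht⟩ := h2.exists
  exact (P.le_bethe hH hB hg hw hR hx (P.lowerIter_mem hg t) fun r =>
    (P.lowerIter_le_coupledIter hB hg t r).trans (ht r).le).trans
    ((h1 t).trans (P.bethe_init_le hH hB hg hw hR))

theorem eventually_coupledThreshold_le (hH : P.FiniteEntropies stdGaussian)
    (hI : P.outEntropy 0 < P.outEntropy 1) (hg : IsDesign g) {Em : ℝ} (hR : 0 < R)
    (hRI : P.outEntropy 1 - P.outEntropy 0 < R * Real.log 2) (hEm : Em ∈ Ioc (0 : ℝ) 1)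
    (hm : R * Real.log 2 < P.halfFisher Em) :
    ∀ᶠ B : ℕ in atTop, P.coupledThreshold g B ≤ ENNReal.ofReal R := by
  obtain ⟨g₀, gL, hg⟩ := hg.exists_isDesignAt
  have hl := Real.log_pos one_lt_two
  set I := P.outEntropy 1 - P.outEntropy 0 with hId
  -- A level strictly between the information and `K`. The energy per bulk column eventually exceeds
  -- `ρ`, and the `8 w` missing columns are negligible for large `Γ`, so that `Γ I` is exceeded.
  set ρ := (I + R * Real.log 2) / 2 with hρ
  have hI0 : 0 < I := sub_pos.2 hI
  have hlim := P.tendsto_redEntropy_invNoise hR hEm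
  rw [max_eq_left (by linarith)] at hlim
  filter_upwards [eventually_ge_atTop 2,
    (P.tendsto_mseFloor hR (P.one_lt_relSnr_zero hR hEm hm)).eventually (gt_mem_nhds hEm.1),
    hlim.eventually (gt_mem_nhds (show 0 < R * Real.log 2 - ρ by linarith))] with B hB h1 h2
  refine liminf_le_of_frequently_le' (Eventually.frequently ?_)
  filter_upwards [eventually_gt_atTop 0] with w hw
  refine liminf_le_of_frequently_le' (Eventually.frequently ?_)
  have hΓ : Tendsto (fun Γ : ℕ => (Γ : ℝ) * (ρ - I)) atTop atTop :=
    tendsto_natCast_atTop_atTop.atTop_mul_const (by linarith)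
  filter_upwards [eventually_ge_atTop (10 * w), hΓ.eventually_gt_atTop (8 * w * ρ)] with Γ h3 h4
  refine iSup₂_le fun R' hR' => ENNReal.ofReal_le_ofReal ?_
  by_contra hc
  have h5 := P.card_bulkColumns_mul_le hH hB (hg w) hw h3 hR (Ioc_subset_Icc_self hEm)
    fun r => (hR'.2 R ⟨hR, (not_le.1 hc).le⟩ r).trans_lt h1
  have h6 : ρ ≤ R * Real.log 2 * (1 - redEntropy B (P.invNoise R Em)) := by linarith
  have h7 := mul_le_mul_of_nonneg_left h6 (Nat.cast_nonneg (α := ℝ) (bulkColumns w Γ).card)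
  have h8 := mul_le_mul_of_nonneg_right (le_card_bulkColumns w Γ) (show 0 ≤ ρ by linarith)
  linarith

theorem tendsto_coupledThreshold (hreg : P.RegularFisher) (hH : P.FiniteEntropies stdGaussian)
    (hI : P.outEntropy 0 < P.outEntropy 1) (hg : IsDesign g) :
    Tendsto (P.coupledThreshold g) atTop
      (𝓝 (ENNReal.ofReal ((P.outEntropy 1 - P.outEntropy 0) / Real.log 2))) := by
  have hl := Real.log_pos one_lt_two
  obtain ⟨Em, hEm, hjm⟩ := P.exists_halfFisher_gt hH hI
  refine tendsto_ofReal_of_bounds (d := P.halfFisher Em / Real.log 2)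
    (div_pos (sub_pos.2 hI) hl) (by gcongr)
    (fun R hR => P.eventually_le_coupledThreshold hreg hH hI hg hR.1 hR.2) fun R hR => ?_
  exact P.eventually_coupledThreshold_le hH hI hg ((div_pos (sub_pos.2 hI) hl).trans hR.1)
    ((div_lt_iff₀ hl).1 hR.1) hEm ((lt_div_iff₀ hl).1 hR.2)

end

end MemorylessChannel
end SparseSuperposition

theorem mainTheorem3 {𝓐 𝓑 : Type*} [MeasurableSpace 𝓐] [MeasurableSpace 𝓑]
    (ν : Measure 𝓑) [SigmaFinite ν]
    (W : SparseSuperposition.MemorylessChannel 𝓐 𝓑 ν)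
    (π : ℝ → 𝓐) (hπ : Measurable π)
    (P : SparseSuperposition.MemorylessChannel ℝ 𝓑 ν) (hP : P = W.withMap π hπ)
    (law : Measure 𝓐) (hlaw : law = SparseSuperposition.stdGaussian.map π)
    (hH : W.FiniteEntropies law) (hI : 0 < W.mutualInfo law)
    (g : ℕ → ℝ → ℝ) (hg : SparseSuperposition.IsDesign g) :
    -- the large alphabet limit of the potential
    (∀ R : ℝ, 0 < R → ∀ E ∈ Icc (0 : ℝ) 1,
      Tendsto (fun B : ℕ => P.potential B R E - (1 + (B : ℝ) / (2 * Real.log B))) atTop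
        (𝓝 (P.largePotential R E))) ∧
    -- its only local minima are at `0` and `1`, and its global minimum is attained there
    (∀ R : ℝ, 0 < R →
      (∀ E ∈ Icc (0 : ℝ) 1, IsLocalMinOn (P.largePotential R) (Icc 0 1) E ↔
        (E = 0 ∧ 1 < P.relSnr R 0) ∨ (E = 1 ∧ P.relSnr R 1 < 1)) ∧
      ∃ E ∈ ({0, 1} : Set ℝ), IsMinOn (P.largePotential R) (Icc 0 1) E) ∧
    -- the MSE floor vanishes
    (∀ R : ℝ, 0 < R → 1 < P.relSnr R 0 → Tendsto (fun B : ℕ => P.mseFloor B R) atTop (𝓝 0)) ∧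
    -- the two minima are equal exactly at the rate `I(A; Y)`
    (∀ R : ℝ, 0 < R →
      (P.largePotential R 1 = P.largePotential R 0 ↔ ENNReal.ofReal R = W.mutualInfo law)) ∧
    P.avgFisher 1 / ENNReal.ofReal (2 * Real.log 2) < W.mutualInfo law ∧
    W.mutualInfo law < P.avgFisher 0 / ENNReal.ofReal (2 * Real.log 2) ∧
    W.mutualInfo law = ENNReal.ofReal (P.infoIntegral SparseSuperposition.stdGaussian) ∧
    W.mutualInfo law = ENNReal.ofReal (W.infoIntegral law) ∧
    -- the thresholds tend to `I(A; Y)`, which is the capacity for a capacity-achieving input law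
    (P.RegularFisher →
      Tendsto P.potThreshold atTop (𝓝 (W.mutualInfo law)) ∧
      Tendsto (P.coupledThreshold g) atTop (𝓝 (W.mutualInfo law)) ∧
      ∀ (𝒬 : Set (ProbabilityMeasure 𝓐)) (Q : ProbabilityMeasure 𝓐), Q ∈ 𝒬 →
        W.mutualInfo (Q : Measure 𝓐) = W.capacity 𝒬 → law = (Q : Measure 𝓐) →
          Tendsto P.potThreshold atTop (𝓝 (W.capacity 𝒬)) ∧
          Tendsto (P.coupledThreshold g) atTop (𝓝 (W.capacity 𝒬))) := by
  subst hP hlaw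
  have hl := Real.log_pos one_lt_two
  have hlaw : IsProbabilityMeasure (SparseSuperposition.stdGaussian.map π) :=
    Measure.isProbabilityMeasure_map hπ.aemeasurable
  set P := W.withMap π hπ with hP
  have hF : P.FiniteEntropies SparseSuperposition.stdGaussian :=
    SparseSuperposition.MemorylessChannel.finiteEntropies_withMap W _ π hπ hH
  have e1 := SparseSuperposition.MemorylessChannel.mutualInfo_eq W _ hH
  have e2 : P.infoIntegral SparseSuperposition.stdGaussian =
      W.infoIntegral (SparseSuperposition.stdGaussian.map π) :=
    SparseSuperposition.MemorylessChannel.infoIntegral_withMap W _ π hπ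
  have e3 := P.infoIntegral_eq hF
  have e4 : W.mutualInfo (SparseSuperposition.stdGaussian.map π) =
      ENNReal.ofReal ((P.outEntropy 1 - P.outEntropy 0) / Real.log 2) := by rw [e1, ← e2, e3]
  have hI' : P.outEntropy 0 < P.outEntropy 1 := by
    rw [e4, ENNReal.ofReal_pos] at hI
    exact sub_pos.1 ((div_pos_iff_of_pos_right hl).1 hI)
  have hdiv : ∀ x : ℝ, ENNReal.ofReal (2 * x) / ENNReal.ofReal (2 * Real.log 2) =
      ENNReal.ofReal (x / Real.log 2) := fun x => by
    rw [← ENNReal.ofReal_div_of_pos (by positivity), mul_div_mul_left _ _ two_ne_zero]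
  refine ⟨fun R _ E _ => P.tendsto_potential R E,
    fun R hR => ⟨fun E hE => P.isLocalMinOn_largePotential_iff hF hI' hR hE,
      P.exists_isMinOn_largePotential hF hI' hR⟩,
    fun R hR h => P.tendsto_mseFloor hR h, fun R hR => ?_, ?_, ?_, by rw [e1, e2], e1,
    fun hreg => ?_⟩
  · rw [P.largePotential_one_eq_zero_iff hF hI' hR, e4,
      ENNReal.ofReal_eq_ofReal_iff hR.le (div_nonneg (sub_pos.2 hI').le hl.le), eq_div_iff hl.ne']
  · rw [P.avgFisher_eq_ofReal ⟨one_pos, le_rfl⟩, hdiv, e4,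
      ENNReal.ofReal_lt_ofReal_iff (div_pos (sub_pos.2 hI') hl)]
    exact div_lt_div_of_pos_right (P.halfFisher_one_lt hF hI') hl
  · rw [e4, ← hdiv]
    exact ENNReal.div_lt_div_right (ENNReal.ofReal_pos.2 (by positivity)).ne'
      ENNReal.ofReal_ne_top (P.lt_avgFisher_zero hF hI')
  · have h1 := P.tendsto_potThreshold hreg hF hI'
    have h2 := P.tendsto_coupledThreshold hreg hF hI' hg
    rw [← e4] at h1 h2
    refine ⟨h1, h2, fun 𝒬 Q _ hcap hQ => ?_⟩
    rw [← hcap, ← hQ]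
    exact ⟨h1, h2⟩
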